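/- **Notation.** Let $\mathbb R^2_+=\{x=(x_1,x_2): x_2>0\}$, $x^*=(x_1,-x_2)$, $\nabla^\perp=(\partial_2,-\partial_1)$, $E(x)=-\frac1{2\pi}\log|x|$, $D(x,y)=E(x-y)-E(x-y^*)$, $\Gamma(x,t)=\frac1{4\pi t}e^{-|x|^2/4t}$, $\Gamma_0(r,t)=\frac1{(4\pi t)^{1/2}}e^{-r^2/4t}$, $P_s(r)=\frac{s}{\pi(r^2+s^2)}$, and let $H$ be the Hilbert transform in the variable $x_1$, $\widehat{H\varphi}(\xi_1)=-i\frac{\xi_1}{|\xi_1|}\hat\varphi(\xi_1)$. Let $M$ be the space of finite signed Borel measures on $\overline{\mathbb R^2_+}$, and let $L^{2,\infty}_\sigma$ be the space of all $u\in L^{2,\infty}(\mathbb R^2_+)$ with values in $\mathbb R^2$ such that $\operatorname{div}u=0$ in $\mathbb R^2_+$ and $u^2(x_1,0)=0$. All integrals against a measure are over the open half plane $\mathbb R^2_+$. Put $K\omega(x)=\int_{\mathbb R^2_+}\nabla^\perp_xD(x,y)\,\omega(dy)$, $(-\Delta_D)^{-1}\omega(x)=\int_{\mathbb R^2_+}D(x,y)\,\omega(dy)$,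 $$e^{t\Delta_N}\varphi=\int_{\mathbb R^2_+}(\Gamma(x-y,t)+\Gamma(x-y^*,t))\varphi(y)\,dy,\quad e^{t\Delta_D}\varphi=\int_{\mathbb R^2_+}(\Gamma(x-y,t)-\Gamma(x-y^*,t))\varphi(y)\,dy,$$ $e^{t\partial_1^2}g(x_1)=\int_{\mathbb R}\Gamma_0(x_1-y_1,t)g(y_1)\,dy_1$, and, for the Stokes semigroup, $S(t)u(x)=\int_{\mathbb R^2_+}G(x,z,t)u(z)\,dz$ with the Green matrix $$G_{ij}(x,z,t)=\Gamma(x-z,t)\delta_{ij}-\Gamma(x-z^*,t)\delta_{ij}-4(1-\delta_{j2})\,\partial_{x_j}\!\int_0^{x_2}\!\!\int_{\mathbb R}\partial_{x_i}E(x-w)\,\Gamma(w-z^*,t)\,dw_1\,dw_2 .$$ Finally let $T(t)\omega=-\nabla^\perp\cdot S(t)K\omega$. **Lemma 3.3.** Let $u_0\in L^{2,\infty}_\sigma$ have vorticity $\partial_1u_0^2-\partial_2u_0^1=\omega_0$ in $\mathbb R^2_+$ in the sense of distributions, with $\omega_0\in M$. Then for all $t>0$ and $x\in\mathbb R^2_+$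 the integrals below converge, $S(t)K\omega_0$ is differentiable at $x$, and $$T(t)\omega_0(x)=\int_{\mathbb R^2_+}W(x,y,t)\,\omega_0(dy),$$ $$W(x,y,t)=\Gamma(x-y,t)+\Gamma(x-y^*,t)+4\int_0^{y_2}\!\Big(\int_{\mathbb R}\Gamma(x-z^*,t)\,\partial_{z_1}^2E(z-y)\,dz_1\Big)dz_2-2\Gamma_0(x_2,t)\int_{\mathbb R}\Gamma_0(x_1-z_1,t)P_{y_2}(z_1-y_1)\,dz_1 .$$ Moreover $u_0^1$ has a tangential trace $u_0^1(\cdot,0)\in L^1(\mathbb R)$ (in the sense that $\frac1\varepsilon\int_0^\varepsilon\|u_0^1(\cdot,s)-u_0^1(\cdot,0)\|_{L^1(\mathbb R)}\,ds\to0$ as $\varepsilon\downarrow0$), the distribution $(H\partial_2-\partial_1)\partial_1(-\Delta_D)^{-1}\omega_0$ on $\mathbb R^2_+$ is well defined, as a family of tempered distributions in $x_1$ on the lines $x_2=s$ for almost every $s>0$, and for all $t>0$ and $x\in\mathbb R^2_+$ $$T(t)\omega_0(x)=\big[e^{t\Delta_N}\omega_0-(e^{t\Delta_N}-e^{t\Delta_D})(H\partial_2-\partial_1)\partial_1(-\Delta_D)^{-1}\omega_0\big](x)-2\Gamma_0(x_2,t)\,\big(e^{t\partial_1^2}u_0^1(\cdot,0)\big)(x_1),$$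 where $e^{t\Delta_N}$ and $e^{t\Delta_D}$ act on such a family by pairing their kernels with it in $y_1$ and then integrating over $y_2>0$. -/

import Mathlib

open MeasureTheory Set Filter Topology SchwartzMap
open scoped ContDiff FourierTransform ENNReal

namespace HalfPlaneStokes

noncomputable section

/-! ### The half plane and partial derivatives -/

/-- The open half plane `ℝ²₊ = {x₂ > 0}`. -/
def halfPlane : Set (ℝ × ℝ) := {x | 0 < x.2}

/-- The closed half plane `{x₂ ≥ 0}`. -/
def closedHalfPlane : Set (ℝ × ℝ) := {x | 0 ≤ x.2}

/-- The reflected point `x* = (x₁, -x₂)`. -/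
def reflect (x : ℝ × ℝ) : ℝ × ℝ := (x.1, -x.2)

/-- The partial derivative in the first variable. -/
def pd₁ (f : ℝ × ℝ → ℝ) (x : ℝ × ℝ) : ℝ := deriv (fun r => f (r, x.2)) x.1

/-- The partial derivative in the second variable. -/
def pd₂ (f : ℝ × ℝ → ℝ) (x : ℝ × ℝ) : ℝ := deriv (fun r => f (x.1, r)) x.2

/-- The partial derivative in the variable with index `i`; the indices `1, 2` of the
mathematical text are the elements `0, 1` of `Fin 2`. -/
def pd (i : Fin 2) (f : ℝ × ℝ → ℝ) : ℝ × ℝ → ℝ := if i = 0 then pd₁ f else pd₂ f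

/-! ### Kernels -/

/-- `E(x) = -(1/2π) log |x|`, with the Euclidean length `|x|`. -/
def E (x : ℝ × ℝ) : ℝ := -(1 / (2 * Real.pi)) * Real.log (Real.sqrt (x.1 ^ 2 + x.2 ^ 2))

/-- The Green function `D(x, y) = E(x - y) - E(x - y*)` of the Dirichlet problem. -/
def D (x y : ℝ × ℝ) : ℝ := E (x - y) - E (x - reflect y)

/-- The one-dimensional heat kernel `Γ₀(r, t)`. -/
def heatKernel₁ (r t : ℝ) : ℝ :=
  1 / (4 * Real.pi * t) ^ (1 / 2 : ℝ) * Real.exp (-r ^ 2 / (4 * t))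

/-- The two-dimensional heat kernel `Γ(x, t)`. -/
def heatKernel₂ (x : ℝ × ℝ) (t : ℝ) : ℝ :=
  1 / (4 * Real.pi * t) * Real.exp (-(x.1 ^ 2 + x.2 ^ 2) / (4 * t))

/-- The Poisson kernel `P_s(r)`. -/
def poissonKernel (s r : ℝ) : ℝ := s / (Real.pi * (r ^ 2 + s ^ 2))

/-! ### Finite signed measures on the closed half plane

Every finite signed Borel measure on the closed half plane is regular, so that `M` is the type
`SignedMeasure closedHalfPlane`. -/

/-- The part `{y₂ > 0}` of the closed half plane. -/
def interiorPart : Set closedHalfPlane := {y | 0 < (y : ℝ × ℝ).2}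

/-- `f` is integrable over the open half plane with respect to `|μ|`. -/
def MIntegrable (μ : SignedMeasure closedHalfPlane) (f : ℝ × ℝ → ℝ) : Prop :=
  IntegrableOn (fun y : closedHalfPlane => f y) interiorPart μ.totalVariation

/-- The integral `∫_{ℝ²₊} f(y) μ(dy)`. -/
def mIntegral (μ : SignedMeasure closedHalfPlane) (f : ℝ × ℝ → ℝ) : ℝ :=
  (∫ y in interiorPart, f y ∂μ.toJordanDecomposition.posPart) -
    ∫ y in interiorPart, f y ∂μ.toJordanDecomposition.negPart

/-! ### Solenoidal vector fields in `L^{2,∞}` and their vorticity -/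

/-- Weak `L²` on the half plane: `sup_l l² |{x ∈ ℝ²₊ : |u(x)| > l}| < ∞`. -/
def MemWeakL2 (u : ℝ × ℝ → ℝ × ℝ) : Prop :=
  AEStronglyMeasurable u (volume.restrict halfPlane) ∧
    ∃ C : ℝ, ∀ l : ℝ, 0 < l →
      volume {x ∈ halfPlane | l < Real.sqrt ((u x).1 ^ 2 + (u x).2 ^ 2)} ≤
        ENNReal.ofReal (C / l ^ 2)

/-- `div u = 0` in `ℝ²₊` in the sense of distributions. -/
def DivFree (u : ℝ × ℝ → ℝ × ℝ) : Prop :=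
  ∀ φ : ℝ × ℝ → ℝ, ContDiff ℝ ∞ φ → HasCompactSupport φ → tsupport φ ⊆ halfPlane →
    ∫ x in halfPlane, ((u x).1 * pd₁ φ x + (u x).2 * pd₂ φ x) = 0

/-- `u²(x₁, 0) = 0`: the normal trace of a solenoidal field, which is the functional on boundary
values of test functions that is given by Green's formula, vanishes. -/
def NormalTraceZero (u : ℝ × ℝ → ℝ × ℝ) : Prop :=
  ∀ φ : ℝ × ℝ → ℝ, ContDiff ℝ ∞ φ → HasCompactSupport φ →
    ∫ x in halfPlane, ((u x).1 * pd₁ φ x + (u x).2 * pd₂ φ x) = 0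

/-- The space `L^{2,∞}_σ(ℝ²₊)`. -/
structure MemWeakL2Solenoidal (u : ℝ × ℝ → ℝ × ℝ) : Prop where
  memWeakL2 : MemWeakL2 u
  divFree : DivFree u
  normalTrace : NormalTraceZero u

/-- `∂₁u² - ∂₂u¹ = μ` in `ℝ²₊` in the sense of distributions. -/
def HasVorticity (u : ℝ × ℝ → ℝ × ℝ) (μ : SignedMeasure closedHalfPlane) : Prop :=
  ∀ φ : ℝ × ℝ → ℝ, ContDiff ℝ ∞ φ → HasCompactSupport φ → tsupport φ ⊆ halfPlane →
    ∫ x in halfPlane, ((u x).1 * pd₂ φ x - (u x).2 * pd₁ φ x) = mIntegral μ φ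

/-- `g` is the tangential trace `u¹(·, 0)`: the functions `u¹(·, s)` tend to `g` in `L¹(ℝ)` as
`s ↓ 0`, in the mean over `0 < s < ε` (which makes sense for `u` defined almost everywhere). -/
def IsTangentialTrace (u : ℝ × ℝ → ℝ × ℝ) (g : ℝ → ℝ) : Prop :=
  Tendsto
    (fun ε : ℝ => (ENNReal.ofReal ε)⁻¹ * ∫⁻ s in Ioo 0 ε, ∫⁻ r : ℝ, ‖(u (r, s)).1 - g r‖ₑ)
    (𝓝[>] 0) (𝓝 0)

/-! ### The Biot-Savart law, the Stokes semigroup and the operator `T(t)` -/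

/-- The Biot-Savart law `Kμ(x) = ∫ ∇^⊥_x D(x, y) μ(dy)`, where `∇^⊥ = (∂₂, -∂₁)`. -/
def biotSavart (μ : SignedMeasure closedHalfPlane) (x : ℝ × ℝ) : ℝ × ℝ :=
  (mIntegral μ fun y => pd₂ (fun x' => D x' y) x,
    mIntegral μ fun y => -pd₁ (fun x' => D x' y) x)

/-- The part `G*_{ij}(x, z, t)` of the Green matrix of the Stokes semigroup. -/
def greenStar (t : ℝ) (i j : Fin 2) (x z : ℝ × ℝ) : ℝ :=
  -heatKernel₂ (x - reflect z) t * (if i = j then 1 else 0) -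
    4 * (1 - (if j = 1 then 1 else 0)) *
      pd j (fun x' => ∫ w₂ in (0 : ℝ)..x'.2, ∫ w₁ : ℝ,
        pd i E (x' - (w₁, w₂)) * heatKernel₂ ((w₁, w₂) - reflect z) t) x

/-- The Green matrix `G_{ij}(x, z, t)` of the Stokes semigroup. -/
def green (t : ℝ) (i j : Fin 2) (x z : ℝ × ℝ) : ℝ :=
  heatKernel₂ (x - z) t * (if i = j then 1 else 0) + greenStar t i j x z

/-- The Stokes semigroup `S(t)u(x) = ∫_{ℝ²₊} G(x, z, t) u(z) dz`. -/
def stokes (t : ℝ) (u : ℝ × ℝ → ℝ × ℝ) (x : ℝ × ℝ) : ℝ × ℝ :=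
  (∫ z in halfPlane, (green t 0 0 x z * (u z).1 + green t 0 1 x z * (u z).2),
    ∫ z in halfPlane, (green t 1 0 x z * (u z).1 + green t 1 1 x z * (u z).2))

/-- The integral that defines `S(t)u(x)` converges absolutely. -/
def StokesConverges (t : ℝ) (u : ℝ × ℝ → ℝ × ℝ) (x : ℝ × ℝ) : Prop :=
  ∀ i : Fin 2, IntegrableOn
    (fun z => green t i 0 x z * (u z).1 + green t i 1 x z * (u z).2) halfPlane

/-- `T(t)μ = -∇^⊥ · S(t)Kμ`. -/
def vorticityFlow (t : ℝ) (μ : SignedMeasure closedHalfPlane) (x : ℝ × ℝ) : ℝ :=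
  -(pd₂ (fun x' => (stokes t (biotSavart μ) x').1) x -
    pd₁ (fun x' => (stokes t (biotSavart μ) x').2) x)

/-! ### The kernel `W` -/

/-- The integrand `Γ(x - z*, t) ∂²_{z₁}E(z - y)`. -/
def correctionIntegrand (t : ℝ) (x y z : ℝ × ℝ) : ℝ :=
  heatKernel₂ (x - reflect z) t * pd₁ (pd₁ fun z' => E (z' - y)) z

/-- The kernel `W(x, y, t)`. The integral over the strip `0 < z₂ < y₂` is an iterated one, first in
`z₁` and then in `z₂`. -/
def W (x y : ℝ × ℝ) (t : ℝ) : ℝ :=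
  heatKernel₂ (x - y) t + heatKernel₂ (x - reflect y) t +
    4 * (∫ z₂ in (0 : ℝ)..y.2, ∫ z₁ : ℝ, correctionIntegrand t x y (z₁, z₂)) -
    2 * heatKernel₁ x.2 t *
      ∫ z₁ : ℝ, heatKernel₁ (x.1 - z₁) t * poissonKernel y.2 (z₁ - y.1)

/-- The iterated integral over the strip in `W(x, y, t)` converges. -/
def CorrectionConverges (t : ℝ) (x y : ℝ × ℝ) : Prop :=
  (∀ z₂ ∈ Ioo 0 y.2, Integrable fun z₁ : ℝ => correctionIntegrand t x y (z₁, z₂)) ∧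
    IntervalIntegrable (fun z₂ => ∫ z₁ : ℝ, correctionIntegrand t x y (z₁, z₂)) volume 0 y.2

/-! ### Heat semigroups on measures and on boundary functions, and `(-Δ_D)⁻¹` -/

/-- `e^{tΔ_N}μ` for a measure `μ`. -/
def heatNeumann (t : ℝ) (μ : SignedMeasure closedHalfPlane) (x : ℝ × ℝ) : ℝ :=
  mIntegral μ fun y => heatKernel₂ (x - y) t + heatKernel₂ (x - reflect y) t

/-- `e^{t∂₁²}g`. -/
def heatLine (t : ℝ) (g : ℝ → ℝ) (r : ℝ) : ℝ :=
  ∫ y₁ : ℝ, heatKernel₁ (r - y₁) t * g y₁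

/-- `(-Δ_D)⁻¹μ(x) = ∫ D(x, y) μ(dy)`. -/
def invDirichletLaplacian (μ : SignedMeasure closedHalfPlane) (x : ℝ × ℝ) : ℝ :=
  mIntegral μ fun y => D x y

/-! ### Distributions on the half plane that are tempered in the tangential variable

They are given by their restrictions `F(·, s)` to the lines `x₂ = s`, for almost every `s > 0`. -/

/-- The tempered distribution `T` is the function `f`. -/
def Represents (T : 𝓢'(ℝ, ℂ)) (f : ℝ → ℂ) : Prop :=
  ∀ φ : 𝓢(ℝ, ℂ), Integrable (fun r => φ r * f r) ∧ T φ = ∫ r, φ r * f r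

/-- `S` is the Hilbert transform of `T`: the Fourier transform of `T` is a function `m`, and that
of `S` is `-i (ξ/|ξ|) m(ξ)`. (The multiplier is homogeneous of degree `0`, so that it does not
matter that the Fourier transform used here is normalized with `exp(-2πirξ)`.) -/
def IsHilbertTransform (T S : 𝓢'(ℝ, ℂ)) : Prop :=
  ∃ m : ℝ → ℂ, Represents (𝓕 T) m ∧
    Represents (𝓕 S) fun ξ => -Complex.I * ((ξ / |ξ| : ℝ) : ℂ) * m ξ

/-- A family of tempered distributions on the lines `x₂ = s`. -/
abbrev TangentialDistribution := ℝ → 𝓢'(ℝ, ℂ)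

namespace TangentialDistribution

/-- `F` is the function `f` on the half plane. -/
def IsFunction (F : TangentialDistribution) (f : ℝ × ℝ → ℝ) : Prop :=
  ∀ᵐ s ∂volume.restrict (Ioi (0 : ℝ)), Represents (F s) fun r => (f (r, s) : ℂ)

/-- `F = G` on the half plane. -/
def AEEq (F G : TangentialDistribution) : Prop :=
  ∀ᵐ s ∂volume.restrict (Ioi (0 : ℝ)), F s = G s

/-- The tangential derivative `∂₁F`. -/
def tangentialDeriv (F : TangentialDistribution) : TangentialDistribution :=
  fun s => TemperedDistribution.derivCLM ℂ (F s)

/-- `G = ∂₂F` in the sense of distributions in the open half plane. -/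
def IsNormalDeriv (F G : TangentialDistribution) : Prop :=
  ∀ φ : 𝓢(ℝ, ℂ), LocallyIntegrableOn (fun s => F s φ) (Ioi 0) ∧
    LocallyIntegrableOn (fun s => G s φ) (Ioi 0) ∧
    ∀ χ : ℝ → ℝ, ContDiff ℝ ∞ χ → HasCompactSupport χ → tsupport χ ⊆ Ioi 0 →
      ∫ s in Ioi (0 : ℝ), ((deriv χ s : ℝ) : ℂ) * F s φ = -∫ s in Ioi (0 : ℝ), (χ s : ℂ) * G s φ

/-- `G = HF`, with the Hilbert transform in the tangential variable. -/
def IsHilbert (F G : TangentialDistribution) : Prop :=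
  ∀ᵐ s ∂volume.restrict (Ioi (0 : ℝ)), IsHilbertTransform (F s) (G s)

end TangentialDistribution

/-- `F = (H∂₂ - ∂₁)∂₁(-Δ_D)⁻¹μ`. -/
def IsCorrectionSource (μ : SignedMeasure closedHalfPlane) (F : TangentialDistribution) : Prop :=
  ∃ Ψ Ψ₁₂ HΨ₁₂ : TangentialDistribution,
    Ψ.IsFunction (invDirichletLaplacian μ) ∧
    Ψ.tangentialDeriv.IsNormalDeriv Ψ₁₂ ∧
    Ψ₁₂.IsHilbert HΨ₁₂ ∧
    F.AEEq fun s => HΨ₁₂ s - Ψ.tangentialDeriv.tangentialDeriv s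

/-! ### Heat semigroups on such distributions -/

theorem poly_mul_gauss_bdd (a : ℝ) (ha : 0 < a) (P : Polynomial ℝ) :
    ∃ C : ℝ, ∀ r : ℝ, |P.eval r * Real.exp (-(a * r ^ 2))| ≤ C := by
  induction P using Polynomial.induction_on' with
  | add p q hp hq =>
    obtain ⟨C, hC⟩ := hp
    obtain ⟨C', hC'⟩ := hq
    refine ⟨C + C', fun r => ?_⟩
    rw [Polynomial.eval_add, add_mul]
    exact (abs_add_le _ _).trans (add_le_add (hC r) (hC' r))
  | monomial n c =>
    refine ⟨|c| * (1 + n.factorial / a ^ n), fun r => ?_⟩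
    have h1 : (a * r ^ 2) ^ n / n.factorial ≤ Real.exp (a * r ^ 2) :=
      Real.pow_div_factorial_le_exp (hx := by positivity) (n := n)
    have hf : (0 : ℝ) < n.factorial := by positivity
    have hexp : Real.exp (-(a * r ^ 2)) * Real.exp (a * r ^ 2) = 1 := by
      rw [← Real.exp_add]; simp
    have h0 : 0 < Real.exp (-(a * r ^ 2)) := Real.exp_pos _
    have h2 : |r| ^ n ≤ 1 + (r ^ 2) ^ n := by
      have : (r ^ 2) ^ n = (|r| ^ n) ^ 2 := by rw [← sq_abs r, ← pow_mul, ← pow_mul, mul_comm]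
      rw [this]; nlinarith [sq_nonneg (|r| ^ n - 1), sq_nonneg (|r| ^ n)]
    have h3 : (r ^ 2) ^ n * Real.exp (-(a * r ^ 2)) ≤ n.factorial / a ^ n := by
      rw [mul_pow, div_le_iff₀ hf] at h1
      rw [le_div_iff₀ (by positivity)]
      have := mul_le_mul_of_nonneg_right h1 h0.le
      nlinarith
    have h4 : Real.exp (-(a * r ^ 2)) ≤ 1 := Real.exp_le_one_iff.2 (by nlinarith [sq_nonneg r])
    rw [Polynomial.eval_monomial, mul_assoc, abs_mul, abs_mul, abs_pow, abs_of_pos h0]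
    gcongr
    nlinarith

theorem iteratedDeriv_gauss (a c : ℝ) (n : ℕ) :
    ∃ P : Polynomial ℝ,
      iteratedDeriv n (fun r : ℝ => ((Real.exp (-(a * (r - c) ^ 2)) : ℝ) : ℂ)) =
        fun r => ((P.eval (r - c) * Real.exp (-(a * (r - c) ^ 2)) : ℝ) : ℂ) := by
  induction n with
  | zero => exact ⟨1, by simp⟩
  | succ n ih =>
    obtain ⟨P, hP⟩ := ih
    refine ⟨P.derivative - Polynomial.C (2 * a) * Polynomial.X * P, ?_⟩
    rw [iteratedDeriv_succ, hP]
    funext r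
    have h1 : HasDerivAt (fun r : ℝ => P.eval (r - c)) (P.derivative.eval (r - c)) r :=
      (P.hasDerivAt (r - c)).comp_sub_const r c
    have h2 : HasDerivAt (fun r : ℝ => Real.exp (-(a * (r - c) ^ 2)))
        (Real.exp (-(a * (r - c) ^ 2)) * (-(a * (2 * (r - c))))) r := by
      have := (((hasDerivAt_id r).sub_const c).pow 2).const_mul a |>.neg.exp
      simpa using this
    have h3 : HasDerivAt
        (fun r : ℝ => ((P.eval (r - c) * Real.exp (-(a * (r - c) ^ 2)) : ℝ) : ℂ)) _ r :=
      (h1.mul h2).ofReal_comp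
    rw [h3.deriv]
    congr 1
    simp
    ring

/-- The Gaussian `r ↦ exp(-a(r - c)²)` as a Schwartz function. -/
def gaussSchwartz (a : ℝ) (ha : 0 < a) (c : ℝ) : 𝓢(ℝ, ℂ) where
  toFun r := ((Real.exp (-(a * (r - c) ^ 2)) : ℝ) : ℂ)
  smooth' := by
    have h : ContDiff ℝ ∞ fun r : ℝ => Real.exp (-(a * (r - c) ^ 2)) :=
      Real.contDiff_exp.comp
        ((contDiff_const.mul ((contDiff_id.sub contDiff_const).pow 2)).neg)
    exact Complex.ofRealCLM.contDiff.comp h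
  decay' k n := by
    obtain ⟨P, hP⟩ := iteratedDeriv_gauss a c n
    obtain ⟨C, hC⟩ := poly_mul_gauss_bdd a ha ((Polynomial.X + Polynomial.C c) ^ k * P)
    refine ⟨C, fun r => ?_⟩
    rw [norm_iteratedFDeriv_eq_norm_iteratedDeriv, hP, Complex.norm_real, Real.norm_eq_abs,
      Real.norm_eq_abs, ← abs_pow, ← abs_mul]
    have := hC (r - c)
    simpa [mul_assoc] using this

/-- The Schwartz function `z₁ ↦ Γ(x - (z₁, s), t)`. -/
def heatSlice (t : ℝ) (ht : 0 < t) (x : ℝ × ℝ) (s : ℝ) : 𝓢(ℝ, ℂ) :=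
  ((1 / (4 * Real.pi * t) * Real.exp (-(x.2 - s) ^ 2 / (4 * t)) : ℝ) : ℂ) •
    gaussSchwartz (1 / (4 * t)) (by positivity) x.1

theorem heatSlice_apply (t : ℝ) (ht : 0 < t) (x : ℝ × ℝ) (s z₁ : ℝ) :
    heatSlice t ht x s z₁ = (heatKernel₂ (x - (z₁, s)) t : ℂ) := by
  change ((_ : ℝ) : ℂ) * ((Real.exp (-(1 / (4 * t) * (z₁ - x.1) ^ 2)) : ℝ) : ℂ) = _
  rw [← Complex.ofReal_mul, heatKernel₂, mul_assoc, ← Real.exp_add]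
  congr 3
  simp only [Prod.fst_sub, Prod.snd_sub]
  ring

/-- The function `s ↦ ⟨F(·, s), Γ(x - z, t) + Γ(x - z*, t)⟩`, the pairing in `z₁`, `z = (z₁, s)`. -/
def neumannPairing (t : ℝ) (ht : 0 < t) (F : TangentialDistribution) (x : ℝ × ℝ) (s : ℝ) : ℂ :=
  F s (heatSlice t ht x s + heatSlice t ht x (-s))

/-- The function `s ↦ ⟨F(·, s), Γ(x - z, t) - Γ(x - z*, t)⟩`, the pairing in `z₁`, `z = (z₁, s)`. -/
def dirichletPairing (t : ℝ) (ht : 0 < t) (F : TangentialDistribution) (x : ℝ × ℝ) (s : ℝ) : ℂ :=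
  F s (heatSlice t ht x s - heatSlice t ht x (-s))

/-- `e^{tΔ_N}F`. -/
def heatNeumannDist (t : ℝ) (ht : 0 < t) (F : TangentialDistribution) (x : ℝ × ℝ) : ℂ :=
  ∫ s in Ioi (0 : ℝ), neumannPairing t ht F x s

/-- `e^{tΔ_D}F`. -/
def heatDirichletDist (t : ℝ) (ht : 0 < t) (F : TangentialDistribution) (x : ℝ × ℝ) : ℂ :=
  ∫ s in Ioi (0 : ℝ), dirichletPairing t ht F x s

end

end HalfPlaneStokes

open HalfPlaneStokes

namespace HalfPlaneStokes

noncomputable section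

/-! ### The entire functions `∫₀^∞ ξᵏ exp(iξζ - tξ²) dξ` -/

/-- The integrand of `heatJ`. -/
def heatJIntegrand (t : ℝ) (k : ℕ) (ζ : ℂ) (ξ : ℝ) : ℂ :=
  (ξ : ℂ) ^ k * Complex.exp (Complex.I * ξ * ζ - t * ξ ^ 2)

/-- The entire function `ζ ↦ ∫₀^∞ ξᵏ exp(iξζ - tξ²) dξ`. -/
def heatJ (t : ℝ) (k : ℕ) (ζ : ℂ) : ℂ := ∫ ξ in Ioi (0 : ℝ), heatJIntegrand t k ζ ξ

/-- The bound of `heatJ` in the closed upper half plane. -/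
def heatJBound (t : ℝ) (k : ℕ) : ℝ := ∫ ξ in Ioi (0 : ℝ), ξ ^ k * Real.exp (-(t * ξ ^ 2))

theorem norm_heatJIntegrand (t : ℝ) (k : ℕ) (ζ : ℂ) (ξ : ℝ) :
    ‖heatJIntegrand t k ζ ξ‖ = |ξ| ^ k * Real.exp (-(ξ * ζ.im) - t * ξ ^ 2) := by
  rw [heatJIntegrand, norm_mul, norm_pow, Complex.norm_real, Complex.norm_exp, Real.norm_eq_abs]
  congr 2
  have h : ((t : ℂ) * (ξ : ℂ) ^ 2) = ((t * ξ ^ 2 : ℝ) : ℂ) := by push_cast; ring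
  rw [h, Complex.sub_re, Complex.ofReal_re]
  simp [Complex.mul_re]

theorem continuous_heatJIntegrand (t : ℝ) (k : ℕ) (ζ : ℂ) :
    Continuous (heatJIntegrand t k ζ) := by
  unfold heatJIntegrand; fun_prop

theorem integrableOn_pow_mul_exp {t : ℝ} (ht : 0 < t) (k : ℕ) (b : ℝ) :
    IntegrableOn (fun ξ : ℝ => ξ ^ k * Real.exp (b * ξ - t * ξ ^ 2)) (Ioi 0) := by
  have h : Integrable (fun ξ : ℝ => ξ ^ (k : ℝ) * Real.exp (-(t / 2) * ξ ^ 2)) :=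
    integrable_rpow_mul_exp_neg_mul_sq (by positivity) (by linarith [(Nat.cast_nonneg k : (0:ℝ) ≤ k)])
  refine ((h.integrableOn (s := Ioi 0)).const_mul (Real.exp (b ^ 2 / (2 * t)))).mono'
    (by fun_prop) ((ae_restrict_mem measurableSet_Ioi).mono fun ξ hξ => ?_)
  have hξ : 0 < ξ := hξ
  rw [Real.rpow_natCast, Real.norm_of_nonneg (by positivity), mul_left_comm, ← Real.exp_add]
  gcongr
  have : b ^ 2 / (2 * t) + -(t / 2) * ξ ^ 2 - (b * ξ - t * ξ ^ 2) = (b - t * ξ) ^ 2 / (2 * t) := by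
    field_simp; ring
  have : 0 ≤ (b - t * ξ) ^ 2 / (2 * t) := by positivity
  linarith

theorem integrableOn_heatJIntegrand {t : ℝ} (ht : 0 < t) (k : ℕ) (ζ : ℂ) :
    IntegrableOn (heatJIntegrand t k ζ) (Ioi 0) := by
  refine (integrableOn_pow_mul_exp ht k (-ζ.im)).mono'
    (continuous_heatJIntegrand t k ζ).aestronglyMeasurable
    ((ae_restrict_mem measurableSet_Ioi).mono fun ξ hξ => ?_)
  have hξ : 0 < ξ := hξ
  rw [norm_heatJIntegrand, abs_of_pos hξ]
  refine le_of_eq ?_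
  rw [show -(ξ * ζ.im) - t * ξ ^ 2 = -ζ.im * ξ - t * ξ ^ 2 by ring]

theorem hasDerivAt_heatJ {t : ℝ} (ht : 0 < t) (k : ℕ) (ζ : ℂ) :
    HasDerivAt (heatJ t k) (Complex.I * heatJ t (k + 1) ζ) ζ := by
  have key := hasDerivAt_integral_of_dominated_loc_of_deriv_le
    (F := fun z ξ => heatJIntegrand t k z ξ)
    (F' := fun z ξ => Complex.I * heatJIntegrand t (k + 1) z ξ)
    (bound := fun ξ => ξ ^ (k + 1) * Real.exp ((|ζ.im| + 1) * ξ - t * ξ ^ 2))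
    (μ := volume.restrict (Ioi 0)) (x₀ := ζ) (s := Metric.ball ζ 1) (Metric.ball_mem_nhds ζ one_pos)
    (Eventually.of_forall fun z => (continuous_heatJIntegrand t k z).aestronglyMeasurable)
    (integrableOn_heatJIntegrand ht k ζ)
    ((continuous_heatJIntegrand t (k + 1) ζ).aestronglyMeasurable.const_mul _)
    ((ae_restrict_mem measurableSet_Ioi).mono fun ξ hξ z hz => ?_)
    (integrableOn_pow_mul_exp ht (k + 1) (|ζ.im| + 1))
    (Eventually.of_forall fun ξ z _ => ?_)
  · have := key.2
    rw [integral_const_mul] at this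
    exact this
  · have hξ : 0 < ξ := hξ
    rw [norm_mul, Complex.norm_I, one_mul, norm_heatJIntegrand, abs_of_pos hξ]
    gcongr
    have h1 : |z.im - ζ.im| ≤ 1 := by
      have := Complex.abs_im_le_norm (z - ζ)
      rw [Complex.sub_im] at this
      exact this.trans (by simpa [dist_eq_norm] using (Metric.mem_ball.1 hz).le)
    have h2 : -z.im ≤ |ζ.im| + 1 := by
      have := abs_le.1 h1
      have := neg_abs_le ζ.im
      linarith
    nlinarith
  · have h : HasDerivAt (fun z : ℂ => Complex.I * ξ * z - t * ξ ^ 2) (Complex.I * ξ) z := by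
      simpa using ((hasDerivAt_id z).const_mul (Complex.I * ξ)).sub_const ((t : ℂ) * ξ ^ 2)
    have := (h.cexp).const_mul ((ξ : ℂ) ^ k)
    unfold heatJIntegrand
    exact this.congr_deriv (by ring)

theorem continuous_heatJ {t : ℝ} (ht : 0 < t) (k : ℕ) : Continuous (heatJ t k) :=
  continuous_iff_continuousAt.2 fun ζ => (hasDerivAt_heatJ ht k ζ).continuousAt

theorem heatJBound_nonneg (t : ℝ) (k : ℕ) : 0 ≤ heatJBound t k :=
  setIntegral_nonneg measurableSet_Ioi fun ξ (hξ : 0 < ξ) => by positivity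

theorem norm_heatJ_le {t : ℝ} (ht : 0 < t) (k : ℕ) {ζ : ℂ} (hζ : 0 ≤ ζ.im) :
    ‖heatJ t k ζ‖ ≤ heatJBound t k := by
  refine norm_integral_le_of_norm_le
    (by simpa [IntegrableOn] using integrableOn_pow_mul_exp ht k 0)
    ((ae_restrict_mem measurableSet_Ioi).mono fun ξ hξ => ?_)
  have hξ : 0 < ξ := hξ
  rw [norm_heatJIntegrand, abs_of_pos hξ]
  gcongr
  nlinarith [mul_nonneg hξ.le hζ]

/-- A point of the plane as a complex number. -/
def toC (r h : ℝ) : ℂ := r + h * Complex.I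

@[simp] theorem toC_re (r h : ℝ) : (toC r h).re = r := by simp [toC]
@[simp] theorem toC_im (r h : ℝ) : (toC r h).im = h := by simp [toC]
theorem toC_zero (r : ℝ) : toC r 0 = r := by simp [toC]

@[fun_prop]
theorem continuous_toC : Continuous fun p : ℝ × ℝ => toC p.1 p.2 := by unfold toC; fun_prop

/-- The real part of `heatJ`. -/
def heatJRe (t : ℝ) (k : ℕ) (r h : ℝ) : ℝ := (heatJ t k (toC r h)).re

/-- The imaginary part of `heatJ`. -/
def heatJIm (t : ℝ) (k : ℕ) (r h : ℝ) : ℝ := (heatJ t k (toC r h)).im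

theorem abs_heatJRe_le {t : ℝ} (ht : 0 < t) (k : ℕ) (r : ℝ) {h : ℝ} (hh : 0 ≤ h) :
    |heatJRe t k r h| ≤ heatJBound t k :=
  (Complex.abs_re_le_norm _).trans (norm_heatJ_le ht k (by simpa))

theorem abs_heatJIm_le {t : ℝ} (ht : 0 < t) (k : ℕ) (r : ℝ) {h : ℝ} (hh : 0 ≤ h) :
    |heatJIm t k r h| ≤ heatJBound t k :=
  (Complex.abs_im_le_norm _).trans (norm_heatJ_le ht k (by simpa))

theorem continuous_heatJRe {t : ℝ} (ht : 0 < t) (k : ℕ) :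
    Continuous fun p : ℝ × ℝ => heatJRe t k p.1 p.2 :=
  Complex.continuous_re.comp ((continuous_heatJ ht k).comp continuous_toC)

theorem hasDerivAt_toC_fst (r h : ℝ) : HasDerivAt (fun r => toC r h) 1 r := by
  unfold toC
  simpa using (hasDerivAt_id r).ofReal_comp.add_const ((h : ℂ) * Complex.I)

theorem hasDerivAt_toC_snd (r h : ℝ) : HasDerivAt (fun h => toC r h) Complex.I h := by
  unfold toC
  simpa using ((hasDerivAt_id h).ofReal_comp.mul_const Complex.I).const_add (r : ℂ)

theorem hasDerivAt_heatJ_fst {t : ℝ} (ht : 0 < t) (k : ℕ) (r h : ℝ) :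
    HasDerivAt (fun r => heatJ t k (toC r h)) (Complex.I * heatJ t (k + 1) (toC r h)) r := by
  simpa [Function.comp_def] using
    (hasDerivAt_heatJ ht k (toC r h)).comp r (hasDerivAt_toC_fst r h)

theorem hasDerivAt_heatJ_snd {t : ℝ} (ht : 0 < t) (k : ℕ) (r h : ℝ) :
    HasDerivAt (fun h => heatJ t k (toC r h)) (-heatJ t (k + 1) (toC r h)) h := by
  have := (hasDerivAt_heatJ ht k (toC r h)).comp h (hasDerivAt_toC_snd r h)
  refine this.congr_deriv ?_
  linear_combination (heatJ t (k + 1) (toC r h)) * Complex.I_mul_I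

theorem hasDerivAt_re {f : ℝ → ℂ} {f' : ℂ} {x : ℝ} (h : HasDerivAt f f' x) :
    HasDerivAt (fun x => (f x).re) f'.re x :=
  (Complex.reCLM.hasFDerivAt.comp_hasDerivAt x h)

theorem hasDerivAt_im {f : ℝ → ℂ} {f' : ℂ} {x : ℝ} (h : HasDerivAt f f' x) :
    HasDerivAt (fun x => (f x).im) f'.im x :=
  (Complex.imCLM.hasFDerivAt.comp_hasDerivAt x h)

theorem hasDerivAt_heatJRe_fst {t : ℝ} (ht : 0 < t) (k : ℕ) (r h : ℝ) :
    HasDerivAt (fun r => heatJRe t k r h) (-heatJIm t (k + 1) r h) r := by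
  simpa [heatJRe, heatJIm] using hasDerivAt_re (hasDerivAt_heatJ_fst ht k r h)

theorem hasDerivAt_heatJIm_fst {t : ℝ} (ht : 0 < t) (k : ℕ) (r h : ℝ) :
    HasDerivAt (fun r => heatJIm t k r h) (heatJRe t (k + 1) r h) r := by
  simpa [heatJRe, heatJIm] using hasDerivAt_im (hasDerivAt_heatJ_fst ht k r h)

theorem hasDerivAt_heatJRe_snd {t : ℝ} (ht : 0 < t) (k : ℕ) (r h : ℝ) :
    HasDerivAt (fun h => heatJRe t k r h) (-heatJRe t (k + 1) r h) h := by
  simpa [heatJRe, heatJIm] using hasDerivAt_re (hasDerivAt_heatJ_snd ht k r h)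

/-! ### The one-dimensional heat kernel -/

/-- The integral over the line of a function with `f(-ξ) = conj f(ξ)`. -/
theorem integral_hermitian {f : ℝ → ℂ} (hf : Integrable f)
    (hs : ∀ ξ, f (-ξ) = (starRingEnd ℂ) (f ξ)) :
    ∫ ξ, f ξ = ((2 * (∫ ξ in Ioi (0 : ℝ), f ξ).re : ℝ) : ℂ) := by
  have h1 : ∫ ξ in Iic (0 : ℝ), f ξ = (starRingEnd ℂ) (∫ ξ in Ioi (0 : ℝ), f ξ) := by
    have := integral_comp_neg_Ioi (0 : ℝ) f
    rw [neg_zero] at this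
    rw [← this, ← integral_conj]
    simp_rw [hs]
  rw [← intervalIntegral.integral_Iic_add_Ioi hf.integrableOn hf.integrableOn, h1, add_comm,
    Complex.add_conj]

theorem integrable_heatJIntegrand_zero {t : ℝ} (ht : 0 < t) (ρ : ℝ) :
    Integrable (heatJIntegrand t 0 ρ) := by
  have := integrable_cexp_quadratic (b := t) (by simpa) (Complex.I * ρ) 0
  refine this.congr (Eventually.of_forall fun ξ => ?_)
  simp only [heatJIntegrand, pow_zero, one_mul]
  congr 1; ring

theorem heatJIntegrand_neg (t : ℝ) (ρ ξ : ℝ) :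
    heatJIntegrand t 0 ρ (-ξ) = (starRingEnd ℂ) (heatJIntegrand t 0 ρ ξ) := by
  simp only [heatJIntegrand, pow_zero, one_mul, ← Complex.exp_conj]
  simp

theorem heatKernel₁_eq {t : ℝ} (ht : 0 < t) (ρ : ℝ) :
    heatKernel₁ ρ t = (1 / Real.pi) * heatJRe t 0 ρ 0 := by
  have h1 := integral_hermitian (integrable_heatJIntegrand_zero ht ρ) (heatJIntegrand_neg t ρ)
  have h2 : ∫ ξ, heatJIntegrand t 0 ρ ξ =
      (((Real.pi / t) ^ (1 / 2 : ℝ) * Real.exp (-ρ ^ 2 / (4 * t)) : ℝ) : ℂ) := by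
    have := fourierIntegral_gaussian (b := t) (by simpa) ρ
    push_cast
    rw [Complex.ofReal_cpow (by positivity)]
    push_cast
    rw [← this]
    congr 1; ext ξ
    simp only [heatJIntegrand, pow_zero, one_mul, ← Complex.exp_add]
    congr 1; ring
  rw [h2, Complex.ofReal_inj] at h1
  rw [heatJRe, toC_zero, heatJ, heatKernel₁]
  have h3 : (4 * Real.pi * t) ^ (1 / 2 : ℝ) * (Real.pi / t) ^ (1 / 2 : ℝ) = 2 * Real.pi := by
    rw [← Real.mul_rpow (by positivity) (by positivity)]
    have : 4 * Real.pi * t * (Real.pi / t) = (2 * Real.pi) ^ 2 := by field_simp; ring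
    rw [this, ← Real.sqrt_eq_rpow, Real.sqrt_sq (by positivity)]
  have h4 : 0 < (4 * Real.pi * t) ^ (1 / 2 : ℝ) := by positivity
  have hpi := Real.pi_pos
  field_simp
  have : (2 * (∫ ξ in Ioi (0 : ℝ), heatJIntegrand t 0 ρ ξ).re) * (4 * Real.pi * t) ^ (1 / 2 : ℝ)
    = 2 * Real.pi * Real.exp (-ρ ^ 2 / (4 * t)) := by rw [← h1, ← h3]; ring
  have e : -(ρ ^ 2) / (4 * t) = -(ρ ^ 2 / (4 * t)) := by ring
  simp only [e] at this ⊢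
  linarith

/-- The derivative of the one-dimensional heat kernel. -/
def heatKernel₁' (r t : ℝ) : ℝ := -(1 / Real.pi) * heatJIm t 1 r 0

theorem hasDerivAt_heatKernel₁ {t : ℝ} (ht : 0 < t) (r : ℝ) :
    HasDerivAt (fun r => heatKernel₁ r t) (heatKernel₁' r t) r := by
  have h : (fun r => heatKernel₁ r t) = fun r => (1 / Real.pi) * heatJRe t 0 r 0 :=
    funext fun r => heatKernel₁_eq ht r
  rw [h, heatKernel₁']
  exact ((hasDerivAt_heatJRe_fst ht 0 r 0).const_mul (1 / Real.pi)).congr_deriv (by ring)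

theorem heatKernel₁'_eq {t : ℝ} (ht : 0 < t) (r : ℝ) :
    heatKernel₁' r t = -(r / (2 * t)) * heatKernel₁ r t := by
  refine (hasDerivAt_heatKernel₁ ht r).unique ?_
  unfold heatKernel₁
  have h : HasDerivAt (fun r : ℝ => -r ^ 2 / (4 * t)) (-(2 * r) / (4 * t)) r := by
    simpa using ((hasDerivAt_pow 2 r).neg).div_const (4 * t)
  refine (h.exp.const_mul (1 / (4 * Real.pi * t) ^ (1 / 2 : ℝ))).congr_deriv ?_
  field_simp
  ring

theorem hasDerivAt_heatKernel₁' {t : ℝ} (ht : 0 < t) (r : ℝ) :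
    HasDerivAt (fun r => heatKernel₁' r t) (-(1 / Real.pi) * heatJRe t 2 r 0) r :=
  (hasDerivAt_heatJIm_fst ht 1 r 0).const_mul _

theorem heatKernel₁_pos {t : ℝ} (ht : 0 < t) (r : ℝ) : 0 < heatKernel₁ r t := by
  unfold heatKernel₁; positivity

theorem heatKernel₁_neg (t r : ℝ) : heatKernel₁ (-r) t = heatKernel₁ r t := by
  simp [heatKernel₁]

@[fun_prop]
theorem continuous_heatKernel₁ (t : ℝ) : Continuous fun r => heatKernel₁ r t := by
  unfold heatKernel₁; fun_prop

theorem continuous_heatKernel₁' {t : ℝ} (ht : 0 < t) : Continuous fun r => heatKernel₁' r t :=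
  continuous_iff_continuousAt.2 fun r => (hasDerivAt_heatKernel₁' ht r).continuousAt

theorem integrable_heatKernel₁ {t : ℝ} (ht : 0 < t) : Integrable fun r => heatKernel₁ r t := by
  have := (integrable_exp_neg_mul_sq (b := 1 / (4 * t)) (by positivity)).const_mul
    (1 / (4 * Real.pi * t) ^ (1 / 2 : ℝ))
  refine this.congr (Eventually.of_forall fun r => ?_)
  simp only [heatKernel₁]
  congr 2; ring

theorem integrable_heatKernel₁' {t : ℝ} (ht : 0 < t) : Integrable fun r => heatKernel₁' r t := by
  have := (integrable_mul_exp_neg_mul_sq (b := 1 / (4 * t)) (by positivity)).const_mul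
    (-(1 / (2 * t)) * (1 / (4 * Real.pi * t) ^ (1 / 2 : ℝ)))
  refine this.congr (Eventually.of_forall fun r => ?_)
  simp only [heatKernel₁'_eq ht, heatKernel₁]
  rw [show -(1 / (4 * t)) * r ^ 2 = -r ^ 2 / (4 * t) by ring]
  ring

theorem heatKernel₂_eq {t : ℝ} (ht : 0 < t) (x : ℝ × ℝ) :
    heatKernel₂ x t = heatKernel₁ x.1 t * heatKernel₁ x.2 t := by
  have h : (4 * Real.pi * t) ^ (1 / 2 : ℝ) * (4 * Real.pi * t) ^ (1 / 2 : ℝ) = 4 * Real.pi * t := by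
    rw [← Real.rpow_add (by positivity)]; norm_num
  simp only [heatKernel₂, heatKernel₁]
  rw [mul_mul_mul_comm, ← Real.exp_add, one_div_mul_one_div, h]
  congr 2; ring

theorem heatKernel₁_le {t : ℝ} (ht : 0 < t) (r : ℝ) : heatKernel₁ r t ≤ heatKernel₁ 0 t := by
  unfold heatKernel₁
  gcongr 2
  have : 0 ≤ r ^ 2 := sq_nonneg r
  rw [show -(0 : ℝ) ^ 2 / (4 * t) = 0 by simp]
  exact div_nonpos_of_nonpos_of_nonneg (by linarith) (by positivity)

theorem heatKernel₁_anti {t : ℝ} (ht : 0 < t) {a b : ℝ} (h : |a| ≤ |b|) :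
    heatKernel₁ b t ≤ heatKernel₁ a t := by
  unfold heatKernel₁
  have : a ^ 2 ≤ b ^ 2 := sq_le_sq.2 h
  gcongr 2
  gcongr

/-! ### The Poisson kernel and its conjugate -/

/-- The conjugate Poisson kernel `Q_h(r) = r / (π (r² + h²))`. -/
def conjPoisson (h r : ℝ) : ℝ := r / (Real.pi * (r ^ 2 + h ^ 2))

theorem poissonKernel_neg (h r : ℝ) : poissonKernel (-h) r = -poissonKernel h r := by
  simp [poissonKernel, neg_div]

theorem poissonKernel_even (h r : ℝ) : poissonKernel h (-r) = poissonKernel h r := by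
  simp [poissonKernel]

@[simp] theorem poissonKernel_zero (r : ℝ) : poissonKernel 0 r = 0 := by simp [poissonKernel]

theorem conjPoisson_neg (h r : ℝ) : conjPoisson (-h) r = conjPoisson h r := by
  simp [conjPoisson]

theorem conjPoisson_abs (h r : ℝ) : conjPoisson |h| r = conjPoisson h r := by
  simp [conjPoisson]

theorem conjPoisson_odd (h r : ℝ) : conjPoisson h (-r) = -conjPoisson h r := by
  simp [conjPoisson, neg_div]

theorem poissonKernel_nonneg {h : ℝ} (hh : 0 ≤ h) (r : ℝ) : 0 ≤ poissonKernel h r := by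
  unfold poissonKernel; positivity

theorem poissonKernel_sign (h r : ℝ) :
    poissonKernel h r = Real.sign h * poissonKernel |h| r := by
  rcases lt_trichotomy h 0 with hh | rfl | hh
  · rw [Real.sign_of_neg hh, abs_of_neg hh, poissonKernel_neg]; ring
  · simp
  · rw [Real.sign_of_pos hh, abs_of_pos hh]; ring

@[fun_prop]
theorem measurable_poissonKernel : Measurable fun p : ℝ × ℝ => poissonKernel p.1 p.2 := by
  unfold poissonKernel; fun_prop

@[fun_prop]
theorem measurable_conjPoisson : Measurable fun p : ℝ × ℝ => conjPoisson p.1 p.2 := by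
  unfold conjPoisson; fun_prop

theorem integrable_poissonKernel (h : ℝ) : Integrable (poissonKernel h) := by
  rcases eq_or_ne h 0 with rfl | hh
  · exact (integrable_zero ℝ ℝ volume).congr (Eventually.of_forall fun r => by simp)
  · have := (integrable_inv_one_add_sq.comp_div hh).const_mul (1 / (Real.pi * h))
    refine this.congr (Eventually.of_forall fun r => ?_)
    have := Real.pi_pos
    simp only [poissonKernel]
    field_simp
    ring

theorem integral_poissonKernel {h : ℝ} (hh : 0 < h) : ∫ r, poissonKernel h r = 1 := by
  have h1 : (fun r => poissonKernel h r) = fun r => (1 / (Real.pi * h)) * (1 + (r / h) ^ 2)⁻¹ := by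
    funext r
    have := Real.pi_pos
    simp only [poissonKernel]
    field_simp
    ring
  rw [h1, integral_const_mul, Measure.integral_comp_div (fun r => (1 + r ^ 2)⁻¹) h,
    integral_univ_inv_one_add_sq, abs_of_pos hh, smul_eq_mul]
  have := Real.pi_pos
  field_simp

theorem abs_le_inv_sqrt_mul_inv_sqrt {a b c : ℝ} (hb : b ≠ 0) (hc : c ≠ 0)
    (h : |a| ≤ max |b| |c|) :
    |a / (Real.pi * (b ^ 2 + c ^ 2))| ≤ (√|b|)⁻¹ * (√|c|)⁻¹ := by
  have hb' : 0 < |b| := abs_pos.2 hb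
  have hc' : 0 < |c| := abs_pos.2 hc
  have hs : |b| ^ 2 + |c| ^ 2 = b ^ 2 + c ^ 2 := by simp
  have hm : 0 < max |b| |c| := lt_max_of_lt_left hb'
  have hmul : √(|b| * |c|) ≤ max |b| |c| := by
    rw [Real.sqrt_le_left hm.le, sq]
    exact mul_le_mul (le_max_left _ _) (le_max_right _ _) hc'.le hm.le
  have hden : max |b| |c| ^ 2 ≤ b ^ 2 + c ^ 2 := by
    rw [← hs]
    rcases max_choice |b| |c| with h | h <;> rw [h] <;> nlinarith
  rw [← mul_inv, ← Real.sqrt_mul hb'.le, abs_div, abs_of_pos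
    (show 0 < Real.pi * (b ^ 2 + c ^ 2) by have := Real.pi_pos; positivity),
    div_le_iff₀ (by have := Real.pi_pos; positivity)]
  have hsq : 0 < √(|b| * |c|) := by positivity
  rw [inv_mul_eq_div, le_div_iff₀ hsq]
  have hpi : 1 ≤ Real.pi := by linarith [Real.pi_gt_three]
  calc |a| * √(|b| * |c|) ≤ max |b| |c| * max |b| |c| := mul_le_mul h hmul hsq.le hm.le
    _ ≤ b ^ 2 + c ^ 2 := by rw [← sq]; exact hden
    _ ≤ Real.pi * (b ^ 2 + c ^ 2) := le_mul_of_one_le_left (by positivity) hpi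

theorem abs_poissonKernel_le {h r : ℝ} (hh : h ≠ 0) (hr : r ≠ 0) :
    |poissonKernel h r| ≤ (√|r|)⁻¹ * (√|h|)⁻¹ :=
  abs_le_inv_sqrt_mul_inv_sqrt hr hh (le_max_right _ _)

theorem abs_conjPoisson_le {h r : ℝ} (hh : h ≠ 0) (hr : r ≠ 0) :
    |conjPoisson h r| ≤ (√|r|)⁻¹ * (√|h|)⁻¹ :=
  abs_le_inv_sqrt_mul_inv_sqrt hr hh (le_max_left _ _)

theorem abs_conjPoisson_le_inv {h : ℝ} (hh : h ≠ 0) (r : ℝ) : |conjPoisson h r| ≤ |h|⁻¹ := by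
  have hh' : 0 < |h| := abs_pos.2 hh
  have hs : |r| ^ 2 + |h| ^ 2 = r ^ 2 + h ^ 2 := by simp
  have hpi : 1 ≤ Real.pi := by linarith [Real.pi_gt_three]
  have hD : 0 < r ^ 2 + h ^ 2 := by positivity
  unfold conjPoisson
  rw [abs_div, abs_of_pos (show 0 < Real.pi * (r ^ 2 + h ^ 2) by positivity), ← one_div,
    div_le_div_iff₀ (by positivity) hh', one_mul]
  calc |r| * |h| ≤ r ^ 2 + h ^ 2 := by rw [← hs]; nlinarith [sq_nonneg (|r| - |h|)]
    _ ≤ Real.pi * (r ^ 2 + h ^ 2) := le_mul_of_one_le_left (by positivity) hpi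

theorem toC_ne_zero (r : ℝ) {h : ℝ} (hh : h ≠ 0) : toC r h ≠ 0 := by
  intro H
  apply hh
  simpa using congrArg Complex.im H

theorem conjPoisson_sub_I_mul_poissonKernel (h r : ℝ) :
    (conjPoisson h r : ℂ) - Complex.I * poissonKernel h r = (1 / Real.pi : ℂ) * (toC r h)⁻¹ := by
  rw [← Complex.ofReal_one, ← Complex.ofReal_div]
  apply Complex.ext
  · rw [Complex.re_ofReal_mul, Complex.inv_re, Complex.normSq_apply, toC_re, toC_im]
    simp only [Complex.sub_re, Complex.ofReal_re, Complex.mul_re, Complex.I_re, Complex.I_im,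
      Complex.ofReal_im, conjPoisson, mul_inv, div_eq_mul_inv]
    ring_nf
  · rw [Complex.im_ofReal_mul, Complex.inv_im, Complex.normSq_apply, toC_re, toC_im]
    simp only [Complex.sub_im, Complex.ofReal_re, Complex.mul_im, Complex.I_re, Complex.I_im,
      Complex.ofReal_im, poissonKernel, mul_inv, div_eq_mul_inv]
    ring_nf

theorem conjPoisson_eq_re (h r : ℝ) :
    conjPoisson h r = ((1 / Real.pi : ℂ) * (toC r h)⁻¹).re := by
  rw [← conjPoisson_sub_I_mul_poissonKernel]; simp

/-! ### The Fourier transform of the Poisson kernel -/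

theorem integral_exp_I_mul_Ioi (r : ℝ) {h : ℝ} (hh : 0 < h) :
    ∫ ξ in Ioi (0 : ℝ), Complex.exp (Complex.I * ξ * toC r h) = Complex.I * (toC r h)⁻¹ := by
  have h1 : (Complex.I * toC r h).re < 0 := by simpa using hh
  have h2 := integral_exp_mul_complex_Ioi h1 0
  have h3 := toC_ne_zero r hh.ne'
  simp only [Complex.ofReal_zero, mul_zero, Complex.exp_zero] at h2
  have : (-1 : ℂ) / (Complex.I * toC r h) = Complex.I * (toC r h)⁻¹ := by
    field_simp; simp
  rw [← this, ← h2]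
  congr 1; ext ξ; congr 1; ring

theorem integrable_exp_neg_mul_abs {a : ℝ} (ha : 0 < a) :
    Integrable fun ξ : ℝ => Real.exp (-(a * |ξ|)) := by
  rw [← integrableOn_univ, ← Iic_union_Ioi (a := (0 : ℝ))]
  refine IntegrableOn.union ?_ ?_
  · refine (integrableOn_exp_mul_Iic ha 0).congr_fun (fun ξ (hξ : ξ ≤ 0) => ?_) measurableSet_Iic
    simp [abs_of_nonpos hξ]
  · refine (integrableOn_exp_mul_Ioi (neg_neg_of_pos ha) 0).congr_fun
      (fun ξ (hξ : 0 < ξ) => ?_) measurableSet_Ioi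
    simp [abs_of_pos hξ]

theorem fourier_exp_neg_abs {h : ℝ} (hh : 0 < h) :
    𝓕 (fun ξ : ℝ => (Real.exp (-(2 * Real.pi * h * |ξ|)) : ℂ)) =
      fun y => (poissonKernel h y : ℂ) := by
  have hpi := Real.pi_pos
  ext y
  rw [Real.fourier_real_eq_integral_exp_smul]
  have hint : Integrable fun v : ℝ =>
      Complex.exp (↑(-2 * Real.pi * v * y) * Complex.I) •
        (Real.exp (-(2 * Real.pi * h * |v|)) : ℂ) := by
    refine (integrable_exp_neg_mul_abs (a := 2 * Real.pi * h) (by positivity)).mono'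
      (by fun_prop) (Eventually.of_forall fun v => ?_)
    rw [norm_smul, Complex.norm_exp_ofReal_mul_I, one_mul, Complex.norm_real, Real.norm_of_nonneg
      (Real.exp_pos _).le]
  rw [integral_hermitian hint]
  · have h1 : ∫ ξ in Ioi (0 : ℝ), Complex.exp (↑(-2 * Real.pi * ξ * y) * Complex.I) •
        (Real.exp (-(2 * Real.pi * h * |ξ|)) : ℂ) =
        ∫ ξ in Ioi (0 : ℝ), Complex.exp (Complex.I * ξ * toC (-2 * Real.pi * y) (2 * Real.pi * h)) := by
      refine setIntegral_congr_fun measurableSet_Ioi fun ξ (hξ : 0 < ξ) => ?_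
      simp only [smul_eq_mul]
      rw [abs_of_pos hξ, Complex.ofReal_exp, ← Complex.exp_add]
      congr 1
      unfold toC
      push_cast
      linear_combination (-(ξ : ℂ) * 2 * Real.pi * h) * Complex.I_mul_I
    rw [h1, integral_exp_I_mul_Ioi _ (by positivity)]
    congr 1
    simp only [Complex.mul_re, Complex.I_re, Complex.I_im, Complex.inv_im, Complex.normSq_apply,
      toC_re, toC_im, poissonKernel]
    have : y ^ 2 + h ^ 2 ≠ 0 := by positivity
    field_simp
    ring
  · intro v
    simp only [smul_eq_mul, map_mul, Complex.conj_ofReal, abs_neg, ← Complex.exp_conj,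
      Complex.conj_I]
    congr 2
    push_cast; ring

theorem integral_poissonKernel_mul_exp {h : ℝ} (hh : 0 < h) (ξ : ℝ) :
    ∫ y, (poissonKernel h y : ℂ) * Complex.exp (Complex.I * ξ * y) = Real.exp (-(h * |ξ|)) := by
  have hpi := Real.pi_pos
  have h1 := Continuous.fourierInv_fourier_eq
    (f := fun ξ : ℝ => (Real.exp (-(2 * Real.pi * h * |ξ|)) : ℂ)) (by fun_prop)
    ((integrable_exp_neg_mul_abs (a := 2 * Real.pi * h) (by positivity)).ofReal)
    (by rw [fourier_exp_neg_abs hh]; exact (integrable_poissonKernel h).ofReal)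
  rw [fourier_exp_neg_abs hh] at h1
  have h2 := congrFun h1 (ξ / (2 * Real.pi))
  rw [Real.fourierInv_eq'] at h2
  rw [show h * |ξ| = 2 * Real.pi * h * |ξ / (2 * Real.pi)| by
    rw [abs_div, abs_of_pos (show 0 < 2 * Real.pi by positivity)]; field_simp, ← h2]
  congr 1; ext y
  rw [smul_eq_mul, mul_comm]
  congr 2
  simp only [RCLike.inner_apply, conj_trivial]
  push_cast
  field_simp

/-! ### Convolutions with heat kernels -/

theorem integral_poissonKernel_mul_heatJ {t : ℝ} (ht : 0 < t) (k : ℕ) {h : ℝ} (hh : 0 < h)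
    (x : ℝ) :
    ∫ y, (poissonKernel h y : ℂ) * heatJ t k (toC (x - y) 0) = heatJ t k (toC x h) := by
  have hint : Integrable (Function.uncurry fun (y ξ : ℝ) =>
      (poissonKernel h y : ℂ) * heatJIntegrand t k (toC (x - y) 0) ξ)
      (volume.prod (volume.restrict (Ioi 0))) := by
    have h0 := (integrable_poissonKernel h).mul_prod
      (show Integrable _ (volume.restrict (Ioi (0 : ℝ))) from integrableOn_pow_mul_exp ht k 0)
    refine h0.mono ?_ ?_
    · refine Measurable.aestronglyMeasurable ?_
      unfold heatJIntegrand toC Function.uncurry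
      fun_prop
    · have hm : ∀ᵐ p : ℝ × ℝ ∂(volume.prod (volume.restrict (Ioi (0 : ℝ)))), p.2 ∈ Ioi (0 : ℝ) :=
        Measure.quasiMeasurePreserving_snd.ae (ae_restrict_mem measurableSet_Ioi)
      filter_upwards [hm] with p hp
      have hp : 0 < p.2 := hp
      simp only [Function.uncurry, norm_mul, norm_heatJIntegrand, Complex.norm_real, toC_im]
      simp [abs_of_pos hp]
  simp_rw [heatJ, ← integral_const_mul]
  rw [integral_integral_swap hint]
  refine setIntegral_congr_fun measurableSet_Ioi fun ξ (hξ : 0 < ξ) => ?_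
  have h1 := integral_poissonKernel_mul_exp hh (-ξ)
  have h2 : ∀ y : ℝ, (poissonKernel h y : ℂ) * heatJIntegrand t k (toC (x - y) 0) ξ =
      ((poissonKernel h y : ℂ) * Complex.exp (Complex.I * (-ξ : ℝ) * y)) *
        heatJIntegrand t k (toC x 0) ξ := by
    intro y
    have : Complex.exp (Complex.I * ξ * toC (x - y) 0 - t * ξ ^ 2) =
        Complex.exp (Complex.I * (-ξ : ℝ) * y) *
          Complex.exp (Complex.I * ξ * toC x 0 - t * ξ ^ 2) := by
      rw [← Complex.exp_add]
      congr 1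
      simp only [toC]
      push_cast; ring
    simp only [heatJIntegrand]
    rw [this]
    ring
  simp_rw [h2]
  rw [integral_mul_const, h1, abs_neg, abs_of_pos hξ]
  simp only [heatJIntegrand]
  rw [Complex.ofReal_exp, mul_left_comm, ← Complex.exp_add]
  congr 2
  simp only [toC]
  push_cast
  linear_combination (-(ξ : ℂ) * h) * Complex.I_mul_I

theorem integrable_bdd_mul_poissonKernel {f : ℝ → ℂ} (hf : Continuous f) {C : ℝ}
    (hC : ∀ r, ‖f r‖ ≤ C) (h x : ℝ) : Integrable fun y => (poissonKernel h y : ℂ) * f (x - y) := by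
  simp_rw [mul_comm]
  exact ((integrable_poissonKernel h).ofReal).bdd_mul (by fun_prop)
    (Eventually.of_forall fun y => hC _)

theorem integrable_poissonKernel_mul_heatJ {t : ℝ} (ht : 0 < t) (k : ℕ) (h x : ℝ) :
    Integrable fun y => (poissonKernel h y : ℂ) * heatJ t k (toC (x - y) 0) :=
  integrable_bdd_mul_poissonKernel (f := fun r => heatJ t k (toC r 0))
    ((continuous_heatJ ht k).comp (by unfold toC; fun_prop))
    (fun r => norm_heatJ_le ht k (by simp)) h x

/-- Harmonic extension of the boundary values of `Re J_k`. -/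
theorem integral_poissonKernel_mul_heatJRe {t : ℝ} (ht : 0 < t) (k : ℕ) (h x b : ℝ) :
    ∫ z, poissonKernel h (z - b) * heatJRe t k (x - z) 0 =
      Real.sign h * heatJRe t k (x - b) |h| := by
  have hsub : ∀ h : ℝ, ∫ z, poissonKernel h (z - b) * heatJRe t k (x - z) 0 =
      ∫ y, poissonKernel h y * heatJRe t k (x - b - y) 0 := fun h => by
    rw [← integral_sub_right_eq_self (fun y => poissonKernel h y * heatJRe t k (x - b - y) 0) b]
    simp only [sub_sub_sub_cancel_right]
  have hpos : ∀ h : ℝ, 0 < h → ∫ z, poissonKernel h (z - b) * heatJRe t k (x - z) 0 =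
      heatJRe t k (x - b) h := fun h hh => by
    have h1 := integral_poissonKernel_mul_heatJ ht k hh (x - b)
    have h2 := congrArg Complex.re h1
    rw [hsub, heatJRe, ← h2, ← RCLike.re_to_complex, ← integral_re
      (integrable_poissonKernel_mul_heatJ ht k h (x - b))]
    congr 1; ext y
    simp [heatJRe]
  simp_rw [poissonKernel_sign h, mul_assoc]
  rw [integral_const_mul]
  rcases eq_or_ne h 0 with rfl | hh
  · simp
  · rw [hpos _ (abs_pos.2 hh)]

theorem integral_poissonKernel_mul_heatKernel₁ {t : ℝ} (ht : 0 < t) (h x b : ℝ) :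
    ∫ z, heatKernel₁ (x - z) t * poissonKernel h (z - b) =
      Real.sign h * ((1 / Real.pi) * heatJRe t 0 (x - b) |h|) := by
  rw [mul_left_comm, ← integral_poissonKernel_mul_heatJRe ht, ← integral_const_mul]
  congr 1; ext z
  rw [heatKernel₁_eq ht]; ring

theorem integral_comp_mul_inv_toC {f : ℝ → ℝ} (hf : Integrable f) {h : ℝ} (hh : 0 < h) (x : ℝ) :
    ∫ y, (f (x - y) : ℂ) * (toC y h)⁻¹ = -Complex.I * ∫ ξ in Ioi (0 : ℝ),
      (∫ y, (f (x - y) : ℂ) * Complex.exp (Complex.I * ξ * y)) * Real.exp (-(h * ξ)) := by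
  have hfx : Integrable fun y => (f (x - y) : ℂ) := (hf.comp_sub_left x).ofReal
  have hint : Integrable (Function.uncurry fun (y ξ : ℝ) =>
      (f (x - y) : ℂ) * Complex.exp (Complex.I * ξ * toC y h))
      (volume.prod (volume.restrict (Ioi 0))) := by
    have h0 := hfx.mul_prod (show Integrable _ (volume.restrict (Ioi (0 : ℝ))) from
      (integrableOn_exp_mul_Ioi (neg_neg_of_pos hh) 0).ofReal (𝕜 := ℂ))
    refine h0.mono ?_ (Eventually.of_forall fun p => ?_)
    · refine AEStronglyMeasurable.mul hfx.aestronglyMeasurable.comp_fst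
        (Measurable.aestronglyMeasurable ?_)
      unfold toC
      fun_prop
    · simp only [Function.uncurry, norm_mul, Complex.norm_exp]
      gcongr
      simp [Complex.norm_exp, mul_comm]
  have h1 : ∀ y : ℝ, (f (x - y) : ℂ) * (toC y h)⁻¹ = -Complex.I * ∫ ξ in Ioi (0 : ℝ),
      (f (x - y) : ℂ) * Complex.exp (Complex.I * ξ * toC y h) := by
    intro y
    rw [integral_const_mul, integral_exp_I_mul_Ioi y hh]
    linear_combination ((f (x - y) : ℂ) * (toC y h)⁻¹) * Complex.I_mul_I
  simp_rw [h1]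
  rw [integral_const_mul, integral_integral_swap hint]
  congr 1
  refine setIntegral_congr_fun measurableSet_Ioi fun ξ _ => ?_
  rw [← integral_mul_const]
  congr 1; ext y
  rw [mul_assoc (f (x - y) : ℂ), Complex.ofReal_exp, ← Complex.exp_add]
  congr 2
  unfold toC
  push_cast
  linear_combination ((ξ : ℂ) * h) * Complex.I_mul_I

theorem integral_heatKernel₁_mul_exp {t : ℝ} (ht : 0 < t) (x ξ : ℝ) :
    ∫ y, (heatKernel₁ (x - y) t : ℂ) * Complex.exp (Complex.I * ξ * y) =
      Complex.exp (Complex.I * ξ * x - t * ξ ^ 2) := by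
  have hpi := Real.pi_pos
  have h0 := fourierIntegral_gaussian (b := (1 / (4 * t) : ℝ))
    (by rw [Complex.ofReal_re]; positivity) (-ξ)
  rw [← integral_sub_left_eq_self _ volume x]
  have h1 : ∀ y : ℝ, (heatKernel₁ (x - (x - y)) t : ℂ) *
      Complex.exp (Complex.I * ξ * ((x - y : ℝ) : ℂ)) =
      ((1 / (4 * Real.pi * t) ^ (1 / 2 : ℝ) : ℝ) * Complex.exp (Complex.I * ξ * x)) *
      (Complex.exp (Complex.I * -ξ * y) * Complex.exp (-((1 / (4 * t) : ℝ) : ℂ) * y ^ 2)) := by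
    intro y
    have : Complex.exp ((-y ^ 2 / (4 * t) : ℝ) : ℂ) *
        Complex.exp (Complex.I * ξ * ((x - y : ℝ) : ℂ)) = Complex.exp (Complex.I * ξ * x) *
        (Complex.exp (Complex.I * -ξ * y) * Complex.exp (-((1 / (4 * t) : ℝ) : ℂ) * y ^ 2)) := by
      rw [← Complex.exp_add, ← Complex.exp_add, ← Complex.exp_add]
      congr 1
      push_cast; ring
    rw [sub_sub_cancel, heatKernel₁, Complex.ofReal_mul, Complex.ofReal_exp]
    linear_combination ((1 / (4 * Real.pi * t) ^ (1 / 2 : ℝ) : ℝ) : ℂ) * this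
  simp_rw [h1]
  rw [integral_const_mul, h0]
  have h2 : ((Real.pi : ℂ) / ((1 / (4 * t) : ℝ) : ℂ)) ^ (1 / 2 : ℂ) =
      (((4 * Real.pi * t) ^ (1 / 2 : ℝ) : ℝ) : ℂ) := by
    rw [Complex.ofReal_cpow (by positivity)]
    congr 1
    · push_cast; field_simp
    · norm_num
  have h3 : ((4 * Real.pi * t) ^ (1 / 2 : ℝ) : ℝ) ≠ 0 := by positivity
  have h4 : Complex.exp (Complex.I * ξ * x) *
      Complex.exp (-(-(ξ : ℂ)) ^ 2 / (4 * ((1 / (4 * t) : ℝ) : ℂ))) =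
      Complex.exp (Complex.I * ξ * x - t * ξ ^ 2) := by
    rw [← Complex.exp_add]
    congr 1
    push_cast
    field_simp
    ring
  have h5 : ((1 / (4 * Real.pi * t) ^ (1 / 2 : ℝ) : ℝ) : ℂ) *
      (((4 * Real.pi * t) ^ (1 / 2 : ℝ) : ℝ) : ℂ) = 1 := by
    rw [← Complex.ofReal_mul, one_div_mul_cancel h3, Complex.ofReal_one]
  rw [h2, ← h4]
  linear_combination (Complex.exp (Complex.I * ξ * x) *
      Complex.exp (-(-(ξ : ℂ)) ^ 2 / (4 * ((1 / (4 * t) : ℝ) : ℂ)))) * h5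

theorem integral_heatKernel₁'_mul_exp {t : ℝ} (ht : 0 < t) (x ξ : ℝ) :
    ∫ y, (heatKernel₁' (x - y) t : ℂ) * Complex.exp (Complex.I * ξ * y) =
      Complex.I * ξ * Complex.exp (Complex.I * ξ * x - t * ξ ^ 2) := by
  have he : ∀ y : ℝ, ‖Complex.exp (Complex.I * ξ * y)‖ ≤ 1 := fun y => by
    simp [Complex.norm_exp]
  have hi0 : Integrable fun y : ℝ =>
      (heatKernel₁ (x - y) t : ℂ) * Complex.exp (Complex.I * ξ * y) :=
    (((integrable_heatKernel₁ ht).comp_sub_left x).ofReal).mul_bdd (by fun_prop)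
      (Eventually.of_forall he)
  have hi1 : Integrable fun y : ℝ =>
      (heatKernel₁' (x - y) t : ℂ) * Complex.exp (Complex.I * ξ * y) :=
    (((integrable_heatKernel₁' ht).comp_sub_left x).ofReal).mul_bdd (by fun_prop)
      (Eventually.of_forall he)
  have hd : ∀ y : ℝ, HasDerivAt (fun y : ℝ =>
      (heatKernel₁ (x - y) t : ℂ) * Complex.exp (Complex.I * ξ * y))
      (-((heatKernel₁' (x - y) t : ℂ) * Complex.exp (Complex.I * ξ * y)) +
        Complex.I * ξ * ((heatKernel₁ (x - y) t : ℂ) * Complex.exp (Complex.I * ξ * y))) y := by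
    intro y
    have h1 : HasDerivAt (fun y : ℝ => (heatKernel₁ (x - y) t : ℂ))
        ((-heatKernel₁' (x - y) t : ℝ) : ℂ) y := by
      have := (hasDerivAt_heatKernel₁ ht (x - y)).comp y ((hasDerivAt_id y).const_sub x)
      simpa using this.ofReal_comp
    have h2 : HasDerivAt (fun y : ℝ => Complex.exp (Complex.I * ξ * y))
        (Complex.exp (Complex.I * ξ * y) * (Complex.I * ξ)) y := by
      have h3 : HasDerivAt (fun y : ℝ => Complex.I * ξ * (y : ℂ)) (Complex.I * ξ) y := by
        simpa using (hasDerivAt_id y).ofReal_comp.const_mul (Complex.I * (ξ : ℂ))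
      exact h3.cexp
    refine (h1.mul h2).congr_deriv ?_
    push_cast; ring
  have := integral_eq_zero_of_hasDerivAt_of_integrable hd (hi1.neg.add (hi0.const_mul _)) hi0
  rw [integral_add (f := fun y : ℝ => -((heatKernel₁' (x - y) t : ℂ) *
    Complex.exp (Complex.I * ξ * y))) hi1.neg (hi0.const_mul _), integral_neg,
    integral_const_mul, integral_heatKernel₁_mul_exp ht] at this
  linear_combination -this

theorem integral_heatKernel₁_mul_inv_toC {t : ℝ} (ht : 0 < t) {h : ℝ} (hh : 0 < h) (x : ℝ) :
    ∫ y, (heatKernel₁ (x - y) t : ℂ) * (toC y h)⁻¹ = -Complex.I * heatJ t 0 (toC x h) := by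
  rw [integral_comp_mul_inv_toC (integrable_heatKernel₁ ht) hh]
  simp_rw [integral_heatKernel₁_mul_exp ht, Complex.ofReal_exp, ← Complex.exp_add]
  congr 1
  refine setIntegral_congr_fun measurableSet_Ioi fun ξ _ => ?_
  simp only [heatJIntegrand, pow_zero, one_mul]
  congr 1
  unfold toC
  push_cast
  linear_combination (-(ξ : ℂ) * h) * Complex.I_mul_I

theorem integral_heatKernel₁'_mul_inv_toC {t : ℝ} (ht : 0 < t) {h : ℝ} (hh : 0 < h) (x : ℝ) :
    ∫ y, (heatKernel₁' (x - y) t : ℂ) * (toC y h)⁻¹ = heatJ t 1 (toC x h) := by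
  rw [integral_comp_mul_inv_toC (integrable_heatKernel₁' ht) hh]
  simp_rw [integral_heatKernel₁'_mul_exp ht, Complex.ofReal_exp, mul_assoc, ← Complex.exp_add]
  rw [heatJ, ← integral_const_mul]
  refine setIntegral_congr_fun measurableSet_Ioi fun ξ _ => ?_
  simp only [heatJIntegrand, pow_one]
  rw [← mul_assoc, ← mul_assoc, neg_mul, Complex.I_mul_I, neg_neg, one_mul]
  congr 2
  unfold toC
  push_cast
  linear_combination (-(ξ : ℂ) * h) * Complex.I_mul_I

theorem integral_mul_conjPoisson {f : ℝ → ℝ} (hf : Integrable f) {h : ℝ} (hh : 0 < h) (x b : ℝ) :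
    ∫ z, f (x - z) * conjPoisson h (z - b) =
      ((1 / Real.pi : ℂ) * ∫ y, (f (x - b - y) : ℂ) * (toC y h)⁻¹).re := by
  have hint : Integrable fun y =>
      (1 / Real.pi : ℂ) * ((f (x - b - y) : ℂ) * (toC y h)⁻¹) := by
    refine Integrable.const_mul (((hf.comp_sub_left (x - b)).ofReal).mul_bdd (c := h⁻¹) ?_ ?_) _
    · refine Measurable.aestronglyMeasurable ?_
      unfold toC
      fun_prop
    · refine Eventually.of_forall fun y => ?_
      rw [norm_inv]
      gcongr
      simpa [abs_of_pos hh] using Complex.abs_im_le_norm (toC y h)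
  rw [← integral_const_mul, ← RCLike.re_to_complex, ← integral_re hint,
    ← integral_sub_right_eq_self (fun y => RCLike.re ((1 / Real.pi : ℂ) *
      ((f (x - b - y) : ℂ) * (toC y h)⁻¹))) b]
  congr 1; ext z
  rw [conjPoisson_eq_re, mul_left_comm, sub_sub_sub_cancel_right, RCLike.re_to_complex,
    Complex.re_ofReal_mul]

theorem integral_heatKernel₁_mul_conjPoisson {t : ℝ} (ht : 0 < t) {h : ℝ} (hh : h ≠ 0)
    (x b : ℝ) :
    ∫ z, heatKernel₁ (x - z) t * conjPoisson h (z - b) =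
      (1 / Real.pi) * heatJIm t 0 (x - b) |h| := by
  simp_rw [← conjPoisson_abs h]
  rw [integral_mul_conjPoisson (f := fun r => heatKernel₁ r t) (integrable_heatKernel₁ ht)
    (abs_pos.2 hh), integral_heatKernel₁_mul_inv_toC ht (abs_pos.2 hh)]
  rw [← Complex.ofReal_one, ← Complex.ofReal_div, Complex.re_ofReal_mul]
  simp [heatJIm]

theorem integral_heatKernel₁'_mul_conjPoisson {t : ℝ} (ht : 0 < t) {h : ℝ} (hh : h ≠ 0)
    (x b : ℝ) :
    ∫ z, heatKernel₁' (x - z) t * conjPoisson h (z - b) =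
      (1 / Real.pi) * heatJRe t 1 (x - b) |h| := by
  simp_rw [← conjPoisson_abs h]
  rw [integral_mul_conjPoisson (f := fun r => heatKernel₁' r t) (integrable_heatKernel₁' ht)
    (abs_pos.2 hh), integral_heatKernel₁'_mul_inv_toC ht (abs_pos.2 hh)]
  rw [← Complex.ofReal_one, ← Complex.ofReal_div, Complex.re_ofReal_mul]
  simp [heatJRe]

section

/-! ### Derivatives of the fundamental solution -/

theorem hasDerivAt_E_fst {r h : ℝ} (hne : r ^ 2 + h ^ 2 ≠ 0) :
    HasDerivAt (fun r => E (r, h)) (-(1 / 2) * conjPoisson h r) r := by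
  have hpi := Real.pi_pos
  have hpos : 0 < r ^ 2 + h ^ 2 := lt_of_le_of_ne (by positivity) hne.symm
  have h1 : HasDerivAt (fun r : ℝ => r ^ 2 + h ^ 2) (2 * r) r := by
    simpa using (hasDerivAt_pow 2 r).add_const (h ^ 2)
  have h2 := ((h1.sqrt hne).log (Real.sqrt_pos.2 hpos).ne').const_mul (-(1 / (2 * Real.pi)))
  refine h2.congr_deriv ?_
  have h3 : √(r ^ 2 + h ^ 2) ≠ 0 := (Real.sqrt_pos.2 hpos).ne'
  rw [div_div, mul_assoc, Real.mul_self_sqrt hpos.le, conjPoisson]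
  field_simp

theorem hasDerivAt_E_snd {r h : ℝ} (hne : r ^ 2 + h ^ 2 ≠ 0) :
    HasDerivAt (fun h => E (r, h)) (-(1 / 2) * poissonKernel h r) h := by
  have h1 : ∀ h, E (r, h) = E (h, r) := fun h => by simp [E, add_comm]
  have h2 : poissonKernel h r = conjPoisson r h := by simp [poissonKernel, conjPoisson, add_comm]
  simp_rw [h1, h2]
  exact hasDerivAt_E_fst (by rwa [add_comm])

theorem pd₁_E_sub {z y : ℝ × ℝ} (hne : z ≠ y) :
    HasDerivAt (fun r => E ((r, z.2) - y)) (-(1 / 2) * conjPoisson (z.2 - y.2) (z.1 - y.1)) z.1 := by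
  have : (z.1 - y.1) ^ 2 + (z.2 - y.2) ^ 2 ≠ 0 := by
    intro H
    have h1 : z.1 - y.1 = 0 := by nlinarith [sq_nonneg (z.1 - y.1), sq_nonneg (z.2 - y.2)]
    have h2 : z.2 - y.2 = 0 := by nlinarith [sq_nonneg (z.1 - y.1), sq_nonneg (z.2 - y.2)]
    exact hne (Prod.ext (by linarith) (by linarith))
  exact (hasDerivAt_E_fst this).comp_sub_const z.1 y.1

theorem pd₂_E_sub {z y : ℝ × ℝ} (hne : z ≠ y) :
    HasDerivAt (fun r => E ((z.1, r) - y)) (-(1 / 2) * poissonKernel (z.2 - y.2) (z.1 - y.1)) z.2 := by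
  have : (z.1 - y.1) ^ 2 + (z.2 - y.2) ^ 2 ≠ 0 := by
    intro H
    have h1 : z.1 - y.1 = 0 := by nlinarith [sq_nonneg (z.1 - y.1), sq_nonneg (z.2 - y.2)]
    have h2 : z.2 - y.2 = 0 := by nlinarith [sq_nonneg (z.1 - y.1), sq_nonneg (z.2 - y.2)]
    exact hne (Prod.ext (by linarith) (by linarith))
  exact (hasDerivAt_E_snd this).comp_sub_const z.2 y.2

/-- The kernel `∂₂D(·, y)` of the first component of the Biot-Savart law. -/
def velKer₁ (z y : ℝ × ℝ) : ℝ :=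
  1 / 2 * (poissonKernel (y.2 - z.2) (z.1 - y.1) + poissonKernel (z.2 + y.2) (z.1 - y.1))

/-- The kernel `-∂₁D(·, y)` of the second component of the Biot-Savart law. -/
def velKer₂ (z y : ℝ × ℝ) : ℝ :=
  1 / 2 * (conjPoisson (z.2 - y.2) (z.1 - y.1) - conjPoisson (z.2 + y.2) (z.1 - y.1))

theorem hasDerivAt_D_snd {z y : ℝ × ℝ} (h1 : z ≠ y) (h2 : z ≠ reflect y) :
    HasDerivAt (fun r => D (z.1, r) y) (velKer₁ z y) z.2 := by
  refine ((pd₂_E_sub h1).sub (pd₂_E_sub h2)).congr_deriv ?_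
  rw [velKer₁, ← neg_sub z.2 y.2, poissonKernel_neg]
  simp only [reflect, sub_neg_eq_add]
  ring

theorem hasDerivAt_D_fst {z y : ℝ × ℝ} (h1 : z ≠ y) (h2 : z ≠ reflect y) :
    HasDerivAt (fun r => D (r, z.2) y) (-velKer₂ z y) z.1 := by
  refine ((pd₁_E_sub h1).sub (pd₁_E_sub h2)).congr_deriv ?_
  rw [velKer₂]
  simp only [reflect, sub_neg_eq_add]
  ring

theorem pd₂_D {z y : ℝ × ℝ} (h1 : z ≠ y) (h2 : z ≠ reflect y) :
    pd₂ (fun x => D x y) z = velKer₁ z y := (hasDerivAt_D_snd h1 h2).deriv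

theorem pd₁_D {z y : ℝ × ℝ} (h1 : z ≠ y) (h2 : z ≠ reflect y) :
    pd₁ (fun x => D x y) z = -velKer₂ z y := (hasDerivAt_D_fst h1 h2).deriv

@[fun_prop]
theorem measurable_velKer₁ : Measurable fun p : (ℝ × ℝ) × (ℝ × ℝ) => velKer₁ p.1 p.2 := by
  have h := measurable_poissonKernel
  unfold velKer₁
  refine Measurable.const_mul (Measurable.add ?_ ?_) _
  · exact h.comp (g := fun p : ℝ × ℝ => poissonKernel p.1 p.2)
      (f := fun p : (ℝ × ℝ) × (ℝ × ℝ) => (p.2.2 - p.1.2, p.1.1 - p.2.1)) (by fun_prop)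
  · exact h.comp (g := fun p : ℝ × ℝ => poissonKernel p.1 p.2)
      (f := fun p : (ℝ × ℝ) × (ℝ × ℝ) => (p.1.2 + p.2.2, p.1.1 - p.2.1)) (by fun_prop)

@[fun_prop]
theorem measurable_velKer₂ : Measurable fun p : (ℝ × ℝ) × (ℝ × ℝ) => velKer₂ p.1 p.2 := by
  have h := measurable_conjPoisson
  unfold velKer₂
  refine Measurable.const_mul (Measurable.sub ?_ ?_) _
  · exact h.comp (g := fun p : ℝ × ℝ => conjPoisson p.1 p.2)
      (f := fun p : (ℝ × ℝ) × (ℝ × ℝ) => (p.1.2 - p.2.2, p.1.1 - p.2.1)) (by fun_prop)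
  · exact h.comp (g := fun p : ℝ × ℝ => conjPoisson p.1 p.2)
      (f := fun p : (ℝ × ℝ) × (ℝ × ℝ) => (p.1.2 + p.2.2, p.1.1 - p.2.1)) (by fun_prop)

/-! ### Signed measures as densities -/

theorem measurableSet_halfPlane : MeasurableSet halfPlane :=
  measurableSet_lt measurable_const measurable_snd

theorem isOpen_halfPlane : IsOpen halfPlane := isOpen_lt continuous_const continuous_snd

theorem measurableSet_closedHalfPlane : MeasurableSet closedHalfPlane :=
  measurableSet_le measurable_const measurable_snd

theorem volume_restrict_halfPlane :
    (volume : Measure (ℝ × ℝ)).restrict halfPlane =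
      (volume : Measure ℝ).prod (volume.restrict (Ioi 0)) := by
  have : halfPlane = univ ×ˢ Ioi (0 : ℝ) := by ext; simp [halfPlane]
  rw [this, Measure.volume_eq_prod, ← Measure.prod_restrict, Measure.restrict_univ]

/-- A bounded measurable density with respect to a measure that is concentrated on the open half
plane. -/
structure IsDensity (ν : Measure (ℝ × ℝ)) (h : ℝ × ℝ → ℝ) : Prop where
  null : ν halfPlaneᶜ = 0
  measurable : Measurable h
  le_one : ∀ y, |h y| ≤ 1

theorem exists_isDensity (μ : SignedMeasure closedHalfPlane) :
    ∃ (ν : Measure (ℝ × ℝ)) (h : ℝ × ℝ → ℝ), IsFiniteMeasure ν ∧ IsDensity ν h ∧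
      ∀ f : ℝ × ℝ → ℝ, Integrable f ν → MIntegrable μ f ∧ mIntegral μ f = ∫ y, h y * f y ∂ν := by
  obtain ⟨s, hs, hp, hn⟩ := μ.toJordanDecomposition.mutuallySingular
  set p := μ.toJordanDecomposition.posPart
  set n := μ.toJordanDecomposition.negPart
  have hemb : MeasurableEmbedding (Subtype.val : closedHalfPlane → ℝ × ℝ) :=
    MeasurableEmbedding.subtype_coe measurableSet_closedHalfPlane
  have hint : MeasurableSet interiorPart := by
    have : interiorPart = Subtype.val ⁻¹' halfPlane := rfl
    rw [this]
    exact measurable_subtype_coe measurableSet_halfPlane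
  classical
  set h : ℝ × ℝ → ℝ := fun y => if y ∈ Subtype.val '' s then -1 else 1 with hh
  have htv : μ.totalVariation = p + n := rfl
  refine ⟨(μ.totalVariation.restrict interiorPart).map Subtype.val, h, ?_, ⟨?_, ?_, ?_⟩, ?_⟩
  · rw [htv]; infer_instance
  · rw [hemb.map_apply, Measure.restrict_apply (measurable_subtype_coe measurableSet_halfPlane.compl)]
    convert measure_empty (μ := μ.totalVariation)
    ext y
    simp [interiorPart, halfPlane]
  · exact Measurable.ite (hemb.measurableSet_image.2 hs) measurable_const measurable_const
  · intro y
    simp only [hh]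
    split_ifs <;> simp
  · intro f hf
    rw [hemb.integrable_map_iff] at hf
    refine ⟨hf, ?_⟩
    rw [hemb.integral_map, mIntegral]
    have hf' := hf
    rw [htv, Measure.restrict_add, integrable_add_measure] at hf'
    have hhm : ∀ y : closedHalfPlane, h y = if y ∈ s then -1 else 1 := fun y => by
      simp only [hh]
      congr 1
      simp [y.2]
    have e1 : ∀ᵐ y : closedHalfPlane ∂p.restrict interiorPart, h y * f y = f y := by
      have : ∀ᵐ y ∂p.restrict interiorPart, y ∉ s :=
        ae_restrict_of_ae (measure_eq_zero_iff_ae_notMem.1 hp)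
      filter_upwards [this] with y hy
      rw [hhm, if_neg hy, one_mul]
    have e2 : ∀ᵐ y : closedHalfPlane ∂n.restrict interiorPart, h y * f y = -f y := by
      have : ∀ᵐ y ∂n.restrict interiorPart, y ∉ sᶜ :=
        ae_restrict_of_ae (measure_eq_zero_iff_ae_notMem.1 hn)
      filter_upwards [this] with y hy
      rw [hhm, if_pos (not_not.1 hy), neg_one_mul]
    have i1 : Integrable (fun y : closedHalfPlane => h y * f y) (p.restrict interiorPart) :=
      (integrable_congr e1).2 hf'.1
    have i2 : Integrable (fun y : closedHalfPlane => h y * f y) (n.restrict interiorPart) :=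
      (integrable_congr e2).2 hf'.2.neg
    rw [htv, Measure.restrict_add, integral_add_measure i1 i2, integral_congr_ae e1,
      integral_congr_ae e2, integral_neg, sub_eq_add_neg]

/-! ### Integrability of the velocity kernels -/

theorem integrable_prod_of_lintegral_le {α β : Type*} [MeasurableSpace α] [MeasurableSpace β]
    {E' : Type*} [NormedAddCommGroup E'] {μ : Measure α} [SFinite μ] {ν : Measure β}
    [IsFiniteMeasure ν] {f : α × β → E'} (hf : AEStronglyMeasurable f (μ.prod ν)) {C : ℝ≥0∞}
    (hC : C ≠ ⊤)
    (h : ∀ᵐ y ∂ν, ∫⁻ z, ‖f (z, y)‖ₑ ∂μ ≤ C) : Integrable f (μ.prod ν) := by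
  refine ⟨hf, ?_⟩
  rw [HasFiniteIntegral, lintegral_prod_symm _ hf.enorm]
  refine lt_of_le_of_lt (lintegral_mono_ae h) ?_
  rw [lintegral_const]
  exact ENNReal.mul_lt_top hC.lt_top (measure_lt_top _ _)

theorem lintegral_poissonKernel_le (h b : ℝ) : ∫⁻ r, ‖poissonKernel h (r - b)‖ₑ ≤ 1 := by
  rcases eq_or_ne h 0 with rfl | hh
  · simp
  · have h1 : ∀ r, ‖poissonKernel h (r - b)‖ₑ = ‖poissonKernel |h| (r - b)‖ₑ := fun r => by
      rw [poissonKernel_sign, enorm_mul]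
      rcases lt_or_gt_of_ne hh with h' | h'
      · simp [Real.sign_of_neg h', enorm_neg]
      · simp [Real.sign_of_pos h']
    simp_rw [h1]
    rw [lintegral_sub_right_eq_self (fun r => ‖poissonKernel |h| r‖ₑ) b]
    have h2 := ofReal_integral_norm_eq_lintegral_enorm (integrable_poissonKernel |h|)
    rw [← h2]
    have h3 : ∀ r, ‖poissonKernel |h| r‖ = poissonKernel |h| r := fun r =>
      Real.norm_of_nonneg (poissonKernel_nonneg (abs_nonneg h) r)
    simp_rw [h3]
    rw [integral_poissonKernel (abs_pos.2 hh), ENNReal.ofReal_one]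

theorem lintegral_velKer₁_le (s : ℝ) (y : ℝ × ℝ) : ∫⁻ r, ‖velKer₁ (r, s) y‖ₑ ≤ 1 := by
  have hm : ∀ h : ℝ, Measurable fun r : ℝ => ‖poissonKernel h (r - y.1)‖ₑ := fun h =>
    by unfold poissonKernel; fun_prop
  calc ∫⁻ r, ‖velKer₁ (r, s) y‖ₑ
      ≤ ∫⁻ r, ‖(1 / 2 : ℝ)‖ₑ * (‖poissonKernel (y.2 - s) (r - y.1)‖ₑ +
          ‖poissonKernel (s + y.2) (r - y.1)‖ₑ) := by
        refine lintegral_mono fun r => ?_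
        rw [velKer₁, enorm_mul]
        gcongr
        exact enorm_add_le _ _
    _ ≤ ‖(1 / 2 : ℝ)‖ₑ * (1 + 1) := by
        rw [lintegral_const_mul _ (by exact (hm _).add (hm _)), lintegral_add_left (hm _)]
        gcongr
        · exact lintegral_poissonKernel_le _ _
        · exact lintegral_poissonKernel_le _ _
    _ = 1 := by
        rw [one_add_one_eq_two, Real.enorm_eq_ofReal (by norm_num), ← ENNReal.ofReal_ofNat 2,
          ← ENNReal.ofReal_mul (by norm_num)]
        norm_num

theorem lintegral_inv_sqrt {R : ℝ} (hR : 0 < R) (a : ℝ) :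
    ∫⁻ r in Icc (a - R) (a + R), ‖(√|r - a|)⁻¹‖ₑ = ENNReal.ofReal (4 * √R) := by
  have h1 : ∫⁻ r in Ioc 0 R, ‖(√|r|)⁻¹‖ₑ = ENNReal.ofReal (2 * √R) := by
    have hi : IntegrableOn (fun r : ℝ => r ^ (-(1 / 2) : ℝ)) (Ioc 0 R) :=
      (intervalIntegrable_iff_integrableOn_Ioc_of_le hR.le).1
        (intervalIntegral.intervalIntegrable_rpow' (by norm_num))
    have hv : ∫ r in Ioc 0 R, r ^ (-(1 / 2) : ℝ) = 2 * √R := by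
      rw [← intervalIntegral.integral_of_le hR.le, integral_rpow (Or.inl (by norm_num)),
        Real.zero_rpow (by norm_num), Real.sqrt_eq_rpow]
      norm_num
      ring
    rw [← hv, ofReal_integral_eq_lintegral_ofReal hi
      ((ae_restrict_mem measurableSet_Ioc).mono fun r hr => Real.rpow_nonneg hr.1.le _)]
    refine setLIntegral_congr_fun measurableSet_Ioc fun r hr => ?_
    rw [Real.enorm_eq_ofReal (by positivity), abs_of_pos hr.1, Real.sqrt_eq_rpow,
      Real.rpow_neg hr.1.le]
  have h2 : ∫⁻ r in Ico (-R) 0, ‖(√|r|)⁻¹‖ₑ = ENNReal.ofReal (2 * √R) := by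
    rw [← h1]
    have h3 := (Measure.measurePreserving_neg (volume : Measure ℝ)).setLIntegral_comp_preimage
      (measurableSet_Ioc (a := (0 : ℝ)) (b := R)) (f := fun r => ‖(√|r|)⁻¹‖ₑ) (by fun_prop)
    rw [← h3]
    simp only [abs_neg]
    congr 2
    ext r
    simp only [mem_Ico, mem_preimage, mem_Ioc]
    constructor <;> rintro ⟨h, h'⟩ <;> constructor <;> linarith
  have h3 : ∫⁻ r in Icc (-R) R, ‖(√|r|)⁻¹‖ₑ = ENNReal.ofReal (4 * √R) := by
    have : ∫⁻ r in Icc (-R) R, ‖(√|r|)⁻¹‖ₑ = ∫⁻ r in Ico (-R) 0 ∪ Ioc 0 R, ‖(√|r|)⁻¹‖ₑ := by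
      refine setLIntegral_congr ?_
      have hz : ∀ᵐ r : ℝ, r ≠ 0 := Measure.ae_ne volume 0
      filter_upwards [hz] with r hr
      apply propext
      change (r ∈ Icc (-R) R) ↔ (r ∈ Ico (-R) 0 ∪ Ioc 0 R)
      simp only [mem_Icc, mem_union, mem_Ico, mem_Ioc]
      constructor
      · rintro ⟨h, h'⟩
        rcases lt_or_gt_of_ne hr with h0 | h0
        · exact Or.inl ⟨h, h0⟩
        · exact Or.inr ⟨h0, h'⟩
      · rintro (⟨h, h'⟩ | ⟨h, h'⟩) <;> constructor <;> linarith
    rw [this, lintegral_union measurableSet_Ioc, h1, h2, ← ENNReal.ofReal_add (by positivity)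
      (by positivity)]
    · congr 1; ring
    · rw [Set.disjoint_left]
      rintro r ⟨_, h⟩ ⟨h', _⟩
      linarith
  rw [← h3]
  have h4 := (measurePreserving_sub_right (volume : Measure ℝ) a).setLIntegral_comp_preimage
      (measurableSet_Icc (a := -R) (b := R)) (f := fun r => ‖(√|r|)⁻¹‖ₑ) (by fun_prop)
  rw [← h4]
  congr 2
  ext r
  simp only [mem_Icc, mem_preimage]
  constructor <;> rintro ⟨h, h'⟩ <;> constructor <;> linarith

/-- A bounded integrable weight against the singularity `|r - a|^{-1/2}`. -/
theorem lintegral_mul_inv_sqrt_le {w : ℝ → ℝ} {C : ℝ} (hC : ∀ r, |w r| ≤ C) {R : ℝ} (hR : 0 < R)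
    (hw : Measurable w) (a : ℝ) :
    ∫⁻ r, ‖w r‖ₑ * ‖(√|r - a|)⁻¹‖ₑ ≤
      ENNReal.ofReal C * ENNReal.ofReal (4 * √R) + ENNReal.ofReal (√R)⁻¹ * ∫⁻ r, ‖w r‖ₑ := by
  rw [← lintegral_add_compl _ (measurableSet_Icc (a := a - R) (b := a + R))]
  have hC0 : 0 ≤ C := (abs_nonneg _).trans (hC 0)
  gcongr
  · rw [← lintegral_inv_sqrt hR a, ← lintegral_const_mul _ (by fun_prop)]
    refine lintegral_mono fun r => ?_
    gcongr
    rw [Real.enorm_eq_ofReal_abs]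
    exact ENNReal.ofReal_le_ofReal (hC r)
  · rw [← lintegral_const_mul _ (by fun_prop)]
    refine (setLIntegral_mono' measurableSet_Icc.compl fun r hr => ?_).trans
      (setLIntegral_le_lintegral _ _)
    rw [mul_comm]
    gcongr
    rw [Real.enorm_eq_ofReal (by positivity)]
    refine ENNReal.ofReal_le_ofReal ?_
    gcongr
    by_contra! H
    apply hr
    have := abs_lt.1 H
    exact ⟨by linarith, by linarith⟩

theorem ae_ne_fst_snd (a b c : ℝ) :
    ∀ᵐ z : ℝ × ℝ, z.1 ≠ a ∧ z.2 ≠ b ∧ z.2 ≠ c := by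
  have h1 : ∀ᵐ z : ℝ × ℝ, z.1 ≠ a := by
    rw [Measure.volume_eq_prod]
    exact Measure.quasiMeasurePreserving_fst.ae (Measure.ae_ne volume a)
  have h2 : ∀ b : ℝ, ∀ᵐ z : ℝ × ℝ, z.2 ≠ b := fun b => by
    rw [Measure.volume_eq_prod]
    exact Measure.quasiMeasurePreserving_snd.ae (Measure.ae_ne volume b)
  filter_upwards [h1, h2 b, h2 c] with z h1 h2 h3 using ⟨h1, h2, h3⟩

theorem enorm_velKer₂_le {z y : ℝ × ℝ} (h1 : z.1 ≠ y.1) (h2 : z.2 ≠ y.2) (h3 : z.2 ≠ -y.2) :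
    ‖velKer₂ z y‖ₑ ≤ ‖(√|z.1 - y.1|)⁻¹‖ₑ *
      (‖(√|z.2 - y.2|)⁻¹‖ₑ + ‖(√|z.2 - -y.2|)⁻¹‖ₑ) := by
  have e : ∀ {h r : ℝ}, h ≠ 0 → r ≠ 0 → ‖conjPoisson h r‖ₑ ≤ ‖(√|r|)⁻¹‖ₑ * ‖(√|h|)⁻¹‖ₑ := by
    intro h r hh hr
    rw [← enorm_mul, Real.enorm_eq_ofReal_abs, Real.enorm_eq_ofReal (by positivity)]
    exact ENNReal.ofReal_le_ofReal (abs_conjPoisson_le hh hr)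
  have hr := sub_ne_zero.2 h1
  calc ‖velKer₂ z y‖ₑ ≤ 1 * (‖conjPoisson (z.2 - y.2) (z.1 - y.1)‖ₑ +
        ‖conjPoisson (z.2 + y.2) (z.1 - y.1)‖ₑ) := by
        rw [velKer₂, enorm_mul]
        gcongr
        · rw [Real.enorm_eq_ofReal (by norm_num)]
          exact ENNReal.ofReal_le_one.2 (by norm_num)
        · exact enorm_sub_le
    _ ≤ _ := by
        rw [one_mul, mul_add]
        have := e (sub_ne_zero.2 h3) hr
        rw [sub_neg_eq_add] at this ⊢
        gcongr
        · exact e (sub_ne_zero.2 h2) hr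

theorem lintegral_velKer₂_le {w₁ w₂ : ℝ → ℝ} (hw₁ : Measurable w₁) (hw₂ : Measurable w₂)
    {C₁ C₂ : ℝ≥0∞} (h₁ : ∀ a, ∫⁻ r, ‖w₁ r‖ₑ * ‖(√|r - a|)⁻¹‖ₑ ≤ C₁)
    (h₂ : ∀ a, ∫⁻ r, ‖w₂ r‖ₑ * ‖(√|r - a|)⁻¹‖ₑ ≤ C₂) (y : ℝ × ℝ) :
    ∫⁻ z : ℝ × ℝ, ‖w₁ z.1 * w₂ z.2 * velKer₂ z y‖ₑ ≤ C₁ * (C₂ + C₂) := by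
  calc ∫⁻ z : ℝ × ℝ, ‖w₁ z.1 * w₂ z.2 * velKer₂ z y‖ₑ
      ≤ ∫⁻ z : ℝ × ℝ, (‖w₁ z.1‖ₑ * ‖(√|z.1 - y.1|)⁻¹‖ₑ) *
          (‖w₂ z.2‖ₑ * ‖(√|z.2 - y.2|)⁻¹‖ₑ + ‖w₂ z.2‖ₑ * ‖(√|z.2 - -y.2|)⁻¹‖ₑ) := by
        refine lintegral_mono_ae ?_
        filter_upwards [ae_ne_fst_snd y.1 y.2 (-y.2)] with z hz
        rw [enorm_mul, enorm_mul]
        refine (mul_le_mul_right (enorm_velKer₂_le hz.1 hz.2.1 hz.2.2) _).trans (le_of_eq ?_)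
        ring
    _ = (∫⁻ r, ‖w₁ r‖ₑ * ‖(√|r - y.1|)⁻¹‖ₑ) *
          ∫⁻ s, (‖w₂ s‖ₑ * ‖(√|s - y.2|)⁻¹‖ₑ + ‖w₂ s‖ₑ * ‖(√|s - -y.2|)⁻¹‖ₑ) := by
        rw [Measure.volume_eq_prod]
        exact lintegral_prod_mul (f := fun r => ‖w₁ r‖ₑ * ‖(√|r - y.1|)⁻¹‖ₑ)
          (g := fun s => ‖w₂ s‖ₑ * ‖(√|s - y.2|)⁻¹‖ₑ + ‖w₂ s‖ₑ * ‖(√|s - -y.2|)⁻¹‖ₑ)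
          (by fun_prop) (by fun_prop)
    _ ≤ C₁ * (C₂ + C₂) := by
        rw [lintegral_add_left (by fun_prop)]
        gcongr
        exacts [h₁ _, h₂ _, h₂ _]

variable {ν : Measure (ℝ × ℝ)} [IsFiniteMeasure ν]

theorem integrable_mul_velKer₁ {w : ℝ × ℝ → ℝ} {v : ℝ → ℝ} (hw : Measurable w)
    (hwv : ∀ z, 0 < z.2 → |w z| ≤ v z.2) (hvi : IntegrableOn v (Ioi 0)) :
    Integrable (fun p : (ℝ × ℝ) × (ℝ × ℝ) => w p.1 * velKer₁ p.1 p.2)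
      ((volume.restrict halfPlane).prod ν) := by
  refine integrable_prod_of_lintegral_le (C := ∫⁻ s in Ioi 0, ‖v s‖ₑ) (by fun_prop) hvi.2.ne
    (Eventually.of_forall fun y => ?_)
  rw [volume_restrict_halfPlane, lintegral_prod_symm _ (by fun_prop)]
  refine setLIntegral_mono' measurableSet_Ioi fun s (hs : 0 < s) => ?_
  calc ∫⁻ r, ‖w (r, s) * velKer₁ (r, s) y‖ₑ ≤ ∫⁻ r, ‖v s‖ₑ * ‖velKer₁ (r, s) y‖ₑ := by
        refine lintegral_mono fun r => ?_
        rw [enorm_mul]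
        gcongr
        rw [Real.enorm_eq_ofReal_abs, Real.enorm_eq_ofReal_abs]
        exact ENNReal.ofReal_le_ofReal ((hwv (r, s) hs).trans (le_abs_self _))
    _ ≤ ‖v s‖ₑ * 1 := by
        rw [lintegral_const_mul _ (by fun_prop)]
        gcongr
        exact lintegral_velKer₁_le s y
    _ = ‖v s‖ₑ := mul_one _

theorem integrable_mul_velKer₂ {w : ℝ × ℝ → ℝ} {w₁ w₂ : ℝ → ℝ} (hw : Measurable w)
    (hw₁ : Measurable w₁) (hw₂ : Measurable w₂) (hle : ∀ z, |w z| ≤ w₁ z.1 * w₂ z.2)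
    {M₁ M₂ : ℝ} (hM₁ : ∀ r, |w₁ r| ≤ M₁) (hM₂ : ∀ r, |w₂ r| ≤ M₂)
    (hi₁ : Integrable w₁) (hi₂ : Integrable w₂) :
    Integrable (fun p : (ℝ × ℝ) × (ℝ × ℝ) => w p.1 * velKer₂ p.1 p.2)
      ((volume.restrict halfPlane).prod ν) := by
  have key : ∀ {w : ℝ → ℝ} {M : ℝ}, Measurable w → (∀ r, |w r| ≤ M) → Integrable w →
      ∃ C : ℝ≥0∞, C ≠ ⊤ ∧ ∀ a, ∫⁻ r, ‖w r‖ₑ * ‖(√|r - a|)⁻¹‖ₑ ≤ C := by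
    intro w M hw hM hi
    have h := hi.2.ne
    exact ⟨_, by finiteness, fun a => lintegral_mul_inv_sqrt_le hM one_pos hw a⟩
  obtain ⟨C₁, hC₁, b₁⟩ := key hw₁ hM₁ hi₁
  obtain ⟨C₂, hC₂, b₂⟩ := key hw₂ hM₂ hi₂
  refine integrable_prod_of_lintegral_le (C := C₁ * (C₂ + C₂)) (by fun_prop) (by finiteness)
    (Eventually.of_forall fun y => ?_)
  · refine (setLIntegral_le_lintegral _ _).trans
      (le_trans ?_ (lintegral_velKer₂_le hw₁ hw₂ b₁ b₂ y))
    refine lintegral_mono fun z => ?_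
    rw [enorm_mul, enorm_mul (w₁ z.1 * w₂ z.2)]
    gcongr
    rw [Real.enorm_eq_ofReal_abs, Real.enorm_eq_ofReal_abs]
    exact ENNReal.ofReal_le_ofReal ((hle z).trans (le_abs_self _))

end

/-! ### The nonlocal part of the Green matrix -/

theorem norm_heatJ_le_of_abs_im_le {t : ℝ} (ht : 0 < t) (k : ℕ) {ζ : ℂ} {M : ℝ}
    (hζ : |ζ.im| ≤ M) :
    ‖heatJ t k ζ‖ ≤ ∫ ξ in Ioi (0 : ℝ), ξ ^ k * Real.exp (M * ξ - t * ξ ^ 2) := by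
  refine norm_integral_le_of_norm_le (integrableOn_pow_mul_exp ht k M)
    ((ae_restrict_mem measurableSet_Ioi).mono fun ξ hξ => ?_)
  have hξ : 0 < ξ := hξ
  rw [norm_heatJIntegrand, abs_of_pos hξ]
  gcongr
  have := neg_le_of_abs_le hζ
  nlinarith

/-- The function `∫₀ᵇ Γ₀(w + a) J_k(ζ - iw) dw`. -/
def stripJ (t : ℝ) (k : ℕ) (a : ℝ) (ζ : ℂ) (b : ℝ) : ℂ :=
  ∫ w in (0 : ℝ)..b, (heatKernel₁ (w + a) t : ℂ) * heatJ t k (ζ - Complex.I * w)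

theorem continuous_stripJ_integrand {t : ℝ} (ht : 0 < t) (k : ℕ) (a : ℝ) :
    Continuous fun p : (ℂ × ℝ) × ℝ =>
      (heatKernel₁ (p.2 + a) t : ℂ) * heatJ t k (p.1.1 - Complex.I * p.2) := by
  have := continuous_heatJ ht k
  fun_prop

theorem continuous_stripJ {t : ℝ} (ht : 0 < t) (k : ℕ) (a : ℝ) :
    Continuous fun p : ℂ × ℝ => stripJ t k a p.1 p.2 :=
  intervalIntegral.continuous_parametric_intervalIntegral_of_continuous
    (f := fun (p : ℂ × ℝ) (w : ℝ) =>
      (heatKernel₁ (w + a) t : ℂ) * heatJ t k (p.1 - Complex.I * w))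
    (continuous_stripJ_integrand ht k a) continuous_snd

theorem hasDerivAt_stripJ_fst {t : ℝ} (ht : 0 < t) (k : ℕ) (a : ℝ) (ζ : ℂ) (b : ℝ) :
    HasDerivAt (fun ζ => stripJ t k a ζ b) (Complex.I * stripJ t (k + 1) a ζ b) ζ := by
  have hc : ∀ k (z : ℂ), Continuous fun w : ℝ =>
      (heatKernel₁ (w + a) t : ℂ) * heatJ t k (z - Complex.I * w) := fun k z => by
    have := continuous_heatJ ht k
    fun_prop
  have key := intervalIntegral.hasDerivAt_integral_of_dominated_loc_of_deriv_le (𝕜 := ℂ)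
    (F := fun z w => (heatKernel₁ (w + a) t : ℂ) * heatJ t k (z - Complex.I * w))
    (F' := fun z w => Complex.I * ((heatKernel₁ (w + a) t : ℂ) *
      heatJ t (k + 1) (z - Complex.I * w)))
    (bound := fun _ => heatKernel₁ 0 t * ∫ ξ in Ioi (0 : ℝ),
      ξ ^ (k + 1) * Real.exp ((|ζ.im| + 1 + |b|) * ξ - t * ξ ^ 2))
    (μ := volume) (a := 0) (b := b) (x₀ := ζ) (s := Metric.ball ζ 1) (Metric.ball_mem_nhds ζ one_pos)
    (Eventually.of_forall fun z => (hc k z).aestronglyMeasurable)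
    ((hc k ζ).intervalIntegrable _ _)
    ((hc (k + 1) ζ).aestronglyMeasurable.const_mul _)
    (Eventually.of_forall fun w hw z hz => ?_)
    intervalIntegrable_const
    (Eventually.of_forall fun w _ z _ => ?_)
  · have := key.2
    rw [intervalIntegral.integral_const_mul] at this
    exact this
  · rw [norm_mul, Complex.norm_I, one_mul, norm_mul, Complex.norm_real,
      Real.norm_of_nonneg (heatKernel₁_pos ht _).le]
    refine mul_le_mul (heatKernel₁_le ht _) (norm_heatJ_le_of_abs_im_le ht _ ?_) (norm_nonneg _)
      (heatKernel₁_pos ht _).le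
    have h1 : |z.im - ζ.im| ≤ 1 := by
      have := Complex.abs_im_le_norm (z - ζ)
      rw [Complex.sub_im] at this
      exact this.trans (by simpa [dist_eq_norm] using (Metric.mem_ball.1 hz).le)
    have h2 : |w| ≤ |b| := by
      rcases le_total 0 b with hb | hb
      · rw [uIoc_of_le hb] at hw
        rw [abs_of_pos hw.1, abs_of_nonneg hb]; exact hw.2
      · rw [uIoc_of_ge hb] at hw
        rw [abs_of_nonpos hw.2, abs_of_nonpos hb]; linarith [hw.1]
    have h3 : (z - Complex.I * w).im = (z.im - ζ.im) + ζ.im - w := by simp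
    rw [h3]
    calc |z.im - ζ.im + ζ.im - w| ≤ |z.im - ζ.im + ζ.im| + |w| := abs_sub _ _
      _ ≤ |z.im - ζ.im| + |ζ.im| + |w| := by gcongr; exact abs_add_le _ _
      _ ≤ _ := by linarith
  · have h1 : HasDerivAt (fun z : ℂ => z - Complex.I * w) 1 z := (hasDerivAt_id z).sub_const _
    have h2 := ((hasDerivAt_heatJ ht k (z - Complex.I * w)).comp z h1).const_mul
      (heatKernel₁ (w + a) t : ℂ)
    exact h2.congr_deriv (by ring)

theorem hasDerivAt_stripJ_snd {t : ℝ} (ht : 0 < t) (k : ℕ) (a : ℝ) (ζ : ℂ) (b : ℝ) :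
    HasDerivAt (fun b => stripJ t k a ζ b)
      ((heatKernel₁ (b + a) t : ℂ) * heatJ t k (ζ - Complex.I * b)) b := by
  have hc : Continuous fun w : ℝ =>
      (heatKernel₁ (w + a) t : ℂ) * heatJ t k (ζ - Complex.I * w) := by
    have := continuous_heatJ ht k
    fun_prop
  exact intervalIntegral.integral_hasDerivAt_right (hc.intervalIntegrable _ _)
    (hc.stronglyMeasurableAtFilter _ _) hc.continuousAt

/-- The linear map `(a, b) ↦ a p + b q`. -/
def planeLinear (p q : ℂ) : ℝ × ℝ →L[ℝ] ℂ :=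
  (ContinuousLinearMap.fst ℝ ℝ ℝ).smulRight p + (ContinuousLinearMap.snd ℝ ℝ ℝ).smulRight q

@[simp] theorem planeLinear_apply (p q : ℂ) (v : ℝ × ℝ) :
    planeLinear p q v = v.1 * p + v.2 * q := by simp [planeLinear]

theorem norm_planeLinear_le (p q : ℂ) : ‖planeLinear p q‖ ≤ ‖p‖ + ‖q‖ := by
  refine ContinuousLinearMap.opNorm_le_bound _ (by positivity) fun v => ?_
  rw [planeLinear_apply, add_mul]
  refine (norm_add_le _ _).trans ?_
  rw [norm_mul, norm_mul, Complex.norm_real, Complex.norm_real, mul_comm ‖v.1‖, mul_comm ‖v.2‖]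
  gcongr
  · exact norm_fst_le v
  · exact norm_snd_le v

theorem planeLinear_add (p q p' q' : ℂ) :
    planeLinear p q + planeLinear p' q' = planeLinear (p + p') (q + q') := by
  ext <;> simp

theorem smul_planeLinear (c p q : ℂ) : c • planeLinear p q = planeLinear (c * p) (c * q) := by
  ext <;> simp

theorem continuous_planeLinear : Continuous fun p : ℂ × ℂ => planeLinear p.1 p.2 := by
  have h : (fun p : ℂ × ℂ => planeLinear p.1 p.2) = fun p : ℂ × ℂ =>
      ContinuousLinearMap.smulRightL ℝ (ℝ × ℝ) ℂ (ContinuousLinearMap.fst ℝ ℝ ℝ) p.1 +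
      ContinuousLinearMap.smulRightL ℝ (ℝ × ℝ) ℂ (ContinuousLinearMap.snd ℝ ℝ ℝ) p.2 := rfl
  rw [h]
  fun_prop

/-- The nonlocal part of the Green matrix, as a function of `x`. -/
def greenStrip (t : ℝ) (k : ℕ) (x z : ℝ × ℝ) : ℂ := stripJ t k z.2 (toC (x.1 - z.1) x.2) x.2

theorem hasFDerivAt_greenStrip {t : ℝ} (ht : 0 < t) (k : ℕ) (x z : ℝ × ℝ) :
    HasFDerivAt (fun x => greenStrip t k x z)
      (planeLinear (Complex.I * greenStrip t (k + 1) x z)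
        ((heatKernel₁ (x.2 + z.2) t : ℂ) * heatJ t k (toC (x.1 - z.1) 0) -
          greenStrip t (k + 1) x z)) x := by
  have hJ := continuous_heatJ ht k
  have h1 := (hasStrictFDerivAt_uncurry_coprod (𝕜 := ℝ) (u := (toC (x.1 - z.1) x.2, x.2))
    (f := fun ζ b => stripJ t k z.2 ζ b)
    (f₁ := fun ζ b => (Complex.I * stripJ t (k + 1) z.2 ζ b) • (1 : ℂ →L[ℝ] ℂ))
    (f₂ := fun ζ b => ContinuousLinearMap.toSpanSingleton ℝ
      ((heatKernel₁ (b + z.2) t : ℂ) * heatJ t k (ζ - Complex.I * b)))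
    (Eventually.of_forall fun p => (hasDerivAt_stripJ_fst ht k z.2 p.1 p.2).complexToReal_fderiv)
    (Eventually.of_forall fun p => (hasDerivAt_stripJ_snd ht k z.2 p.1 p.2).hasFDerivAt)
    (((continuous_const.mul (continuous_stripJ ht (k + 1) z.2)).smul continuous_const).continuousAt)
    (Continuous.continuousAt (by
      have h : Continuous fun p : ℂ × ℝ => ContinuousLinearMap.toSpanSingletonCLE (𝕜 := ℝ)
        ((heatKernel₁ (p.2 + z.2) t : ℂ) * heatJ t k (p.1 - Complex.I * p.2)) := by
        fun_prop
      exact h))).hasFDerivAt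
  have h2 : HasFDerivAt (fun x : ℝ × ℝ => (toC (x.1 - z.1) x.2, x.2))
      ((planeLinear 1 Complex.I).prod (ContinuousLinearMap.snd ℝ ℝ ℝ)) x := by
    refine HasFDerivAt.prodMk ?_ hasFDerivAt_snd
    have h3 := (planeLinear 1 Complex.I).hasFDerivAt (x := x) |>.sub_const (z.1 : ℂ)
    refine h3.congr_of_eventuallyEq (Eventually.of_forall fun x => ?_)
    simp only [toC, planeLinear_apply]
    push_cast; ring
  have h3 := h1.comp x h2
  refine h3.congr_fderiv ?_
  have e : toC (x.1 - z.1) x.2 - Complex.I * x.2 = toC (x.1 - z.1) 0 := by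
    simp only [toC]; push_cast; ring
  ext <;> simp [greenStrip, Function.HasUncurry.uncurry, e]
  · linear_combination (stripJ t (k + 1) z.2 (toC (x.1 - z.1) x.2) x.2) * Complex.I_mul_I

/-! ### The Green matrix in closed form -/

theorem pd_zero (f : ℝ × ℝ → ℝ) : pd 0 f = pd₁ f := by simp [pd]
theorem pd_one (f : ℝ × ℝ → ℝ) : pd 1 f = pd₂ f := by simp [pd]

theorem pd₁_E {p : ℝ × ℝ} (hp : p.2 ≠ 0) : pd₁ E p = -(1 / 2) * conjPoisson p.2 p.1 :=
  (hasDerivAt_E_fst (r := p.1) (h := p.2) (by positivity)).deriv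

theorem pd₂_E {p : ℝ × ℝ} (hp : p.2 ≠ 0) : pd₂ E p = -(1 / 2) * poissonKernel p.2 p.1 :=
  (hasDerivAt_E_snd (r := p.1) (h := p.2) (by positivity)).deriv

theorem integral_pd₁_E_mul_heat {t : ℝ} (ht : 0 < t) (x z : ℝ × ℝ) {w : ℝ} (hw : w < x.2) :
    ∫ w₁ : ℝ, pd₁ E (x - (w₁, w)) * heatKernel₂ ((w₁, w) - reflect z) t =
      -(1 / (2 * Real.pi)) * (heatKernel₁ (w + z.2) t * heatJIm t 0 (x.1 - z.1) (x.2 - w)) := by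
  have hne : x.2 - w ≠ 0 := (sub_pos.2 hw).ne'
  rw [← integral_sub_left_eq_self _ volume (x.1 + z.1)]
  have h1 : ∀ u : ℝ, pd₁ E (x - (x.1 + z.1 - u, w)) *
      heatKernel₂ ((x.1 + z.1 - u, w) - reflect z) t = (-(1 / 2) * heatKernel₁ (w + z.2) t) *
        (heatKernel₁ (x.1 - u) t * conjPoisson (x.2 - w) (u - z.1)) := by
    intro u
    rw [pd₁_E hne, heatKernel₂_eq ht]
    simp only [reflect, Prod.fst_sub, Prod.snd_sub, sub_neg_eq_add]
    rw [show x.1 - (x.1 + z.1 - u) = u - z.1 by ring, show x.1 + z.1 - u - z.1 = x.1 - u by ring]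
    ring
  simp_rw [h1]
  rw [integral_const_mul, integral_heatKernel₁_mul_conjPoisson ht hne, abs_of_pos (sub_pos.2 hw)]
  field_simp

theorem integral_pd₂_E_mul_heat {t : ℝ} (ht : 0 < t) (x z : ℝ × ℝ) {w : ℝ} (hw : w < x.2) :
    ∫ w₁ : ℝ, pd₂ E (x - (w₁, w)) * heatKernel₂ ((w₁, w) - reflect z) t =
      -(1 / (2 * Real.pi)) * (heatKernel₁ (w + z.2) t * heatJRe t 0 (x.1 - z.1) (x.2 - w)) := by
  have hne : x.2 - w ≠ 0 := (sub_pos.2 hw).ne'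
  rw [← integral_sub_left_eq_self _ volume (x.1 + z.1)]
  have h1 : ∀ u : ℝ, pd₂ E (x - (x.1 + z.1 - u, w)) *
      heatKernel₂ ((x.1 + z.1 - u, w) - reflect z) t = (-(1 / 2) * heatKernel₁ (w + z.2) t) *
        (heatKernel₁ (x.1 - u) t * poissonKernel (x.2 - w) (u - z.1)) := by
    intro u
    rw [pd₂_E hne, heatKernel₂_eq ht]
    simp only [reflect, Prod.fst_sub, Prod.snd_sub, sub_neg_eq_add]
    rw [show x.1 - (x.1 + z.1 - u) = u - z.1 by ring, show x.1 + z.1 - u - z.1 = x.1 - u by ring]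
    ring
  simp_rw [h1]
  rw [integral_const_mul, integral_poissonKernel_mul_heatKernel₁ ht, abs_of_pos (sub_pos.2 hw),
    Real.sign_of_pos (sub_pos.2 hw)]
  field_simp

theorem toC_sub_I_mul (r b w : ℝ) : toC r b - Complex.I * w = toC r (b - w) := by
  simp only [toC]; push_cast; ring

theorem intervalIntegrable_strip {t : ℝ} (ht : 0 < t) (k : ℕ) (a r b c : ℝ) :
    IntervalIntegrable (fun w : ℝ => (heatKernel₁ (w + a) t : ℂ) * heatJ t k (toC r (b - w)))
      volume 0 c := by
  have hJ := continuous_heatJ ht k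
  refine Continuous.intervalIntegrable ?_ _ _
  unfold toC
  fun_prop

theorem stripJ_re {t : ℝ} (ht : 0 < t) (k : ℕ) (a r b : ℝ) :
    (stripJ t k a (toC r b) b).re =
      ∫ w in (0 : ℝ)..b, heatKernel₁ (w + a) t * heatJRe t k r (b - w) := by
  have h := Complex.reCLM.intervalIntegral_comp_comm (intervalIntegrable_strip ht k a r b b)
  simp only [Complex.reCLM_apply, Complex.re_ofReal_mul] at h
  simp only [stripJ, toC_sub_I_mul]
  exact h.symm

theorem stripJ_im {t : ℝ} (ht : 0 < t) (k : ℕ) (a r b : ℝ) :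
    (stripJ t k a (toC r b) b).im =
      ∫ w in (0 : ℝ)..b, heatKernel₁ (w + a) t * heatJIm t k r (b - w) := by
  have h := Complex.imCLM.intervalIntegral_comp_comm (intervalIntegrable_strip ht k a r b b)
  simp only [Complex.imCLM_apply, Complex.im_ofReal_mul] at h
  simp only [stripJ, toC_sub_I_mul]
  exact h.symm

theorem pd₁_strip {t : ℝ} (ht : 0 < t) {x : ℝ × ℝ} (hx : 0 < x.2) (z : ℝ × ℝ) :
    pd₁ (fun x' => ∫ w₂ in (0 : ℝ)..x'.2, ∫ w₁ : ℝ,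
        pd 0 E (x' - (w₁, w₂)) * heatKernel₂ ((w₁, w₂) - reflect z) t) x =
      -(1 / (2 * Real.pi)) * (greenStrip t 1 x z).re ∧
    pd₁ (fun x' => ∫ w₂ in (0 : ℝ)..x'.2, ∫ w₁ : ℝ,
        pd 1 E (x' - (w₁, w₂)) * heatKernel₂ ((w₁, w₂) - reflect z) t) x =
      1 / (2 * Real.pi) * (greenStrip t 1 x z).im := by
  have hae : ∀ᵐ w : ℝ, w ≠ x.2 := Measure.ae_ne volume x.2
  have e0 : ∀ r : ℝ, (∫ w₂ in (0 : ℝ)..x.2, ∫ w₁ : ℝ,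
      pd 0 E ((r, x.2) - (w₁, w₂)) * heatKernel₂ ((w₁, w₂) - reflect z) t) =
      -(1 / (2 * Real.pi)) * (stripJ t 0 z.2 (toC (r - z.1) x.2) x.2).im := by
    intro r
    rw [stripJ_im ht, ← intervalIntegral.integral_const_mul]
    refine intervalIntegral.integral_congr_ae ?_
    filter_upwards [hae] with w hw hw'
    rw [uIoc_of_le hx.le] at hw'
    rw [pd_zero]
    exact integral_pd₁_E_mul_heat ht (r, x.2) z (lt_of_le_of_ne hw'.2 hw)
  have e1 : ∀ r : ℝ, (∫ w₂ in (0 : ℝ)..x.2, ∫ w₁ : ℝ,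
      pd 1 E ((r, x.2) - (w₁, w₂)) * heatKernel₂ ((w₁, w₂) - reflect z) t) =
      -(1 / (2 * Real.pi)) * (stripJ t 0 z.2 (toC (r - z.1) x.2) x.2).re := by
    intro r
    rw [stripJ_re ht, ← intervalIntegral.integral_const_mul]
    refine intervalIntegral.integral_congr_ae ?_
    filter_upwards [hae] with w hw hw'
    rw [uIoc_of_le hx.le] at hw'
    rw [pd_one]
    exact integral_pd₂_E_mul_heat ht (r, x.2) z (lt_of_le_of_ne hw'.2 hw)
  have hd : HasDerivAt (fun r => stripJ t 0 z.2 (toC (r - z.1) x.2) x.2)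
      (Complex.I * greenStrip t 1 x z) x.1 := by
    have h1 : HasDerivAt (fun r : ℝ => toC (r - z.1) x.2) 1 x.1 :=
      (hasDerivAt_toC_fst (x.1 - z.1) x.2).comp_sub_const x.1 z.1
    simpa [Function.comp_def, greenStrip] using
      (hasDerivAt_stripJ_fst ht 0 z.2 (toC (x.1 - z.1) x.2) x.2).comp x.1 h1
  simp only [pd₁, e0, e1]
  refine ⟨(((hasDerivAt_im hd).const_mul _).deriv).trans ?_,
    (((hasDerivAt_re hd).const_mul _).deriv).trans ?_⟩
  · simp
  · simp

/-- The local part `Γ(x - z, t) - Γ(x - z*, t)` of the Green matrix. -/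
def greenDir (t : ℝ) (x z : ℝ × ℝ) : ℝ :=
  heatKernel₁ (x.1 - z.1) t * (heatKernel₁ (x.2 - z.2) t - heatKernel₁ (x.2 + z.2) t)

theorem heatKernel₂_sub {t : ℝ} (ht : 0 < t) (x z : ℝ × ℝ) :
    heatKernel₂ (x - z) t = heatKernel₁ (x.1 - z.1) t * heatKernel₁ (x.2 - z.2) t :=
  heatKernel₂_eq ht _

theorem heatKernel₂_sub_reflect {t : ℝ} (ht : 0 < t) (x z : ℝ × ℝ) :
    heatKernel₂ (x - reflect z) t = heatKernel₁ (x.1 - z.1) t * heatKernel₁ (x.2 + z.2) t := by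
  rw [heatKernel₂_eq ht]
  simp [reflect]

theorem green_zero_zero {t : ℝ} (ht : 0 < t) {x : ℝ × ℝ} (hx : 0 < x.2) (z : ℝ × ℝ) :
    green t 0 0 x z = greenDir t x z + 2 / Real.pi * (greenStrip t 1 x z).re := by
  rw [green, greenStar, heatKernel₂_sub ht, heatKernel₂_sub_reflect ht, pd_zero,
    (pd₁_strip ht hx z).1, greenDir]
  simp
  ring

theorem green_one_zero {t : ℝ} (ht : 0 < t) {x : ℝ × ℝ} (hx : 0 < x.2) (z : ℝ × ℝ) :
    green t 1 0 x z = -(2 / Real.pi) * (greenStrip t 1 x z).im := by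
  rw [green, greenStar, pd_zero, (pd₁_strip ht hx z).2]
  simp
  ring

theorem green_zero_one (t : ℝ) (x z : ℝ × ℝ) : green t 0 1 x z = 0 := by
  simp [green, greenStar]

theorem green_one_one {t : ℝ} (ht : 0 < t) (x z : ℝ × ℝ) :
    green t 1 1 x z = greenDir t x z := by
  rw [green, greenStar, heatKernel₂_sub ht, heatKernel₂_sub_reflect ht, greenDir]
  simp
  ring

theorem hasFDerivAt_greenDir {t : ℝ} (ht : 0 < t) (x z : ℝ × ℝ) :
    HasFDerivAt (fun x => (greenDir t x z : ℂ)) (planeLinear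
      ((heatKernel₁' (x.1 - z.1) t *
        (heatKernel₁ (x.2 - z.2) t - heatKernel₁ (x.2 + z.2) t) : ℝ) : ℂ)
      ((heatKernel₁ (x.1 - z.1) t *
        (heatKernel₁' (x.2 - z.2) t - heatKernel₁' (x.2 + z.2) t) : ℝ) : ℂ)) x := by
  have h1 : HasFDerivAt (fun x : ℝ × ℝ => heatKernel₁ (x.1 - z.1) t)
      (heatKernel₁' (x.1 - z.1) t • ContinuousLinearMap.fst ℝ ℝ ℝ) x :=
    (hasDerivAt_heatKernel₁ ht (x.1 - z.1)).comp_hasFDerivAt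
      (f := fun x : ℝ × ℝ => x.1 - z.1) x (hasFDerivAt_fst.sub_const z.1)
  have h2 : HasFDerivAt (fun x : ℝ × ℝ => heatKernel₁ (x.2 - z.2) t)
      (heatKernel₁' (x.2 - z.2) t • ContinuousLinearMap.snd ℝ ℝ ℝ) x :=
    (hasDerivAt_heatKernel₁ ht (x.2 - z.2)).comp_hasFDerivAt
      (f := fun x : ℝ × ℝ => x.2 - z.2) x (hasFDerivAt_snd.sub_const z.2)
  have h3 : HasFDerivAt (fun x : ℝ × ℝ => heatKernel₁ (x.2 + z.2) t)
      (heatKernel₁' (x.2 + z.2) t • ContinuousLinearMap.snd ℝ ℝ ℝ) x :=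
    (hasDerivAt_heatKernel₁ ht (x.2 + z.2)).comp_hasFDerivAt
      (f := fun x : ℝ × ℝ => x.2 + z.2) x (hasFDerivAt_snd.add_const z.2)
  refine (Complex.ofRealCLM.hasFDerivAt.comp x (h1.mul (h2.sub h3))).congr_fderiv ?_
  ext <;> simp
  ring

/-! ### Gaussian domination -/

theorem exp_shift_le {t : ℝ} (ht : 0 < t) {x x₀ z : ℝ} (hx : |x - x₀| ≤ 1) :
    Real.exp (-(x - z) ^ 2 / (8 * t)) ≤
      Real.exp (1 / (8 * t)) * Real.exp (-(x₀ - z) ^ 2 / (16 * t)) := by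
  rw [← Real.exp_add]
  apply Real.exp_le_exp.2
  have h1 : (x - x₀) ^ 2 ≤ 1 := by rw [← sq_abs]; nlinarith [abs_nonneg (x - x₀)]
  have h2 : (x₀ - z) ^ 2 ≤ 2 * (x - z) ^ 2 + 2 := by
    nlinarith [sq_nonneg ((x - z) + (x - x₀))]
  have e : 1 / (8 * t) + -(x₀ - z) ^ 2 / (16 * t) - -(x - z) ^ 2 / (8 * t) =
      (2 * (x - z) ^ 2 + 2 - (x₀ - z) ^ 2) / (16 * t) := by field_simp; ring
  have : 0 ≤ (2 * (x - z) ^ 2 + 2 - (x₀ - z) ^ 2) / (16 * t) :=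
    div_nonneg (by linarith) (by positivity)
  linarith

/-- The Gaussian weight that dominates the heat kernels and their derivatives locally. -/
def gaussWeight (t r : ℝ) : ℝ := Real.exp (-r ^ 2 / (16 * t))

theorem gaussWeight_pos (t r : ℝ) : 0 < gaussWeight t r := Real.exp_pos _

theorem gaussWeight_le_one {t : ℝ} (ht : 0 < t) (r : ℝ) : gaussWeight t r ≤ 1 :=
  Real.exp_le_one_iff.2 (div_nonpos_of_nonpos_of_nonneg (by nlinarith [sq_nonneg r]) (by positivity))

@[fun_prop]
theorem continuous_gaussWeight (t : ℝ) : Continuous (gaussWeight t) := by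
  unfold gaussWeight; fun_prop

theorem integrable_gaussWeight {t : ℝ} (ht : 0 < t) : Integrable (gaussWeight t) := by
  refine (integrable_exp_neg_mul_sq (b := 1 / (16 * t)) (by positivity)).congr
    (Eventually.of_forall fun r => ?_)
  simp only [gaussWeight]
  congr 1; ring

theorem exists_heatKernel₁_le {t : ℝ} (ht : 0 < t) : ∃ C : ℝ, 0 ≤ C ∧
    ∀ x x₀ z : ℝ, |x - x₀| ≤ 1 → heatKernel₁ (x - z) t ≤ C * gaussWeight t (x₀ - z) ∧
      |heatKernel₁' (x - z) t| ≤ C * gaussWeight t (x₀ - z) := by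
  obtain ⟨C, hC⟩ := poly_mul_gauss_bdd (1 / (8 * t)) (by positivity)
    (Polynomial.C (1 / (2 * t)) * Polynomial.X)
  have hC0 : 0 ≤ C := (abs_nonneg _).trans (hC 0)
  set A := 1 / (4 * Real.pi * t) ^ (1 / 2 : ℝ) with hA
  have hA0 : 0 ≤ A := by positivity
  set e := Real.exp (1 / (8 * t)) with he
  have he0 : 0 < e := Real.exp_pos _
  have hsplit : ∀ r : ℝ, heatKernel₁ r t = A * (Real.exp (-r ^ 2 / (8 * t)) *
      Real.exp (-r ^ 2 / (8 * t))) := fun r => by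
    rw [heatKernel₁, ← Real.exp_add]
    congr 2; field_simp; ring
  have hle1 : ∀ r : ℝ, Real.exp (-r ^ 2 / (8 * t)) ≤ 1 := fun r =>
    Real.exp_le_one_iff.2
      (div_nonpos_of_nonpos_of_nonneg (by nlinarith [sq_nonneg r]) (by positivity))
  refine ⟨A * (1 + C) * e, by positivity, fun x x₀ z hx => ⟨?_, ?_⟩⟩
  · have h1 := exp_shift_le ht (z := z) hx
    calc heatKernel₁ (x - z) t ≤ A * (1 * (e * gaussWeight t (x₀ - z))) := by
          rw [hsplit]
          gcongr
          · exact hle1 _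
          · exact h1
      _ ≤ A * (1 + C) * e * gaussWeight t (x₀ - z) := by
          have := (gaussWeight_pos t (x₀ - z)).le
          have h3 : 0 ≤ A * C * e * gaussWeight t (x₀ - z) := by positivity
          nlinarith
  · have h1 := exp_shift_le ht (z := z) hx
    have h2 := hC (x - z)
    rw [Polynomial.eval_mul, Polynomial.eval_C, Polynomial.eval_X] at h2
    rw [show -(1 / (8 * t) * (x - z) ^ 2) = -(x - z) ^ 2 / (8 * t) by ring] at h2
    have e2 : heatKernel₁' (x - z) t = -(A * ((1 / (2 * t) * (x - z) *
        Real.exp (-(x - z) ^ 2 / (8 * t))) * Real.exp (-(x - z) ^ 2 / (8 * t)))) := by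
      rw [heatKernel₁'_eq ht, hsplit]; ring
    calc |heatKernel₁' (x - z) t| ≤ A * (C * (e * gaussWeight t (x₀ - z))) := by
          rw [e2, abs_neg, abs_mul, abs_mul, abs_of_nonneg hA0,
            abs_of_pos (Real.exp_pos (-(x - z) ^ 2 / (8 * t)))]
          gcongr
          exact h1
      _ ≤ A * (1 + C) * e * gaussWeight t (x₀ - z) := by
          have := (gaussWeight_pos t (x₀ - z)).le
          have h3 : 0 ≤ A * e * gaussWeight t (x₀ - z) := by positivity
          nlinarith

theorem gaussWeight_anti {t : ℝ} (ht : 0 < t) {a b : ℝ} (h : |a| ≤ |b|) :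
    gaussWeight t b ≤ gaussWeight t a := by
  unfold gaussWeight
  have : a ^ 2 ≤ b ^ 2 := sq_le_sq.2 h
  gcongr

/-- Domination of the local part of the Green matrix and of its derivatives. -/
theorem exists_greenDir_le {t : ℝ} (ht : 0 < t) : ∃ C : ℝ, 0 ≤ C ∧
    ∀ x₀ x z : ℝ × ℝ, 0 < x₀.2 → 0 < z.2 → |x.1 - x₀.1| ≤ 1 → |x.2 - x₀.2| ≤ 1 →
      |greenDir t x z| ≤ C * (gaussWeight t (x₀.1 - z.1) * gaussWeight t (x₀.2 - z.2)) ∧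
      |heatKernel₁' (x.1 - z.1) t * (heatKernel₁ (x.2 - z.2) t - heatKernel₁ (x.2 + z.2) t)| ≤
        C * (gaussWeight t (x₀.1 - z.1) * gaussWeight t (x₀.2 - z.2)) ∧
      |heatKernel₁ (x.1 - z.1) t * (heatKernel₁' (x.2 - z.2) t - heatKernel₁' (x.2 + z.2) t)| ≤
        C * (gaussWeight t (x₀.1 - z.1) * gaussWeight t (x₀.2 - z.2)) := by
  obtain ⟨C, hC0, hC⟩ := exists_heatKernel₁_le ht
  refine ⟨C * (2 * C), by positivity, fun x₀ x z hx₀ hz h1 h2 => ?_⟩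
  obtain ⟨a1, a2⟩ := hC x.1 x₀.1 z.1 h1
  obtain ⟨b1, b2⟩ := hC x.2 x₀.2 z.2 h2
  obtain ⟨c1, c2⟩ := hC x.2 x₀.2 (-z.2) h2
  have hw : gaussWeight t (x₀.2 - -z.2) ≤ gaussWeight t (x₀.2 - z.2) := by
    refine gaussWeight_anti ht ?_
    rw [abs_of_pos (show 0 < x₀.2 - -z.2 by linarith), abs_le]
    constructor <;> linarith
  simp only [sub_neg_eq_add] at c1 c2 hw
  have c1' := c1.trans (mul_le_mul_of_nonneg_left hw hC0)
  have c2' := c2.trans (mul_le_mul_of_nonneg_left hw hC0)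
  have p1 := heatKernel₁_pos ht (x.1 - z.1)
  have p2 := heatKernel₁_pos ht (x.2 - z.2)
  have p3 := heatKernel₁_pos ht (x.2 + z.2)
  have d1 : |heatKernel₁ (x.2 - z.2) t - heatKernel₁ (x.2 + z.2) t| ≤
      2 * C * gaussWeight t (x₀.2 - z.2) := by
    refine (abs_sub _ _).trans ?_
    rw [abs_of_pos p2, abs_of_pos p3]
    linarith
  have d2 : |heatKernel₁' (x.2 - z.2) t - heatKernel₁' (x.2 + z.2) t| ≤
      2 * C * gaussWeight t (x₀.2 - z.2) := by
    refine (abs_sub _ _).trans ?_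
    linarith
  have hg1 := (gaussWeight_pos t (x₀.1 - z.1)).le
  have fin : ∀ {a b : ℝ}, |a| ≤ C * gaussWeight t (x₀.1 - z.1) →
      |b| ≤ 2 * C * gaussWeight t (x₀.2 - z.2) →
      |a * b| ≤ C * (2 * C) * (gaussWeight t (x₀.1 - z.1) * gaussWeight t (x₀.2 - z.2)) := by
    intro a b ha hb
    rw [abs_mul]
    refine (mul_le_mul ha hb (abs_nonneg _) (by positivity)).trans (le_of_eq (by ring))
  exact ⟨fin (by rwa [abs_of_pos p1]) d1, fin a2 d1, fin (by rwa [abs_of_pos p1]) d2⟩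

theorem norm_greenStrip_le {t : ℝ} (ht : 0 < t) (k : ℕ) {x z : ℝ × ℝ} (hx : 0 ≤ x.2)
    (hz : 0 < z.2) :
    ‖greenStrip t k x z‖ ≤ heatKernel₁ z.2 t * heatJBound t k * x.2 := by
  have h := intervalIntegral.norm_integral_le_of_norm_le_const (a := 0) (b := x.2)
    (f := fun w : ℝ => (heatKernel₁ (w + z.2) t : ℂ) *
      heatJ t k (toC (x.1 - z.1) x.2 - Complex.I * w))
    (C := heatKernel₁ z.2 t * heatJBound t k) ?_
  · rwa [sub_zero, abs_of_nonneg hx] at h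
  · intro w hw
    rw [uIoc_of_le hx] at hw
    rw [norm_mul, Complex.norm_real, Real.norm_of_nonneg (heatKernel₁_pos ht _).le, toC_sub_I_mul]
    refine mul_le_mul (heatKernel₁_anti ht ?_) (norm_heatJ_le ht k ?_) (norm_nonneg _)
      (heatKernel₁_pos ht _).le
    · rw [abs_of_pos hz, abs_of_pos (add_pos hw.1 hz)]
      linarith [hw.1]
    · rw [toC_im]; linarith [hw.2]

section

variable {ν : Measure (ℝ × ℝ)} {h : ℝ × ℝ → ℝ}

theorem IsDensity.integrable_mul [SFinite ν] (hd : IsDensity ν h) {α : Type*} [MeasurableSpace α]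
    {μ : Measure α} [SFinite μ] {f : α × (ℝ × ℝ) → ℝ} (hf : Integrable f (μ.prod ν)) :
    Integrable (fun p => h p.2 * f p) (μ.prod ν) :=
  hf.bdd_mul (hd.measurable.comp measurable_snd).aestronglyMeasurable
    (Eventually.of_forall fun p => hd.le_one p.2)

theorem IsDensity.ae_mem (hd : IsDensity ν h) : ∀ᵐ y ∂ν, 0 < y.2 := by
  have := measure_eq_zero_iff_ae_notMem.1 hd.null
  filter_upwards [this] with y hy
  simpa [halfPlane] using hy

variable [IsFiniteMeasure ν]

/-! ### The velocity field of a density -/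

/-- The first component of the Biot-Savart law. -/
def vel₁ (ν : Measure (ℝ × ℝ)) (h : ℝ × ℝ → ℝ) (z : ℝ × ℝ) : ℝ := ∫ y, h y * velKer₁ z y ∂ν

/-- The second component of the Biot-Savart law. -/
def vel₂ (ν : Measure (ℝ × ℝ)) (h : ℝ × ℝ → ℝ) (z : ℝ × ℝ) : ℝ := ∫ y, h y * velKer₂ z y ∂ν

theorem measurable_integral_right {f : (ℝ × ℝ) × (ℝ × ℝ) → ℝ} (hf : Measurable f) :
    Measurable fun z => ∫ y, f (z, y) ∂ν :=
  (hf.stronglyMeasurable.integral_prod_right' (ν := ν)).measurable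

theorem measurable_vel₁ (hm : Measurable h) : Measurable (vel₁ ν h) :=
  measurable_integral_right (f := fun p => h p.2 * velKer₁ p.1 p.2) (by fun_prop)

theorem measurable_vel₂ (hm : Measurable h) : Measurable (vel₂ ν h) :=
  measurable_integral_right (f := fun p => h p.2 * velKer₂ p.1 p.2) (by fun_prop)

theorem integrableOn_mul_vel₁ (hd : IsDensity ν h) {w : ℝ × ℝ → ℝ} {v : ℝ → ℝ}
    (hw : Measurable w) (hwv : ∀ z, 0 < z.2 → |w z| ≤ v z.2)
    (hvi : IntegrableOn v (Ioi 0)) :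
    IntegrableOn (fun z => w z * vel₁ ν h z) halfPlane := by
  have h1 := (hd.integrable_mul (integrable_mul_velKer₁ (ν := ν) hw hwv hvi)).integral_prod_left
  refine h1.congr (Eventually.of_forall fun z => ?_)
  simp only [vel₁]
  rw [← integral_const_mul]
  congr 1; ext y; ring

theorem integrableOn_mul_vel₂ (hd : IsDensity ν h) {w : ℝ × ℝ → ℝ} {w₁ w₂ : ℝ → ℝ}
    (hw : Measurable w) (hw₁ : Measurable w₁) (hw₂ : Measurable w₂)
    (hle : ∀ z, |w z| ≤ w₁ z.1 * w₂ z.2) {M₁ M₂ : ℝ} (hM₁ : ∀ r, |w₁ r| ≤ M₁)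
    (hM₂ : ∀ r, |w₂ r| ≤ M₂) (hi₁ : Integrable w₁) (hi₂ : Integrable w₂) :
    IntegrableOn (fun z => w z * vel₂ ν h z) halfPlane := by
  have h1 := (hd.integrable_mul
    (integrable_mul_velKer₂ (ν := ν) hw hw₁ hw₂ hle hM₁ hM₂ hi₁ hi₂)).integral_prod_left
  refine h1.congr (Eventually.of_forall fun z => ?_)
  simp only [vel₂]
  rw [← integral_const_mul]
  congr 1; ext y; ring

theorem ae_integrable_velKer :
    ∀ᵐ z ∂(volume : Measure (ℝ × ℝ)).restrict halfPlane,
      Integrable (fun y => velKer₁ z y) ν ∧ Integrable (fun y => velKer₂ z y) ν := by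
  have hg := integrable_gaussWeight one_pos
  have hb : ∀ r, |gaussWeight 1 r| ≤ 1 := fun r => by
    rw [abs_of_pos (gaussWeight_pos 1 r)]; exact gaussWeight_le_one one_pos r
  have h1 := (integrable_mul_velKer₁ (ν := ν) (w := fun z => gaussWeight 1 z.2)
    (v := gaussWeight 1) (by fun_prop)
    (fun z _ => (abs_of_pos (gaussWeight_pos 1 z.2)).le) hg.integrableOn).prod_right_ae
  have h2 := (integrable_mul_velKer₂ (ν := ν) (w := fun z => gaussWeight 1 z.1 * gaussWeight 1 z.2)
    (w₁ := gaussWeight 1) (w₂ := gaussWeight 1) (by fun_prop) (by fun_prop) (by fun_prop)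
    (fun z => (abs_of_pos (mul_pos (gaussWeight_pos 1 z.1) (gaussWeight_pos 1 z.2))).le)
    hb hb hg hg).prod_right_ae
  filter_upwards [h1, h2] with z h1 h2
  refine ⟨(h1.const_mul (gaussWeight 1 z.2)⁻¹).congr (Eventually.of_forall fun y => ?_),
    (h2.const_mul (gaussWeight 1 z.1 * gaussWeight 1 z.2)⁻¹).congr
      (Eventually.of_forall fun y => ?_)⟩
  · have := (gaussWeight_pos 1 z.2).ne'
    simp only
    field_simp
  · have := (gaussWeight_pos 1 z.1).ne'
    have := (gaussWeight_pos 1 z.2).ne'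
    simp only
    field_simp

theorem ae_ae_ne (ν : Measure (ℝ × ℝ)) [IsFiniteMeasure ν] :
    ∀ᵐ z : ℝ × ℝ, ∀ᵐ y ∂ν, y ≠ z := by
  have hmeas : MeasurableSet {p : (ℝ × ℝ) × (ℝ × ℝ) | p.2 = p.1} :=
    measurableSet_eq_fun measurable_snd measurable_fst
  have h0 : (volume.prod ν) {p : (ℝ × ℝ) × (ℝ × ℝ) | p.2 = p.1} = 0 := by
    rw [Measure.prod_apply_symm hmeas]
    simp [Set.preimage]
  have := Measure.measure_ae_null_of_prod_null h0
  filter_upwards [this] with z hz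
  exact measure_eq_zero_iff_ae_notMem.1 (hz : ν (Prod.mk z ⁻¹' {p | p.2 = p.1}) = 0)

theorem biotSavart_ae_eq {μ : SignedMeasure closedHalfPlane} (hd : IsDensity ν h)
    (hrep : ∀ f : ℝ × ℝ → ℝ, Integrable f ν → MIntegrable μ f ∧
      mIntegral μ f = ∫ y, h y * f y ∂ν) :
    ∀ᵐ z ∂(volume : Measure (ℝ × ℝ)).restrict halfPlane,
      biotSavart μ z = (vel₁ ν h z, vel₂ ν h z) := by
  filter_upwards [ae_integrable_velKer (ν := ν), ae_restrict_of_ae (ae_ae_ne ν),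
    ae_restrict_mem measurableSet_halfPlane] with z hz hne hz0
  have hz0 : 0 < z.2 := hz0
  have hne' : ∀ᵐ y ∂ν, z ≠ y ∧ z ≠ reflect y := by
    filter_upwards [hne, hd.ae_mem] with y hy hy0
    refine ⟨hy.symm, fun H => ?_⟩
    have : z.2 = -y.2 := by rw [H]; rfl
    linarith
  have e1 : (fun y => pd₂ (fun x' => D x' y) z) =ᵐ[ν] fun y => velKer₁ z y := by
    filter_upwards [hne'] with y hy using pd₂_D hy.1 hy.2
  have e2 : (fun y => -pd₁ (fun x' => D x' y) z) =ᵐ[ν] fun y => velKer₂ z y := by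
    filter_upwards [hne'] with y hy
    rw [pd₁_D hy.1 hy.2, neg_neg]
  rw [biotSavart, (hrep _ ((integrable_congr e1).2 hz.1)).2,
    (hrep _ ((integrable_congr e2).2 hz.2)).2]
  refine Prod.ext (integral_congr_ae ?_) (integral_congr_ae ?_)
  · filter_upwards [e1] with y hy
    rw [hy]
  · filter_upwards [e2] with y hy
    rw [hy]

/-! ### Differentiation of the Stokes semigroup -/

theorem continuous_greenStrip_snd {t : ℝ} (ht : 0 < t) (k : ℕ) (x : ℝ × ℝ) :
    Continuous fun z => greenStrip t k x z := by
  have hJ := continuous_heatJ ht k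
  refine intervalIntegral.continuous_parametric_intervalIntegral_of_continuous'
    (f := fun (z : ℝ × ℝ) (w : ℝ) => (heatKernel₁ (w + z.2) t : ℂ) *
      heatJ t k (toC (x.1 - z.1) x.2 - Complex.I * w)) ?_ 0 x.2
  unfold toC Function.uncurry
  fun_prop

theorem continuous_greenDir_snd (t : ℝ) (x : ℝ × ℝ) : Continuous fun z => greenDir t x z := by
  unfold greenDir; fun_prop

/-- The integrand of `(S(t)u)¹ - i (S(t)u)²`. -/
def stokesIntegrand (t : ℝ) (u₁ u₂ : ℝ × ℝ → ℝ) (x z : ℝ × ℝ) : ℂ :=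
  (greenDir t x z : ℂ) * (u₁ z - Complex.I * u₂ z) +
    (2 / Real.pi : ℝ) * greenStrip t 1 x z * u₁ z

/-- The derivative in `x₁` of `stokesIntegrand`. -/
def stokesIntegrand₁ (t : ℝ) (u₁ u₂ : ℝ × ℝ → ℝ) (x z : ℝ × ℝ) : ℂ :=
  ((heatKernel₁' (x.1 - z.1) t * (heatKernel₁ (x.2 - z.2) t - heatKernel₁ (x.2 + z.2) t) : ℝ) : ℂ) *
    (u₁ z - Complex.I * u₂ z) +
    (2 / Real.pi : ℝ) * (Complex.I * greenStrip t 2 x z) * u₁ z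

/-- The derivative in `x₂` of `stokesIntegrand`. -/
def stokesIntegrand₂ (t : ℝ) (u₁ u₂ : ℝ × ℝ → ℝ) (x z : ℝ × ℝ) : ℂ :=
  ((heatKernel₁ (x.1 - z.1) t * (heatKernel₁' (x.2 - z.2) t - heatKernel₁' (x.2 + z.2) t) : ℝ) : ℂ) *
    (u₁ z - Complex.I * u₂ z) +
    (2 / Real.pi : ℝ) * ((heatKernel₁ (x.2 + z.2) t : ℂ) * heatJ t 1 (toC (x.1 - z.1) 0) -
      greenStrip t 2 x z) * u₁ z

theorem hasFDerivAt_stokesIntegrand {t : ℝ} (ht : 0 < t) (u₁ u₂ : ℝ × ℝ → ℝ) (x z : ℝ × ℝ) :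
    HasFDerivAt (fun x => stokesIntegrand t u₁ u₂ x z)
      (planeLinear (stokesIntegrand₁ t u₁ u₂ x z) (stokesIntegrand₂ t u₁ u₂ x z)) x := by
  have h1 := (hasFDerivAt_greenDir ht x z).mul_const (u₁ z - Complex.I * u₂ z : ℂ)
  have h2 := ((hasFDerivAt_greenStrip ht 1 x z).const_mul ((2 / Real.pi : ℝ) : ℂ)).mul_const
    (u₁ z : ℂ)
  refine (h1.add h2).congr_fderiv ?_
  rw [smul_planeLinear, smul_planeLinear, smul_planeLinear, planeLinear_add]
  congr 1
  · rw [stokesIntegrand₁]; ring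
  · rw [stokesIntegrand₂]; ring

/-- The common dominating function of the Stokes integrand and its derivatives. -/
def stokesBound (t : ℝ) (C C' : ℝ) (u₁ u₂ : ℝ × ℝ → ℝ) (x₀ z : ℝ × ℝ) : ℝ :=
  C * (gaussWeight t (x₀.1 - z.1) * gaussWeight t (x₀.2 - z.2)) * |u₁ z| +
    C * (gaussWeight t (x₀.1 - z.1) * gaussWeight t (x₀.2 - z.2)) * |u₂ z| +
    C' * heatKernel₁ z.2 t * |u₁ z|

theorem exists_stokesBound {t : ℝ} (ht : 0 < t) {x₀ : ℝ × ℝ} (hx₀ : 0 < x₀.2) :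
    ∃ C C' : ℝ, ∀ (u₁ u₂ : ℝ × ℝ → ℝ) (x z : ℝ × ℝ), 0 < x.2 → 0 < z.2 → |x.1 - x₀.1| ≤ 1 →
      |x.2 - x₀.2| ≤ 1 →
      ‖stokesIntegrand t u₁ u₂ x z‖ ≤ stokesBound t C C' u₁ u₂ x₀ z ∧
      ‖stokesIntegrand₁ t u₁ u₂ x z‖ ≤ stokesBound t C C' u₁ u₂ x₀ z ∧
      ‖stokesIntegrand₂ t u₁ u₂ x z‖ ≤ stokesBound t C C' u₁ u₂ x₀ z := by
  obtain ⟨C, hC0, hC⟩ := exists_greenDir_le ht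
  have hM1 := heatJBound_nonneg t 1
  have hM2 := heatJBound_nonneg t 2
  refine ⟨C, 2 / Real.pi * ((heatJBound t 1 + heatJBound t 2) * (x₀.2 + 1) + heatJBound t 1),
    fun u₁ u₂ x z hx hz h1 h2 => ?_⟩
  obtain ⟨a1, a2, a3⟩ := hC x₀ x z hx₀ hz h1 h2
  have hx' : x.2 ≤ x₀.2 + 1 := by have := (abs_le.1 h2).2; linarith
  have hΓ := heatKernel₁_pos ht z.2
  have hpi := Real.pi_pos
  have gen : ∀ (b : ℝ) (N : ℂ), |b| ≤ C * (gaussWeight t (x₀.1 - z.1) * gaussWeight t (x₀.2 - z.2)) →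
      ‖N‖ ≤ heatKernel₁ z.2 t *
        ((heatJBound t 1 + heatJBound t 2) * (x₀.2 + 1) + heatJBound t 1) →
      ‖(b : ℂ) * (u₁ z - Complex.I * u₂ z) + (2 / Real.pi : ℝ) * N * u₁ z‖ ≤
        stokesBound t C (2 / Real.pi * ((heatJBound t 1 + heatJBound t 2) * (x₀.2 + 1) +
          heatJBound t 1)) u₁ u₂ x₀ z := by
    intro b N hb hN
    have e1 : ‖(u₁ z - Complex.I * u₂ z : ℂ)‖ ≤ |u₁ z| + |u₂ z| := by
      refine (norm_sub_le _ _).trans ?_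
      simp
    calc ‖(b : ℂ) * (u₁ z - Complex.I * u₂ z) + (2 / Real.pi : ℝ) * N * u₁ z‖
        ≤ |b| * (|u₁ z| + |u₂ z|) + 2 / Real.pi * ‖N‖ * |u₁ z| := by
          refine (norm_add_le _ _).trans ?_
          rw [norm_mul, norm_mul, norm_mul, Complex.norm_real, Complex.norm_real, Complex.norm_real,
            Real.norm_eq_abs, Real.norm_eq_abs, Real.norm_eq_abs,
            abs_of_nonneg (show 0 ≤ 2 / Real.pi by positivity)]
          gcongr
      _ ≤ C * (gaussWeight t (x₀.1 - z.1) * gaussWeight t (x₀.2 - z.2)) * (|u₁ z| + |u₂ z|) +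
          2 / Real.pi * (heatKernel₁ z.2 t *
        ((heatJBound t 1 + heatJBound t 2) * (x₀.2 + 1) + heatJBound t 1)) * |u₁ z| := by
          gcongr
      _ = _ := by rw [stokesBound]; ring
  have n1 := norm_greenStrip_le ht 1 hx.le hz (x := x)
  have n2 := norm_greenStrip_le ht 2 hx.le hz (x := x)
  have n1' : heatKernel₁ z.2 t * heatJBound t 1 * x.2 ≤
      heatKernel₁ z.2 t * heatJBound t 1 * (x₀.2 + 1) := by gcongr
  have n2' : heatKernel₁ z.2 t * heatJBound t 2 * x.2 ≤
      heatKernel₁ z.2 t * heatJBound t 2 * (x₀.2 + 1) := by gcongr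
  have q1 : 0 ≤ heatKernel₁ z.2 t * heatJBound t 1 * (x₀.2 + 1) := by positivity
  have q2 : 0 ≤ heatKernel₁ z.2 t * heatJBound t 2 * (x₀.2 + 1) := by positivity
  have q3 : 0 ≤ heatKernel₁ z.2 t * heatJBound t 1 := by positivity
  refine ⟨gen _ _ a1 (by linarith), gen _ _ a2 ?_, gen _ _ a3 ?_⟩
  · rw [norm_mul, Complex.norm_I, one_mul]; linarith
  · refine (norm_sub_le _ _).trans ?_
    have : ‖(heatKernel₁ (x.2 + z.2) t : ℂ) * heatJ t 1 (toC (x.1 - z.1) 0)‖ ≤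
        heatKernel₁ z.2 t * heatJBound t 1 := by
      rw [norm_mul, Complex.norm_real, Real.norm_of_nonneg (heatKernel₁_pos ht _).le]
      refine mul_le_mul (heatKernel₁_anti ht ?_) (norm_heatJ_le ht 1 (by simp)) (norm_nonneg _) hΓ.le
      rw [abs_of_pos hz, abs_of_pos (add_pos hx hz)]
      linarith
    linarith

theorem integrableOn_stokesBound {t : ℝ} (ht : 0 < t) (hd : IsDensity ν h) (C C' : ℝ)
    (x₀ : ℝ × ℝ) :
    IntegrableOn (stokesBound t C C' (vel₁ ν h) (vel₂ ν h) x₀) halfPlane := by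
  have hg := integrable_gaussWeight ht
  have hb : ∀ r, |gaussWeight t r| ≤ 1 := fun r => by
    rw [abs_of_pos (gaussWeight_pos t r)]; exact gaussWeight_le_one ht r
  have hle : ∀ z : ℝ × ℝ, |gaussWeight t (x₀.1 - z.1) * gaussWeight t (x₀.2 - z.2)| =
      gaussWeight t (x₀.1 - z.1) * gaussWeight t (x₀.2 - z.2) := fun z =>
    abs_of_pos (mul_pos (gaussWeight_pos t _) (gaussWeight_pos t _))
  have i1 : IntegrableOn (fun z => (gaussWeight t (x₀.1 - z.1) * gaussWeight t (x₀.2 - z.2)) *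
      vel₁ ν h z) halfPlane :=
    integrableOn_mul_vel₁ hd (v := fun s => gaussWeight t (x₀.2 - s)) (by fun_prop)
      (fun z _ => by
        rw [hle]
        exact mul_le_of_le_one_left (gaussWeight_pos t _).le (gaussWeight_le_one ht _))
      (hg.comp_sub_left x₀.2).integrableOn
  have i2 : IntegrableOn (fun z => (gaussWeight t (x₀.1 - z.1) * gaussWeight t (x₀.2 - z.2)) *
      vel₂ ν h z) halfPlane :=
    integrableOn_mul_vel₂ hd (w₁ := fun r => gaussWeight t (x₀.1 - r))
      (w₂ := fun s => gaussWeight t (x₀.2 - s)) (by fun_prop) (by fun_prop) (by fun_prop)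
      (fun z => (hle z).le) (fun r => hb _) (fun r => hb _) (hg.comp_sub_left x₀.1)
      (hg.comp_sub_left x₀.2)
  have i3 : IntegrableOn (fun z => heatKernel₁ z.2 t * vel₁ ν h z) halfPlane :=
    integrableOn_mul_vel₁ hd (v := fun s => heatKernel₁ s t) (by fun_prop)
      (fun z _ => (abs_of_pos (heatKernel₁_pos ht _)).le) (integrable_heatKernel₁ ht).integrableOn
  refine (((i1.norm.const_mul C).add (i2.norm.const_mul C)).add (i3.norm.const_mul C')).congr
    (Eventually.of_forall fun z => ?_)
  simp only [stokesBound, Pi.add_apply, norm_mul, Real.norm_eq_abs]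
  rw [← abs_mul, hle, abs_of_pos (heatKernel₁_pos ht z.2)]
  ring

theorem aestronglyMeasurable_stokesIntegrand {t : ℝ} (ht : 0 < t) (hm : Measurable h)
    (x : ℝ × ℝ) (μ : Measure (ℝ × ℝ)) :
    AEStronglyMeasurable (stokesIntegrand t (vel₁ ν h) (vel₂ ν h) x) μ ∧
    AEStronglyMeasurable (stokesIntegrand₁ t (vel₁ ν h) (vel₂ ν h) x) μ ∧
    AEStronglyMeasurable (stokesIntegrand₂ t (vel₁ ν h) (vel₂ ν h) x) μ := by
  have m1 := measurable_vel₁ (ν := ν) hm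
  have m2 := measurable_vel₂ (ν := ν) hm
  have c1 := (continuous_greenStrip_snd ht 1 x).measurable
  have c2 := (continuous_greenStrip_snd ht 2 x).measurable
  have c3 := (continuous_greenDir_snd t x).measurable
  have c4 := (continuous_heatKernel₁' ht).measurable
  have c5 : Measurable fun z : ℝ × ℝ => heatJ t 1 (toC (x.1 - z.1) 0) := by
    refine Continuous.measurable ?_
    have := continuous_heatJ ht 1
    unfold toC
    fun_prop
  refine ⟨Measurable.aestronglyMeasurable ?_, Measurable.aestronglyMeasurable ?_,
    Measurable.aestronglyMeasurable ?_⟩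
  · unfold stokesIntegrand; fun_prop
  · unfold stokesIntegrand₁; fun_prop
  · unfold stokesIntegrand₂; fun_prop

theorem hasFDerivAt_integral_planeLinear {α : Type*} [MeasurableSpace α] {μ : Measure α}
    {F P Q : ℝ × ℝ → α → ℂ} {bound : α → ℝ} {x₀ : ℝ × ℝ} {s : Set (ℝ × ℝ)} (hs : s ∈ 𝓝 x₀)
    (hF : ∀ x, AEStronglyMeasurable (F x) μ) (hFi : Integrable (F x₀) μ)
    (hP : Integrable (P x₀) μ) (hQ : Integrable (Q x₀) μ)
    (hb : ∀ᵐ z ∂μ, ∀ x ∈ s, ‖P x z‖ ≤ bound z ∧ ‖Q x z‖ ≤ bound z) (hbi : Integrable bound μ)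
    (hd : ∀ z x, HasFDerivAt (fun x => F x z) (planeLinear (P x z) (Q x z)) x) :
    HasFDerivAt (fun x => ∫ z, F x z ∂μ) (planeLinear (∫ z, P x₀ z ∂μ) (∫ z, Q x₀ z ∂μ)) x₀ := by
  have hF'm : AEStronglyMeasurable (fun z => planeLinear (P x₀ z) (Q x₀ z)) μ :=
    Continuous.comp_aestronglyMeasurable (g := fun p : ℂ × ℂ => planeLinear p.1 p.2)
      (f := fun z => (P x₀ z, Q x₀ z)) continuous_planeLinear
      (hP.aestronglyMeasurable.prodMk hQ.aestronglyMeasurable)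
  have hi : Integrable (fun z => planeLinear (P x₀ z) (Q x₀ z)) μ :=
    (hP.norm.add hQ.norm).mono' hF'm (Eventually.of_forall fun z => norm_planeLinear_le _ _)
  have key := hasFDerivAt_integral_of_dominated_of_fderiv_le (𝕜 := ℝ) (F := F)
    (F' := fun x z => planeLinear (P x z) (Q x z)) (bound := fun z => bound z + bound z)
    (μ := μ) hs (Eventually.of_forall hF) hFi hF'm
    (hb.mono fun z hz x hx => (norm_planeLinear_le _ _).trans
      (add_le_add (hz x hx).1 (hz x hx).2)) (hbi.add hbi)
    (Eventually.of_forall fun z x _ => hd z x)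
  refine key.congr_fderiv (ContinuousLinearMap.ext fun v => ?_)
  rw [ContinuousLinearMap.integral_apply hi]
  simp only [planeLinear_apply]
  rw [integral_add (hP.const_mul _) (hQ.const_mul _), integral_const_mul, integral_const_mul]

theorem integrableOn_stokesIntegrand {t : ℝ} (ht : 0 < t) (hd : IsDensity ν h)
    {x₀ : ℝ × ℝ} (hx₀ : 0 < x₀.2) :
    IntegrableOn (stokesIntegrand t (vel₁ ν h) (vel₂ ν h) x₀) halfPlane ∧
    IntegrableOn (stokesIntegrand₁ t (vel₁ ν h) (vel₂ ν h) x₀) halfPlane ∧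
    IntegrableOn (stokesIntegrand₂ t (vel₁ ν h) (vel₂ ν h) x₀) halfPlane := by
  obtain ⟨C, C', hC⟩ := exists_stokesBound ht hx₀
  have hB := integrableOn_stokesBound ht hd C C' x₀
  have hm := aestronglyMeasurable_stokesIntegrand (ν := ν) ht hd.measurable x₀
    ((volume : Measure (ℝ × ℝ)).restrict halfPlane)
  have hb : ∀ᵐ z ∂(volume : Measure (ℝ × ℝ)).restrict halfPlane, _ :=
    (ae_restrict_mem measurableSet_halfPlane).mono fun z (hz : 0 < z.2) =>
      hC (vel₁ ν h) (vel₂ ν h) x₀ z hx₀ hz (by simp) (by simp)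
  exact ⟨hB.mono' hm.1 (hb.mono fun z hz => hz.1), hB.mono' hm.2.1 (hb.mono fun z hz => hz.2.1),
    hB.mono' hm.2.2 (hb.mono fun z hz => hz.2.2)⟩

theorem hasFDerivAt_integral_stokesIntegrand {t : ℝ} (ht : 0 < t) (hd : IsDensity ν h)
    {x₀ : ℝ × ℝ} (hx₀ : 0 < x₀.2) :
    HasFDerivAt (fun x => ∫ z in halfPlane, stokesIntegrand t (vel₁ ν h) (vel₂ ν h) x z)
      (planeLinear (∫ z in halfPlane, stokesIntegrand₁ t (vel₁ ν h) (vel₂ ν h) x₀ z)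
        (∫ z in halfPlane, stokesIntegrand₂ t (vel₁ ν h) (vel₂ ν h) x₀ z)) x₀ := by
  obtain ⟨C, C', hC⟩ := exists_stokesBound ht hx₀
  obtain ⟨i0, i1, i2⟩ := integrableOn_stokesIntegrand ht hd hx₀
  refine hasFDerivAt_integral_planeLinear
    (s := Metric.ball x₀ (min 1 x₀.2)) (Metric.ball_mem_nhds x₀ (lt_min one_pos hx₀))
    (fun x => (aestronglyMeasurable_stokesIntegrand (ν := ν) ht hd.measurable x _).1) i0 i1 i2
    ((ae_restrict_mem measurableSet_halfPlane).mono fun z (hz : 0 < z.2) x hx => ?_)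
    (integrableOn_stokesBound ht hd C C' x₀)
    (fun z x => hasFDerivAt_stokesIntegrand ht _ _ x z)
  rw [Metric.mem_ball, Prod.dist_eq, max_lt_iff, Real.dist_eq, Real.dist_eq] at hx
  have hx1 := hx.1.le.trans (min_le_left _ _)
  have hx2 := hx.2.le.trans (min_le_left _ _)
  have hx3 : 0 < x.2 := by
    have := (abs_lt.1 (hx.2.trans_le (min_le_right _ _))).1
    linarith
  exact (hC (vel₁ ν h) (vel₂ ν h) x z hx3 hz hx1 hx2).2

/-- The kernel of the vorticity of the Stokes flow against the first velocity component. -/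
def vortKer₁ (t : ℝ) (x z : ℝ × ℝ) : ℝ :=
  -(heatKernel₁ (x.1 - z.1) t * (heatKernel₁' (x.2 - z.2) t - heatKernel₁' (x.2 + z.2) t)) -
    2 / Real.pi * (heatKernel₁ (x.2 + z.2) t * heatJRe t 1 (x.1 - z.1) 0)

/-- The kernel of the vorticity of the Stokes flow against the second velocity component. -/
def vortKer₂ (t : ℝ) (x z : ℝ × ℝ) : ℝ :=
  heatKernel₁' (x.1 - z.1) t * (heatKernel₁ (x.2 - z.2) t - heatKernel₁ (x.2 + z.2) t)

theorem curl_stokesIntegrand (t : ℝ) (u₁ u₂ : ℝ × ℝ → ℝ) (x z : ℝ × ℝ) :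
    -((stokesIntegrand₂ t u₁ u₂ x z).re + (stokesIntegrand₁ t u₁ u₂ x z).im) =
      vortKer₁ t x z * u₁ z + vortKer₂ t x z * u₂ z := by
  simp only [stokesIntegrand₁, stokesIntegrand₂, vortKer₁, vortKer₂, heatJRe, Complex.add_re,
    Complex.add_im, Complex.mul_re, Complex.mul_im, Complex.sub_re, Complex.sub_im,
    Complex.ofReal_re, Complex.ofReal_im, Complex.I_re, Complex.I_im]
  ring

theorem stokes_eq {t : ℝ} (ht : 0 < t) (hd : IsDensity ν h) {u : ℝ × ℝ → ℝ × ℝ}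
    (hu : ∀ᵐ z ∂(volume : Measure (ℝ × ℝ)).restrict halfPlane, u z = (vel₁ ν h z, vel₂ ν h z))
    {x : ℝ × ℝ} (hx : 0 < x.2) :
    StokesConverges t u x ∧
    stokes t u x = ((∫ z in halfPlane, stokesIntegrand t (vel₁ ν h) (vel₂ ν h) x z).re,
      -(∫ z in halfPlane, stokesIntegrand t (vel₁ ν h) (vel₂ ν h) x z).im) := by
  obtain ⟨i0, _⟩ := integrableOn_stokesIntegrand ht hd hx
  have e0 : (fun z => green t 0 0 x z * (u z).1 + green t 0 1 x z * (u z).2)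
      =ᵐ[(volume : Measure (ℝ × ℝ)).restrict halfPlane]
      fun z => (stokesIntegrand t (vel₁ ν h) (vel₂ ν h) x z).re := by
    filter_upwards [hu] with z hz
    rw [hz, green_zero_zero ht hx, green_zero_one]
    simp only [stokesIntegrand, Complex.add_re, Complex.mul_re, Complex.mul_im, Complex.sub_re,
      Complex.sub_im, Complex.ofReal_re, Complex.ofReal_im, Complex.I_re, Complex.I_im]
    ring
  have e1 : (fun z => green t 1 0 x z * (u z).1 + green t 1 1 x z * (u z).2)
      =ᵐ[(volume : Measure (ℝ × ℝ)).restrict halfPlane]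
      fun z => -(stokesIntegrand t (vel₁ ν h) (vel₂ ν h) x z).im := by
    filter_upwards [hu] with z hz
    rw [hz, green_one_zero ht hx, green_one_one ht]
    simp only [stokesIntegrand, Complex.add_im, Complex.mul_re, Complex.mul_im, Complex.sub_re,
      Complex.sub_im, Complex.ofReal_re, Complex.ofReal_im, Complex.I_re, Complex.I_im]
    ring
  refine ⟨fun i => ?_, ?_⟩
  · fin_cases i
    · exact (integrable_congr e0).2 i0.re
    · exact (integrable_congr e1).2 i0.im.neg
  · rw [stokes, integral_congr_ae e0, integral_congr_ae e1, integral_neg]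
    have r1 := integral_re i0
    have r2 := integral_im i0
    simp only [RCLike.re_to_complex, RCLike.im_to_complex] at r1 r2
    rw [r1, r2]

theorem vorticityFlow_eq {t : ℝ} (ht : 0 < t) (hd : IsDensity ν h)
    {μ : SignedMeasure closedHalfPlane}
    (hu : ∀ᵐ z ∂(volume : Measure (ℝ × ℝ)).restrict halfPlane,
      biotSavart μ z = (vel₁ ν h z, vel₂ ν h z))
    {x : ℝ × ℝ} (hx : 0 < x.2) :
    DifferentiableAt ℝ (stokes t (biotSavart μ)) x ∧
    vorticityFlow t μ x = ∫ z in halfPlane,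
      (vortKer₁ t x z * vel₁ ν h z + vortKer₂ t x z * vel₂ ν h z) := by
  obtain ⟨_, i1, i2⟩ := integrableOn_stokesIntegrand ht hd hx
  have hS := hasFDerivAt_integral_stokesIntegrand ht hd hx
  set S := fun x => ∫ z in halfPlane, stokesIntegrand t (vel₁ ν h) (vel₂ ν h) x z
  set P := ∫ z in halfPlane, stokesIntegrand₁ t (vel₁ ν h) (vel₂ ν h) x z with hP
  set Q := ∫ z in halfPlane, stokesIntegrand₂ t (vel₁ ν h) (vel₂ ν h) x z with hQ
  have hev : stokes t (biotSavart μ) =ᶠ[𝓝 x] fun x => ((S x).re, -(S x).im) := by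
    filter_upwards [isOpen_halfPlane.mem_nhds hx] with x' hx'
    exact (stokes_eq ht hd hu hx').2
  have d1 : HasFDerivAt (fun x => (S x).re) (Complex.reCLM.comp (planeLinear P Q)) x :=
    Complex.reCLM.hasFDerivAt.comp x hS
  have d2 : HasFDerivAt (fun x => (S x).im) (Complex.imCLM.comp (planeLinear P Q)) x :=
    Complex.imCLM.hasFDerivAt.comp x hS
  have hd12 := (d1.prodMk d2.neg).congr_of_eventuallyEq hev
  refine ⟨hd12.differentiableAt, ?_⟩
  have p2 : pd₂ (fun x' => (stokes t (biotSavart μ) x').1) x = Q.re := by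
    have h1 : HasFDerivAt (fun x' => (stokes t (biotSavart μ) x').1) _ x := hd12.fst
    have h2 : HasDerivAt (fun r : ℝ => (x.1, r)) ((0 : ℝ), (1 : ℝ)) x.2 :=
      (hasDerivAt_const _ _).prodMk (hasDerivAt_id _)
    have := h1.comp_hasDerivAt x.2 h2
    rw [pd₂]
    refine this.deriv.trans ?_
    simp
  have p1 : pd₁ (fun x' => (stokes t (biotSavart μ) x').2) x = -P.im := by
    have h1 : HasFDerivAt (fun x' => (stokes t (biotSavart μ) x').2) _ x := hd12.snd
    have h2 : HasDerivAt (fun r : ℝ => (r, x.2)) ((1 : ℝ), (0 : ℝ)) x.1 :=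
      (hasDerivAt_id _).prodMk (hasDerivAt_const _ _)
    have := h1.comp_hasDerivAt x.1 h2
    rw [pd₁]
    refine this.deriv.trans ?_
    simp
  have r1 := integral_im i1
  have r2 := integral_re i2
  simp only [RCLike.re_to_complex, RCLike.im_to_complex] at r1 r2
  have r3 := integral_add i2.re i1.im
  simp only [RCLike.re_to_complex, RCLike.im_to_complex] at r3
  rw [vorticityFlow, p1, p2, hP, hQ, ← r1, ← r2, sub_neg_eq_add, ← r3, ← integral_neg]
  congr 1; ext z
  exact curl_stokesIntegrand t _ _ x z

end

section

/-! ### The kernel `W` in closed form -/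

/-- The kernel `W` in terms of `heatJ`. -/
def vortKernel (t : ℝ) (x y : ℝ × ℝ) : ℝ :=
  heatKernel₁ (x.1 - y.1) t * (heatKernel₁ (x.2 - y.2) t + heatKernel₁ (x.2 + y.2) t) -
    2 / Real.pi * (∫ s in (0 : ℝ)..y.2, heatKernel₁ (x.2 + s) t *
      heatJRe t 1 (x.1 - y.1) (y.2 - s)) -
    2 / Real.pi * (heatKernel₁ x.2 t * heatJRe t 0 (x.1 - y.1) y.2)

theorem hasDerivAt_conjPoisson {h : ℝ} (hh : h ≠ 0) (r : ℝ) :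
    HasDerivAt (conjPoisson h) ((h ^ 2 - r ^ 2) / (Real.pi * (r ^ 2 + h ^ 2) ^ 2)) r := by
  have hpi := Real.pi_pos
  have hne : r ^ 2 + h ^ 2 ≠ 0 := by positivity
  have h1 : HasDerivAt (fun r : ℝ => Real.pi * (r ^ 2 + h ^ 2)) (Real.pi * (2 * r)) r := by
    simpa using ((hasDerivAt_pow 2 r).add_const (h ^ 2)).const_mul Real.pi
  refine ((hasDerivAt_id r).div h1 (by positivity)).congr_deriv ?_
  simp only [id]
  field_simp
  ring

theorem abs_deriv_conjPoisson_le {h : ℝ} (hh : h ≠ 0) (r : ℝ) :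
    |(h ^ 2 - r ^ 2) / (Real.pi * (r ^ 2 + h ^ 2) ^ 2)| ≤ (h ^ 2)⁻¹ := by
  have hpi : 1 ≤ Real.pi := by linarith [Real.pi_gt_three]
  have hh2 : 0 < h ^ 2 := by positivity
  have hr2 : 0 ≤ r ^ 2 := sq_nonneg r
  have hD : 0 < r ^ 2 + h ^ 2 := by positivity
  rw [abs_div, abs_of_pos (show 0 < Real.pi * (r ^ 2 + h ^ 2) ^ 2 by positivity), ← one_div,
    div_le_div_iff₀ (by positivity) hh2, one_mul]
  have h1 : |h ^ 2 - r ^ 2| ≤ r ^ 2 + h ^ 2 := by rw [abs_le]; constructor <;> linarith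
  calc |h ^ 2 - r ^ 2| * h ^ 2 ≤ (r ^ 2 + h ^ 2) * (r ^ 2 + h ^ 2) := by
        gcongr
        linarith
    _ = 1 * (r ^ 2 + h ^ 2) ^ 2 := by ring
    _ ≤ Real.pi * (r ^ 2 + h ^ 2) ^ 2 := by gcongr

theorem pd₁_pd₁_E_sub {y z : ℝ × ℝ} (hz : z.2 ≠ y.2) :
    pd₁ (pd₁ fun z' => E (z' - y)) z = -(1 / 2) * (((z.2 - y.2) ^ 2 - (z.1 - y.1) ^ 2) /
      (Real.pi * ((z.1 - y.1) ^ 2 + (z.2 - y.2) ^ 2) ^ 2)) := by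
  have h1 : (fun r : ℝ => pd₁ (fun z' => E (z' - y)) (r, z.2)) =
      fun r => -(1 / 2) * conjPoisson (z.2 - y.2) (r - y.1) := by
    funext r
    exact (pd₁_E_sub (z := (r, z.2)) (y := y) (fun H => hz (by rw [← H]))).deriv
  rw [pd₁, h1]
  exact (((hasDerivAt_conjPoisson (sub_ne_zero.2 hz) (z.1 - y.1)).comp_sub_const z.1 y.1).const_mul
    (-(1 / 2))).deriv

theorem integrable_heatKernel₁_mul_bdd {t : ℝ} (ht : 0 < t) (x : ℝ) {f : ℝ → ℝ}
    (hf : Measurable f) {C : ℝ} (hC : ∀ r, |f r| ≤ C) :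
    Integrable fun r => heatKernel₁ (x - r) t * f r :=
  ((integrable_heatKernel₁ ht).comp_sub_left x).mul_bdd hf.aestronglyMeasurable
    (Eventually.of_forall hC)

theorem integrable_heatKernel₁'_mul_bdd {t : ℝ} (ht : 0 < t) (x : ℝ) {f : ℝ → ℝ}
    (hf : Measurable f) {C : ℝ} (hC : ∀ r, |f r| ≤ C) :
    Integrable fun r => heatKernel₁' (x - r) t * f r :=
  ((integrable_heatKernel₁' ht).comp_sub_left x).mul_bdd hf.aestronglyMeasurable
    (Eventually.of_forall hC)

theorem integral_correction {t : ℝ} (ht : 0 < t) (x y : ℝ × ℝ) {s : ℝ} (hs : s ≠ y.2) :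
    Integrable (fun r : ℝ => correctionIntegrand t x y (r, s)) ∧
    ∫ r : ℝ, correctionIntegrand t x y (r, s) =
      -(1 / (2 * Real.pi)) * (heatKernel₁ (x.2 + s) t * heatJRe t 1 (x.1 - y.1) |s - y.2|) := by
  have hh : s - y.2 ≠ 0 := sub_ne_zero.2 hs
  set q : ℝ → ℝ := fun r => ((s - y.2) ^ 2 - (r - y.1) ^ 2) /
      (Real.pi * ((r - y.1) ^ 2 + (s - y.2) ^ 2) ^ 2) with hq
  have hqm : Measurable q := by fun_prop
  have e : ∀ r : ℝ, correctionIntegrand t x y (r, s) =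
      (-(1 / 2) * heatKernel₁ (x.2 + s) t) * (heatKernel₁ (x.1 - r) t * q r) := fun r => by
    rw [correctionIntegrand, heatKernel₂_sub_reflect ht, pd₁_pd₁_E_sub hs]
    ring
  have i1 : Integrable fun r => heatKernel₁ (x.1 - r) t * q r :=
    integrable_heatKernel₁_mul_bdd ht x.1 hqm (fun r => abs_deriv_conjPoisson_le hh _)
  have hQm : Measurable fun r => conjPoisson (s - y.2) (r - y.1) := by
    unfold conjPoisson; fun_prop
  have i2 : Integrable fun r => heatKernel₁ (x.1 - r) t * conjPoisson (s - y.2) (r - y.1) :=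
    integrable_heatKernel₁_mul_bdd ht x.1 hQm (fun r => abs_conjPoisson_le_inv hh _)
  have i3 : Integrable fun r => heatKernel₁' (x.1 - r) t * conjPoisson (s - y.2) (r - y.1) :=
    integrable_heatKernel₁'_mul_bdd ht x.1 hQm (fun r => abs_conjPoisson_le_inv hh _)
  have hd : ∀ r, HasDerivAt
      (fun r => heatKernel₁ (x.1 - r) t * conjPoisson (s - y.2) (r - y.1))
      (-(heatKernel₁' (x.1 - r) t * conjPoisson (s - y.2) (r - y.1)) +
        heatKernel₁ (x.1 - r) t * q r) r := fun r => by
    have h1 : HasDerivAt (fun r : ℝ => heatKernel₁ (x.1 - r) t) (-heatKernel₁' (x.1 - r) t) r := by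
      simpa [Function.comp_def] using
        (hasDerivAt_heatKernel₁ ht (x.1 - r)).comp r ((hasDerivAt_id r).const_sub x.1)
    have h2 := (hasDerivAt_conjPoisson hh (r - y.1)).comp_sub_const r y.1
    exact (h1.mul h2).congr_deriv (by ring)
  have key := integral_eq_zero_of_hasDerivAt_of_integrable hd (i3.neg.add i1) i2
  rw [integral_add (f := fun r => -(heatKernel₁' (x.1 - r) t * conjPoisson (s - y.2) (r - y.1)))
    i3.neg i1, integral_neg, integral_heatKernel₁'_mul_conjPoisson ht hh] at key
  simp_rw [e]
  refine ⟨i1.const_mul _, ?_⟩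
  rw [integral_const_mul, show ∫ r, heatKernel₁ (x.1 - r) t * q r =
    1 / Real.pi * heatJRe t 1 (x.1 - y.1) |s - y.2| by linarith]
  field_simp

theorem intervalIntegrable_vortKernel {t : ℝ} (ht : 0 < t) (x : ℝ) (ρ b c d : ℝ) :
    IntervalIntegrable (fun s : ℝ => heatKernel₁ (x + s) t * heatJRe t 1 ρ (b - s))
      volume c d := by
  have h := continuous_heatJRe ht 1
  refine Continuous.intervalIntegrable (Continuous.mul (by fun_prop) ?_) _ _
  exact h.comp (g := fun p : ℝ × ℝ => heatJRe t 1 p.1 p.2) (f := fun s : ℝ => (ρ, b - s))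
    (by fun_prop)

theorem correctionConverges {t : ℝ} (ht : 0 < t) (x : ℝ × ℝ) {y : ℝ × ℝ} (hy : 0 < y.2) :
    CorrectionConverges t x y := by
  refine ⟨fun s hs => (integral_correction ht x y hs.2.ne).1, ?_⟩
  refine ((intervalIntegrable_vortKernel ht x.2 (x.1 - y.1) y.2 0 y.2).const_mul
    (-(1 / (2 * Real.pi)))).congr_ae ?_
  rw [uIoc_of_le hy.le]
  filter_upwards [ae_restrict_mem measurableSet_Ioc,
    ae_restrict_of_ae (Measure.ae_ne volume y.2)] with s hs hne
  rw [(integral_correction ht x y hne).2, abs_sub_comm, abs_of_nonneg (by linarith [hs.2])]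

theorem W_eq_vortKernel {t : ℝ} (ht : 0 < t) (x : ℝ × ℝ) {y : ℝ × ℝ} (hy : 0 < y.2) :
    W x y t = vortKernel t x y := by
  have h1 : ∫ s in (0 : ℝ)..y.2, ∫ r : ℝ, correctionIntegrand t x y (r, s) =
      -(1 / (2 * Real.pi)) * ∫ s in (0 : ℝ)..y.2, heatKernel₁ (x.2 + s) t *
        heatJRe t 1 (x.1 - y.1) (y.2 - s) := by
    rw [← intervalIntegral.integral_const_mul]
    refine intervalIntegral.integral_congr_ae ?_
    filter_upwards [Measure.ae_ne volume y.2] with s hne hs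
    rw [uIoc_of_le hy.le] at hs
    rw [(integral_correction ht x y hne).2, abs_sub_comm, abs_of_nonneg (by linarith [hs.2])]
  rw [W, h1, integral_poissonKernel_mul_heatKernel₁ ht, heatKernel₂_sub ht,
    heatKernel₂_sub_reflect ht, Real.sign_of_pos hy, abs_of_pos hy, vortKernel]
  ring

/-! ### The vorticity of the Stokes flow of a single vortex -/

theorem abs_heatKernel₁'_le {t : ℝ} (ht : 0 < t) (r : ℝ) :
    |heatKernel₁' r t| ≤ heatJBound t 1 / Real.pi := by
  have hpi := Real.pi_pos
  rw [heatKernel₁', abs_mul, abs_neg, abs_of_pos (show 0 < 1 / Real.pi by positivity),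
    one_div_mul_eq_div]
  gcongr
  exact abs_heatJIm_le ht 1 r le_rfl

/-- The bound of `vortKer₁` by a function of the second variable. -/
theorem exists_vortKer₁_le {t : ℝ} (ht : 0 < t) (x : ℝ × ℝ) : ∃ v : ℝ → ℝ,
    Integrable v ∧ ∀ z, |vortKer₁ t x z| ≤ v z.2 := by
  have hpi := Real.pi_pos
  have hM := heatJBound_nonneg t 1
  have i1 := ((integrable_heatKernel₁' ht).comp_sub_left x.2).abs
  have i2 := ((integrable_heatKernel₁' ht).comp_add_left x.2).abs
  have i3 := (integrable_heatKernel₁ ht).comp_add_left x.2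
  refine ⟨fun s => heatKernel₁ 0 t * (|heatKernel₁' (x.2 - s) t| + |heatKernel₁' (x.2 + s) t|) +
    2 / Real.pi * heatJBound t 1 * heatKernel₁ (x.2 + s) t,
    ((i1.add i2).const_mul _).add (i3.const_mul _), fun z => ?_⟩
  have p1 := heatKernel₁_pos ht (x.1 - z.1)
  have p2 := heatKernel₁_pos ht (x.2 + z.2)
  have hJ := abs_heatJRe_le ht 1 (x.1 - z.1) (le_refl (0 : ℝ))
  refine (abs_sub _ _).trans ?_
  rw [abs_neg, abs_mul, abs_mul, abs_mul, abs_of_pos p1, abs_of_pos p2,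
    abs_of_pos (show 0 < 2 / Real.pi by positivity)]
  refine add_le_add ?_ ?_
  · exact mul_le_mul (heatKernel₁_le ht _) (abs_sub _ _) (abs_nonneg _) (heatKernel₁_pos ht 0).le
  · rw [mul_assoc, mul_comm (heatJBound t 1)]
    gcongr

theorem measurable_vortKer {t : ℝ} (ht : 0 < t) (x : ℝ × ℝ) :
    Measurable (vortKer₁ t x) ∧ Measurable (vortKer₂ t x) := by
  have m := (continuous_heatKernel₁' ht).measurable
  have mJ : Measurable fun z : ℝ × ℝ => heatJRe t 1 (x.1 - z.1) 0 :=
    ((continuous_heatJRe ht 1).comp (g := fun p : ℝ × ℝ => heatJRe t 1 p.1 p.2)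
      (f := fun z : ℝ × ℝ => (x.1 - z.1, (0 : ℝ))) (by fun_prop)).measurable
  constructor
  · unfold vortKer₁; fun_prop
  · unfold vortKer₂; fun_prop

variable {ν : Measure (ℝ × ℝ)} [IsFiniteMeasure ν]

theorem integrable_vortKer₁_mul {t : ℝ} (ht : 0 < t) (x : ℝ × ℝ) :
    Integrable (fun p : (ℝ × ℝ) × (ℝ × ℝ) => vortKer₁ t x p.1 * velKer₁ p.1 p.2)
      (((volume : Measure (ℝ × ℝ)).restrict halfPlane).prod ν) := by
  obtain ⟨v, hvi, hle⟩ := exists_vortKer₁_le ht x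
  exact integrable_mul_velKer₁ (measurable_vortKer ht x).1 (fun z _ => hle z) hvi.integrableOn

theorem integrable_vortKer₂_mul {t : ℝ} (ht : 0 < t) (x : ℝ × ℝ) :
    Integrable (fun p : (ℝ × ℝ) × (ℝ × ℝ) => vortKer₂ t x p.1 * velKer₂ p.1 p.2)
      (((volume : Measure (ℝ × ℝ)).restrict halfPlane).prod ν) := by
  have m := (continuous_heatKernel₁' ht).measurable
  refine integrable_mul_velKer₂ (w₁ := fun r => |heatKernel₁' (x.1 - r) t|)
    (w₂ := fun s => heatKernel₁ (x.2 - s) t + heatKernel₁ (x.2 + s) t)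
    (M₁ := heatJBound t 1 / Real.pi) (M₂ := heatKernel₁ 0 t + heatKernel₁ 0 t)
    (measurable_vortKer ht x).2 ?_ (by fun_prop) (fun z => ?_) (fun r => ?_) (fun s => ?_)
    ((integrable_heatKernel₁' ht).comp_sub_left x.1).abs
    (((integrable_heatKernel₁ ht).comp_sub_left x.2).add
      ((integrable_heatKernel₁ ht).comp_add_left x.2))
  · simp_rw [← Real.norm_eq_abs]; fun_prop
  · rw [vortKer₂, abs_mul]
    gcongr
    refine (abs_sub _ _).trans ?_
    rw [abs_of_pos (heatKernel₁_pos ht _), abs_of_pos (heatKernel₁_pos ht _)]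
  · rw [abs_abs]; exact abs_heatKernel₁'_le ht _
  · rw [abs_of_pos (add_pos (heatKernel₁_pos ht _) (heatKernel₁_pos ht _))]
    exact add_le_add (heatKernel₁_le ht _) (heatKernel₁_le ht _)

theorem integrable_mul_poissonKernel {f : ℝ → ℝ} (hf : Measurable f) {C : ℝ}
    (hC : ∀ r, |f r| ≤ C) (h b : ℝ) : Integrable fun r => f r * poissonKernel h (r - b) :=
  ((integrable_poissonKernel h).comp_sub_right b).bdd_mul hf.aestronglyMeasurable
    (Eventually.of_forall hC)

theorem integral_linearCombination {f g k : ℝ → ℝ} (hf : Integrable f) (hg : Integrable g)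
    (hk : Integrable k) (a b c : ℝ) :
    ∫ r, (a * f r + b * g r + c * k r) = a * (∫ r, f r) + b * (∫ r, g r) + c * ∫ r, k r := by
  have h : Integrable fun r => a * f r + b * g r := (hf.const_mul a).add (hg.const_mul b)
  rw [integral_add h (hk.const_mul c), integral_add (hf.const_mul a) (hg.const_mul b),
    integral_const_mul, integral_const_mul, integral_const_mul]

/-- The integral over a line of the integrand of the vorticity of the flow of a vortex at `y`. -/
theorem integral_vortKer_slice {t : ℝ} (ht : 0 < t) (x y : ℝ × ℝ) {s : ℝ} (hs : 0 < s)
    (hy : 0 < y.2) (hne : s ≠ y.2) :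
    ∫ r, (vortKer₁ t x (r, s) * velKer₁ (r, s) y + vortKer₂ t x (r, s) * velKer₂ (r, s) y) =
      1 / (2 * Real.pi) * (
        -(heatKernel₁' (x.2 - s) t - heatKernel₁' (x.2 + s) t) *
          (Real.sign (y.2 - s) * heatJRe t 0 (x.1 - y.1) |y.2 - s| +
            heatJRe t 0 (x.1 - y.1) (s + y.2)) -
        2 * heatKernel₁ (x.2 + s) t *
          (Real.sign (y.2 - s) * heatJRe t 1 (x.1 - y.1) |y.2 - s| +
            heatJRe t 1 (x.1 - y.1) (s + y.2)) +
        (heatKernel₁ (x.2 - s) t - heatKernel₁ (x.2 + s) t) *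
          (heatJRe t 1 (x.1 - y.1) |y.2 - s| - heatJRe t 1 (x.1 - y.1) (s + y.2))) := by
  have hpi := Real.pi_pos
  have hsy : 0 < s + y.2 := by linarith
  have hh : s - y.2 ≠ 0 := sub_ne_zero.2 hne
  have mJ : Measurable fun r : ℝ => heatJRe t 1 (x.1 - r) 0 :=
    ((continuous_heatJRe ht 1).comp (g := fun p : ℝ × ℝ => heatJRe t 1 p.1 p.2)
      (f := fun r : ℝ => (x.1 - r, (0 : ℝ))) (by fun_prop)).measurable
  have bΓ : ∀ r : ℝ, |heatKernel₁ (x.1 - r) t| ≤ heatKernel₁ 0 t := fun r => by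
    rw [abs_of_pos (heatKernel₁_pos ht _)]; exact heatKernel₁_le ht _
  have bJ : ∀ r : ℝ, |heatJRe t 1 (x.1 - r) 0| ≤ heatJBound t 1 := fun r =>
    abs_heatJRe_le ht 1 _ le_rfl
  have i1 : ∀ h, Integrable fun r => heatKernel₁ (x.1 - r) t * poissonKernel h (r - y.1) :=
    fun h => integrable_mul_poissonKernel (by fun_prop) bΓ h y.1
  have i2 : ∀ h, Integrable fun r => heatJRe t 1 (x.1 - r) 0 * poissonKernel h (r - y.1) :=
    fun h => integrable_mul_poissonKernel mJ bJ h y.1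
  have i3 : ∀ h, h ≠ 0 → Integrable fun r => heatKernel₁' (x.1 - r) t * conjPoisson h (r - y.1) :=
    fun h hh => integrable_heatKernel₁'_mul_bdd ht x.1 (by unfold conjPoisson; fun_prop)
      (fun r => abs_conjPoisson_le_inv hh _)
  have i1' : Integrable fun r => heatKernel₁ (x.1 - r) t * poissonKernel (y.2 - s) (r - y.1) +
      heatKernel₁ (x.1 - r) t * poissonKernel (s + y.2) (r - y.1) :=
    (i1 (y.2 - s)).add (i1 (s + y.2))
  have i2' : Integrable fun r => heatJRe t 1 (x.1 - r) 0 * poissonKernel (y.2 - s) (r - y.1) +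
      heatJRe t 1 (x.1 - r) 0 * poissonKernel (s + y.2) (r - y.1) :=
    (i2 (y.2 - s)).add (i2 (s + y.2))
  have i3' : Integrable fun r => heatKernel₁' (x.1 - r) t * conjPoisson (s - y.2) (r - y.1) -
      heatKernel₁' (x.1 - r) t * conjPoisson (s + y.2) (r - y.1) :=
    (i3 (s - y.2) hh).sub (i3 (s + y.2) hsy.ne')
  have e : ∀ r, vortKer₁ t x (r, s) * velKer₁ (r, s) y + vortKer₂ t x (r, s) * velKer₂ (r, s) y =
      (-(1 / 2) * (heatKernel₁' (x.2 - s) t - heatKernel₁' (x.2 + s) t)) *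
        (heatKernel₁ (x.1 - r) t * poissonKernel (y.2 - s) (r - y.1) +
          heatKernel₁ (x.1 - r) t * poissonKernel (s + y.2) (r - y.1)) +
      (-(1 / Real.pi) * heatKernel₁ (x.2 + s) t) *
        (heatJRe t 1 (x.1 - r) 0 * poissonKernel (y.2 - s) (r - y.1) +
          heatJRe t 1 (x.1 - r) 0 * poissonKernel (s + y.2) (r - y.1)) +
      (1 / 2 * (heatKernel₁ (x.2 - s) t - heatKernel₁ (x.2 + s) t)) *
        (heatKernel₁' (x.1 - r) t * conjPoisson (s - y.2) (r - y.1) -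
          heatKernel₁' (x.1 - r) t * conjPoisson (s + y.2) (r - y.1)) := fun r => by
    simp only [vortKer₁, vortKer₂, velKer₁, velKer₂]
    ring
  have c2 : ∀ h, ∫ r, heatJRe t 1 (x.1 - r) 0 * poissonKernel h (r - y.1) =
      Real.sign h * heatJRe t 1 (x.1 - y.1) |h| := fun h => by
    rw [← integral_poissonKernel_mul_heatJRe ht]
    congr 1; ext r; ring
  simp_rw [e]
  rw [integral_linearCombination i1' i2' i3', integral_add (i1 _) (i1 _), integral_add (i2 _) (i2 _),
    integral_sub (i3 _ hh) (i3 _ hsy.ne'), integral_poissonKernel_mul_heatKernel₁ ht,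
    integral_poissonKernel_mul_heatKernel₁ ht, c2, c2,
    integral_heatKernel₁'_mul_conjPoisson ht hh, integral_heatKernel₁'_mul_conjPoisson ht hsy.ne',
    Real.sign_of_pos hsy, abs_of_pos hsy, abs_sub_comm s y.2]
  field_simp
  ring

/-- The primitive in the proof of `integral_vortKer`. -/
def vortPrim (t : ℝ) (x₂ ρ y₂ ε : ℝ) (s : ℝ) : ℝ :=
  (heatKernel₁ (x₂ - s) t + heatKernel₁ (x₂ + s) t) *
    (ε * heatJRe t 0 ρ (ε * (y₂ - s)) + heatJRe t 0 ρ (s + y₂))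

/-- The derivative of `vortPrim`. -/
def vortPrim' (t : ℝ) (x₂ ρ y₂ ε : ℝ) (s : ℝ) : ℝ :=
  -(heatKernel₁' (x₂ - s) t - heatKernel₁' (x₂ + s) t) *
      (ε * heatJRe t 0 ρ (ε * (y₂ - s)) + heatJRe t 0 ρ (s + y₂)) +
    (heatKernel₁ (x₂ - s) t + heatKernel₁ (x₂ + s) t) *
      (ε ^ 2 * heatJRe t 1 ρ (ε * (y₂ - s)) - heatJRe t 1 ρ (s + y₂))

theorem hasDerivAt_vortPrim {t : ℝ} (ht : 0 < t) (x₂ ρ y₂ ε s : ℝ) :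
    HasDerivAt (vortPrim t x₂ ρ y₂ ε) (vortPrim' t x₂ ρ y₂ ε s) s := by
  have h1 : HasDerivAt (fun s : ℝ => heatKernel₁ (x₂ - s) t) (-heatKernel₁' (x₂ - s) t) s := by
    simpa [Function.comp_def] using
      (hasDerivAt_heatKernel₁ ht (x₂ - s)).comp s ((hasDerivAt_id s).const_sub x₂)
  have h2 : HasDerivAt (fun s : ℝ => heatKernel₁ (x₂ + s) t) (heatKernel₁' (x₂ + s) t) s := by
    simpa [Function.comp_def] using
      (hasDerivAt_heatKernel₁ ht (x₂ + s)).comp s ((hasDerivAt_id s).const_add x₂)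
  have h3 : HasDerivAt (fun s : ℝ => heatJRe t 0 ρ (ε * (y₂ - s)))
      (ε * heatJRe t 1 ρ (ε * (y₂ - s))) s := by
    have := (hasDerivAt_heatJRe_snd ht 0 ρ (ε * (y₂ - s))).comp s
      (((hasDerivAt_id s).const_sub y₂).const_mul ε)
    refine this.congr_deriv ?_
    ring
  have h4 : HasDerivAt (fun s : ℝ => heatJRe t 0 ρ (s + y₂)) (-heatJRe t 1 ρ (s + y₂)) s := by
    simpa [Function.comp_def] using
      (hasDerivAt_heatJRe_snd ht 0 ρ (s + y₂)).comp s ((hasDerivAt_id s).add_const y₂)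
  refine ((h1.add h2).mul ((h3.const_mul ε).add h4)).congr_deriv ?_
  simp only [vortPrim', Pi.add_apply]
  ring

theorem continuous_vortPrim' {t : ℝ} (ht : 0 < t) (x₂ ρ y₂ ε : ℝ) :
    Continuous (vortPrim' t x₂ ρ y₂ ε) := by
  have c := continuous_heatKernel₁' ht
  have cJ : ∀ k, ∀ f : ℝ → ℝ, Continuous f → Continuous fun s => heatJRe t k ρ (f s) :=
    fun k f hf => (continuous_heatJRe ht k).comp (g := fun p : ℝ × ℝ => heatJRe t k p.1 p.2)
      (f := fun s => (ρ, f s)) (by fun_prop)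
  have c1 := cJ 0 (fun s => ε * (y₂ - s)) (by fun_prop)
  have c2 := cJ 1 (fun s => ε * (y₂ - s)) (by fun_prop)
  have c3 := cJ 0 (fun s => s + y₂) (by fun_prop)
  have c4 := cJ 1 (fun s => s + y₂) (by fun_prop)
  unfold vortPrim'
  fun_prop

theorem tendsto_heatKernel₁ {t : ℝ} (ht : 0 < t) : Tendsto (fun r => heatKernel₁ r t) atTop (𝓝 0) := by
  unfold heatKernel₁
  have h : Tendsto (fun r : ℝ => -r ^ 2 / (4 * t)) atTop atBot := by
    simp_rw [neg_div]
    exact tendsto_neg_atTop_atBot.comp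
      ((tendsto_pow_atTop two_ne_zero).atTop_div_const (by positivity))
  simpa using (Real.tendsto_exp_atBot.comp h).const_mul (1 / (4 * Real.pi * t) ^ (1 / 2 : ℝ))

theorem tendsto_vortPrim {t : ℝ} (ht : 0 < t) (x₂ ρ : ℝ) {y₂ : ℝ} (hy : 0 < y₂) :
    Tendsto (vortPrim t x₂ ρ y₂ (-1)) atTop (𝓝 0) := by
  have h1 : Tendsto (fun s => heatKernel₁ (x₂ + s) t) atTop (𝓝 0) :=
    (tendsto_heatKernel₁ ht).comp (tendsto_atTop_add_const_left _ _ tendsto_id)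
  have h2 : Tendsto (fun s => heatKernel₁ (x₂ - s) t) atTop (𝓝 0) := by
    have : (fun s => heatKernel₁ (x₂ - s) t) = fun s => heatKernel₁ (-x₂ + s) t := by
      funext s; rw [← heatKernel₁_neg]; congr 1; ring
    rw [this]
    exact (tendsto_heatKernel₁ ht).comp (tendsto_atTop_add_const_left _ _ tendsto_id)
  have h3 := (h2.add h1).mul_const (heatJBound t 0 + heatJBound t 0)
  rw [add_zero, zero_mul] at h3
  refine squeeze_zero_norm' ?_ h3
  filter_upwards [eventually_gt_atTop y₂] with s hs
  rw [vortPrim, norm_mul, Real.norm_of_nonneg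
    (add_pos (heatKernel₁_pos ht _) (heatKernel₁_pos ht _)).le]
  have p1 := heatKernel₁_pos ht (x₂ - s)
  have p2 := heatKernel₁_pos ht (x₂ + s)
  gcongr
  refine (norm_add_le _ _).trans (add_le_add ?_ ?_)
  · rw [norm_mul, norm_neg, norm_one, one_mul]
    exact abs_heatJRe_le ht 0 _ (by linarith)
  · exact abs_heatJRe_le ht 0 _ (by linarith)

theorem integral_vortKer {t : ℝ} (ht : 0 < t) (x y : ℝ × ℝ) (hy : 0 < y.2)
    (hi : IntegrableOn (fun z => vortKer₁ t x z * velKer₁ z y + vortKer₂ t x z * velKer₂ z y)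
      halfPlane) :
    ∫ z in halfPlane, (vortKer₁ t x z * velKer₁ z y + vortKer₂ t x z * velKer₂ z y) =
      vortKernel t x y := by
  have hpi := Real.pi_pos
  set ρ := x.1 - y.1 with hρ
  rw [IntegrableOn, volume_restrict_halfPlane] at hi
  rw [volume_restrict_halfPlane, integral_prod_symm _ hi]
  have hI := hi.integral_prod_right
  set I : ℝ → ℝ := fun s =>
    ∫ r, (vortKer₁ t x (r, s) * velKer₁ (r, s) y + vortKer₂ t x (r, s) * velKer₂ (r, s) y) with hIdef
  have hI : IntegrableOn I (Ioi 0) := hI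
  change ∫ s in Ioi 0, I s = _
  have e1 : ∀ s ∈ Ioo 0 y.2, I s = 1 / (2 * Real.pi) * vortPrim' t x.2 ρ y.2 1 s -
      2 / Real.pi * (heatKernel₁ (x.2 + s) t * heatJRe t 1 ρ (y.2 - s)) := by
    intro s hs
    have hs' : 0 < y.2 - s := sub_pos.2 hs.2
    rw [hIdef]
    simp only
    rw [integral_vortKer_slice ht x y hs.1 hy hs.2.ne, Real.sign_of_pos hs', abs_of_pos hs',
      vortPrim', ← hρ, one_mul]
    field_simp
    ring
  have e2 : ∀ s ∈ Ioi y.2, I s = 1 / (2 * Real.pi) * vortPrim' t x.2 ρ y.2 (-1) s := by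
    intro s hs
    have hs : y.2 < s := hs
    have hs' : y.2 - s < 0 := sub_neg.2 hs
    rw [hIdef]
    simp only
    rw [integral_vortKer_slice ht x y (hy.trans hs) hy hs.ne', Real.sign_of_neg hs',
      abs_of_neg hs', vortPrim', ← hρ, neg_one_mul (y.2 - s)]
    ring
  have v1 : ∫ s in Ioc 0 y.2, I s =
      1 / (2 * Real.pi) * (vortPrim t x.2 ρ y.2 1 y.2 - vortPrim t x.2 ρ y.2 1 0) -
      2 / Real.pi * ∫ s in (0 : ℝ)..y.2, heatKernel₁ (x.2 + s) t * heatJRe t 1 ρ (y.2 - s) := by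
    have hc := (continuous_vortPrim' ht x.2 ρ y.2 1).intervalIntegrable (μ := volume) 0 y.2
    rw [integral_Ioc_eq_integral_Ioo, setIntegral_congr_fun measurableSet_Ioo e1,
      ← integral_Ioc_eq_integral_Ioo, ← intervalIntegral.integral_of_le hy.le,
      intervalIntegral.integral_sub (hc.const_mul _)
        ((intervalIntegrable_vortKernel ht x.2 ρ y.2 0 y.2).const_mul _),
      intervalIntegral.integral_const_mul, intervalIntegral.integral_const_mul,
      intervalIntegral.integral_eq_sub_of_hasDerivAt
        (fun s _ => hasDerivAt_vortPrim ht x.2 ρ y.2 1 s) hc]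
  have v2 : ∫ s in Ioi y.2, I s = 1 / (2 * Real.pi) * (0 - vortPrim t x.2 ρ y.2 (-1) y.2) := by
    rw [setIntegral_congr_fun measurableSet_Ioi e2, integral_const_mul,
      integral_Ioi_of_hasDerivAt_of_tendsto
        (hasDerivAt_vortPrim ht x.2 ρ y.2 (-1) y.2).continuousAt.continuousWithinAt
        (fun s _ => hasDerivAt_vortPrim ht x.2 ρ y.2 (-1) s) ?_ (tendsto_vortPrim ht x.2 ρ hy)]
    have h1 : IntegrableOn (fun s => 2 * Real.pi * I s) (Ioi y.2) :=
      (hI.mono_set (Ioi_subset_Ioi hy.le)).const_mul (2 * Real.pi)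
    refine h1.congr_fun (fun s hs => ?_) measurableSet_Ioi
    simp only
    rw [e2 s hs]
    field_simp
  rw [← Ioc_union_Ioi_eq_Ioi hy.le, setIntegral_union Ioc_disjoint_Ioi_same measurableSet_Ioi
    (hI.mono_set Ioc_subset_Ioi_self) (hI.mono_set (Ioi_subset_Ioi hy.le)), v1, v2, vortKernel,
    ← hρ, heatKernel₁_eq ht ρ]
  simp only [vortPrim, sub_self, mul_zero, sub_zero, add_zero, zero_add, one_mul]
  field_simp
  ring

/-- The representation of the vorticity of the Stokes flow by the kernel `W`. -/
theorem integral_vortKer_mul_vel {t : ℝ} (ht : 0 < t) {h : ℝ × ℝ → ℝ} (hd : IsDensity ν h)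
    (x : ℝ × ℝ) :
    Integrable (fun y => vortKernel t x y) ν ∧
    ∫ z in halfPlane, (vortKer₁ t x z * vel₁ ν h z + vortKer₂ t x z * vel₂ ν h z) =
      ∫ y, h y * vortKernel t x y ∂ν := by
  have j1 := integrable_vortKer₁_mul (ν := ν) ht x
  have j2 := integrable_vortKer₂_mul (ν := ν) ht x
  have j := j1.add j2
  have jh := hd.integrable_mul j
  have hV : ∀ᵐ y ∂ν, ∫ z in halfPlane,
      (vortKer₁ t x z * velKer₁ z y + vortKer₂ t x z * velKer₂ z y) = vortKernel t x y := by
    filter_upwards [j.prod_left_ae, hd.ae_mem] with y hy hy0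
    exact integral_vortKer ht x y hy0 hy
  refine ⟨j.integral_prod_right.congr hV, ?_⟩
  have e1 : ∫ z in halfPlane, (vortKer₁ t x z * vel₁ ν h z + vortKer₂ t x z * vel₂ ν h z) =
      ∫ z in halfPlane, ∫ y, h y *
        (vortKer₁ t x z * velKer₁ z y + vortKer₂ t x z * velKer₂ z y) ∂ν := by
    refine integral_congr_ae ?_
    filter_upwards [(hd.integrable_mul j1).prod_right_ae, (hd.integrable_mul j2).prod_right_ae]
      with z h1 h2
    simp_rw [mul_add]
    rw [integral_add h1 h2, vel₁, vel₂, ← integral_const_mul, ← integral_const_mul]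
    congr 1 <;> (congr 1; ext y; ring)
  rw [e1, integral_integral_swap jh]
  refine integral_congr_ae ?_
  filter_upwards [hV] with y hy
  rw [integral_const_mul, hy]

end

section

variable {ν : Measure (ℝ × ℝ)} {h : ℝ × ℝ → ℝ}

/-! ### The tangential trace -/

/-- The tangential trace of the velocity field of a density. -/
def tangentialTrace (ν : Measure (ℝ × ℝ)) (h : ℝ × ℝ → ℝ) (r : ℝ) : ℝ :=
  ∫ y, h y * poissonKernel y.2 (r - y.1) ∂ν

@[fun_prop]
theorem measurable_poissonKernel_pair :
    Measurable fun p : ℝ × (ℝ × ℝ) => poissonKernel p.2.2 (p.1 - p.2.1) :=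
  measurable_poissonKernel.comp (g := fun p : ℝ × ℝ => poissonKernel p.1 p.2)
    (f := fun p : ℝ × (ℝ × ℝ) => (p.2.2, p.1 - p.2.1)) (by fun_prop)

@[fun_prop]
theorem measurable_velKer₁_slice (s : ℝ) :
    Measurable fun p : ℝ × (ℝ × ℝ) => velKer₁ (p.1, s) p.2 :=
  measurable_velKer₁.comp (g := fun p : (ℝ × ℝ) × (ℝ × ℝ) => velKer₁ p.1 p.2)
    (f := fun p : ℝ × (ℝ × ℝ) => ((p.1, s), p.2)) (by fun_prop)

theorem tendsto_poissonKernel_L1 {b : ℝ} (hb : 0 < b) (c : ℝ) :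
    Tendsto (fun a => ∫⁻ r, ‖poissonKernel a (r - c) - poissonKernel b (r - c)‖ₑ) (𝓝 b) (𝓝 0) := by
  have hpi := Real.pi_pos
  have hle : ∀ a ∈ Ioo (b / 2) (2 * b), ∀ r,
      poissonKernel a r ≤ 4 * poissonKernel (b / 2) r := by
    rintro a ⟨h1, h2⟩ r
    unfold poissonKernel
    rw [mul_div_assoc']
    have h3 : (b / 2) ^ 2 ≤ a ^ 2 := by gcongr
    gcongr
    linarith
  have h0 : (0 : ℝ≥0∞) = ∫⁻ r : ℝ, 0 := by simp
  rw [h0]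
  refine tendsto_lintegral_filter_of_dominated_convergence
    (fun r => ‖8 * poissonKernel (b / 2) (r - c)‖ₑ) (Eventually.of_forall fun a => ?_) ?_ ?_ ?_
  · unfold poissonKernel; fun_prop
  · filter_upwards [Ioo_mem_nhds (show b / 2 < b by linarith) (show b < 2 * b by linarith)]
      with a ha
    refine Eventually.of_forall fun r => ?_
    rw [Real.enorm_eq_ofReal_abs, Real.enorm_eq_ofReal_abs]
    refine ENNReal.ofReal_le_ofReal ((abs_sub _ _).trans (le_trans ?_ (le_abs_self _)))
    have p1 := poissonKernel_nonneg (by linarith [ha.1] : 0 ≤ a) (r - c)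
    have p2 := poissonKernel_nonneg hb.le (r - c)
    rw [abs_of_nonneg p1, abs_of_nonneg p2]
    linarith [hle a ha (r - c), hle b ⟨by linarith, by linarith⟩ (r - c)]
  · exact (((integrable_poissonKernel (b / 2)).comp_sub_right c).const_mul 8).2.ne
  · refine Eventually.of_forall fun r => ?_
    have hc : ContinuousAt (fun a => ‖poissonKernel a (r - c) - poissonKernel b (r - c)‖ₑ) b := by
      unfold poissonKernel
      refine ContinuousAt.enorm (ContinuousAt.sub (ContinuousAt.div ?_ ?_ ?_) continuousAt_const)
      · fun_prop
      · fun_prop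
      · positivity
    simpa using hc.tendsto

theorem tendsto_velKer₁_L1 {y : ℝ × ℝ} (hy : 0 < y.2) :
    Tendsto (fun s => ∫⁻ r, ‖velKer₁ (r, s) y - poissonKernel y.2 (r - y.1)‖ₑ) (𝓝[>] 0) (𝓝 0) := by
  have h1 : Tendsto (fun s : ℝ => y.2 - s) (𝓝[>] 0) (𝓝 y.2) := by
    have : ContinuousAt (fun s : ℝ => y.2 - s) 0 := by fun_prop
    simpa using this.tendsto.mono_left nhdsWithin_le_nhds
  have h2 : Tendsto (fun s : ℝ => s + y.2) (𝓝[>] 0) (𝓝 y.2) := by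
    have : ContinuousAt (fun s : ℝ => s + y.2) 0 := by fun_prop
    simpa using this.tendsto.mono_left nhdsWithin_le_nhds
  have h3 := ((tendsto_poissonKernel_L1 hy y.1).comp h1).add
    ((tendsto_poissonKernel_L1 hy y.1).comp h2)
  rw [add_zero] at h3
  refine tendsto_of_tendsto_of_tendsto_of_le_of_le tendsto_const_nhds h3 (fun s => zero_le)
    fun s => ?_
  simp only [Function.comp_apply]
  rw [← lintegral_add_left (by unfold poissonKernel; fun_prop)]
  refine lintegral_mono fun r => ?_
  have e : velKer₁ (r, s) y - poissonKernel y.2 (r - y.1) =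
      (1 / 2) * ((poissonKernel (y.2 - s) (r - y.1) - poissonKernel y.2 (r - y.1)) +
        (poissonKernel (s + y.2) (r - y.1) - poissonKernel y.2 (r - y.1))) := by
    simp only [velKer₁]; ring
  rw [e, enorm_mul]
  refine le_trans ?_ (enorm_add_le _ _)
  refine mul_le_of_le_one_left (zero_le) ?_
  rw [Real.enorm_eq_ofReal (by norm_num)]
  exact ENNReal.ofReal_le_one.2 (by norm_num)

theorem measurable_lintegral_velKer₁_sub (s : ℝ) :
    Measurable fun y => ∫⁻ r : ℝ, ‖velKer₁ (r, s) y - poissonKernel y.2 (r - y.1)‖ₑ := by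
  have hm : Measurable fun p : ℝ × (ℝ × ℝ) =>
      ‖velKer₁ (p.1, s) p.2 - poissonKernel p.2.2 (p.1 - p.2.1)‖ₑ := by fun_prop
  exact (hm.comp measurable_swap).lintegral_prod_right'

theorem lintegral_velKer₁_sub_le (s : ℝ) (y : ℝ × ℝ) :
    ∫⁻ r, ‖velKer₁ (r, s) y - poissonKernel y.2 (r - y.1)‖ₑ ≤ 2 := by
  calc ∫⁻ r, ‖velKer₁ (r, s) y - poissonKernel y.2 (r - y.1)‖ₑ
      ≤ ∫⁻ r, (‖velKer₁ (r, s) y‖ₑ + ‖poissonKernel y.2 (r - y.1)‖ₑ) :=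
        lintegral_mono fun r => enorm_sub_le
    _ ≤ 1 + 1 := by
        rw [lintegral_add_right _ (by unfold poissonKernel; fun_prop)]
        exact add_le_add (lintegral_velKer₁_le s y) (lintegral_poissonKernel_le _ _)
    _ = 2 := one_add_one_eq_two

variable [IsFiniteMeasure ν]

theorem integrable_poissonKernel_pair :
    Integrable (fun p : ℝ × (ℝ × ℝ) => poissonKernel p.2.2 (p.1 - p.2.1)) (volume.prod ν) :=
  integrable_prod_of_lintegral_le measurable_poissonKernel_pair.aestronglyMeasurable
    ENNReal.one_ne_top (Eventually.of_forall fun y => lintegral_poissonKernel_le y.2 y.1)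

theorem integrable_velKer₁_slice (s : ℝ) :
    Integrable (fun p : ℝ × (ℝ × ℝ) => velKer₁ (p.1, s) p.2) (volume.prod ν) :=
  integrable_prod_of_lintegral_le (measurable_velKer₁_slice s).aestronglyMeasurable ENNReal.one_ne_top
    (Eventually.of_forall fun y => lintegral_velKer₁_le s y)

theorem integrable_tangentialTrace (hd : IsDensity ν h) : Integrable (tangentialTrace ν h) :=
  (hd.integrable_mul integrable_poissonKernel_pair).integral_prod_left

theorem lintegral_vel₁_sub_trace_le (hd : IsDensity ν h) (s : ℝ) :
    ∫⁻ r, ‖vel₁ ν h (r, s) - tangentialTrace ν h r‖ₑ ≤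
      ∫⁻ y, (∫⁻ r : ℝ, ‖velKer₁ (r, s) y - poissonKernel y.2 (r - y.1)‖ₑ) ∂ν := by
  have hm : Measurable fun p : ℝ × (ℝ × ℝ) =>
      ‖velKer₁ (p.1, s) p.2 - poissonKernel p.2.2 (p.1 - p.2.1)‖ₑ := by fun_prop
  rw [lintegral_lintegral_swap (f := fun y r => ‖velKer₁ (r, s) y - poissonKernel y.2 (r - y.1)‖ₑ)
    (hm.comp measurable_swap).aemeasurable]
  refine lintegral_mono_ae ?_
  filter_upwards [(hd.integrable_mul (integrable_velKer₁_slice (ν := ν) s)).prod_right_ae,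
    (hd.integrable_mul (integrable_poissonKernel_pair (ν := ν))).prod_right_ae] with r h1 h2
  rw [vel₁, tangentialTrace, ← integral_sub h1 h2]
  refine (enorm_integral_le_lintegral_enorm _).trans (lintegral_mono fun y => ?_)
  rw [← mul_sub, enorm_mul]
  refine mul_le_of_le_one_left (zero_le) ?_
  rw [Real.enorm_eq_ofReal_abs]
  exact ENNReal.ofReal_le_one.2 (hd.le_one y)

theorem tendsto_vel₁_sub_trace (hd : IsDensity ν h) :
    Tendsto (fun s => ∫⁻ r, ‖vel₁ ν h (r, s) - tangentialTrace ν h r‖ₑ) (𝓝[>] 0) (𝓝 0) := by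
  have h0 : (0 : ℝ≥0∞) = ∫⁻ _, 0 ∂ν := by simp
  have : Tendsto (fun s => ∫⁻ y, (∫⁻ r : ℝ, ‖velKer₁ (r, s) y - poissonKernel y.2 (r - y.1)‖ₑ) ∂ν)
      (𝓝[>] 0) (𝓝 0) := by
    rw [h0]
    have hb : ∫⁻ _ : ℝ × ℝ, (2 : ℝ≥0∞) ∂ν ≠ ⊤ := by
      rw [lintegral_const]; finiteness
    have hl : ∀ᵐ y ∂ν, Tendsto
        (fun s => ∫⁻ r : ℝ, ‖velKer₁ (r, s) y - poissonKernel y.2 (r - y.1)‖ₑ)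
        (𝓝[>] 0) (𝓝 0) := by
      filter_upwards [hd.ae_mem] with y hy using tendsto_velKer₁_L1 hy
    exact tendsto_lintegral_filter_of_dominated_convergence (fun _ => 2)
      (Eventually.of_forall measurable_lintegral_velKer₁_sub)
      (Eventually.of_forall fun s => Eventually.of_forall fun y => lintegral_velKer₁_sub_le s y)
      hb hl
  exact tendsto_of_tendsto_of_tendsto_of_le_of_le tendsto_const_nhds this (fun s => zero_le)
    fun s => lintegral_vel₁_sub_trace_le hd s

theorem tendsto_mean_of_tendsto {A : ℝ → ℝ≥0∞} (hA : Tendsto A (𝓝[>] 0) (𝓝 0)) :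
    Tendsto (fun ε : ℝ => (ENNReal.ofReal ε)⁻¹ * ∫⁻ s in Ioo 0 ε, A s) (𝓝[>] 0) (𝓝 0) := by
  rw [ENNReal.tendsto_nhds_zero] at hA ⊢
  intro c hc
  have h1 := hA c hc
  obtain ⟨δ, hδ, hδ'⟩ := mem_nhdsGT_iff_exists_Ioo_subset.1 h1
  filter_upwards [Ioo_mem_nhdsGT hδ] with ε hε
  have h2 : ∫⁻ s in Ioo 0 ε, A s ≤ c * ENNReal.ofReal ε := by
    refine (setLIntegral_mono' measurableSet_Ioo (g := fun _ => c) fun s hs =>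
      hδ' ⟨hs.1, hs.2.trans hε.2⟩).trans (le_of_eq ?_)
    rw [setLIntegral_const, Real.volume_Ioo, sub_zero]
  calc (ENNReal.ofReal ε)⁻¹ * ∫⁻ s in Ioo 0 ε, A s
      ≤ (ENNReal.ofReal ε)⁻¹ * (c * ENNReal.ofReal ε) := by gcongr
    _ = c * (ENNReal.ofReal ε * (ENNReal.ofReal ε)⁻¹) := by ring
    _ = c := by
        rw [ENNReal.mul_inv_cancel (by simpa using hε.1) ENNReal.ofReal_ne_top, mul_one]

theorem ae_ae_slice {p : ℝ × ℝ → Prop}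
    (hp : ∀ᵐ z ∂(volume : Measure (ℝ × ℝ)).restrict halfPlane, p z) :
    ∀ᵐ s ∂volume.restrict (Ioi (0 : ℝ)), ∀ᵐ r : ℝ, p (r, s) := by
  rw [volume_restrict_halfPlane] at hp
  exact Measure.ae_ae_of_ae_prod (Measure.measurePreserving_swap.quasiMeasurePreserving.ae hp)

theorem isTangentialTrace {u : ℝ × ℝ → ℝ × ℝ} (hd : IsDensity ν h)
    (hu : ∀ᵐ z ∂(volume : Measure (ℝ × ℝ)).restrict halfPlane, (u z).1 = vel₁ ν h z) :
    IsTangentialTrace u (tangentialTrace ν h) := by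
  have h1 := tendsto_mean_of_tendsto (tendsto_vel₁_sub_trace hd)
  refine h1.congr fun ε => ?_
  congr 1
  refine lintegral_congr_ae ?_
  filter_upwards [ae_restrict_of_ae_restrict_of_subset Ioo_subset_Ioi_self (ae_ae_slice hu)]
    with s hs
  refine lintegral_congr_ae ?_
  filter_upwards [hs] with r hr
  rw [hr]

theorem heatLine_tangentialTrace {t : ℝ} (ht : 0 < t) (hd : IsDensity ν h) (r : ℝ) :
    Integrable (fun y => heatJRe t 0 (r - y.1) |y.2|) ν ∧
    heatLine t (tangentialTrace ν h) r =
      ∫ y, h y * ((1 / Real.pi) * heatJRe t 0 (r - y.1) y.2) ∂ν := by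
  have hi : Integrable (fun p : ℝ × (ℝ × ℝ) => heatKernel₁ (r - p.1) t *
      poissonKernel p.2.2 (p.1 - p.2.1)) (volume.prod ν) :=
    integrable_poissonKernel_pair.bdd_mul (c := heatKernel₁ 0 t)
      ((by fun_prop : Continuous fun p : ℝ × (ℝ × ℝ) =>
        heatKernel₁ (r - p.1) t)).aestronglyMeasurable
      (Eventually.of_forall fun p => by
        rw [Real.norm_eq_abs, abs_of_pos (heatKernel₁_pos ht _)]; exact heatKernel₁_le ht _)
  have hih := hd.integrable_mul hi
  refine ⟨?_, ?_⟩
  · refine Integrable.of_bound (C := heatJBound t 0) ?_ (Eventually.of_forall fun y =>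
      abs_heatJRe_le ht 0 _ (abs_nonneg _))
    exact ((continuous_heatJRe ht 0).comp (g := fun p : ℝ × ℝ => heatJRe t 0 p.1 p.2)
      (f := fun y : ℝ × ℝ => (r - y.1, |y.2|)) (by fun_prop)).aestronglyMeasurable
  · have e : heatLine t (tangentialTrace ν h) r =
        ∫ s, ∫ y, h y * (heatKernel₁ (r - s) t * poissonKernel y.2 (s - y.1)) ∂ν := by
      rw [heatLine]
      congr 1; ext s
      rw [tangentialTrace, ← integral_const_mul]
      congr 1; ext y; ring
    rw [e, integral_integral_swap hih]
    refine integral_congr_ae ?_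
    filter_upwards [hd.ae_mem] with y hy
    rw [integral_const_mul, integral_poissonKernel_mul_heatKernel₁ ht, Real.sign_of_pos hy, one_mul,
      abs_of_pos hy]

end

/-! ### Partial derivatives of differentiable functions -/

theorem hasDerivAt_pd₁ {f : ℝ × ℝ → ℝ} (hf : Differentiable ℝ f) (x : ℝ × ℝ) :
    HasDerivAt (fun r => f (r, x.2)) (fderiv ℝ f x (1, 0)) x.1 := by
  have h1 : HasDerivAt (fun r : ℝ => (r, x.2)) (1, 0) x.1 :=
    (hasDerivAt_id x.1).prodMk (hasDerivAt_const x.1 x.2)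
  exact (hf (x.1, x.2)).hasFDerivAt.comp_hasDerivAt x.1 h1

theorem hasDerivAt_pd₂ {f : ℝ × ℝ → ℝ} (hf : Differentiable ℝ f) (x : ℝ × ℝ) :
    HasDerivAt (fun r => f (x.1, r)) (fderiv ℝ f x (0, 1)) x.2 := by
  have h1 : HasDerivAt (fun r : ℝ => (x.1, r)) (0, 1) x.2 :=
    (hasDerivAt_const x.2 x.1).prodMk (hasDerivAt_id x.2)
  exact (hf (x.1, x.2)).hasFDerivAt.comp_hasDerivAt x.2 h1

theorem pd₁_eq_fderiv {f : ℝ × ℝ → ℝ} (hf : Differentiable ℝ f) (x : ℝ × ℝ) :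
    pd₁ f x = fderiv ℝ f x (1, 0) := (hasDerivAt_pd₁ hf x).deriv

theorem pd₂_eq_fderiv {f : ℝ × ℝ → ℝ} (hf : Differentiable ℝ f) (x : ℝ × ℝ) :
    pd₂ f x = fderiv ℝ f x (0, 1) := (hasDerivAt_pd₂ hf x).deriv

theorem fderiv_apply_eq_pd {f : ℝ × ℝ → ℝ} (hf : Differentiable ℝ f) (x : ℝ × ℝ) (a b : ℝ) :
    fderiv ℝ f x (a, b) = a * pd₁ f x + b * pd₂ f x := by
  rw [pd₁_eq_fderiv hf, pd₂_eq_fderiv hf]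
  have : ((a, b) : ℝ × ℝ) = a • (1, 0) + b • (0, 1) := by simp
  rw [this, map_add, map_smul, map_smul, smul_eq_mul, smul_eq_mul]

theorem pd₁_mul {f g : ℝ × ℝ → ℝ} (hf : Differentiable ℝ f) (hg : Differentiable ℝ g)
    (x : ℝ × ℝ) : pd₁ (fun x => f x * g x) x = pd₁ f x * g x + f x * pd₁ g x := by
  rw [pd₁_eq_fderiv hf, pd₁_eq_fderiv hg]
  exact ((hasDerivAt_pd₁ hf x).mul (hasDerivAt_pd₁ hg x)).deriv

theorem pd₂_mul {f g : ℝ × ℝ → ℝ} (hf : Differentiable ℝ f) (hg : Differentiable ℝ g)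
    (x : ℝ × ℝ) : pd₂ (fun x => f x * g x) x = pd₂ f x * g x + f x * pd₂ g x := by
  rw [pd₂_eq_fderiv hf, pd₂_eq_fderiv hg]
  exact ((hasDerivAt_pd₂ hf x).mul (hasDerivAt_pd₂ hg x)).deriv

theorem continuous_pd₁ {f : ℝ × ℝ → ℝ} (hf : ContDiff ℝ ∞ f) : Continuous (pd₁ f) := by
  have hd := hf.differentiable (by simp)
  rw [funext (pd₁_eq_fderiv hd)]
  exact (hf.continuous_fderiv (by simp)).clm_apply continuous_const

theorem continuous_pd₂ {f : ℝ × ℝ → ℝ} (hf : ContDiff ℝ ∞ f) : Continuous (pd₂ f) := by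
  have hd := hf.differentiable (by simp)
  rw [funext (pd₂_eq_fderiv hd)]
  exact (hf.continuous_fderiv (by simp)).clm_apply continuous_const

theorem pd₁_eq_zero_of_notMem_tsupport {f : ℝ × ℝ → ℝ} (hf : Differentiable ℝ f) {x : ℝ × ℝ}
    (hx : x ∉ tsupport f) : pd₁ f x = 0 := by
  rw [pd₁_eq_fderiv hf, image_eq_zero_of_notMem_tsupport
    (fun h => hx (tsupport_fderiv_subset ℝ h)), zero_apply]

theorem pd₂_eq_zero_of_notMem_tsupport {f : ℝ × ℝ → ℝ} (hf : Differentiable ℝ f) {x : ℝ × ℝ}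
    (hx : x ∉ tsupport f) : pd₂ f x = 0 := by
  rw [pd₂_eq_fderiv hf, image_eq_zero_of_notMem_tsupport
    (fun h => hx (tsupport_fderiv_subset ℝ h)), zero_apply]

/-! ### The gradient of the Newtonian potential -/

/-- `x₁ / (2π|x|²)`. -/
def newton₁ (w : ℝ × ℝ) : ℝ := 1 / 2 * conjPoisson w.2 w.1

/-- `x₂ / (2π|x|²)`. -/
def newton₂ (w : ℝ × ℝ) : ℝ := 1 / 2 * poissonKernel w.2 w.1

@[fun_prop]
theorem measurable_newton₁ : Measurable newton₁ := by unfold newton₁ conjPoisson; fun_prop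

@[fun_prop]
theorem measurable_newton₂ : Measurable newton₂ := by unfold newton₂ poissonKernel; fun_prop

theorem abs_div_norm_sq_le {a : ℝ} {w : ℝ × ℝ} (ha : |a| ≤ ‖w‖) :
    |1 / 2 * (a / (Real.pi * (w.1 ^ 2 + w.2 ^ 2)))| ≤ ‖w‖⁻¹ := by
  have hpi := Real.pi_gt_three
  rcases eq_or_ne w 0 with rfl | hw
  · simp
  have hw' : 0 < ‖w‖ := norm_pos_iff.2 hw
  have h1 : ‖w‖ ^ 2 ≤ w.1 ^ 2 + w.2 ^ 2 := by
    rw [Prod.norm_def, Real.norm_eq_abs, Real.norm_eq_abs]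
    rcases max_choice |w.1| |w.2| with h | h <;> rw [h, sq_abs] <;> nlinarith
  have hD : 0 < w.1 ^ 2 + w.2 ^ 2 := lt_of_lt_of_le (by positivity) h1
  rw [abs_mul, abs_of_pos (by norm_num : (0 : ℝ) < 1 / 2), abs_div,
    abs_of_pos (show 0 < Real.pi * (w.1 ^ 2 + w.2 ^ 2) by positivity), ← one_div, div_mul_div_comm, one_mul,
    div_le_div_iff₀ (by positivity) hw', one_mul]
  nlinarith [mul_le_mul_of_nonneg_right ha hw'.le]

theorem abs_newton₁_le (w : ℝ × ℝ) : |newton₁ w| ≤ ‖w‖⁻¹ :=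
  abs_div_norm_sq_le (norm_fst_le w)

theorem abs_newton₂_le (w : ℝ × ℝ) : |newton₂ w| ≤ ‖w‖⁻¹ :=
  abs_div_norm_sq_le (norm_snd_le w)

theorem locallyIntegrable_of_le_inv_sqrt {k : ℝ × ℝ → ℝ} (hk : Measurable k)
    (hle : ∀ w : ℝ × ℝ, w.1 ≠ 0 → w.2 ≠ 0 → |k w| ≤ (√|w.1|)⁻¹ * (√|w.2|)⁻¹) :
    LocallyIntegrable k := by
  rw [locallyIntegrable_iff]
  intro K hK
  obtain ⟨R, hR⟩ := hK.isBounded.subset_closedBall 0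
  set R' := max R 1
  have hR' : 0 < R' := lt_max_of_lt_right one_pos
  have hsub : K ⊆ Icc (0 - R') (0 + R') ×ˢ Icc (0 - R') (0 + R') := by
    intro w hw
    have h1 : ‖w‖ ≤ R' := (mem_closedBall_zero_iff.1 (hR hw)).trans (le_max_left _ _)
    have h2 := abs_le.1 ((norm_fst_le w).trans h1)
    have h3 := abs_le.1 ((norm_snd_le w).trans h1)
    simp only [zero_sub, zero_add]
    exact ⟨h2, h3⟩
  refine IntegrableOn.mono_set ⟨hk.aestronglyMeasurable, ?_⟩ hsub
  have hb : ∫⁻ w in Icc (0 - R') (0 + R') ×ˢ Icc (0 - R') (0 + R'),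
      ‖(√|w.1 - 0|)⁻¹‖ₑ * ‖(√|w.2 - 0|)⁻¹‖ₑ =
      ENNReal.ofReal (4 * √R') * ENNReal.ofReal (4 * √R') := by
    rw [Measure.volume_eq_prod, ← Measure.prod_restrict,
      lintegral_prod_mul (f := fun r : ℝ => ‖(√|r - 0|)⁻¹‖ₑ) (g := fun r : ℝ => ‖(√|r - 0|)⁻¹‖ₑ)
      (by fun_prop) (by fun_prop), lintegral_inv_sqrt hR']
  refine lt_of_le_of_lt ?_ (hb.trans_lt (by finiteness))
  refine lintegral_mono_ae (ae_restrict_of_ae ?_)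
  filter_upwards [ae_ne_fst_snd 0 0 0] with w hw
  rw [← enorm_mul, Real.enorm_eq_ofReal_abs, Real.enorm_eq_ofReal (by positivity), sub_zero, sub_zero]
  exact ENNReal.ofReal_le_ofReal (hle w hw.1 hw.2.1)

theorem locallyIntegrable_newton₁ : LocallyIntegrable newton₁ :=
  locallyIntegrable_of_le_inv_sqrt measurable_newton₁ fun w h1 h2 => by
    rw [newton₁, abs_mul, abs_of_pos (by norm_num : (0 : ℝ) < 1 / 2)]
    have := abs_conjPoisson_le h2 h1
    linarith [abs_nonneg (conjPoisson w.2 w.1)]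

theorem locallyIntegrable_newton₂ : LocallyIntegrable newton₂ :=
  locallyIntegrable_of_le_inv_sqrt measurable_newton₂ fun w h1 h2 => by
    rw [newton₂, abs_mul, abs_of_pos (by norm_num : (0 : ℝ) < 1 / 2)]
    have := abs_poissonKernel_le h2 h1
    linarith [abs_nonneg (poissonKernel w.2 w.1)]

/-- The convolution of a kernel with a test function. -/
def conv (k χ : ℝ × ℝ → ℝ) (x : ℝ × ℝ) : ℝ := ∫ w, k w * χ (x - w)

open scoped Convolution in
theorem conv_eq (k χ : ℝ × ℝ → ℝ) : conv k χ = k ⋆[ContinuousLinearMap.mul ℝ ℝ] χ := rfl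

section

variable {k χ : ℝ × ℝ → ℝ}

theorem contDiff_conv (hk : LocallyIntegrable k) (hχ : ContDiff ℝ ∞ χ) (hc : HasCompactSupport χ) :
    ContDiff ℝ ∞ (conv k χ) := by
  rw [conv_eq]
  exact hc.contDiff_convolution_right _ hk hχ

theorem fderiv_conv (hk : LocallyIntegrable k) (hχ : ContDiff ℝ ∞ χ) (hc : HasCompactSupport χ)
    (x v : ℝ × ℝ) : fderiv ℝ (conv k χ) x v = conv k (fun z => fderiv ℝ χ z v) x := by
  rw [conv_eq, (hc.hasFDerivAt_convolution_right (ContinuousLinearMap.mul ℝ ℝ) hk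
    (hχ.of_le (by simp)) x).fderiv]
  exact convolution_precompR_apply _ hk (hc.fderiv ℝ) (hχ.continuous_fderiv (by simp)) x v

theorem pd₁_conv (hk : LocallyIntegrable k) (hχ : ContDiff ℝ ∞ χ) (hc : HasCompactSupport χ)
    (x : ℝ × ℝ) : pd₁ (conv k χ) x = conv k (pd₁ χ) x := by
  rw [pd₁_eq_fderiv ((contDiff_conv hk hχ hc).differentiable (by simp)), fderiv_conv hk hχ hc]
  simp_rw [← pd₁_eq_fderiv (hχ.differentiable (by simp))]

theorem pd₂_conv (hk : LocallyIntegrable k) (hχ : ContDiff ℝ ∞ χ) (hc : HasCompactSupport χ)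
    (x : ℝ × ℝ) : pd₂ (conv k χ) x = conv k (pd₂ χ) x := by
  rw [pd₂_eq_fderiv ((contDiff_conv hk hχ hc).differentiable (by simp)), fderiv_conv hk hχ hc]
  simp_rw [← pd₂_eq_fderiv (hχ.differentiable (by simp))]

theorem hasCompactSupport_pd₁ (hχ : ContDiff ℝ ∞ χ) (hc : HasCompactSupport χ) :
    HasCompactSupport (pd₁ χ) := by
  rw [funext (pd₁_eq_fderiv (hχ.differentiable (by simp)))]
  exact hc.fderiv_apply ℝ _

theorem hasCompactSupport_pd₂ (hχ : ContDiff ℝ ∞ χ) (hc : HasCompactSupport χ) :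
    HasCompactSupport (pd₂ χ) := by
  rw [funext (pd₂_eq_fderiv (hχ.differentiable (by simp)))]
  exact hc.fderiv_apply ℝ _

theorem integrable_conv (hk : LocallyIntegrable k) (hχ : Continuous χ) (hc : HasCompactSupport χ)
    (x : ℝ × ℝ) : Integrable fun w => k w * χ (x - w) :=
  hc.convolutionExists_right (ContinuousLinearMap.mul ℝ ℝ) hk hχ x

/-- A convolution with a kernel of order `|x|⁻¹` decays like `|x|⁻¹`. -/
theorem exists_abs_conv_le (hk : LocallyIntegrable k) (hle : ∀ w, |k w| ≤ ‖w‖⁻¹)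
    (hχ : ContDiff ℝ ∞ χ) (hc : HasCompactSupport χ) :
    ∃ C, ∀ x, |conv k χ x| * (1 + ‖x‖) ≤ C := by
  obtain ⟨R, hR⟩ := hc.isCompact.isBounded.subset_closedBall 0
  set R' := max R 1
  have hR' : 1 ≤ R' := le_max_right _ _
  have hcont := (contDiff_conv hk hχ hc).continuous
  obtain ⟨C, hC⟩ := (isCompact_closedBall (0 : ℝ × ℝ) (2 * R')).exists_bound_of_continuousOn
    (f := fun x => |conv k χ x| * (1 + ‖x‖)) (by fun_prop)
  have hχi : Integrable χ := hχ.continuous.integrable_of_hasCompactSupport hc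
  refine ⟨max C (3 * ∫ w, |χ w|), fun x => ?_⟩
  rcases le_or_gt ‖x‖ (2 * R') with hx | hx
  · exact (le_abs_self _).trans ((hC x (mem_closedBall_zero_iff.2 hx)).trans (le_max_left _ _))
  · refine le_trans ?_ (le_max_right _ _)
    have hx0 : 0 < ‖x‖ := by linarith
    have hpt : ∀ w, |k w * χ (x - w)| ≤ 2 / ‖x‖ * |χ (x - w)| := fun w => by
      rw [abs_mul]
      rcases eq_or_ne (χ (x - w)) 0 with h0 | h0
      · simp [h0]
      · have h1 : ‖x - w‖ ≤ R' := (mem_closedBall_zero_iff.1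
          (hR (subset_tsupport _ h0))).trans (le_max_left _ _)
        have h2 : ‖x‖ ≤ ‖x - w‖ + ‖w‖ := by simpa using norm_add_le (x - w) w
        gcongr
        refine (hle w).trans ?_
        rw [inv_eq_one_div, div_le_div_iff₀ (by linarith) hx0]
        linarith
    have hi : Integrable fun w => |χ (x - w)| := (hχi.comp_sub_left x).abs
    have h1 : |conv k χ x| ≤ 2 / ‖x‖ * ∫ w, |χ w| := by
      calc |conv k χ x| ≤ ∫ w, |k w * χ (x - w)| := abs_integral_le_integral_abs
        _ ≤ ∫ w, 2 / ‖x‖ * |χ (x - w)| :=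
            integral_mono (integrable_conv hk hχ.continuous hc x).abs (hi.const_mul _) hpt
        _ = 2 / ‖x‖ * ∫ w, |χ w| := by
            rw [integral_const_mul, integral_sub_left_eq_self (fun w => |χ w|)]
    have hI : 0 ≤ ∫ w, |χ w| := integral_nonneg fun w => abs_nonneg _
    calc |conv k χ x| * (1 + ‖x‖) ≤ (2 / ‖x‖ * ∫ w, |χ w|) * (1 + ‖x‖) := by gcongr
      _ = (2 * (1 + ‖x‖) / ‖x‖) * ∫ w, |χ w| := by ring
      _ ≤ 3 * ∫ w, |χ w| := by
          gcongr
          rw [div_le_iff₀ hx0]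
          linarith

end

/-! ### The Cauchy-Pompeiu formula -/

theorem polar_integrableOn {f : ℝ × ℝ → ℝ} (hf : Continuous f) {M : ℝ}
    (hM : ∀ p : ℝ × ℝ, M < p.1 → f p = 0) :
    IntegrableOn f (Ioi 0 ×ˢ Ioo (-Real.pi) Real.pi) := by
  have hK : IsCompact (Icc 0 M ×ˢ Icc (-Real.pi) Real.pi) := isCompact_Icc.prod isCompact_Icc
  refine (hf.continuousOn.integrableOn_compact hK).of_forall_sdiff_eq_zero
    (measurableSet_Ioi.prod measurableSet_Ioo) fun p hp => hM p ?_
  by_contra! H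
  exact hp.2 ⟨⟨le_of_lt hp.1.1, H⟩, Ioo_subset_Icc_self hp.1.2⟩

section

variable {g : ℝ × ℝ → ℝ}

theorem exists_polar_radius (hc : HasCompactSupport g) (x : ℝ × ℝ) :
    ∃ M : ℝ, 0 ≤ M ∧ ∀ p : ℝ × ℝ, M < p.1 →
      x - (p.1 * Real.cos p.2, p.1 * Real.sin p.2) ∉ tsupport g := by
  obtain ⟨R, hR⟩ := hc.isCompact.isBounded.subset_closedBall 0
  refine ⟨2 * (|R| + ‖x‖), by positivity, fun p hp hmem => ?_⟩
  set w : ℝ × ℝ := (p.1 * Real.cos p.2, p.1 * Real.sin p.2)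
  have h1 : ‖x - w‖ ≤ |R| := (mem_closedBall_zero_iff.1 (hR hmem)).trans (le_abs_self R)
  have h2 : ‖w‖ ≤ |R| + ‖x‖ := by
    have := norm_sub_le x (x - w)
    rw [sub_sub_cancel] at this
    linarith
  have h3 : p.1 ^ 2 = w.1 ^ 2 + w.2 ^ 2 := by
    simp only [w]
    nlinarith [Real.sin_sq_add_cos_sq p.2]
  have h4 := (norm_fst_le w).trans h2
  have h5 := (norm_snd_le w).trans h2
  rw [Real.norm_eq_abs] at h4 h5
  have h6 : w.1 ^ 2 ≤ (|R| + ‖x‖) ^ 2 := sq_le_sq' (abs_le.1 h4).1 (abs_le.1 h4).2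
  have h7 : w.2 ^ 2 ≤ (|R| + ‖x‖) ^ 2 := sq_le_sq' (abs_le.1 h5).1 (abs_le.1 h5).2
  nlinarith [abs_nonneg R, norm_nonneg x]

theorem hasDerivAt_polar_radius (hg : Differentiable ℝ g) (x : ℝ × ℝ) (ρ θ : ℝ) :
    HasDerivAt (fun ρ => g (x - (ρ * Real.cos θ, ρ * Real.sin θ)))
      (-(Real.cos θ * pd₁ g (x - (ρ * Real.cos θ, ρ * Real.sin θ)) +
        Real.sin θ * pd₂ g (x - (ρ * Real.cos θ, ρ * Real.sin θ)))) ρ := by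
  have h1 : HasDerivAt (fun ρ : ℝ => x - (ρ * Real.cos θ, ρ * Real.sin θ))
      (-(Real.cos θ, Real.sin θ)) ρ := by
    have := (((hasDerivAt_id ρ).mul_const (Real.cos θ)).prodMk
      ((hasDerivAt_id ρ).mul_const (Real.sin θ))).const_sub x
    simpa using this
  have h2 := (hg (x - (ρ * Real.cos θ, ρ * Real.sin θ))).hasFDerivAt.comp_hasDerivAt ρ h1
  rw [map_neg, fderiv_apply_eq_pd hg] at h2
  exact h2

theorem hasDerivAt_polar_angle (hg : Differentiable ℝ g) (x : ℝ × ℝ) (ρ θ : ℝ) :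
    HasDerivAt (fun θ => g (x - (ρ * Real.cos θ, ρ * Real.sin θ)))
      (-(ρ * (Real.cos θ * pd₂ g (x - (ρ * Real.cos θ, ρ * Real.sin θ)) -
        Real.sin θ * pd₁ g (x - (ρ * Real.cos θ, ρ * Real.sin θ))))) θ := by
  have h1 : HasDerivAt (fun θ : ℝ => x - (ρ * Real.cos θ, ρ * Real.sin θ))
      (-(ρ * -Real.sin θ, ρ * Real.cos θ)) θ :=
    (((Real.hasDerivAt_cos θ).const_mul ρ).prodMk ((Real.hasDerivAt_sin θ).const_mul ρ)).const_sub x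
  have h2 := (hg (x - (ρ * Real.cos θ, ρ * Real.sin θ))).hasFDerivAt.comp_hasDerivAt θ h1
  rw [map_neg, fderiv_apply_eq_pd hg] at h2
  refine h2.congr_deriv ?_
  ring

theorem integral_newton_eq_polar (a b : ℝ × ℝ → ℝ) :
    ∫ w, (newton₁ w * a w + newton₂ w * b w) =
      1 / (2 * Real.pi) * ∫ p in Ioi (0 : ℝ) ×ˢ Ioo (-Real.pi) Real.pi,
        (Real.cos p.2 * a (p.1 * Real.cos p.2, p.1 * Real.sin p.2) +
          Real.sin p.2 * b (p.1 * Real.cos p.2, p.1 * Real.sin p.2)) := by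
  rw [← integral_comp_polarCoord_symm, ← integral_const_mul]
  refine setIntegral_congr_fun (measurableSet_Ioi.prod measurableSet_Ioo) fun p hp => ?_
  have hp0 : 0 < p.1 := hp.1
  have hpi := Real.pi_pos
  have h3 : (p.1 * Real.cos p.2) ^ 2 + (p.1 * Real.sin p.2) ^ 2 = p.1 ^ 2 := by
    nlinarith [Real.sin_sq_add_cos_sq p.2]
  have h4 : (p.1 * Real.sin p.2) ^ 2 + (p.1 * Real.cos p.2) ^ 2 = p.1 ^ 2 := by
    rw [add_comm, h3]
  simp only [polarCoord_symm_apply, newton₁, newton₂, conjPoisson, poissonKernel, smul_eq_mul, h3]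
  field_simp

theorem conv_newton_div (hg : ContDiff ℝ ∞ g) (hc : HasCompactSupport g) (x : ℝ × ℝ) :
    conv newton₁ (pd₁ g) x + conv newton₂ (pd₂ g) x = g x := by
  have hd := hg.differentiable (by simp)
  have c1 := continuous_pd₁ hg
  have c2 := continuous_pd₂ hg
  have hpi := Real.pi_pos
  obtain ⟨M, hM0, hM⟩ := exists_polar_radius hc x
  rw [conv, conv, ← integral_add
    (integrable_conv locallyIntegrable_newton₁ c1 (hasCompactSupport_pd₁ hg hc) x)
    (integrable_conv locallyIntegrable_newton₂ c2 (hasCompactSupport_pd₂ hg hc) x),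
    integral_newton_eq_polar (fun w => pd₁ g (x - w)) (fun w => pd₂ g (x - w))]
  set f : ℝ × ℝ → ℝ := fun p =>
    Real.cos p.2 * pd₁ g (x - (p.1 * Real.cos p.2, p.1 * Real.sin p.2)) +
      Real.sin p.2 * pd₂ g (x - (p.1 * Real.cos p.2, p.1 * Real.sin p.2)) with hf
  have hfM : ∀ p : ℝ × ℝ, M < p.1 → f p = 0 := fun p hp => by
    simp only [hf]
    rw [pd₁_eq_zero_of_notMem_tsupport hd (hM p hp), pd₂_eq_zero_of_notMem_tsupport hd (hM p hp)]
    ring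
  have hi := polar_integrableOn (by fun_prop : Continuous f) hfM
  have hin : ∀ θ : ℝ, ∫ ρ in Ioi (0 : ℝ), f (ρ, θ) = g x := fun θ => by
    have hi1 : IntegrableOn (fun ρ => f (ρ, θ)) (Ioi 0) := by
      refine ((by fun_prop : Continuous fun ρ => f (ρ, θ)).continuousOn.integrableOn_compact
        (isCompact_Icc (a := (0 : ℝ)) (b := M))).of_forall_sdiff_eq_zero measurableSet_Ioi
        fun ρ hρ => hfM (ρ, θ) ?_
      by_contra! H
      exact hρ.2 ⟨le_of_lt hρ.1, H⟩
    have ht : Tendsto (fun ρ => -g (x - (ρ * Real.cos θ, ρ * Real.sin θ))) atTop (𝓝 0) := by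
      refine tendsto_const_nhds.congr' ?_
      filter_upwards [Ioi_mem_atTop M] with ρ hρ
      rw [image_eq_zero_of_notMem_tsupport (hM (ρ, θ) hρ), neg_zero]
    have := integral_Ioi_of_hasDerivAt_of_tendsto' (a := 0)
      (f := fun ρ => -g (x - (ρ * Real.cos θ, ρ * Real.sin θ))) (f' := fun ρ => f (ρ, θ))
      (fun ρ _ => (hasDerivAt_polar_radius hd x ρ θ).neg.congr_deriv (by simp [hf])) hi1 ht
    rw [this]
    simp [← Prod.zero_eq_mk]
  rw [IntegrableOn, Measure.volume_eq_prod, ← Measure.prod_restrict] at hi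
  rw [Measure.volume_eq_prod, ← Measure.prod_restrict, integral_prod_symm f hi]
  simp_rw [hin]
  rw [setIntegral_const, measureReal_def, Real.volume_Ioo, ENNReal.toReal_ofReal (by linarith),
    smul_eq_mul]
  field_simp
  ring

theorem conv_newton_curl (hg : ContDiff ℝ ∞ g) (hc : HasCompactSupport g) (x : ℝ × ℝ) :
    conv newton₁ (pd₂ g) x - conv newton₂ (pd₁ g) x = 0 := by
  have hd := hg.differentiable (by simp)
  have c1 := continuous_pd₁ hg
  have c2 := continuous_pd₂ hg
  have hpi := Real.pi_pos
  obtain ⟨M, hM0, hM⟩ := exists_polar_radius hc x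
  have i1 := integrable_conv locallyIntegrable_newton₁ c2 (hasCompactSupport_pd₂ hg hc) x
  have i2 := integrable_conv locallyIntegrable_newton₂ c1 (hasCompactSupport_pd₁ hg hc) x
  have e : ∫ w, (newton₁ w * pd₂ g (x - w) - newton₂ w * pd₁ g (x - w)) =
      ∫ w, (newton₁ w * pd₂ g (x - w) + newton₂ w * (-pd₁ g (x - w))) := by
    congr 1; ext w; ring
  rw [conv, conv, ← integral_sub i1 i2, e,
    integral_newton_eq_polar (fun w => pd₂ g (x - w)) (fun w => -pd₁ g (x - w))]
  set f : ℝ × ℝ → ℝ := fun p =>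
    Real.cos p.2 * pd₂ g (x - (p.1 * Real.cos p.2, p.1 * Real.sin p.2)) +
      Real.sin p.2 * -pd₁ g (x - (p.1 * Real.cos p.2, p.1 * Real.sin p.2)) with hf
  have hfM : ∀ p : ℝ × ℝ, M < p.1 → f p = 0 := fun p hp => by
    simp only [hf]
    rw [pd₁_eq_zero_of_notMem_tsupport hd (hM p hp), pd₂_eq_zero_of_notMem_tsupport hd (hM p hp)]
    ring
  have hi := polar_integrableOn (by fun_prop : Continuous f) hfM
  have hin : ∀ ρ ∈ Ioi (0 : ℝ), ∫ θ in Ioo (-Real.pi) Real.pi, f (ρ, θ) = 0 := fun ρ hρ => by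
    have hρ0 : ρ ≠ 0 := ne_of_gt hρ
    rw [← integral_Ioc_eq_integral_Ioo, ← intervalIntegral.integral_of_le (by linarith),
      intervalIntegral.integral_eq_sub_of_hasDerivAt
        (f := fun θ => -ρ⁻¹ * g (x - (ρ * Real.cos θ, ρ * Real.sin θ)))]
    · simp
    · intro θ _
      refine ((hasDerivAt_polar_angle hd x ρ θ).const_mul (-ρ⁻¹)).congr_deriv ?_
      simp only [hf]
      field_simp
      ring
    · exact (by fun_prop : Continuous fun θ => f (ρ, θ)).intervalIntegrable _ _
  rw [Measure.volume_eq_prod, setIntegral_prod _ hi, setIntegral_congr_fun measurableSet_Ioi hin]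
  simp

end

/-! ### Growth of fields in weak `L²` -/

/-- The mass of `|f|` in the part of the half plane of size `R` is at most `CR`. -/
def HasLinearGrowth (f : ℝ × ℝ → ℝ) (C : ℝ) : Prop :=
  ∀ R : ℝ, 1 ≤ R → IntegrableOn f (halfPlane ∩ Metric.closedBall 0 R) ∧
    ∫ z in halfPlane ∩ Metric.closedBall 0 R, |f z| ≤ C * R

theorem measurableSet_halfPlane_inter (R : ℝ) :
    MeasurableSet (halfPlane ∩ Metric.closedBall (0 : ℝ × ℝ) R) :=
  measurableSet_halfPlane.inter Metric.isClosed_closedBall.measurableSet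

theorem volume_closedBall_prod {R : ℝ} (hR : 0 ≤ R) :
    volume (Metric.closedBall (0 : ℝ × ℝ) R) = ENNReal.ofReal (4 * R ^ 2) := by
  rw [← Prod.mk_zero_zero, ← closedBall_prod_same, Measure.volume_eq_prod, Measure.prod_prod,
    Real.volume_closedBall, ← ENNReal.ofReal_mul (by positivity)]
  congr 1; ring

theorem lintegral_Ioi_inv_sq {c l : ℝ} (hc : 0 ≤ c) (hl : 0 < l) :
    ∫⁻ t in Ioi l, ENNReal.ofReal (c / t ^ 2) = ENNReal.ofReal (c / l) := by
  have e : ∀ t ∈ Ioi l, c / t ^ 2 = c * t ^ (-2 : ℝ) := fun t ht => by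
    have ht' : 0 < t := hl.trans ht
    rw [Real.rpow_neg ht'.le, div_eq_mul_inv]
    norm_num
  have hi := (integrableOn_Ioi_rpow_of_lt (by norm_num : (-2 : ℝ) < -1) hl).const_mul c
  rw [setLIntegral_congr_fun measurableSet_Ioi fun t ht => congrArg ENNReal.ofReal (e t ht),
    ← ofReal_integral_eq_lintegral_ofReal hi, integral_const_mul,
    integral_Ioi_rpow_of_lt (by norm_num) hl]
  · congr 1
    norm_num
    rw [Real.rpow_neg_one, div_eq_mul_inv]
  · filter_upwards [ae_restrict_mem measurableSet_Ioi] with t ht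
    have : 0 < t := hl.trans ht
    simp only [Pi.zero_apply]
    positivity

theorem MemWeakL2.exists_lintegral_le {u : ℝ × ℝ → ℝ × ℝ} (hu : MemWeakL2 u) :
    ∃ C : ℝ, 0 ≤ C ∧ ∀ R : ℝ, 1 ≤ R →
      ∫⁻ z in halfPlane ∩ Metric.closedBall 0 R, ENNReal.ofReal √((u z).1 ^ 2 + (u z).2 ^ 2) ≤
        ENNReal.ofReal (C * R) := by
  obtain ⟨hm, C, hC⟩ := hu
  refine ⟨4 + |C|, by positivity, fun R hR => ?_⟩
  have hR0 : 0 < R := by linarith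
  set m := (volume : Measure (ℝ × ℝ)).restrict (halfPlane ∩ Metric.closedBall 0 R) with hmdef
  have hm1 : AEMeasurable (fun z => √((u z).1 ^ 2 + (u z).2 ^ 2)) m := by
    have := (hm.mono_measure (Measure.restrict_mono_set volume
      (inter_subset_left : halfPlane ∩ Metric.closedBall 0 R ⊆ halfPlane))).aemeasurable
    exact ((this.fst.pow_const 2).add (this.snd.pow_const 2)).sqrt
  rw [lintegral_eq_lintegral_meas_lt m (Eventually.of_forall fun z => Real.sqrt_nonneg _) hm1,
    ← Ioc_union_Ioi_eq_Ioi (inv_pos.2 hR0).le, lintegral_union measurableSet_Ioi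
      Ioc_disjoint_Ioi_same]
  have b1 : ∀ t, m {z | t < √((u z).1 ^ 2 + (u z).2 ^ 2)} ≤ ENNReal.ofReal (4 * R ^ 2) :=
    fun t => by
      refine (measure_mono (subset_univ _)).trans ?_
      rw [hmdef, Measure.restrict_apply_univ, ← volume_closedBall_prod hR0.le]
      exact measure_mono inter_subset_right
  have b2 : ∀ t, 0 < t → m {z | t < √((u z).1 ^ 2 + (u z).2 ^ 2)} ≤ ENNReal.ofReal (|C| / t ^ 2) :=
    fun t ht => by
      rw [hmdef, Measure.restrict_apply' (measurableSet_halfPlane_inter R)]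
      refine le_trans (measure_mono fun z hz => ?_) ((hC t ht).trans
        (ENNReal.ofReal_le_ofReal (by gcongr; exact le_abs_self C)))
      exact ⟨hz.2.1, hz.1⟩
  calc _ ≤ (∫⁻ _ in Ioc 0 R⁻¹, ENNReal.ofReal (4 * R ^ 2)) +
        ∫⁻ t in Ioi R⁻¹, ENNReal.ofReal (|C| / t ^ 2) := by
        refine add_le_add (lintegral_mono fun t => b1 t)
          (setLIntegral_mono' measurableSet_Ioi fun t ht => b2 t ?_)
        exact (inv_pos.2 hR0).trans ht
    _ = ENNReal.ofReal ((4 + |C|) * R) := by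
        rw [setLIntegral_const, Real.volume_Ioc, lintegral_Ioi_inv_sq (abs_nonneg C)
          (inv_pos.2 hR0), ← ENNReal.ofReal_mul (by positivity),
          ← ENNReal.ofReal_add (by simp; positivity) (by positivity)]
        congr 1
        field_simp
        ring

theorem MemWeakL2.exists_hasLinearGrowth {u : ℝ × ℝ → ℝ × ℝ} (hu : MemWeakL2 u) :
    ∃ C : ℝ, 0 ≤ C ∧ HasLinearGrowth (fun z => (u z).1) C ∧
      HasLinearGrowth (fun z => (u z).2) C := by
  obtain ⟨C, hC0, hC⟩ := hu.exists_lintegral_le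
  have hsub : ∀ R : ℝ, halfPlane ∩ Metric.closedBall (0 : ℝ × ℝ) R ⊆ halfPlane :=
    fun R => inter_subset_left
  have key : ∀ f : ℝ × ℝ → ℝ, AEStronglyMeasurable f (volume.restrict halfPlane) →
      (∀ z, |f z| ≤ √((u z).1 ^ 2 + (u z).2 ^ 2)) → HasLinearGrowth f C := by
    intro f hf hle R hR
    have h1 : ∫⁻ z in halfPlane ∩ Metric.closedBall 0 R, ‖f z‖ₑ ≤ ENNReal.ofReal (C * R) := by
      refine (lintegral_mono fun z => ?_).trans (hC R hR)
      rw [Real.enorm_eq_ofReal_abs]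
      exact ENNReal.ofReal_le_ofReal (hle z)
    have hm := hf.mono_measure (Measure.restrict_mono_set volume (hsub R))
    refine ⟨⟨hm, h1.trans_lt ENNReal.ofReal_lt_top⟩, ?_⟩
    have h2 : ∫ z in halfPlane ∩ Metric.closedBall 0 R, |f z| =
        (∫⁻ z in halfPlane ∩ Metric.closedBall 0 R, ‖f z‖ₑ).toReal :=
      integral_norm_eq_lintegral_enorm hm
    rw [h2]
    refine (ENNReal.toReal_mono ENNReal.ofReal_ne_top h1).trans_eq ?_
    exact ENNReal.toReal_ofReal (by positivity)
  refine ⟨C, hC0, key _ hu.1.fst fun z => ?_, key _ hu.1.snd fun z => ?_⟩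
  · exact Real.abs_le_sqrt (by nlinarith [sq_nonneg (u z).2])
  · exact Real.abs_le_sqrt (by nlinarith [sq_nonneg (u z).1])

/-! ### Test functions that vanish on the boundary -/

/-- A smooth step function that is `0` on `s ≤ 1` and `1` on `s ≥ 2`. -/
def smoothStep (s : ℝ) : ℝ := Real.smoothTransition (s - 1)

theorem contDiff_smoothStep : ContDiff ℝ ∞ smoothStep :=
  Real.smoothTransition.contDiff.comp (contDiff_id.sub contDiff_const)

theorem smoothStep_of_le {s : ℝ} (hs : s ≤ 1) : smoothStep s = 0 :=
  Real.smoothTransition.zero_of_nonpos (by linarith)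

theorem smoothStep_of_ge {s : ℝ} (hs : 2 ≤ s) : smoothStep s = 1 :=
  Real.smoothTransition.one_of_one_le (by linarith)

theorem abs_smoothStep_le (s : ℝ) : |smoothStep s| ≤ 1 := by
  rw [smoothStep, abs_of_nonneg (Real.smoothTransition.nonneg _)]
  exact Real.smoothTransition.le_one _

theorem deriv_smoothStep_of_gt {s : ℝ} (hs : 2 < s) : deriv smoothStep s = 0 := by
  have : smoothStep =ᶠ[𝓝 s] fun _ => 1 := by
    filter_upwards [Ioi_mem_nhds hs] with r hr using smoothStep_of_ge (le_of_lt hr)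
  rw [this.deriv_eq, deriv_const]

theorem deriv_smoothStep_of_lt {s : ℝ} (hs : s < 1) : deriv smoothStep s = 0 := by
  have : smoothStep =ᶠ[𝓝 s] fun _ => 0 := by
    filter_upwards [Iio_mem_nhds hs] with r hr using smoothStep_of_le (le_of_lt hr)
  rw [this.deriv_eq, deriv_const]

theorem exists_abs_mul_deriv_smoothStep_le :
    ∃ K : ℝ, 0 ≤ K ∧ ∀ s, |s * deriv smoothStep s| ≤ K := by
  obtain ⟨K, hK⟩ := (isCompact_Icc (a := (1 : ℝ)) (b := 2)).exists_bound_of_continuousOn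
    (f := fun s => s * deriv smoothStep s)
    (continuous_id.mul (contDiff_smoothStep.continuous_deriv (by simp))).continuousOn
  have hK0 : 0 ≤ K := (norm_nonneg _).trans (hK 1 ⟨le_rfl, by norm_num⟩)
  refine ⟨K, hK0, fun s => ?_⟩
  by_cases hs : s ∈ Icc (1 : ℝ) 2
  · exact hK s hs
  · rw [mem_Icc, not_and_or, not_le, not_le] at hs
    rcases hs with hs | hs
    · simpa [deriv_smoothStep_of_lt hs] using hK0
    · simpa [deriv_smoothStep_of_gt hs] using hK0

theorem pd₁_normalCutoff (ε : ℝ) (x : ℝ × ℝ) :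
    pd₁ (fun x => smoothStep (ε⁻¹ * x.2)) x = 0 := by
  simp [pd₁]

theorem pd₂_normalCutoff (ε : ℝ) (x : ℝ × ℝ) :
    pd₂ (fun x => smoothStep (ε⁻¹ * x.2)) x = ε⁻¹ * deriv smoothStep (ε⁻¹ * x.2) :=
  deriv_comp_mul_left ε⁻¹ smoothStep x.2

theorem contDiff_normalCutoff (ε : ℝ) :
    ContDiff ℝ ∞ fun x : ℝ × ℝ => smoothStep (ε⁻¹ * x.2) :=
  contDiff_smoothStep.comp (contDiff_const.mul contDiff_snd)

theorem exists_bound_of_hasCompactSupport {f : ℝ × ℝ → ℝ} (hf : Continuous f)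
    (hc : HasCompactSupport f) : ∃ C, 0 ≤ C ∧ ∀ x, |f x| ≤ C := by
  obtain ⟨C, hC⟩ := hc.exists_bound_of_continuous hf
  exact ⟨C, (norm_nonneg _).trans (hC 0), hC⟩

theorem abs_le_of_boundary_zero {β : ℝ × ℝ → ℝ} (hβ : Differentiable ℝ β) {M : ℝ}
    (hM : ∀ x, |pd₂ β x| ≤ M) (h0 : ∀ r, β (r, 0) = 0) (x : ℝ × ℝ) : |β x| ≤ M * |x.2| := by
  have h := (convex_univ (𝕜 := ℝ) (E := ℝ)).norm_image_sub_le_of_norm_hasDerivWithin_le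
    (f := fun r => β (x.1, r)) (f' := fun r => pd₂ β (x.1, r)) (C := M)
    (fun r _ => by
      rw [pd₂_eq_fderiv hβ]
      exact (hasDerivAt_pd₂ hβ (x.1, r)).hasDerivWithinAt)
    (fun r _ => hM (x.1, r)) (mem_univ 0) (mem_univ x.2)
  simpa [h0] using h

theorem exists_support_closedBall {f : ℝ × ℝ → ℝ} (hc : HasCompactSupport f) :
    ∃ R : ℝ, 1 ≤ R ∧ ∀ x, R < ‖x‖ → x ∉ tsupport f := by
  obtain ⟨R, hR⟩ := hc.isCompact.isBounded.subset_closedBall 0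
  refine ⟨max R 1, le_max_right _ _, fun x hx hmem => ?_⟩
  have := mem_closedBall_zero_iff.1 (hR hmem)
  exact absurd hx (not_lt.2 (this.trans (le_max_left _ _)))

theorem setIntegral_halfPlane_eq {f : ℝ × ℝ → ℝ} {R : ℝ} (hf : ∀ x, R < ‖x‖ → f x = 0) :
    ∫ z in halfPlane, f z = ∫ z in halfPlane ∩ Metric.closedBall 0 R, f z := by
  refine setIntegral_eq_of_subset_of_forall_sdiff_eq_zero measurableSet_halfPlane
    inter_subset_left fun x hx => hf x ?_
  by_contra! H
  exact hx.2 ⟨hx.1, mem_closedBall_zero_iff.2 H⟩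

section

variable {ν : Measure (ℝ × ℝ)} [IsFiniteMeasure ν] {h : ℝ × ℝ → ℝ}
  {μ : SignedMeasure closedHalfPlane} {u : ℝ × ℝ → ℝ × ℝ} {C : ℝ}

theorem integrable_of_bdd {f : ℝ × ℝ → ℝ} (hf : Continuous f) {C : ℝ} (hC : ∀ x, |f x| ≤ C) :
    Integrable f ν :=
  Integrable.of_bound hf.aestronglyMeasurable C (Eventually.of_forall hC)

theorem HasVorticity.eq_of_boundary_zero (hd : IsDensity ν h)
    (hrep : ∀ f : ℝ × ℝ → ℝ, Integrable f ν → MIntegrable μ f ∧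
      mIntegral μ f = ∫ y, h y * f y ∂ν)
    (hu : HasVorticity u μ) (h₁ : HasLinearGrowth (fun z => (u z).1) C)
    (h₂ : HasLinearGrowth (fun z => (u z).2) C) {β : ℝ × ℝ → ℝ} (hβ : ContDiff ℝ ∞ β)
    (hc : HasCompactSupport β) (h0 : ∀ r, β (r, 0) = 0) :
    ∫ x in halfPlane, ((u x).1 * pd₂ β x - (u x).2 * pd₁ β x) = ∫ y, h y * β y ∂ν := by
  have hdβ := hβ.differentiable (by simp)
  obtain ⟨M₀, hM₀, bβ⟩ := exists_bound_of_hasCompactSupport hβ.continuous hc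
  obtain ⟨M₁, hM₁, b₁⟩ := exists_bound_of_hasCompactSupport (continuous_pd₁ hβ)
    (hasCompactSupport_pd₁ hβ hc)
  obtain ⟨M₂, hM₂, b₂⟩ := exists_bound_of_hasCompactSupport (continuous_pd₂ hβ)
    (hasCompactSupport_pd₂ hβ hc)
  obtain ⟨K, hK0, hK⟩ := exists_abs_mul_deriv_smoothStep_le
  obtain ⟨R, hR, hsupp⟩ := exists_support_closedBall hc
  set ε : ℕ → ℝ := fun n => ((n : ℝ) + 1)⁻¹ with hε
  have hε0 : ∀ n, 0 < ε n := fun n => by positivity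
  have hεt : Tendsto ε atTop (𝓝 0) := by
    simpa [hε, one_div] using tendsto_one_div_add_atTop_nhds_zero_nat (𝕜 := ℝ)
  set φ : ℕ → ℝ × ℝ → ℝ := fun n x => smoothStep ((ε n)⁻¹ * x.2) * β x with hφ
  have hcd : ∀ n, ContDiff ℝ ∞ (φ n) := fun n => (contDiff_normalCutoff (ε n)).mul hβ
  have hdc : ∀ n, Differentiable ℝ fun x : ℝ × ℝ => smoothStep ((ε n)⁻¹ * x.2) :=
    fun n => (contDiff_normalCutoff (ε n)).differentiable (by simp)
  have hp₁ : ∀ n x, pd₁ (φ n) x = smoothStep ((ε n)⁻¹ * x.2) * pd₁ β x := fun n x => by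
    rw [hφ, pd₁_mul (hdc n) hdβ, pd₁_normalCutoff]; ring
  have hp₂ : ∀ n x, pd₂ (φ n) x = (ε n)⁻¹ * deriv smoothStep ((ε n)⁻¹ * x.2) * β x +
      smoothStep ((ε n)⁻¹ * x.2) * pd₂ β x := fun n x => by
    rw [hφ, pd₂_mul (hdc n) hdβ, pd₂_normalCutoff]
  have hev : ∀ x : ℝ × ℝ, 0 < x.2 → ∀ᶠ n in atTop, 2 < (ε n)⁻¹ * x.2 := fun x hx => by
    filter_upwards [hεt.eventually (gt_mem_nhds (show 0 < x.2 / 2 by positivity))] with n hn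
    rw [inv_mul_eq_div, lt_div_iff₀ (hε0 n)]
    linarith
  have hvort : ∀ n, ∫ x in halfPlane, ((u x).1 * pd₂ (φ n) x - (u x).2 * pd₁ (φ n) x) =
      ∫ y, h y * φ n y ∂ν := fun n => by
    have hcn : HasCompactSupport (φ n) := hc.mul_left
    rw [hu (φ n) (hcd n) hcn ?_]
    · obtain ⟨Cn, _, hCn⟩ := exists_bound_of_hasCompactSupport (hcd n).continuous hcn
      exact (hrep _ (integrable_of_bdd (hcd n).continuous hCn)).2
    · have hcl : IsClosed {x : ℝ × ℝ | ε n ≤ x.2} := isClosed_le continuous_const continuous_snd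
      refine (closure_minimal (fun x hx => ?_) hcl).trans fun x (hx : ε n ≤ x.2) =>
        (hε0 n).trans_le hx
      by_contra H
      apply hx
      have : (ε n)⁻¹ * x.2 ≤ 1 := by
        rw [inv_mul_eq_div, div_le_one (hε0 n)]
        exact le_of_lt (not_le.1 H)
      simp [hφ, smoothStep_of_le this]
  have hz : ∀ x, R < ‖x‖ → β x = 0 ∧ pd₁ β x = 0 ∧ pd₂ β x = 0 := fun x hx =>
    ⟨image_eq_zero_of_notMem_tsupport (hsupp x hx),
      pd₁_eq_zero_of_notMem_tsupport hdβ (hsupp x hx),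
      pd₂_eq_zero_of_notMem_tsupport hdβ (hsupp x hx)⟩
  have hL : Tendsto (fun n => ∫ x in halfPlane,
      ((u x).1 * pd₂ (φ n) x - (u x).2 * pd₁ (φ n) x)) atTop
      (𝓝 (∫ x in halfPlane, ((u x).1 * pd₂ β x - (u x).2 * pd₁ β x))) := by
    have e1 : ∀ n, ∫ x in halfPlane, ((u x).1 * pd₂ (φ n) x - (u x).2 * pd₁ (φ n) x) =
        ∫ x in halfPlane ∩ Metric.closedBall 0 R,
          ((u x).1 * pd₂ (φ n) x - (u x).2 * pd₁ (φ n) x) := fun n =>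
      setIntegral_halfPlane_eq fun x hx => by
        obtain ⟨z0, z1, z2⟩ := hz x hx
        rw [hp₁, hp₂, z0, z1, z2]; ring
    have e2 : ∫ x in halfPlane, ((u x).1 * pd₂ β x - (u x).2 * pd₁ β x) =
        ∫ x in halfPlane ∩ Metric.closedBall 0 R, ((u x).1 * pd₂ β x - (u x).2 * pd₁ β x) :=
      setIntegral_halfPlane_eq fun x hx => by
        obtain ⟨z0, z1, z2⟩ := hz x hx
        rw [z1, z2]; ring
    simp_rw [e1, e2]
    have i1 := (h₁ R hR).1
    have i2 := (h₂ R hR).1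
    refine tendsto_integral_of_dominated_convergence
      (fun x => |(u x).1| * (K * M₂ + M₂) + |(u x).2| * M₁) (fun n => ?_)
      ((i1.abs.mul_const _).add (i2.abs.mul_const _)) (fun n => ?_) ?_
    · exact (i1.aestronglyMeasurable.mul (continuous_pd₂ (hcd n)).aestronglyMeasurable).sub
        (i2.aestronglyMeasurable.mul (continuous_pd₁ (hcd n)).aestronglyMeasurable)
    · refine Eventually.of_forall fun x => ?_
      have q1 : |pd₁ (φ n) x| ≤ M₁ := by
        rw [hp₁, abs_mul]
        exact (mul_le_of_le_one_left (abs_nonneg _) (abs_smoothStep_le _)).trans (b₁ x)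
      have q2 : |pd₂ (φ n) x| ≤ K * M₂ + M₂ := by
        rw [hp₂]
        refine (abs_add_le _ _).trans (add_le_add ?_ ?_)
        · rw [abs_mul]
          calc |(ε n)⁻¹ * deriv smoothStep ((ε n)⁻¹ * x.2)| * |β x|
              ≤ |(ε n)⁻¹ * deriv smoothStep ((ε n)⁻¹ * x.2)| * (M₂ * |x.2|) := by
                gcongr; exact abs_le_of_boundary_zero hdβ b₂ h0 x
            _ = |(ε n)⁻¹ * x.2 * deriv smoothStep ((ε n)⁻¹ * x.2)| * M₂ := by
                simp only [abs_mul]; ring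
            _ ≤ K * M₂ := by gcongr; exact hK _
        · rw [abs_mul]
          exact (mul_le_of_le_one_left (abs_nonneg _) (abs_smoothStep_le _)).trans (b₂ x)
      rw [Real.norm_eq_abs]
      refine (abs_sub _ _).trans ?_
      rw [abs_mul, abs_mul]
      gcongr
    · filter_upwards [ae_restrict_mem (measurableSet_halfPlane_inter R)] with x hx
      refine tendsto_const_nhds.congr' ?_
      filter_upwards [hev x hx.1] with n hn
      rw [hp₁, hp₂, deriv_smoothStep_of_gt hn, smoothStep_of_ge hn.le]
      ring
  have hRt : Tendsto (fun n => ∫ y, h y * φ n y ∂ν) atTop (𝓝 (∫ y, h y * β y ∂ν)) := by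
    refine tendsto_integral_of_dominated_convergence (fun _ => M₀) (fun n => ?_)
      (integrable_const _) (fun n => Eventually.of_forall fun y => ?_) ?_
    · exact hd.measurable.aestronglyMeasurable.mul (hcd n).continuous.aestronglyMeasurable
    · rw [Real.norm_eq_abs, abs_mul, hφ, abs_mul]
      have := mul_le_one₀ (hd.le_one y) (abs_nonneg _) (abs_smoothStep_le ((ε n)⁻¹ * y.2))
      rw [← mul_assoc]
      exact (mul_le_of_le_one_left (abs_nonneg _) this).trans (bβ y)
    · filter_upwards [hd.ae_mem] with y hy
      refine tendsto_const_nhds.congr' ?_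
      filter_upwards [hev y hy] with n hn
      simp [hφ, smoothStep_of_ge hn.le]
  refine tendsto_nhds_unique hL ?_
  simp_rw [hvort]
  exact hRt

end

/-! ### Test functions that decay at infinity -/

/-- A smooth cutoff that is `1` on the ball of radius `1` and `0` outside that of radius `2`. -/
def bump : ContDiffBump (0 : ℝ × ℝ) := ⟨1, 2, one_pos, one_lt_two⟩

/-- A smooth cutoff at scale `R`. -/
def cutoff (R : ℝ) (x : ℝ × ℝ) : ℝ := bump (R⁻¹ • x)

theorem contDiff_bump : ContDiff ℝ ∞ (bump : ℝ × ℝ → ℝ) := bump.contDiff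

theorem contDiff_cutoff (R : ℝ) : ContDiff ℝ ∞ (cutoff R) :=
  contDiff_bump.comp (contDiff_const_smul _)

theorem pd₁_cutoff (R : ℝ) (x : ℝ × ℝ) : pd₁ (cutoff R) x = R⁻¹ * pd₁ bump (R⁻¹ • x) :=
  deriv_comp_mul_left R⁻¹ (fun r => bump (r, R⁻¹ * x.2)) x.1

theorem pd₂_cutoff (R : ℝ) (x : ℝ × ℝ) : pd₂ (cutoff R) x = R⁻¹ * pd₂ bump (R⁻¹ • x) :=
  deriv_comp_mul_left R⁻¹ (fun r => bump (R⁻¹ * x.1, r)) x.2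

theorem abs_cutoff_le (R : ℝ) (x : ℝ × ℝ) : |cutoff R x| ≤ 1 := by
  rw [cutoff, abs_of_nonneg bump.nonneg]
  exact bump.le_one

theorem norm_inv_smul {R : ℝ} (hR : 0 < R) (x : ℝ × ℝ) : ‖R⁻¹ • x‖ = ‖x‖ / R := by
  rw [norm_smul, Real.norm_of_nonneg (inv_pos.2 hR).le, inv_mul_eq_div]

theorem cutoff_eq_one {R : ℝ} (hR : 0 < R) {x : ℝ × ℝ} (hx : ‖x‖ ≤ R) : cutoff R x = 1 := by
  refine bump.one_of_mem_closedBall ?_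
  rw [mem_closedBall_zero_iff, norm_inv_smul hR, div_le_iff₀ hR]
  change ‖x‖ ≤ 1 * R
  linarith

theorem cutoff_eq_zero {R : ℝ} (hR : 0 < R) {x : ℝ × ℝ} (hx : 2 * R < ‖x‖) : cutoff R x = 0 := by
  refine image_eq_zero_of_notMem_tsupport (f := bump) fun H => ?_
  rw [bump.tsupport_eq, mem_closedBall_zero_iff, norm_inv_smul hR, div_le_iff₀ hR] at H
  change ‖x‖ ≤ 2 * R at H
  linarith

theorem hasCompactSupport_cutoff {R : ℝ} (hR : 0 < R) : HasCompactSupport (cutoff R) := by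
  refine HasCompactSupport.intro (isCompact_closedBall (0 : ℝ × ℝ) (2 * R)) fun x hx => ?_
  rw [mem_closedBall_zero_iff, not_le] at hx
  exact cutoff_eq_zero hR hx

theorem pd_bump_eq_zero {x : ℝ × ℝ} (hx : ‖x‖ < 1 ∨ 2 < ‖x‖) :
    pd₁ bump x = 0 ∧ pd₂ bump x = 0 := by
  have hd := contDiff_bump.differentiable (by simp)
  rcases hx with hx | hx
  · have h1 : (bump : ℝ × ℝ → ℝ) =ᶠ[𝓝 x] 1 :=
      bump.eventuallyEq_one_of_mem_ball (mem_ball_zero_iff.2 hx)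
    rw [pd₁_eq_fderiv hd, pd₂_eq_fderiv hd, h1.fderiv_eq]
    simp
  · have h1 : x ∉ tsupport bump := fun H => by
      rw [bump.tsupport_eq, mem_closedBall_zero_iff] at H
      change ‖x‖ ≤ 2 at H
      linarith
    exact ⟨pd₁_eq_zero_of_notMem_tsupport hd h1, pd₂_eq_zero_of_notMem_tsupport hd h1⟩

theorem pd_cutoff_eq_zero {R : ℝ} (hR : 0 < R) {x : ℝ × ℝ} (hx : ‖x‖ < R ∨ 2 * R < ‖x‖) :
    pd₁ (cutoff R) x = 0 ∧ pd₂ (cutoff R) x = 0 := by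
  have h := pd_bump_eq_zero (x := R⁻¹ • x) (by
    rw [norm_inv_smul hR, div_lt_one hR, lt_div_iff₀ hR]; exact hx)
  rw [pd₁_cutoff, pd₂_cutoff, h.1, h.2]
  simp

theorem exists_abs_pd_cutoff_le :
    ∃ K : ℝ, 0 ≤ K ∧ ∀ R : ℝ, 0 < R → ∀ x,
      |pd₁ (cutoff R) x| ≤ K / R ∧ |pd₂ (cutoff R) x| ≤ K / R := by
  obtain ⟨K₁, hK₁, h₁⟩ := exists_bound_of_hasCompactSupport (continuous_pd₁ contDiff_bump)
    (hasCompactSupport_pd₁ contDiff_bump bump.hasCompactSupport)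
  obtain ⟨K₂, hK₂, h₂⟩ := exists_bound_of_hasCompactSupport (continuous_pd₂ contDiff_bump)
    (hasCompactSupport_pd₂ contDiff_bump bump.hasCompactSupport)
  refine ⟨max K₁ K₂, le_max_of_le_left hK₁, fun R hR x => ?_⟩
  rw [pd₁_cutoff, pd₂_cutoff, abs_mul, abs_mul, abs_of_pos (inv_pos.2 hR), inv_mul_eq_div,
    inv_mul_eq_div]
  exact ⟨by gcongr; exact (h₁ _).trans (le_max_left _ _),
    by gcongr; exact (h₂ _).trans (le_max_right _ _)⟩

section

variable {ν : Measure (ℝ × ℝ)} [IsFiniteMeasure ν] {h : ℝ × ℝ → ℝ}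
  {μ : SignedMeasure closedHalfPlane} {u : ℝ × ℝ → ℝ × ℝ} {C : ℝ}

theorem HasLinearGrowth.integrableOn_mul {f : ℝ × ℝ → ℝ} (hf : HasLinearGrowth f C)
    {g : ℝ × ℝ → ℝ} (hg : Continuous g) {R : ℝ} (hR : 1 ≤ R) (h0 : ∀ x, R < ‖x‖ → g x = 0) :
    IntegrableOn (fun x => f x * g x) halfPlane := by
  obtain ⟨M, hM⟩ := (isCompact_closedBall (0 : ℝ × ℝ) R).exists_bound_of_continuousOn hg.continuousOn
  have h1 : IntegrableOn (fun x => f x * g x) (halfPlane ∩ Metric.closedBall 0 R) := by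
    refine (hf R hR).1.mul_bdd hg.aestronglyMeasurable (c := M) ?_
    filter_upwards [ae_restrict_mem (measurableSet_halfPlane_inter R)] with x hx using hM x hx.2
  refine h1.of_forall_sdiff_eq_zero measurableSet_halfPlane fun x hx => ?_
  rw [h0 x, mul_zero]
  by_contra! H
  exact hx.2 ⟨hx.1, mem_closedBall_zero_iff.2 H⟩

/-- The weak formulation of `div u = 0`, `curl u = μ` with test functions that decay like
`|x|⁻¹`. -/
theorem integral_mul_div_add_mul_curl (hd : IsDensity ν h)
    (hrep : ∀ f : ℝ × ℝ → ℝ, Integrable f ν → MIntegrable μ f ∧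
      mIntegral μ f = ∫ y, h y * f y ∂ν)
    (hn : NormalTraceZero u) (hu : HasVorticity u μ)
    (h₁ : HasLinearGrowth (fun z => (u z).1) C)
    (h₂ : HasLinearGrowth (fun z => (u z).2) C) {α β p q : ℝ × ℝ → ℝ} (hα : ContDiff ℝ ∞ α)
    (hβ : ContDiff ℝ ∞ β) (h0 : ∀ r, β (r, 0) = 0) {A : ℝ}
    (bα : ∀ x, |α x| * (1 + ‖x‖) ≤ A) (bβ : ∀ x, |β x| * (1 + ‖x‖) ≤ A)
    (hp : ∀ x, pd₁ α x + pd₂ β x = p x) (hq : ∀ x, pd₂ α x - pd₁ β x = q x)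
    (hpc : HasCompactSupport p) (hqc : HasCompactSupport q) :
    ∫ x in halfPlane, ((u x).1 * p x + (u x).2 * q x) = ∫ y, h y * β y ∂ν := by
  have hdα := hα.differentiable (by simp)
  have hdβ := hβ.differentiable (by simp)
  have cp : Continuous p := by
    rw [← funext hp]; exact (continuous_pd₁ hα).add (continuous_pd₂ hβ)
  have cq : Continuous q := by
    rw [← funext hq]; exact (continuous_pd₂ hα).sub (continuous_pd₁ hβ)
  obtain ⟨Rp, hRp, sp⟩ := exists_support_closedBall hpc
  obtain ⟨Rq, hRq, sq'⟩ := exists_support_closedBall hqc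
  obtain ⟨K, hK0, hK⟩ := exists_abs_pd_cutoff_le
  have hA0 : 0 ≤ A := le_trans (by positivity) (bα 0)
  set R₀ := max Rp Rq with hR₀
  have hR₀1 : 1 ≤ R₀ := hRp.trans (le_max_left _ _)
  have zp : ∀ x, R₀ < ‖x‖ → p x = 0 := fun x hx =>
    image_eq_zero_of_notMem_tsupport (sp x (lt_of_le_of_lt (le_max_left _ _) hx))
  have zq : ∀ x, R₀ < ‖x‖ → q x = 0 := fun x hx =>
    image_eq_zero_of_notMem_tsupport (sq' x (lt_of_le_of_lt (le_max_right _ _) hx))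
  set I := ∫ x in halfPlane, ((u x).1 * p x + (u x).2 * q x) with hI
  have key : ∀ R : ℝ, R₀ ≤ R → |(∫ y, h y * (cutoff R y * β y) ∂ν) - I| ≤
      (8 * K * A * C) / R := by
    intro R hR
    have hR1 : 1 ≤ R := hR₀1.trans hR
    have hR0 : 0 < R := by linarith
    have hcd := contDiff_cutoff R
    have hdc := hcd.differentiable (by simp)
    have c1 := continuous_pd₁ hcd
    have c2 := continuous_pd₂ hcd
    have cα₁ := continuous_pd₁ hα
    have cα₂ := continuous_pd₂ hα
    have cβ₁ := continuous_pd₁ hβ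
    have cβ₂ := continuous_pd₂ hβ
    have cc := hcd.continuous
    have cα := hα.continuous
    have cβ := hβ.continuous
    have hcs := hasCompactSupport_cutoff hR0
    have t1 := hn (fun x => cutoff R x * α x) (hcd.mul hα) hcs.mul_right
    have t2 := hu.eq_of_boundary_zero hd hrep h₁ h₂ (hcd.mul hβ) hcs.mul_right
      (fun r => by rw [h0, mul_zero])
    simp only [pd₁_mul hdc hdα, pd₂_mul hdc hdα] at t1
    simp only [pd₁_mul hdc hdβ, pd₂_mul hdc hdβ] at t2
    have hz : ∀ x, 2 * R < ‖x‖ → cutoff R x = 0 ∧ pd₁ (cutoff R) x = 0 ∧ pd₂ (cutoff R) x = 0 :=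
      fun x hx => ⟨cutoff_eq_zero hR0 hx, pd_cutoff_eq_zero hR0 (Or.inr hx)⟩
    have h2R : 1 ≤ 2 * R := by linarith
    have i1 : IntegrableOn (fun x => (u x).1 * (pd₁ (cutoff R) x * α x + cutoff R x * pd₁ α x))
        halfPlane := h₁.integrableOn_mul (by fun_prop) h2R fun x hx => by
      rw [(hz x hx).1, (hz x hx).2.1]; ring
    have i2 : IntegrableOn (fun x => (u x).2 * (pd₂ (cutoff R) x * α x + cutoff R x * pd₂ α x))
        halfPlane := h₂.integrableOn_mul (by fun_prop) h2R fun x hx => by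
      rw [(hz x hx).1, (hz x hx).2.2]; ring
    have i3 : IntegrableOn (fun x => (u x).1 * (pd₂ (cutoff R) x * β x + cutoff R x * pd₂ β x))
        halfPlane := h₁.integrableOn_mul (by fun_prop) h2R fun x hx => by
      rw [(hz x hx).1, (hz x hx).2.2]; ring
    have i4 : IntegrableOn (fun x => (u x).2 * (pd₁ (cutoff R) x * β x + cutoff R x * pd₁ β x))
        halfPlane := h₂.integrableOn_mul (by fun_prop) h2R fun x hx => by
      rw [(hz x hx).1, (hz x hx).2.1]; ring
    have ip : IntegrableOn (fun x => (u x).1 * p x) halfPlane :=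
      h₁.integrableOn_mul cp hR₀1 zp
    have iq : IntegrableOn (fun x => (u x).2 * q x) halfPlane :=
      h₂.integrableOn_mul cq hR₀1 zq
    set e : ℝ × ℝ → ℝ := fun x =>
      (u x).1 * (pd₁ (cutoff R) x * α x + pd₂ (cutoff R) x * β x) +
        (u x).2 * (pd₂ (cutoff R) x * α x - pd₁ (cutoff R) x * β x) with he
    have hsum : (∫ y, h y * (cutoff R y * β y) ∂ν) - I = ∫ x in halfPlane, e x := by
      have i12 : IntegrableOn (fun x => (u x).1 * (pd₁ (cutoff R) x * α x + cutoff R x * pd₁ α x) +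
        (u x).2 * (pd₂ (cutoff R) x * α x + cutoff R x * pd₂ α x)) halfPlane := i1.add i2
      have i34 : IntegrableOn (fun x => (u x).1 * (pd₂ (cutoff R) x * β x + cutoff R x * pd₂ β x) -
        (u x).2 * (pd₁ (cutoff R) x * β x + cutoff R x * pd₁ β x)) halfPlane := i3.sub i4
      have ipq : IntegrableOn (fun x => (u x).1 * p x + (u x).2 * q x) halfPlane := ip.add iq
      have i1234 : IntegrableOn (fun x =>
        ((u x).1 * (pd₂ (cutoff R) x * β x + cutoff R x * pd₂ β x) -
        (u x).2 * (pd₁ (cutoff R) x * β x + cutoff R x * pd₁ β x)) +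
        ((u x).1 * (pd₁ (cutoff R) x * α x + cutoff R x * pd₁ α x) +
        (u x).2 * (pd₂ (cutoff R) x * α x + cutoff R x * pd₂ α x))) halfPlane := i34.add i12
      rw [← t2, ← add_zero (∫ x in halfPlane, _), ← t1, ← integral_add i34 i12, hI,
        ← integral_sub i1234 ipq]
      congr 1; ext x
      have hη : cutoff R x * p x = p x ∧ cutoff R x * q x = q x := by
        rcases le_or_gt ‖x‖ R with hx | hx
        · rw [cutoff_eq_one hR0 hx]; simp
        · rw [zp x (hR.trans_lt hx), zq x (hR.trans_lt hx)]; simp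
      have e1 : (u x).1 * p x = (u x).1 * (cutoff R x * (pd₁ α x + pd₂ β x)) := by
        rw [hp, hη.1]
      have e2 : (u x).2 * q x = (u x).2 * (cutoff R x * (pd₂ α x - pd₁ β x)) := by
        rw [hq, hη.2]
      simp only [he]
      rw [e1, e2]
      ring
    have hz' : ∀ x, 2 * R < ‖x‖ → e x = 0 := fun x hx => by
      simp only [he]
      rw [(hz x hx).2.1, (hz x hx).2.2]; ring
    have hb : ∀ {γ : ℝ × ℝ → ℝ}, (∀ x, |γ x| * (1 + ‖x‖) ≤ A) → ∀ x,
        |pd₁ (cutoff R) x * γ x| ≤ K * A / R ^ 2 ∧ |pd₂ (cutoff R) x * γ x| ≤ K * A / R ^ 2 := by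
      intro γ hγ x
      have hnn : 0 ≤ K * A / R ^ 2 := by positivity
      rcases lt_or_ge ‖x‖ R with hx | hx
      · have := pd_cutoff_eq_zero hR0 (Or.inl hx)
        rw [this.1, this.2]
        simpa using hnn
      · have hγx : |γ x| ≤ A / R := by
          rw [le_div_iff₀ hR0]
          exact (mul_le_mul_of_nonneg_left (by linarith) (abs_nonneg _)).trans (hγ x)
        have hval : K * A / R ^ 2 = K / R * (A / R) := by field_simp
        rw [hval, abs_mul, abs_mul]
        have := hK R hR0 x
        exact ⟨mul_le_mul this.1 hγx (abs_nonneg _) (by positivity),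
          mul_le_mul this.2 hγx (abs_nonneg _) (by positivity)⟩
    have g1 := h₁ (2 * R) h2R
    have g2 := h₂ (2 * R) h2R
    rw [hsum, setIntegral_halfPlane_eq hz']
    calc |∫ x in halfPlane ∩ Metric.closedBall 0 (2 * R), e x|
        ≤ ∫ x in halfPlane ∩ Metric.closedBall 0 (2 * R),
          (|(u x).1| * (2 * (K * A / R ^ 2)) + |(u x).2| * (2 * (K * A / R ^ 2))) := by
          rw [← Real.norm_eq_abs]
          refine norm_integral_le_of_norm_le
            ((g1.1.abs.mul_const _).add (g2.1.abs.mul_const _))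
            (Eventually.of_forall fun x => ?_)
          rw [Real.norm_eq_abs]
          refine (abs_add_le _ _).trans (add_le_add ?_ ?_)
          · rw [abs_mul]
            gcongr
            exact (abs_add_le _ _).trans (by linarith [(hb bα x).1, (hb bβ x).2])
          · rw [abs_mul]
            gcongr
            exact (abs_sub _ _).trans (by linarith [(hb bα x).2, (hb bβ x).1])
      _ ≤ C * (2 * R) * (2 * (K * A / R ^ 2)) + C * (2 * R) * (2 * (K * A / R ^ 2)) := by
          rw [integral_add (g1.1.abs.mul_const _) (g2.1.abs.mul_const _), integral_mul_const,
            integral_mul_const]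
          gcongr
          exacts [g1.2, g2.2]
      _ = (8 * K * A * C) / R := by
          field_simp
          ring
  have hlim : Tendsto (fun n : ℕ => ∫ y, h y * (cutoff n y * β y) ∂ν) atTop
      (𝓝 (∫ y, h y * β y ∂ν)) := by
    refine tendsto_integral_of_dominated_convergence (fun _ => A) (fun n => ?_)
      (integrable_const _) (fun n => Eventually.of_forall fun y => ?_)
      (Eventually.of_forall fun y => ?_)
    · exact hd.measurable.aestronglyMeasurable.mul
        ((contDiff_cutoff n).continuous.mul hβ.continuous).aestronglyMeasurable
    · rw [Real.norm_eq_abs, abs_mul, abs_mul, ← mul_assoc]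
      have h3 := mul_le_one₀ (hd.le_one y) (abs_nonneg _) (abs_cutoff_le n y)
      have h4 : |β y| ≤ A :=
        le_trans (le_mul_of_one_le_right (abs_nonneg _) (by linarith [norm_nonneg y])) (bβ y)
      exact (mul_le_of_le_one_left (abs_nonneg _) h3).trans h4
    · refine tendsto_const_nhds.congr' ?_
      filter_upwards [eventually_ge_atTop (max 1 ⌈‖y‖⌉₊)] with n hn
      have hn1 : (1 : ℝ) ≤ n := by exact_mod_cast (le_max_left _ _).trans hn
      have hn2 : ‖y‖ ≤ n := (Nat.le_ceil _).trans (by exact_mod_cast (le_max_right _ _).trans hn)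
      rw [cutoff_eq_one (by linarith) hn2, one_mul]
  have hlim' : Tendsto (fun n : ℕ => ∫ y, h y * (cutoff n y * β y) ∂ν) atTop (𝓝 I) := by
    rw [tendsto_iff_norm_sub_tendsto_zero]
    refine squeeze_zero' (Eventually.of_forall fun n => norm_nonneg _) ?_
      (tendsto_const_div_atTop_nhds_zero_nat (8 * K * A * C))
    filter_upwards [eventually_ge_atTop ⌈R₀⌉₊] with n hn
    exact key n ((Nat.le_ceil _).trans (by exact_mod_cast hn))
  exact tendsto_nhds_unique hlim' hlim

/-! ### Recovery of a field from its vorticity -/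

theorem integral_comp_reflect (f : ℝ × ℝ → ℝ) : ∫ w, f (reflect w) = ∫ w, f w := by
  have h1 : MeasurePreserving reflect (volume : Measure (ℝ × ℝ)) volume := by
    rw [Measure.volume_eq_prod]
    exact (MeasurePreserving.id volume).prod (Measure.measurePreserving_neg volume)
  have h2 : MeasurableEmbedding reflect := by
    refine ((MeasurableEquiv.refl ℝ).prodCongr (MeasurableEquiv.neg ℝ)).measurableEmbedding
  exact h1.integral_comp h2 f

theorem continuous_reflect : Continuous reflect := by unfold reflect; fun_prop

theorem contDiff_reflect : ContDiff ℝ ∞ reflect := by unfold reflect; fun_prop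

theorem reflect_reflect (w : ℝ × ℝ) : reflect (reflect w) = w := by simp [reflect]

theorem hasCompactSupport_comp_reflect {χ : ℝ × ℝ → ℝ} (hc : HasCompactSupport χ) :
    HasCompactSupport fun w => χ (reflect w) :=
  hc.comp_homeomorph (⟨⟨reflect, reflect, reflect_reflect, reflect_reflect⟩,
    continuous_reflect, continuous_reflect⟩ : (ℝ × ℝ) ≃ₜ (ℝ × ℝ))

/-- The even (`σ = 1`) or odd (`σ = -1`) extension of a function on the half plane. -/
def reflectExt (σ : ℝ) (χ : ℝ × ℝ → ℝ) (w : ℝ × ℝ) : ℝ := χ w + σ * χ (reflect w)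

section

variable {χ k : ℝ × ℝ → ℝ}

theorem contDiff_reflectExt (σ : ℝ) (hχ : ContDiff ℝ ∞ χ) : ContDiff ℝ ∞ (reflectExt σ χ) :=
  hχ.add (contDiff_const.mul (hχ.comp contDiff_reflect))

theorem hasCompactSupport_reflectExt (σ : ℝ) (hc : HasCompactSupport χ) :
    HasCompactSupport (reflectExt σ χ) :=
  hc.add (hasCompactSupport_comp_reflect hc).mul_left

theorem conv_reflectExt (hk : LocallyIntegrable k) (hχ : ContDiff ℝ ∞ χ)
    (hc : HasCompactSupport χ) (σ : ℝ) (y : ℝ × ℝ) :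
    conv k (reflectExt σ χ) y = ∫ w, χ w * (k (y - w) + σ * k (y - reflect w)) := by
  have i1 := integrable_conv hk hχ.continuous hc y
  have i1' : Integrable fun w => χ w * k (y - w) := by
    refine (i1.comp_sub_left y).congr (Eventually.of_forall fun w => ?_)
    simp only [sub_sub_cancel]
    ring
  have hc' := hasCompactSupport_comp_reflect hc
  have i2 := integrable_conv hk (hχ.comp contDiff_reflect).continuous hc' y
  have i2' : Integrable fun w => χ (reflect w) * k (y - w) := by
    refine (i2.comp_sub_left y).congr (Eventually.of_forall fun w => ?_)
    simp only [sub_sub_cancel, Function.comp_apply]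
    ring
  have i3 : Integrable fun w => χ w * k (y - reflect w) := by
    have h1 : MeasurePreserving reflect (volume : Measure (ℝ × ℝ)) volume := by
      rw [Measure.volume_eq_prod]
      exact (MeasurePreserving.id volume).prod (Measure.measurePreserving_neg volume)
    have := h1.integrable_comp_of_integrable i2'
    refine this.congr (Eventually.of_forall fun w => ?_)
    simp [Function.comp_apply, reflect_reflect]
  have e1 : conv k (reflectExt σ χ) y =
      ∫ w, (χ w * k (y - w) + σ * (χ (reflect w) * k (y - w))) := by
    rw [conv, ← integral_sub_left_eq_self _ volume y]
    congr 1; ext w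
    simp only [sub_sub_cancel, reflectExt]
    ring
  have e2 : ∫ w, χ (reflect w) * k (y - w) = ∫ w, χ w * k (y - reflect w) := by
    rw [← integral_comp_reflect]
    simp_rw [reflect_reflect]
  rw [e1, integral_add i1' (i2'.const_mul σ), integral_const_mul, e2, ← integral_const_mul,
    ← integral_add i1' (i3.const_mul σ)]
  congr 1; ext w; ring

theorem conv_newton₂_reflectExt (hχ : ContDiff ℝ ∞ χ) (hc : HasCompactSupport χ) (y : ℝ × ℝ) :
    conv newton₂ (reflectExt 1 χ) y = ∫ w, χ w * velKer₁ w y := by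
  rw [conv_reflectExt locallyIntegrable_newton₂ hχ hc]
  congr 1; ext w
  simp only [newton₂, velKer₁, reflect, Prod.fst_sub, Prod.snd_sub, sub_neg_eq_add]
  rw [← poissonKernel_even (y.2 - w.2), ← poissonKernel_even (y.2 + w.2), neg_sub, add_comm y.2]
  ring

theorem conv_newton₁_reflectExt (hχ : ContDiff ℝ ∞ χ) (hc : HasCompactSupport χ) (y : ℝ × ℝ) :
    -conv newton₁ (reflectExt (-1) χ) y = ∫ w, χ w * velKer₂ w y := by
  rw [conv_reflectExt locallyIntegrable_newton₁ hχ hc, ← integral_neg]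
  congr 1; ext w
  simp only [newton₁, velKer₂, reflect, Prod.fst_sub, Prod.snd_sub, sub_neg_eq_add]
  rw [← neg_sub w.1 y.1, conjPoisson_odd, conjPoisson_odd, ← neg_sub w.2 y.2, conjPoisson_neg,
    add_comm y.2]
  ring

end

theorem velKer₁_boundary (w : ℝ × ℝ) (r : ℝ) : velKer₁ w (r, 0) = 0 := by
  simp [velKer₁, poissonKernel_neg]

theorem velKer₂_boundary (w : ℝ × ℝ) (r : ℝ) : velKer₂ w (r, 0) = 0 := by
  simp [velKer₂]

theorem integral_mul_vel_swap (hd : IsDensity ν h) {k : (ℝ × ℝ) → (ℝ × ℝ) → ℝ}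
    {χ : ℝ × ℝ → ℝ} (hs : tsupport χ ⊆ halfPlane)
    (hi : Integrable (fun p : (ℝ × ℝ) × (ℝ × ℝ) => χ p.1 * k p.1 p.2)
      ((volume.restrict halfPlane).prod ν)) :
    ∫ y, h y * (∫ w, χ w * k w y) ∂ν = ∫ w in halfPlane, χ w * ∫ y, h y * k w y ∂ν := by
  have e1 : ∀ w, χ w * ∫ y, h y * k w y ∂ν = ∫ y, h y * (χ w * k w y) ∂ν := fun w => by
    rw [← integral_const_mul]
    congr 1; ext y; ring
  simp_rw [e1]
  rw [integral_integral_swap (hd.integrable_mul hi)]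
  congr 1; ext y
  rw [integral_const_mul, setIntegral_eq_integral_of_forall_compl_eq_zero]
  intro w hw
  rw [image_eq_zero_of_notMem_tsupport (fun H => hw (hs H)), zero_mul]

theorem integrable_test_mul_velKer {χ : ℝ × ℝ → ℝ} (hχ : ContDiff ℝ ∞ χ)
    (hc : HasCompactSupport χ) :
    Integrable (fun p : (ℝ × ℝ) × (ℝ × ℝ) => χ p.1 * velKer₁ p.1 p.2)
      ((volume.restrict halfPlane).prod ν) ∧
    Integrable (fun p : (ℝ × ℝ) × (ℝ × ℝ) => χ p.1 * velKer₂ p.1 p.2)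
      ((volume.restrict halfPlane).prod ν) := by
  obtain ⟨M, hM0, hM⟩ := exists_bound_of_hasCompactSupport hχ.continuous hc
  obtain ⟨R, hR, hs⟩ := exists_support_closedBall hc
  set w : ℝ → ℝ := (Icc (-R) R).indicator fun _ => 1 with hw
  have hwm : Measurable w := measurable_const.indicator measurableSet_Icc
  have hwi : Integrable w := by
    rw [hw, integrable_indicator_iff measurableSet_Icc]
    exact integrableOn_const (by simp)
  have hw0 : ∀ r, 0 ≤ w r := fun r => indicator_nonneg (fun _ _ => zero_le_one) r
  have hw1 : ∀ r, |w r| ≤ 1 := fun r => by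
    rw [abs_of_nonneg (hw0 r)]
    exact indicator_le_self' (fun _ _ => zero_le_one) r
  have hle : ∀ z : ℝ × ℝ, |χ z| ≤ M * w z.1 * w z.2 := fun z => by
    rcases le_or_gt ‖z‖ R with hz | hz
    · have h1 : z.1 ∈ Icc (-R) R := abs_le.1 ((norm_fst_le z).trans hz)
      have h2 : z.2 ∈ Icc (-R) R := abs_le.1 ((norm_snd_le z).trans hz)
      rw [hw, indicator_of_mem h1, indicator_of_mem h2]
      simpa using hM z
    · rw [image_eq_zero_of_notMem_tsupport (hs z hz), abs_zero]
      have := hw0 z.1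
      have := hw0 z.2
      positivity
  have hχm : Measurable χ := hχ.continuous.measurable
  refine ⟨integrable_mul_velKer₁ (v := fun s => M * w s) hχm (fun z _ => ?_)
      (hwi.const_mul M).integrableOn,
    integrable_mul_velKer₂ (w₁ := fun r => M * w r) (w₂ := w) hχm (hwm.const_mul M) hwm hle
      (M₁ := M) (M₂ := 1) (fun r => ?_) hw1 (hwi.const_mul M) hwi⟩
  · refine (hle z).trans ?_
    have := (abs_le.1 (hw1 z.1)).2
    gcongr
    · exact hw0 _
    · exact mul_le_of_le_one_right hM0 this
  · rw [abs_mul, abs_of_nonneg hM0]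
    exact mul_le_of_le_one_right hM0 (hw1 r)

theorem HasLinearGrowth.locallyIntegrableOn {f : ℝ × ℝ → ℝ} (hf : HasLinearGrowth f C) :
    LocallyIntegrableOn f halfPlane := by
  rw [locallyIntegrableOn_iff isOpen_halfPlane.isLocallyClosed]
  intro K hK hKc
  obtain ⟨R, hR⟩ := hKc.isBounded.subset_closedBall 0
  exact (hf (max R 1) (le_max_right _ _)).1.mono_set fun z hz =>
    ⟨hK hz, Metric.closedBall_subset_closedBall (le_max_left _ _) (hR hz)⟩

theorem locallyIntegrableOn_of_weight {f w : ℝ × ℝ → ℝ} (hw : Continuous w) (hw0 : ∀ z, w z ≠ 0)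
    (hf : IntegrableOn (fun z => w z * f z) halfPlane) : LocallyIntegrableOn f halfPlane := by
  rw [locallyIntegrableOn_iff isOpen_halfPlane.isLocallyClosed]
  intro K hK hKc
  have h1 := (hf.mono_set hK).continuousOn_mul (hw.inv₀ hw0).continuousOn hKc
  refine h1.congr (Eventually.of_forall fun z => ?_)
  exact inv_mul_cancel_left₀ (hw0 z) (f z)

theorem continuous_gaussWeight_mul :
    Continuous fun z : ℝ × ℝ => gaussWeight 1 z.1 * gaussWeight 1 z.2 := by
  unfold gaussWeight; fun_prop

theorem locallyIntegrableOn_vel (hd : IsDensity ν h) :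
    LocallyIntegrableOn (vel₁ ν h) halfPlane ∧ LocallyIntegrableOn (vel₂ ν h) halfPlane := by
  have hg := integrable_gaussWeight one_pos
  have hb : ∀ r, |gaussWeight 1 r| ≤ 1 := fun r => by
    rw [abs_of_pos (gaussWeight_pos 1 r)]; exact gaussWeight_le_one one_pos r
  have hle : ∀ z : ℝ × ℝ, |gaussWeight 1 z.1 * gaussWeight 1 z.2| ≤
      gaussWeight 1 z.1 * gaussWeight 1 z.2 := fun z =>
    (abs_of_pos (mul_pos (gaussWeight_pos 1 z.1) (gaussWeight_pos 1 z.2))).le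
  have hne : ∀ z : ℝ × ℝ, gaussWeight 1 z.1 * gaussWeight 1 z.2 ≠ 0 := fun z =>
    (mul_pos (gaussWeight_pos 1 z.1) (gaussWeight_pos 1 z.2)).ne'
  refine ⟨locallyIntegrableOn_of_weight continuous_gaussWeight_mul hne
      (integrableOn_mul_vel₁ hd (v := gaussWeight 1) (by fun_prop) (fun z _ => ?_)
        hg.integrableOn),
    locallyIntegrableOn_of_weight continuous_gaussWeight_mul hne
      (integrableOn_mul_vel₂ hd (by fun_prop) (by fun_prop) (by fun_prop) hle hb hb hg hg)⟩
  refine (hle z).trans (mul_le_of_le_one_left (gaussWeight_pos 1 z.2).le ?_)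
  exact gaussWeight_le_one one_pos _

theorem integrable_mul_test {f χ : ℝ × ℝ → ℝ} (hf : LocallyIntegrableOn f halfPlane)
    (hχ : Continuous χ) (hc : HasCompactSupport χ) (hs : tsupport χ ⊆ halfPlane) :
    Integrable fun w => f w * χ w := by
  have h1 := (hf.integrableOn_compact_subset hs hc.isCompact).mul_continuousOn
    hχ.continuousOn hc.isCompact
  refine (integrableOn_iff_integrable_of_support_subset (s := tsupport χ) fun w hw => ?_).1 h1
  exact subset_tsupport _ (right_ne_zero_of_mul hw)

theorem ae_eq_of_integral_test_eq {f g : ℝ × ℝ → ℝ}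
    (hf : LocallyIntegrableOn f halfPlane) (hg : LocallyIntegrableOn g halfPlane)
    (h : ∀ χ : ℝ × ℝ → ℝ, ContDiff ℝ ∞ χ → HasCompactSupport χ → tsupport χ ⊆ halfPlane →
      ∫ w in halfPlane, f w * χ w = ∫ w in halfPlane, χ w * g w) :
    ∀ᵐ z ∂(volume : Measure (ℝ × ℝ)).restrict halfPlane, f z = g z := by
  have := isOpen_halfPlane.ae_eq_zero_of_integral_contDiff_smul_eq_zero (hf.sub hg)
    fun χ hχ hc hs => ?_
  · rw [ae_restrict_iff' measurableSet_halfPlane]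
    filter_upwards [this] with z hz hz'
    have := hz hz'
    simp only [Pi.sub_apply] at this
    linarith
  · have i1 := integrable_mul_test hf hχ.continuous hc hs
    have i2 := integrable_mul_test hg hχ.continuous hc hs
    have e : ∀ w, χ w • (f - g) w = f w * χ w - g w * χ w := fun w => by
      simp only [smul_eq_mul, Pi.sub_apply]; ring
    have hz : ∀ w, w ∉ halfPlane → f w * χ w - g w * χ w = 0 := fun w hw => by
      rw [image_eq_zero_of_notMem_tsupport (fun H => hw (hs H))]; ring
    simp_rw [e]
    rw [← setIntegral_eq_integral_of_forall_compl_eq_zero hz,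
      integral_sub i1.integrableOn i2.integrableOn, h χ hχ hc hs, sub_eq_zero]
    congr 1; ext w; ring

theorem reflectExt_of_mem (σ : ℝ) {χ : ℝ × ℝ → ℝ} (hs : tsupport χ ⊆ halfPlane) {w : ℝ × ℝ}
    (hw : w ∈ halfPlane) : reflectExt σ χ w = χ w := by
  have : reflect w ∉ tsupport χ := fun H => by
    have h1 : 0 < -w.2 := hs H
    have h2 : 0 < w.2 := hw
    linarith
  rw [reflectExt, image_eq_zero_of_notMem_tsupport this, mul_zero, add_zero]

/-- A solenoidal field in weak `L²` is given by its vorticity through the Biot-Savart law. -/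
theorem ae_eq_vel (hd : IsDensity ν h)
    (hrep : ∀ f : ℝ × ℝ → ℝ, Integrable f ν → MIntegrable μ f ∧
      mIntegral μ f = ∫ y, h y * f y ∂ν)
    (hm : MemWeakL2Solenoidal u) (hu : HasVorticity u μ) :
    (∀ᵐ z ∂(volume : Measure (ℝ × ℝ)).restrict halfPlane, (u z).1 = vel₁ ν h z) ∧
    ∀ᵐ z ∂(volume : Measure (ℝ × ℝ)).restrict halfPlane, (u z).2 = vel₂ ν h z := by
  obtain ⟨C, hC0, h₁, h₂⟩ := hm.memWeakL2.exists_hasLinearGrowth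
  obtain ⟨l₁, l₂⟩ := locallyIntegrableOn_vel hd
  have L₁ := locallyIntegrable_newton₁
  have L₂ := locallyIntegrable_newton₂
  refine ⟨ae_eq_of_integral_test_eq h₁.locallyIntegrableOn l₁ fun χ hχ hc hs => ?_,
    ae_eq_of_integral_test_eq h₂.locallyIntegrableOn l₂ fun χ hχ hc hs => ?_⟩
  · have hX := contDiff_reflectExt 1 hχ
    have hXc := hasCompactSupport_reflectExt 1 hc
    obtain ⟨A₁, hA₁⟩ := exists_abs_conv_le L₁ abs_newton₁_le hX hXc
    obtain ⟨A₂, hA₂⟩ := exists_abs_conv_le L₂ abs_newton₂_le hX hXc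
    have key := integral_mul_div_add_mul_curl hd hrep hm.normalTrace hu h₁ h₂
      (p := reflectExt 1 χ) (q := fun _ => 0) (A := max A₁ A₂)
      (contDiff_conv L₁ hX hXc) (contDiff_conv L₂ hX hXc)
      (fun r => by rw [conv_newton₂_reflectExt hχ hc]; simp [velKer₁_boundary])
      (fun x => (hA₁ x).trans (le_max_left _ _)) (fun x => (hA₂ x).trans (le_max_right _ _))
      (fun x => by rw [pd₁_conv L₁ hX hXc, pd₂_conv L₂ hX hXc, conv_newton_div hX hXc])
      (fun x => by rw [pd₂_conv L₁ hX hXc, pd₁_conv L₂ hX hXc, conv_newton_curl hX hXc])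
      hXc HasCompactSupport.zero
    simp_rw [conv_newton₂_reflectExt hχ hc] at key
    rw [integral_mul_vel_swap hd hs (integrable_test_mul_velKer hχ hc).1] at key
    refine Eq.trans (setIntegral_congr_fun measurableSet_halfPlane fun w hw => ?_) key
    simp [reflectExt_of_mem 1 hs hw]
  · have hX := contDiff_reflectExt (-1) hχ
    have hXc := hasCompactSupport_reflectExt (-1) hc
    obtain ⟨A₁, hA₁⟩ := exists_abs_conv_le L₁ abs_newton₁_le hX hXc
    obtain ⟨A₂, hA₂⟩ := exists_abs_conv_le L₂ abs_newton₂_le hX hXc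
    have n₁ : ∀ f : ℝ × ℝ → ℝ, ∀ x, pd₁ (fun x => -f x) x = -pd₁ f x := fun f x => by simp [pd₁]
    have n₂ : ∀ f : ℝ × ℝ → ℝ, ∀ x, pd₂ (fun x => -f x) x = -pd₂ f x := fun f x => by simp [pd₂]
    have key := integral_mul_div_add_mul_curl hd hrep hm.normalTrace hu h₁ h₂
      (α := conv newton₂ (reflectExt (-1) χ)) (β := fun x => -conv newton₁ (reflectExt (-1) χ) x)
      (p := fun _ => 0) (q := reflectExt (-1) χ) (A := max A₁ A₂)
      (contDiff_conv L₂ hX hXc) (contDiff_conv L₁ hX hXc).neg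
      (fun r => by rw [conv_newton₁_reflectExt hχ hc]; simp [velKer₂_boundary])
      (fun x => (hA₂ x).trans (le_max_right _ _))
      (fun x => by rw [abs_neg]; exact (hA₁ x).trans (le_max_left _ _))
      (fun x => by
        rw [n₂, pd₁_conv L₂ hX hXc, pd₂_conv L₁ hX hXc]
        linarith [conv_newton_curl hX hXc x])
      (fun x => by
        rw [n₁, pd₂_conv L₂ hX hXc, pd₁_conv L₁ hX hXc]
        linarith [conv_newton_div hX hXc x])
      HasCompactSupport.zero hXc
    simp_rw [conv_newton₁_reflectExt hχ hc] at key
    rw [integral_mul_vel_swap hd hs (integrable_test_mul_velKer hχ hc).2] at key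
    refine Eq.trans (setIntegral_congr_fun measurableSet_halfPlane fun w hw => ?_) key
    simp [reflectExt_of_mem (-1) hs hw]

end

/-! ### The Dirichlet potential on horizontal lines -/

theorem D_boundary (r : ℝ) (y : ℝ × ℝ) : D (r, 0) y = 0 := by
  simp [D, E, reflect]

@[fun_prop]
theorem measurable_D : Measurable fun p : (ℝ × ℝ) × (ℝ × ℝ) => D p.1 p.2 := by
  unfold D E reflect
  fun_prop

@[fun_prop]
theorem measurable_D_slice (s : ℝ) : Measurable fun p : ℝ × (ℝ × ℝ) => D (p.1, s) p.2 :=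
  measurable_D.comp (g := fun p : (ℝ × ℝ) × (ℝ × ℝ) => D p.1 p.2)
    (f := fun p : ℝ × (ℝ × ℝ) => ((p.1, s), p.2)) (by fun_prop)

@[fun_prop]
theorem measurable_velKer₁_triple :
    Measurable fun p : (ℝ × (ℝ × ℝ)) × ℝ => velKer₁ (p.2, p.1.1) p.1.2 :=
  measurable_velKer₁.comp (g := fun p : (ℝ × ℝ) × (ℝ × ℝ) => velKer₁ p.1 p.2)
    (f := fun p : (ℝ × (ℝ × ℝ)) × ℝ => ((p.2, p.1.1), p.1.2)) (by fun_prop)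

theorem continuous_velKer₁_vertical {r : ℝ} {y : ℝ × ℝ} (hr : r ≠ y.1) :
    Continuous fun σ => velKer₁ (r, σ) y := by
  have hr' : r - y.1 ≠ 0 := sub_ne_zero.2 hr
  have hpi := Real.pi_pos
  unfold velKer₁ poissonKernel
  refine continuous_const.mul (Continuous.add ?_ ?_)
  · exact Continuous.div (by fun_prop) (by fun_prop) fun σ => by positivity
  · exact Continuous.div (by fun_prop) (by fun_prop) fun σ => by positivity

theorem D_eq_integral {r s : ℝ} {y : ℝ × ℝ} (hr : r ≠ y.1) (hs : 0 ≤ s) :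
    D (r, s) y = ∫ σ in Ioo 0 s, velKer₁ (r, σ) y := by
  have h := intervalIntegral.integral_eq_sub_of_hasDerivAt (a := 0) (b := s)
    (f := fun σ => D (r, σ) y) (f' := fun σ => velKer₁ (r, σ) y)
    (fun σ _ => hasDerivAt_D_snd (z := (r, σ))
      (fun H => hr (congrArg Prod.fst H)) (fun H => hr (congrArg Prod.fst H)))
    ((continuous_velKer₁_vertical hr).intervalIntegrable 0 s)
  rw [D_boundary, sub_zero, intervalIntegral.integral_of_le hs, integral_Ioc_eq_integral_Ioo] at h
  exact h.symm

theorem ae_ne_real (a : ℝ) : ∀ᵐ r : ℝ, r ≠ a := Measure.ae_ne volume a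

theorem lintegral_D_le {s : ℝ} (hs : 0 ≤ s) (y : ℝ × ℝ) :
    ∫⁻ r, ‖D (r, s) y‖ₑ ≤ ENNReal.ofReal s := by
  have hm : Measurable fun p : ℝ × ℝ => ‖velKer₁ p y‖ₑ :=
    (measurable_velKer₁.comp (g := fun p : (ℝ × ℝ) × (ℝ × ℝ) => velKer₁ p.1 p.2)
      (f := fun p : ℝ × ℝ => (p, y)) (by fun_prop)).enorm
  calc ∫⁻ r, ‖D (r, s) y‖ₑ ≤ ∫⁻ r, ∫⁻ σ in Ioo 0 s, ‖velKer₁ (r, σ) y‖ₑ := by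
        refine lintegral_mono_ae ?_
        filter_upwards [ae_ne_real y.1] with r hr
        rw [D_eq_integral hr hs]
        exact enorm_integral_le_lintegral_enorm _
    _ = ∫⁻ σ in Ioo 0 s, ∫⁻ r, ‖velKer₁ (r, σ) y‖ₑ :=
        lintegral_lintegral_swap (f := fun r σ => ‖velKer₁ (r, σ) y‖ₑ) hm.aemeasurable
    _ ≤ ∫⁻ _ in Ioo 0 s, 1 := lintegral_mono fun σ => lintegral_velKer₁_le σ y
    _ = ENNReal.ofReal s := by simp

section

variable {φ : ℝ → ℂ} {M : ℝ}

theorem integrable_velKer₁_line (s : ℝ) (y : ℝ × ℝ) : Integrable fun r => velKer₁ (r, s) y :=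
  ⟨(((measurable_velKer₁_slice s).comp measurable_prodMk_right :
    Measurable fun r => velKer₁ (r, s) y)).aestronglyMeasurable,
    (lintegral_velKer₁_le s y).trans_lt ENNReal.one_lt_top⟩

theorem norm_integral_mul_velKer₁_le (hM : ∀ r, ‖φ r‖ ≤ M) (s : ℝ) (y : ℝ × ℝ) :
    ‖∫ r, φ r * (velKer₁ (r, s) y : ℂ)‖ ≤ M := by
  have hM0 : 0 ≤ M := (norm_nonneg _).trans (hM 0)
  have hi := integrable_velKer₁_line s y
  calc ‖∫ r, φ r * (velKer₁ (r, s) y : ℂ)‖ ≤ ∫ r, M * ‖velKer₁ (r, s) y‖ := by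
        refine norm_integral_le_of_norm_le (hi.norm.const_mul M) (Eventually.of_forall fun r => ?_)
        rw [norm_mul, Complex.norm_real]
        exact mul_le_mul_of_nonneg_right (hM r) (norm_nonneg _)
    _ = M * (∫⁻ r, ‖velKer₁ (r, s) y‖ₑ).toReal := by
        rw [integral_const_mul, integral_norm_eq_lintegral_enorm hi.1]
    _ ≤ M * 1 := by
        gcongr
        exact ENNReal.toReal_le_of_le_ofReal zero_le_one
          (by simpa using lintegral_velKer₁_le s y)
    _ = M := mul_one M

theorem measurable_integral_mul_velKer₁ (hφ : Continuous φ) :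
    Measurable fun p : ℝ × (ℝ × ℝ) => ∫ r, φ r * (velKer₁ (r, p.1) p.2 : ℂ) := by
  have hm : Measurable fun p : (ℝ × (ℝ × ℝ)) × ℝ => φ p.2 * (velKer₁ (p.2, p.1.1) p.1.2 : ℂ) :=
    (hφ.measurable.comp measurable_snd).mul
      (Complex.measurable_ofReal.comp measurable_velKer₁_triple)
  exact hm.stronglyMeasurable.integral_prod_right'.measurable

theorem integral_mul_D (hφ : Continuous φ) (hM : ∀ r, ‖φ r‖ ≤ M) {s : ℝ} (hs : 0 ≤ s)
    (y : ℝ × ℝ) :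
    ∫ r, φ r * (D (r, s) y : ℂ) = ∫ σ in Ioo 0 s, ∫ r, φ r * (velKer₁ (r, σ) y : ℂ) := by
  have hm : Measurable fun p : ℝ × ℝ => velKer₁ p y :=
    measurable_velKer₁.comp (g := fun p : (ℝ × ℝ) × (ℝ × ℝ) => velKer₁ p.1 p.2)
      (f := fun p : ℝ × ℝ => (p, y)) (by fun_prop)
  have hi : Integrable (fun p : ℝ × ℝ => velKer₁ p y)
      ((volume : Measure ℝ).prod (volume.restrict (Ioo 0 s))) :=
    integrable_prod_of_lintegral_le hm.aestronglyMeasurable ENNReal.one_ne_top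
      (Eventually.of_forall fun σ => lintegral_velKer₁_le σ y)
  have hi' : Integrable (fun p : ℝ × ℝ => φ p.1 * (velKer₁ p y : ℂ))
      ((volume : Measure ℝ).prod (volume.restrict (Ioo 0 s))) :=
    hi.ofReal.bdd_mul (hφ.comp continuous_fst).aestronglyMeasurable
      (Eventually.of_forall fun p => hM p.1)
  have e : ∀ᵐ r : ℝ, φ r * (D (r, s) y : ℂ) = ∫ σ in Ioo 0 s, φ r * (velKer₁ (r, σ) y : ℂ) := by
    filter_upwards [ae_ne_real y.1] with r hr
    rw [D_eq_integral hr hs, integral_const_mul, integral_complex_ofReal]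
  rw [integral_congr_ae e]
  exact integral_integral_swap (f := fun r σ => φ r * (velKer₁ (r, σ) y : ℂ)) hi'

variable {ν : Measure (ℝ × ℝ)} [IsFiniteMeasure ν] {h : ℝ × ℝ → ℝ}

/-- The Dirichlet potential of a density. -/
def pot (ν : Measure (ℝ × ℝ)) (h : ℝ × ℝ → ℝ) (z : ℝ × ℝ) : ℝ := ∫ y, h y * D z y ∂ν

theorem integrable_D_slice {s : ℝ} (hs : 0 ≤ s) :
    Integrable (fun p : ℝ × (ℝ × ℝ) => D (p.1, s) p.2) (volume.prod ν) :=
  integrable_prod_of_lintegral_le (measurable_D_slice s).aestronglyMeasurable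
    ENNReal.ofReal_ne_top (Eventually.of_forall fun y => lintegral_D_le hs y)

theorem integrable_pot (hd : IsDensity ν h) {s : ℝ} (hs : 0 ≤ s) :
    Integrable fun r => pot ν h (r, s) :=
  (hd.integrable_mul (integrable_D_slice hs)).integral_prod_left

theorem integrable_vel₁_line (hd : IsDensity ν h) (s : ℝ) :
    Integrable fun r => vel₁ ν h (r, s) :=
  (hd.integrable_mul (integrable_velKer₁_slice s)).integral_prod_left

theorem integral_mul_slice (hd : IsDensity ν h) {k : ℝ × (ℝ × ℝ) → ℝ}
    (hk : Integrable k (volume.prod ν)) (hφ : Continuous φ) (hM : ∀ r, ‖φ r‖ ≤ M) :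
    ∫ r, φ r * ((∫ y, h y * k (r, y) ∂ν : ℝ) : ℂ) =
      ∫ y, (h y : ℂ) * (∫ r, φ r * (k (r, y) : ℂ)) ∂ν := by
  have hi : Integrable (fun p : ℝ × (ℝ × ℝ) => φ p.1 * ((h p.2 * k p : ℝ) : ℂ))
      (volume.prod ν) :=
    (hd.integrable_mul hk).ofReal.bdd_mul (hφ.comp continuous_fst).aestronglyMeasurable
      (Eventually.of_forall fun p => hM p.1)
  have e1 : ∀ r, φ r * ((∫ y, h y * k (r, y) ∂ν : ℝ) : ℂ) =
      ∫ y, φ r * ((h y * k (r, y) : ℝ) : ℂ) ∂ν := fun r => by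
    rw [integral_const_mul, integral_complex_ofReal]
  simp_rw [e1]
  rw [integral_integral_swap (f := fun r y => φ r * ((h y * k (r, y) : ℝ) : ℂ)) hi]
  congr 1; ext y
  rw [← integral_const_mul]
  congr 1; ext r
  push_cast
  ring

theorem integral_mul_vel₁ (hd : IsDensity ν h) (hφ : Continuous φ) (hM : ∀ r, ‖φ r‖ ≤ M)
    (s : ℝ) :
    ∫ r, φ r * (vel₁ ν h (r, s) : ℂ) =
      ∫ y, (h y : ℂ) * (∫ r, φ r * (velKer₁ (r, s) y : ℂ)) ∂ν :=
  integral_mul_slice hd (integrable_velKer₁_slice s) hφ hM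

/-- The derivative `∂₂(-Δ_D)⁻¹ω = (Kω)¹`, integrated along vertical lines and tested
tangentially. -/
theorem integral_mul_pot (hd : IsDensity ν h) (hφ : Continuous φ) (hM : ∀ r, ‖φ r‖ ≤ M)
    {s : ℝ} (hs : 0 ≤ s) :
    ∫ r, φ r * (pot ν h (r, s) : ℂ) =
      ∫ σ in Ioo 0 s, ∫ r, φ r * (vel₁ ν h (r, σ) : ℂ) := by
  have hi : Integrable (fun p : ℝ × (ℝ × ℝ) =>
      (h p.2 : ℂ) * ∫ r, φ r * (velKer₁ (r, p.1) p.2 : ℂ))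
      ((volume.restrict (Ioo 0 s)).prod ν) := by
    refine Integrable.of_bound ?_ (1 * M) (Eventually.of_forall fun p => ?_)
    · exact ((Complex.measurable_ofReal.comp (hd.measurable.comp measurable_snd)).mul
        (measurable_integral_mul_velKer₁ hφ)).aestronglyMeasurable
    · rw [norm_mul, Complex.norm_real]
      exact mul_le_mul (hd.le_one _) (norm_integral_mul_velKer₁_le hM _ _) (norm_nonneg _)
        zero_le_one
  have e1 : ∫ r, φ r * (pot ν h (r, s) : ℂ) =
      ∫ y, (h y : ℂ) * (∫ r, φ r * (D (r, s) y : ℂ)) ∂ν :=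
    integral_mul_slice hd (integrable_D_slice hs) hφ hM
  rw [e1]
  simp_rw [integral_mul_vel₁ hd hφ hM]
  rw [integral_integral_swap hi]
  congr 1; ext y
  rw [integral_mul_D hφ hM hs, integral_const_mul]

theorem measurable_integral_mul_vel₁ (hd : IsDensity ν h) (hφ : Continuous φ) :
    Measurable fun s => ∫ r, φ r * (vel₁ ν h (r, s) : ℂ) := by
  have hm : Measurable fun p : ℝ × ℝ => φ p.2 * (vel₁ ν h (p.2, p.1) : ℂ) :=
    (hφ.measurable.comp measurable_snd).mul (Complex.measurable_ofReal.comp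
      ((measurable_vel₁ hd.measurable).comp measurable_swap))
  exact hm.stronglyMeasurable.integral_prod_right'.measurable

theorem norm_integral_mul_vel₁_le (hd : IsDensity ν h) (hφ : Continuous φ)
    (hM : ∀ r, ‖φ r‖ ≤ M) (s : ℝ) :
    ‖∫ r, φ r * (vel₁ ν h (r, s) : ℂ)‖ ≤ M * ν.real univ := by
  rw [integral_mul_vel₁ hd hφ hM]
  refine norm_integral_le_of_norm_le_const (Eventually.of_forall fun y => ?_)
  rw [norm_mul, Complex.norm_real]
  exact (mul_le_mul (hd.le_one _) (norm_integral_mul_velKer₁_le hM _ _) (norm_nonneg _)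
    zero_le_one).trans_eq (one_mul M)

theorem invDirichletLaplacian_ae_eq {μ : SignedMeasure closedHalfPlane}
    (hrep : ∀ f : ℝ × ℝ → ℝ, Integrable f ν → MIntegrable μ f ∧
      mIntegral μ f = ∫ y, h y * f y ∂ν) {s : ℝ} (hs : 0 ≤ s) :
    ∀ᵐ r : ℝ, invDirichletLaplacian μ (r, s) = pot ν h (r, s) := by
  filter_upwards [(integrable_D_slice (ν := ν) hs).prod_right_ae] with r hr
  exact (hrep _ hr).2

end

/-! ### The primitive of an integrable function, tested -/

theorem integral_deriv_mul_primitive {a : ℝ → ℂ} (ham : Measurable a) {B : ℝ}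
    (haB : ∀ s, ‖a s‖ ≤ B) {χ : ℝ → ℝ} (hχ : ContDiff ℝ ∞ χ) (hc : HasCompactSupport χ) :
    ∫ s in Ioi (0 : ℝ), ((deriv χ s : ℝ) : ℂ) * ∫ σ in Ioo 0 s, a σ =
      -∫ s in Ioi (0 : ℝ), (χ s : ℂ) * a s := by
  have hdc : Continuous (deriv χ) := hχ.continuous_deriv (by simp)
  obtain ⟨R, hR⟩ := hc.isCompact.isBounded.subset_closedBall 0
  have hz : ∀ s, R < s → deriv χ s = 0 := fun s hs => by
    refine image_eq_zero_of_notMem_tsupport fun H => ?_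
    have := hR (tsupport_deriv_subset H)
    rw [mem_closedBall_zero_iff, Real.norm_eq_abs] at this
    exact absurd hs (not_lt.2 ((le_abs_self s).trans this))
  set K : ℝ × ℝ → ℂ := fun p => ((deriv χ p.1 : ℝ) : ℂ) * (Ioo 0 p.1).indicator a p.2 with hK
  have hset : MeasurableSet {p : ℝ × ℝ | p.2 ∈ Ioo 0 p.1} :=
    (measurableSet_lt measurable_const measurable_snd).inter
      (measurableSet_lt measurable_snd measurable_fst)
  have hKm : Measurable K := by
    refine (Complex.measurable_ofReal.comp (hdc.measurable.comp measurable_fst)).mul ?_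
    exact (ham.comp measurable_snd).indicator hset
  have hKi : Integrable K ((volume.restrict (Ioi 0)).prod (volume.restrict (Ioi 0))) := by
    obtain ⟨C, hC⟩ := hc.deriv.exists_bound_of_continuous hdc
    have hC0 : 0 ≤ C := (norm_nonneg _).trans (hC 0)
    have hB0 : 0 ≤ B := (norm_nonneg _).trans (haB 0)
    have h1 : IntegrableOn K (Ioc 0 R ×ˢ Ioc 0 R) (volume.prod volume) := by
      refine IntegrableOn.of_bound ?_ hKm.aestronglyMeasurable (C * B)
        (Eventually.of_forall fun p => ?_)
      · rw [Measure.prod_prod]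
        simp only [Real.volume_Ioc]
        finiteness
      · rw [hK, norm_mul, Complex.norm_real]
        refine mul_le_mul (hC _) ((norm_indicator_le_norm_self _ _).trans (haB _)) (norm_nonneg _)
          hC0
    rw [Measure.prod_restrict]
    refine h1.of_forall_sdiff_eq_zero (measurableSet_Ioi.prod measurableSet_Ioi) fun p hp => ?_
    rcases le_or_gt p.1 R with h | h
    · have h2 : p.2 ∉ Ioo 0 p.1 := fun H =>
        hp.2 ⟨⟨hp.1.1, h⟩, ⟨hp.1.2, H.2.le.trans h⟩⟩
      rw [hK]
      simp only
      rw [indicator_of_notMem h2, mul_zero]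
    · rw [hK]
      simp only
      rw [hz _ h, Complex.ofReal_zero, zero_mul]
  have e1 : ∀ s ∈ Ioi (0 : ℝ), ((deriv χ s : ℝ) : ℂ) * ∫ σ in Ioo 0 s, a σ =
      ∫ σ in Ioi (0 : ℝ), K (s, σ) := fun s _ => by
    simp only [hK]
    rw [integral_const_mul, integral_indicator measurableSet_Ioo, Measure.restrict_restrict
      measurableSet_Ioo, inter_eq_left.2 Ioo_subset_Ioi_self]
  have e2 : ∀ σ ∈ Ioi (0 : ℝ), ∫ s in Ioi (0 : ℝ), K (s, σ) = -((χ σ : ℂ) * a σ) := fun σ hσ => by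
    have hσ0 : (0 : ℝ) < σ := hσ
    have h3 : ∀ s ∈ Ioi (0 : ℝ), K (s, σ) =
        (Ioi σ).indicator (fun s => ((deriv χ s : ℝ) : ℂ) * a σ) s := fun s _ => by
      simp only [hK]
      by_cases hs : σ < s
      · rw [indicator_of_mem (show σ ∈ Ioo 0 s from ⟨hσ0, hs⟩), indicator_of_mem (show s ∈ Ioi σ from hs)]
      · rw [indicator_of_notMem (fun H : σ ∈ Ioo 0 s => hs H.2),
          indicator_of_notMem (show s ∉ Ioi σ from hs), mul_zero]
    rw [setIntegral_congr_fun measurableSet_Ioi h3, integral_indicator measurableSet_Ioi,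
      Measure.restrict_restrict measurableSet_Ioi, inter_eq_left.2 (Ioi_subset_Ioi hσ0.le),
      integral_mul_const, integral_complex_ofReal]
    have hd : ∫ s in Ioi σ, deriv χ s = 0 - χ σ := by
      refine integral_Ioi_of_hasDerivAt_of_tendsto'
        (fun s _ => (hχ.differentiable (by simp) s).hasDerivAt)
        (hdc.integrable_of_hasCompactSupport hc.deriv).integrableOn ?_
      refine tendsto_const_nhds.congr' ?_
      filter_upwards [Ioi_mem_atTop R] with s hs
      refine (image_eq_zero_of_notMem_tsupport fun H => ?_).symm
      have := hR H
      rw [mem_closedBall_zero_iff, Real.norm_eq_abs] at this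
      exact absurd (show R < s from hs) (not_lt.2 ((le_abs_self s).trans this))
    rw [hd]
    push_cast
    ring
  rw [setIntegral_congr_fun measurableSet_Ioi e1, integral_integral_swap hKi,
    setIntegral_congr_fun measurableSet_Ioi e2, integral_neg]

/-! ### Tempered distributions given by functions on the line -/

open Classical in
/-- The tempered distribution given by a function in `Lᵖ(ℝ)`. -/
def lpDist (p : ℝ≥0∞) [Fact (1 ≤ p)] (f : ℝ → ℂ) : 𝓢'(ℝ, ℂ) :=
  if h : MemLp f p volume then Lp.toTemperedDistribution (h.toLp f) else 0

theorem lpDist_apply {p : ℝ≥0∞} [Fact (1 ≤ p)] {f : ℝ → ℂ} (h : MemLp f p volume)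
    (φ : 𝓢(ℝ, ℂ)) : lpDist p f φ = ∫ r, φ r * f r := by
  rw [lpDist, dif_pos h, Lp.toTemperedDistribution_apply]
  refine integral_congr_ae ?_
  filter_upwards [h.coeFn_toLp] with r hr
  rw [hr, smul_eq_mul]

theorem schwartz_bounded (φ : 𝓢(ℝ, ℂ)) : ∃ C, ∀ r, ‖φ r‖ ≤ C := by
  obtain ⟨C, hC⟩ := φ.decay 0 0
  exact ⟨C, fun r => by simpa using hC.2 r⟩

theorem represents_lpDist_one {f : ℝ → ℂ} (h : Integrable f) : Represents (lpDist 1 f) f := by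
  intro φ
  obtain ⟨C, hC⟩ := schwartz_bounded φ
  exact ⟨h.bdd_mul φ.continuous.aestronglyMeasurable (Eventually.of_forall hC),
    lpDist_apply (memLp_one_iff_integrable.2 h) φ⟩

theorem Represents.congr_ae {T : 𝓢'(ℝ, ℂ)} {f g : ℝ → ℂ} (h : Represents T f) (e : f =ᵐ[volume] g) :
    Represents T g := by
  intro φ
  have e' : (fun r => φ r * f r) =ᵐ[volume] fun r => φ r * g r := by
    filter_upwards [e] with r hr
    rw [hr]
  exact ⟨(h φ).1.congr e', (h φ).2.trans (integral_congr_ae e')⟩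

section

variable {U : ℝ → ℂ}

theorem continuous_fourier_of_integrable (hU : Integrable U) : Continuous (𝓕 U) :=
  VectorFourier.fourierIntegral_continuous Real.continuous_fourierChar
    (by exact continuous_inner) hU

theorem norm_fourier_le (U : ℝ → ℂ) (ξ : ℝ) : ‖𝓕 U ξ‖ ≤ ∫ r, ‖U r‖ :=
  VectorFourier.norm_fourierIntegral_le_integral_norm _ _ _ _ _

theorem integral_fourier_mul {f : ℝ → ℂ} (hf : Integrable f) (hU : Integrable U) :
    ∫ r, 𝓕 f r * U r = ∫ ξ, f ξ * 𝓕 U ξ := by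
  have := VectorFourier.integral_fourierIntegral_smul_eq_flip (L := innerₗ ℝ)
    Real.continuous_fourierChar continuous_inner hf hU
  rw [flip_innerₗ] at this
  exact this

theorem hasTemperateGrowth_mul_ofReal (c : ℂ) :
    (fun ξ : ℝ => c * (ξ : ℂ)).HasTemperateGrowth := by
  fun_prop

theorem represents_fourier_deriv (hU : Integrable U) :
    Represents (𝓕 (TemperedDistribution.derivCLM ℂ (lpDist 1 U)))
      fun ξ => 2 * Real.pi * Complex.I * ξ * 𝓕 U ξ := by
  intro φ
  set ψ : 𝓢(ℝ, ℂ) := SchwartzMap.smulLeftCLM ℂ (fun ξ : ℝ => (2 * Real.pi * Complex.I) * (ξ : ℂ)) φ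
    with hψ
  have hψa : ∀ ξ, ψ ξ = (2 * Real.pi * Complex.I) * (ξ : ℂ) * φ ξ := fun ξ => by
    rw [hψ, SchwartzMap.smulLeftCLM_apply_apply (hasTemperateGrowth_mul_ofReal _), smul_eq_mul]
  have e : ∀ ξ, ψ ξ * 𝓕 U ξ = φ ξ * (2 * Real.pi * Complex.I * ξ * 𝓕 U ξ) := fun ξ => by
    rw [hψa]; ring
  have hi : Integrable fun ξ => ψ ξ * 𝓕 U ξ :=
    ψ.integrable.mul_bdd (continuous_fourier_of_integrable hU).aestronglyMeasurable
      (Eventually.of_forall (norm_fourier_le U))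
  refine ⟨hi.congr (Eventually.of_forall e), ?_⟩
  rw [TemperedDistribution.fourier_apply, TemperedDistribution.derivCLM_apply_apply,
    lpDist_apply (memLp_one_iff_integrable.2 hU)]
  rw [← integral_congr_ae (Eventually.of_forall e), ← integral_fourier_mul ψ.integrable hU]
  refine integral_congr_ae (Eventually.of_forall fun r => ?_)
  have hφx : Integrable fun x : ℝ => x • φ x := by
    have := (SchwartzMap.smulLeftCLM ℂ (fun ξ : ℝ => (1 : ℂ) * (ξ : ℂ)) φ).integrable (μ := volume)
    refine this.congr (Eventually.of_forall fun ξ => ?_)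
    simp only []
    rw [SchwartzMap.smulLeftCLM_apply_apply (hasTemperateGrowth_mul_ofReal _)]
    simp
  have hd := congrFun (Real.deriv_fourier φ.integrable hφx) r
  have h1 : 𝓕 (ψ : ℝ → ℂ) r = -deriv (𝓕 (φ : ℝ → ℂ)) r := by
    rw [hd, Real.fourier_eq', Real.fourier_eq', ← integral_neg]
    congr 1; ext x
    rw [hψa]
    simp only [smul_eq_mul]
    ring
  simp only [neg_apply, SchwartzMap.derivCLM_apply, SchwartzMap.fourier_coe, h1]

/-- The Hilbert transform of the derivative of an integrable function. -/
def hilbertDeriv (U : ℝ → ℂ) : 𝓢'(ℝ, ℂ) :=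
  𝓕⁻ (TemperedDistribution.smulLeftCLM ℂ (fun ξ : ℝ => (2 * Real.pi : ℂ) * (ξ : ℂ))
    (lpDist ⊤ fun ξ => ((ξ / |ξ| : ℝ) : ℂ) * 𝓕 U ξ))

theorem norm_div_abs_le (ξ : ℝ) : ‖ξ / |ξ|‖ ≤ 1 := by
  rw [Real.norm_eq_abs, abs_div, abs_abs]
  exact div_self_le_one _

theorem memLp_sign_mul_fourier (hU : Integrable U) :
    MemLp (fun ξ : ℝ => ((ξ / |ξ| : ℝ) : ℂ) * 𝓕 U ξ) ⊤ volume := by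
  refine memLp_top_of_bound ?_ (∫ r, ‖U r‖) (Eventually.of_forall fun ξ => ?_)
  · exact ((Complex.measurable_ofReal.comp (by fun_prop)).mul
      (continuous_fourier_of_integrable hU).measurable).aestronglyMeasurable
  · rw [norm_mul, Complex.norm_real]
    calc ‖ξ / |ξ|‖ * ‖𝓕 U ξ‖ ≤ 1 * ∫ r, ‖U r‖ :=
          mul_le_mul (norm_div_abs_le ξ) (norm_fourier_le U ξ) (norm_nonneg _) zero_le_one
      _ = _ := one_mul _

theorem isHilbertTransform_hilbertDeriv (hU : Integrable U) :
    IsHilbertTransform (TemperedDistribution.derivCLM ℂ (lpDist 1 U)) (hilbertDeriv U) := by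
  refine ⟨_, represents_fourier_deriv hU, fun φ => ?_⟩
  set ψ : 𝓢(ℝ, ℂ) := SchwartzMap.smulLeftCLM ℂ (fun ξ : ℝ => (2 * Real.pi : ℂ) * (ξ : ℂ)) φ
    with hψ
  have hm := memLp_sign_mul_fourier hU
  have e : ∀ ξ : ℝ, ψ ξ * (((ξ / |ξ| : ℝ) : ℂ) * 𝓕 U ξ) =
      φ ξ * (-Complex.I * ((ξ / |ξ| : ℝ) : ℂ) * (2 * Real.pi * Complex.I * ξ * 𝓕 U ξ)) := fun ξ => by
    rw [hψ, SchwartzMap.smulLeftCLM_apply_apply (hasTemperateGrowth_mul_ofReal _), smul_eq_mul]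
    linear_combination (((ξ / |ξ| : ℝ) : ℂ) * 𝓕 U ξ * φ ξ * 2 * Real.pi * ξ) * Complex.I_mul_I
  constructor
  · have hi : Integrable fun ξ : ℝ => ψ ξ * (((ξ / |ξ| : ℝ) : ℂ) * 𝓕 U ξ) :=
      memLp_one_iff_integrable.1 (hm.mul (memLp_one_iff_integrable.2 ψ.integrable))
    exact hi.congr (Eventually.of_forall e)
  · rw [hilbertDeriv, FourierTransform.fourier_fourierInv_eq,
      TemperedDistribution.smulLeftCLM_apply_apply, lpDist_apply hm]
    exact integral_congr_ae (Eventually.of_forall e)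

theorem hilbertDeriv_apply (hU : Integrable U) (γ : 𝓢(ℝ, ℂ)) :
    hilbertDeriv U γ =
      ∫ r, 𝓕 (fun ξ : ℝ => ((2 * Real.pi * |ξ| : ℝ) : ℂ) * 𝓕⁻ (γ : ℝ → ℂ) ξ) r * U r := by
  set ψ : 𝓢(ℝ, ℂ) := SchwartzMap.smulLeftCLM ℂ (fun ξ : ℝ => (2 * Real.pi : ℂ) * (ξ : ℂ)) (𝓕⁻ γ)
    with hψ
  have hψa : ∀ ξ : ℝ, ((2 * Real.pi * |ξ| : ℝ) : ℂ) * 𝓕⁻ (γ : ℝ → ℂ) ξ =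
      ψ ξ * ((ξ / |ξ| : ℝ) : ℂ) := fun ξ => by
    have h1 : |ξ| = ξ * (ξ / |ξ|) := by
      rcases eq_or_ne ξ 0 with rfl | h
      · simp
      · rw [mul_div_assoc', eq_div_iff (abs_ne_zero.2 h), abs_mul_abs_self]
    rw [hψ, SchwartzMap.smulLeftCLM_apply_apply (hasTemperateGrowth_mul_ofReal _), smul_eq_mul,
      SchwartzMap.fourierInv_coe]
    nth_rewrite 1 [h1]
    push_cast
    ring
  have hi : Integrable fun ξ : ℝ => ((2 * Real.pi * |ξ| : ℝ) : ℂ) * 𝓕⁻ (γ : ℝ → ℂ) ξ := by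
    simp_rw [hψa]
    refine ψ.integrable.mul_bdd (c := 1) (Complex.measurable_ofReal.comp
      (by fun_prop)).aestronglyMeasurable (Eventually.of_forall fun ξ => ?_)
    rw [Complex.norm_real]
    exact norm_div_abs_le ξ
  rw [integral_fourier_mul hi hU, hilbertDeriv, TemperedDistribution.fourierInv_apply,
    TemperedDistribution.smulLeftCLM_apply_apply, lpDist_apply (memLp_sign_mul_fourier hU)]
  refine integral_congr_ae (Eventually.of_forall fun ξ => ?_)
  simp only [hψa]
  rw [mul_assoc]

end

section

/-! ### The distribution `(H∂₂ - ∂₁)∂₁(-Δ_D)⁻¹ω` -/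

variable {ν : Measure (ℝ × ℝ)} [IsFiniteMeasure ν] {h : ℝ × ℝ → ℝ}

/-- The distribution `(H∂₂ - ∂₁)∂₁(-Δ_D)⁻¹ω` for a density. -/
def sourceDist (ν : Measure (ℝ × ℝ)) (h : ℝ × ℝ → ℝ) : TangentialDistribution := fun s =>
  hilbertDeriv (fun r => (vel₁ ν h (r, s) : ℂ)) -
    TemperedDistribution.derivCLM ℂ (TemperedDistribution.derivCLM ℂ
      (lpDist 1 fun r => (pot ν h (r, s) : ℂ)))

theorem integrable_vel₁_line_complex (hd : IsDensity ν h) (s : ℝ) :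
    Integrable fun r => (vel₁ ν h (r, s) : ℂ) := (integrable_vel₁_line hd s).ofReal

theorem integrable_pot_complex (hd : IsDensity ν h) {s : ℝ} (hs : 0 ≤ s) :
    Integrable fun r => (pot ν h (r, s) : ℂ) := (integrable_pot hd hs).ofReal

theorem isNormalDeriv_pot (hd : IsDensity ν h) :
    TangentialDistribution.IsNormalDeriv
      (TangentialDistribution.tangentialDeriv fun s => lpDist 1 fun r => (pot ν h (r, s) : ℂ))
      fun s => TemperedDistribution.derivCLM ℂ (lpDist 1 fun r => (vel₁ ν h (r, s) : ℂ)) := by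
  intro φ
  set ψ : 𝓢(ℝ, ℂ) := -SchwartzMap.derivCLM ℂ ℂ φ with hψ
  obtain ⟨M, hM⟩ := schwartz_bounded ψ
  set a : ℝ → ℂ := fun s => ∫ r, ψ r * (vel₁ ν h (r, s) : ℂ) with ha
  have ham : Measurable a := measurable_integral_mul_vel₁ hd ψ.continuous
  have haB : ∀ s, ‖a s‖ ≤ M * ν.real univ := norm_integral_mul_vel₁_le hd ψ.continuous hM
  have hG : ∀ s, TemperedDistribution.derivCLM ℂ
      (lpDist 1 fun r => (vel₁ ν h (r, s) : ℂ)) φ = a s := fun s => by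
    rw [TemperedDistribution.derivCLM_apply_apply,
      lpDist_apply (memLp_one_iff_integrable.2 (integrable_vel₁_line_complex hd s))]
  have hF : ∀ s ∈ Ioi (0 : ℝ), TangentialDistribution.tangentialDeriv
      (fun s => lpDist 1 fun r => (pot ν h (r, s) : ℂ)) s φ = ∫ σ in Ioo 0 s, a σ := fun s hs => by
    have hs' : (0 : ℝ) ≤ s := le_of_lt hs
    rw [TangentialDistribution.tangentialDeriv, TemperedDistribution.derivCLM_apply_apply,
      lpDist_apply (memLp_one_iff_integrable.2 (integrable_pot_complex hd hs'))]
    exact integral_mul_pot hd ψ.continuous hM hs'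
  have hai : LocallyIntegrable a := fun s =>
    ⟨Ioo (s - 1) (s + 1), Ioo_mem_nhds (by linarith) (by linarith),
      IntegrableOn.of_bound (by simp) ham.aestronglyMeasurable _ (Eventually.of_forall haB)⟩
  refine ⟨?_, ?_, fun χ hχ hc hs => ?_⟩
  · have hc : Continuous fun s => ∫ σ in (0 : ℝ)..s, a σ :=
      intervalIntegral.continuous_primitive (fun b c =>
        (hai.integrableOn_isCompact isCompact_uIcc).intervalIntegrable) 0
    refine (locallyIntegrableOn_congr ?_).2 (hc.locallyIntegrable.locallyIntegrableOn _)
    filter_upwards [ae_restrict_mem measurableSet_Ioi] with s hs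
    rw [hF s hs, intervalIntegral.integral_of_le (le_of_lt hs), integral_Ioc_eq_integral_Ioo]
  · simp_rw [hG]
    exact hai.locallyIntegrableOn _
  · simp_rw [hG]
    rw [← integral_deriv_mul_primitive ham haB hχ hc]
    exact setIntegral_congr_fun measurableSet_Ioi fun s hs => by simp only [hF s hs]

theorem isCorrectionSource_sourceDist (hd : IsDensity ν h) {μ : SignedMeasure closedHalfPlane}
    (hrep : ∀ f : ℝ × ℝ → ℝ, Integrable f ν → MIntegrable μ f ∧
      mIntegral μ f = ∫ y, h y * f y ∂ν) : IsCorrectionSource μ (sourceDist ν h) := by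
  refine ⟨fun s => lpDist 1 fun r => (pot ν h (r, s) : ℂ),
    fun s => TemperedDistribution.derivCLM ℂ (lpDist 1 fun r => (vel₁ ν h (r, s) : ℂ)),
    fun s => hilbertDeriv fun r => (vel₁ ν h (r, s) : ℂ), ?_, isNormalDeriv_pot hd, ?_, ?_⟩
  · filter_upwards [ae_restrict_mem measurableSet_Ioi] with s hs
    have hs' : (0 : ℝ) ≤ s := le_of_lt hs
    refine (represents_lpDist_one (integrable_pot_complex hd hs')).congr_ae ?_
    filter_upwards [invDirichletLaplacian_ae_eq hrep hs'] with r hr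
    simp only [hr]
  · exact Eventually.of_forall fun s => isHilbertTransform_hilbertDeriv
      (integrable_vel₁_line_complex hd s)
  · exact Eventually.of_forall fun s => rfl

/-! ### Pairing with the heat kernel -/

section

variable {t : ℝ}

/-- The Schwartz function `r ↦ Γ₀(x - r, t)`. -/
def heatSchwartz (t : ℝ) (ht : 0 < t) (x : ℝ) : 𝓢(ℝ, ℂ) :=
  ((1 / (4 * Real.pi * t) ^ (1 / 2 : ℝ) : ℝ) : ℂ) • gaussSchwartz (1 / (4 * t)) (by positivity) x

theorem heatSchwartz_apply (ht : 0 < t) (x r : ℝ) :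
    heatSchwartz t ht x r = (heatKernel₁ (x - r) t : ℂ) := by
  change ((_ : ℝ) : ℂ) * ((Real.exp (-(1 / (4 * t) * (r - x) ^ 2)) : ℝ) : ℂ) = _
  rw [← Complex.ofReal_mul, heatKernel₁]
  congr 3
  ring

theorem heatSlice_eq (ht : 0 < t) (x : ℝ × ℝ) (s : ℝ) :
    heatSlice t ht x s = (heatKernel₁ (x.2 - s) t : ℂ) • heatSchwartz t ht x.1 := by
  ext r
  rw [heatSlice_apply, smul_apply, heatSchwartz_apply, heatKernel₂_sub ht, smul_eq_mul]
  push_cast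
  ring

theorem heatJIntegrand_abs_neg (t : ℝ) (ρ ξ : ℝ) :
    ((|-ξ| : ℝ) : ℂ) * heatJIntegrand t 0 ρ (-ξ) =
      (starRingEnd ℂ) (((|ξ| : ℝ) : ℂ) * heatJIntegrand t 0 ρ ξ) := by
  rw [heatJIntegrand_neg, abs_neg, map_mul, Complex.conj_ofReal]

theorem integrable_abs_mul_heatJIntegrand (ht : 0 < t) (ρ : ℝ) :
    Integrable fun ξ : ℝ => ((|ξ| : ℝ) : ℂ) * heatJIntegrand t 0 ρ ξ := by
  have hi : Integrable fun ξ : ℝ => ξ * Real.exp (-t * ξ ^ 2) := integrable_mul_exp_neg_mul_sq ht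
  refine hi.mono ((Complex.continuous_ofReal.comp continuous_abs).mul
    (continuous_heatJIntegrand t 0 ρ)).aestronglyMeasurable (Eventually.of_forall fun ξ => ?_)
  rw [norm_mul, norm_mul, Complex.norm_real, norm_heatJIntegrand, Complex.ofReal_im]
  simp

theorem integral_abs_mul_heatJIntegrand (ht : 0 < t) (ρ : ℝ) :
    ∫ ξ : ℝ, ((|ξ| : ℝ) : ℂ) * heatJIntegrand t 0 ρ ξ = ((2 * heatJRe t 1 ρ 0 : ℝ) : ℂ) := by
  rw [integral_hermitian (integrable_abs_mul_heatJIntegrand ht ρ) (heatJIntegrand_abs_neg t ρ),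
    heatJRe, toC_zero, heatJ]
  congr 3
  refine setIntegral_congr_fun measurableSet_Ioi fun ξ (hξ : 0 < ξ) => ?_
  simp only [heatJIntegrand, abs_of_pos hξ, pow_zero, pow_one, one_mul]

theorem fourierInv_heatSchwartz (ht : 0 < t) (x ξ : ℝ) :
    𝓕⁻ (heatSchwartz t ht x : ℝ → ℂ) ξ =
      Complex.exp (Complex.I * (2 * Real.pi * ξ : ℝ) * x - t * (2 * Real.pi * ξ : ℝ) ^ 2) := by
  rw [← integral_heatKernel₁_mul_exp ht, Real.fourierInv_eq']
  congr 1; ext r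
  rw [heatSchwartz_apply, smul_eq_mul, mul_comm]
  congr 2
  simp only [RCLike.inner_apply, conj_trivial]
  push_cast
  ring

theorem fourier_abs_mul_fourierInv_heatSchwartz (ht : 0 < t) (x r : ℝ) :
    𝓕 (fun ξ : ℝ => ((2 * Real.pi * |ξ| : ℝ) : ℂ) * 𝓕⁻ (heatSchwartz t ht x : ℝ → ℂ) ξ) r =
      ((1 / Real.pi * heatJRe t 1 (x - r) 0 : ℝ) : ℂ) := by
  have hpi := Real.pi_pos
  have h1 : ∀ ξ : ℝ, Complex.exp (((-2 * Real.pi * inner ℝ ξ r : ℝ) : ℂ) * Complex.I) •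
      (((2 * Real.pi * |ξ| : ℝ) : ℂ) * 𝓕⁻ (heatSchwartz t ht x : ℝ → ℂ) ξ) =
      (fun η : ℝ => ((|η| : ℝ) : ℂ) * heatJIntegrand t 0 ((x - r : ℝ) : ℂ) η)
        ((2 * Real.pi) * ξ) := fun ξ => by
    simp only
    rw [fourierInv_heatSchwartz, smul_eq_mul, mul_left_comm, ← Complex.exp_add, abs_mul,
      abs_of_pos (show 0 < 2 * Real.pi by positivity), heatJIntegrand, pow_zero, one_mul]
    congr 2
    simp only [RCLike.inner_apply, conj_trivial]
    push_cast
    ring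
  rw [Real.fourier_eq', integral_congr_ae (Eventually.of_forall h1),
    Measure.integral_comp_mul_left
      (fun η : ℝ => ((|η| : ℝ) : ℂ) * heatJIntegrand t 0 ((x - r : ℝ) : ℂ) η), integral_abs_mul_heatJIntegrand ht, Complex.real_smul,
    ← Complex.ofReal_mul, abs_of_pos (show 0 < (2 * Real.pi)⁻¹ by positivity)]
  congr 1
  field_simp

theorem deriv_deriv_heatSchwartz (ht : 0 < t) (x r : ℝ) :
    deriv (deriv (heatSchwartz t ht x : ℝ → ℂ)) r =
      ((-(1 / Real.pi) * heatJRe t 2 (x - r) 0 : ℝ) : ℂ) := by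
  have h0 : (heatSchwartz t ht x : ℝ → ℂ) = fun r => (heatKernel₁ (x - r) t : ℂ) :=
    funext (heatSchwartz_apply ht x)
  have h1 : deriv (heatSchwartz t ht x : ℝ → ℂ) = fun r => ((-heatKernel₁' (x - r) t : ℝ) : ℂ) := by
    funext r
    rw [h0]
    refine HasDerivAt.deriv ?_
    have := (hasDerivAt_heatKernel₁ ht (x - r)).comp r ((hasDerivAt_id r).const_sub x)
    simpa [Function.comp_def] using this.ofReal_comp
  rw [h1]
  have := ((hasDerivAt_heatKernel₁' ht (x - r)).comp r ((hasDerivAt_id r).const_sub x)).neg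
  have := this.ofReal_comp.deriv
  simpa [Function.comp_def] using this

theorem sourceDist_heatSchwartz (ht : 0 < t) (hd : IsDensity ν h) {s : ℝ} (hs : 0 ≤ s) (x : ℝ) :
    sourceDist ν h s (heatSchwartz t ht x) =
      (∫ r, ((1 / Real.pi * heatJRe t 1 (x - r) 0 : ℝ) : ℂ) * (vel₁ ν h (r, s) : ℂ)) +
      ∫ r, ((1 / Real.pi * heatJRe t 2 (x - r) 0 : ℝ) : ℂ) * (pot ν h (r, s) : ℂ) := by
  have e : sourceDist ν h s (heatSchwartz t ht x) =
      hilbertDeriv (fun r => (vel₁ ν h (r, s) : ℂ)) (heatSchwartz t ht x) -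
      TemperedDistribution.derivCLM ℂ (TemperedDistribution.derivCLM ℂ
      (lpDist 1 fun r => (pot ν h (r, s) : ℂ))) (heatSchwartz t ht x) := rfl
  rw [e, hilbertDeriv_apply (integrable_vel₁_line_complex hd s),
    TemperedDistribution.derivCLM_apply_apply, TemperedDistribution.derivCLM_apply_apply,
    lpDist_apply (memLp_one_iff_integrable.2 (integrable_pot_complex hd hs)), sub_eq_add_neg,
    ← integral_neg]
  congr 1
  · congr 1; ext r
    rw [fourier_abs_mul_fourierInv_heatSchwartz]
  · congr 1; ext r
    have h1 : (-SchwartzMap.derivCLM ℂ ℂ (-SchwartzMap.derivCLM ℂ ℂ (heatSchwartz t ht x))) r =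
        ((-(1 / Real.pi) * heatJRe t 2 (x - r) 0 : ℝ) : ℂ) := by
      rw [← deriv_deriv_heatSchwartz ht, map_neg, neg_neg, SchwartzMap.derivCLM_apply]
      congr 1
    rw [h1]
    push_cast
    ring

end

end

/-! ### The heat semigroups applied to `(H∂₂ - ∂₁)∂₁(-Δ_D)⁻¹ω` -/

theorem measurable_sign : Measurable Real.sign := by
  unfold Real.sign
  exact Measurable.ite measurableSet_Iio measurable_const
    (Measurable.ite measurableSet_Ioi measurable_const measurable_const)

theorem abs_sign_le (r : ℝ) : |Real.sign r| ≤ 1 := by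
  rcases Real.sign_apply_eq r with h | h | h <;> rw [h] <;> norm_num

section

variable {t : ℝ}

theorem continuous_heatJRe_comp (ht : 0 < t) (k : ℕ) {α : Type*} [TopologicalSpace α]
    {f g : α → ℝ} (hf : Continuous f) (hg : Continuous g) :
    Continuous fun a => heatJRe t k (f a) (g a) :=
  (continuous_heatJRe ht k).comp (g := fun p : ℝ × ℝ => heatJRe t k p.1 p.2)
    (f := fun a => (f a, g a)) (by fun_prop)

theorem integral_heatJRe_mul_velKer₁ (ht : 0 < t) (k : ℕ) (x s : ℝ) (y : ℝ × ℝ) :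
    ∫ r, heatJRe t k (x - r) 0 * velKer₁ (r, s) y =
      1 / 2 * (Real.sign (y.2 - s) * heatJRe t k (x - y.1) |y.2 - s| +
        Real.sign (s + y.2) * heatJRe t k (x - y.1) |s + y.2|) := by
  have hm : Measurable fun r => heatJRe t k (x - r) 0 :=
    (continuous_heatJRe_comp ht k (by fun_prop) (by fun_prop)).measurable
  have i := integrable_mul_poissonKernel hm (C := heatJBound t k)
    (fun r => abs_heatJRe_le ht k _ le_rfl)
  rw [← integral_poissonKernel_mul_heatJRe ht, ← integral_poissonKernel_mul_heatJRe ht,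
    ← integral_add ((i _ _).congr (Eventually.of_forall fun r => mul_comm _ _))
      ((i _ _).congr (Eventually.of_forall fun r => mul_comm _ _)), ← integral_const_mul]
  congr 1; ext r
  rw [velKer₁]
  ring

theorem integral_heatJRe_mul_velKer₁_complex (ht : 0 < t) (k : ℕ) (x s : ℝ) (y : ℝ × ℝ) :
    ∫ r, ((1 / Real.pi * heatJRe t k (x - r) 0 : ℝ) : ℂ) * (velKer₁ (r, s) y : ℂ) =
      ((1 / (2 * Real.pi) * (Real.sign (y.2 - s) * heatJRe t k (x - y.1) |y.2 - s| +
        Real.sign (s + y.2) * heatJRe t k (x - y.1) |s + y.2|) : ℝ) : ℂ) := by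
  have e : ∀ r, ((1 / Real.pi * heatJRe t k (x - r) 0 : ℝ) : ℂ) * (velKer₁ (r, s) y : ℂ) =
      ((1 / Real.pi * (heatJRe t k (x - r) 0 * velKer₁ (r, s) y) : ℝ) : ℂ) := fun r => by
    push_cast; ring
  simp_rw [e]
  rw [integral_complex_ofReal, integral_const_mul, integral_heatJRe_mul_velKer₁ ht]
  congr 1
  field_simp

theorem integral_sign_mul_heatJRe (ht : 0 < t) (ρ : ℝ) {s y₂ : ℝ} (hs : 0 ≤ s) (hy : 0 < y₂) :
    ∫ σ in Ioo 0 s, (Real.sign (y₂ - σ) * heatJRe t 2 ρ |y₂ - σ| +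
        Real.sign (σ + y₂) * heatJRe t 2 ρ |σ + y₂|) =
      heatJRe t 1 ρ |y₂ - s| - heatJRe t 1 ρ (s + y₂) := by
  set f : ℝ → ℝ := fun σ => heatJRe t 1 ρ |y₂ - σ| - heatJRe t 1 ρ (σ + y₂) with hf
  set f' : ℝ → ℝ := fun σ => Real.sign (y₂ - σ) * heatJRe t 2 ρ |y₂ - σ| +
    Real.sign (σ + y₂) * heatJRe t 2 ρ |σ + y₂| with hf'
  have hfc : Continuous f := (continuous_heatJRe_comp ht 1 (by fun_prop) (by fun_prop)).sub
    (continuous_heatJRe_comp ht 1 (by fun_prop) (by fun_prop))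
  have hd : ∀ σ ∈ Ioo 0 s \ {y₂}, HasDerivAt f (f' σ) σ := fun σ hσ => by
    have hσ0 : 0 < σ := hσ.1.1
    have hne : y₂ - σ ≠ 0 := sub_ne_zero.2 (Ne.symm hσ.2)
    have h2 : HasDerivAt (fun σ => heatJRe t 1 ρ (σ + y₂)) (-heatJRe t 2 ρ (σ + y₂)) σ :=
      (hasDerivAt_heatJRe_snd ht 1 ρ (σ + y₂)).comp_add_const σ y₂
    have h1 : HasDerivAt (fun σ => heatJRe t 1 ρ |y₂ - σ|)
        (Real.sign (y₂ - σ) * heatJRe t 2 ρ |y₂ - σ|) σ := by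
      have ha : HasDerivAt (fun σ => |y₂ - σ|) (-Real.sign (y₂ - σ)) σ := by
        have h3 := (hasDerivAt_id σ).const_sub y₂
        rcases lt_or_gt_of_ne hne with h | h
        · rw [Real.sign_of_neg h]
          have := (hasDerivAt_abs_neg h).comp σ h3
          simpa [Function.comp_def] using this
        · rw [Real.sign_of_pos h]
          have := (hasDerivAt_abs_pos h).comp σ h3
          simpa [Function.comp_def] using this
      have := (hasDerivAt_heatJRe_snd ht 1 ρ |y₂ - σ|).comp σ ha
      refine this.congr_deriv (by ring)
    refine (h1.sub h2).congr_deriv ?_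
    have hp : 0 < σ + y₂ := by linarith
    rw [hf']
    simp only
    rw [Real.sign_of_pos hp, abs_of_pos hp]
    ring
  have hm : Measurable f' := by
    have c1 : Measurable fun σ => heatJRe t 2 ρ |y₂ - σ| :=
      (continuous_heatJRe_comp ht 2 (by fun_prop) (by fun_prop)).measurable
    have c2 : Measurable fun σ => heatJRe t 2 ρ |σ + y₂| :=
      (continuous_heatJRe_comp ht 2 (by fun_prop) (by fun_prop)).measurable
    exact ((measurable_sign.comp (by fun_prop)).mul c1).add
      ((measurable_sign.comp (by fun_prop)).mul c2)
  have hb : ∀ σ, ‖f' σ‖ ≤ 1 * heatJBound t 2 + 1 * heatJBound t 2 := fun σ => by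
    refine (norm_add_le _ _).trans (add_le_add ?_ ?_) <;>
    · rw [norm_mul]
      exact mul_le_mul (abs_sign_le _) (abs_heatJRe_le ht 2 _ (abs_nonneg _)) (norm_nonneg _)
        zero_le_one
  have hi : IntervalIntegrable f' volume 0 s := by
    rw [intervalIntegrable_iff_integrableOn_Ioc_of_le hs]
    exact IntegrableOn.of_bound (by simp) hm.aestronglyMeasurable _ (Eventually.of_forall hb)
  have key := integral_eq_of_hasDerivAt_off_countable_of_le f f' hs (countable_singleton y₂)
    hfc.continuousOn hd hi
  rw [intervalIntegral.integral_of_le hs, integral_Ioc_eq_integral_Ioo] at key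
  rw [key, hf]
  simp [abs_of_pos hy]

/-- The pairing of `(H∂₂ - ∂₁)∂₁D(·, y)` on the line of height `s` with `Γ₀(x - ·, t)`. -/
def srcKernel (t x s : ℝ) (y : ℝ × ℝ) : ℝ :=
  1 / (2 * Real.pi) * ((1 + Real.sign (y.2 - s)) * heatJRe t 1 (x - y.1) |y.2 - s|)

theorem measurable_srcKernel (ht : 0 < t) (x : ℝ) :
    Measurable fun p : ℝ × (ℝ × ℝ) => srcKernel t x p.1 p.2 := by
  have c1 : Measurable fun p : ℝ × (ℝ × ℝ) => heatJRe t 1 (x - p.2.1) |p.2.2 - p.1| :=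
    (continuous_heatJRe_comp ht 1 (by fun_prop) (by fun_prop)).measurable
  exact measurable_const.mul ((measurable_const.add (measurable_sign.comp (by fun_prop))).mul c1)

theorem abs_srcKernel_le (ht : 0 < t) (x s : ℝ) (y : ℝ × ℝ) :
    |srcKernel t x s y| ≤ 1 / Real.pi * heatJBound t 1 := by
  have hpi := Real.pi_pos
  have hB := heatJBound_nonneg t 1
  have h1 : |1 + Real.sign (y.2 - s)| ≤ 2 :=
    (abs_add_le _ _).trans (by rw [abs_one]; linarith [abs_sign_le (y.2 - s)])
  rw [srcKernel, abs_mul, abs_mul, abs_of_pos (show 0 < 1 / (2 * Real.pi) by positivity)]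
  calc 1 / (2 * Real.pi) * (|1 + Real.sign (y.2 - s)| * |heatJRe t 1 (x - y.1) (|y.2 - s|)|)
      ≤ 1 / (2 * Real.pi) * (2 * heatJBound t 1) := by
        gcongr
        exact abs_heatJRe_le ht 1 _ (abs_nonneg _)
    _ = 1 / Real.pi * heatJBound t 1 := by field_simp

variable {ν : Measure (ℝ × ℝ)} [IsFiniteMeasure ν] {h : ℝ × ℝ → ℝ}

theorem sourceDist_heatSchwartz_eq (ht : 0 < t) (hd : IsDensity ν h) {s : ℝ} (hs : 0 ≤ s) (x : ℝ) :
    sourceDist ν h s (heatSchwartz t ht x) = ((∫ y, h y * srcKernel t x s y ∂ν : ℝ) : ℂ) := by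
  have hc : ∀ k, Continuous fun r => ((1 / Real.pi * heatJRe t k (x - r) 0 : ℝ) : ℂ) := fun k =>
    Complex.continuous_ofReal.comp (continuous_const.mul
      (continuous_heatJRe_comp ht k (by fun_prop) (by fun_prop)))
  have hM : ∀ k r, ‖((1 / Real.pi * heatJRe t k (x - r) 0 : ℝ) : ℂ)‖ ≤
      1 / Real.pi * heatJBound t k := fun k r => by
    have hpi := Real.pi_pos
    rw [Complex.norm_real, norm_mul, Real.norm_of_nonneg (by positivity)]
    gcongr
    exact abs_heatJRe_le ht k _ le_rfl
  have hDm : ∀ y, (∫ r, ((1 / Real.pi * heatJRe t 2 (x - r) 0 : ℝ) : ℂ) * (D (r, s) y : ℂ)) =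
      ((1 / (2 * Real.pi) * ∫ σ in Ioo 0 s, (Real.sign (y.2 - σ) * heatJRe t 2 (x - y.1) |y.2 - σ| +
        Real.sign (σ + y.2) * heatJRe t 2 (x - y.1) |σ + y.2|) : ℝ) : ℂ) := fun y => by
    rw [integral_mul_D (hc 2) (hM 2) hs]
    simp_rw [integral_heatJRe_mul_velKer₁_complex ht]
    rw [integral_complex_ofReal, integral_const_mul]
  have e2 : ∫ r, ((1 / Real.pi * heatJRe t 2 (x - r) 0 : ℝ) : ℂ) * (pot ν h (r, s) : ℂ) =
      ∫ y, (h y : ℂ) *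
        (∫ r, ((1 / Real.pi * heatJRe t 2 (x - r) 0 : ℝ) : ℂ) * (D (r, s) y : ℂ)) ∂ν :=
    integral_mul_slice hd (integrable_D_slice hs) (hc 2) (hM 2)
  have i1 : Integrable (fun y => (h y : ℂ) *
      ∫ r, ((1 / Real.pi * heatJRe t 1 (x - r) 0 : ℝ) : ℂ) * (velKer₁ (r, s) y : ℂ)) ν := by
    refine Integrable.of_bound ?_ (1 * (1 / Real.pi * heatJBound t 1))
      (Eventually.of_forall fun y => ?_)
    · exact ((Complex.measurable_ofReal.comp hd.measurable).mul
        ((measurable_integral_mul_velKer₁ (hc 1)).comp (measurable_prodMk_left (x := s)))).aestronglyMeasurable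
    · rw [norm_mul, Complex.norm_real]
      exact mul_le_mul (hd.le_one _) (norm_integral_mul_velKer₁_le (hM 1) _ _) (norm_nonneg _)
        zero_le_one
  have i2 : Integrable (fun y => (h y : ℂ) *
      ∫ r, ((1 / Real.pi * heatJRe t 2 (x - r) 0 : ℝ) : ℂ) * (D (r, s) y : ℂ)) ν := by
    have hk : Integrable (fun p : ℝ × (ℝ × ℝ) => (h p.2 : ℂ) *
        (((1 / Real.pi * heatJRe t 2 (x - p.1) 0 : ℝ) : ℂ) * (D (p.1, s) p.2 : ℂ)))
        (volume.prod ν) := by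
      refine Integrable.bdd_mul (c := 1) ?_ (Complex.measurable_ofReal.comp
        (hd.measurable.comp measurable_snd)).aestronglyMeasurable
        (Eventually.of_forall fun p => ?_)
      · exact Integrable.bdd_mul (c := 1 / Real.pi * heatJBound t 2)
          (integrable_D_slice hs).ofReal ((hc 2).comp continuous_fst).aestronglyMeasurable
          (Eventually.of_forall fun p => hM 2 p.1)
      · rw [Complex.norm_real]
        exact hd.le_one _
    refine hk.integral_prod_right.congr (Eventually.of_forall fun y => ?_)
    simp only [integral_const_mul]
  rw [sourceDist_heatSchwartz ht hd hs, integral_mul_vel₁ hd (hc 1) (hM 1), e2, ← integral_add i1 i2,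
    ← integral_complex_ofReal]
  refine integral_congr_ae ?_
  filter_upwards [hd.ae_mem] with y hy
  have hp : 0 < s + y.2 := by linarith
  rw [hDm, integral_sign_mul_heatJRe ht _ hs hy, integral_heatJRe_mul_velKer₁_complex ht,
    Real.sign_of_pos hp, abs_of_pos hp, srcKernel]
  push_cast
  ring

end

/-! ### The solution formula -/

section

variable {t : ℝ} {ν : Measure (ℝ × ℝ)} [IsFiniteMeasure ν] {h : ℝ × ℝ → ℝ}

theorem measurable_integral_srcKernel (ht : 0 < t) (hd : IsDensity ν h) (x : ℝ) :
    Measurable fun s => ∫ y, h y * srcKernel t x s y ∂ν :=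
  ((hd.measurable.comp measurable_snd).mul
    (measurable_srcKernel ht x)).stronglyMeasurable.integral_prod_right'.measurable

theorem abs_integral_srcKernel_le (ht : 0 < t) (hd : IsDensity ν h) (x s : ℝ) :
    |∫ y, h y * srcKernel t x s y ∂ν| ≤ 1 / Real.pi * heatJBound t 1 * ν.real univ := by
  rw [← Real.norm_eq_abs]
  refine norm_integral_le_of_norm_le_const (Eventually.of_forall fun y => ?_)
  rw [norm_mul]
  exact (mul_le_mul (hd.le_one _) (abs_srcKernel_le ht x s y) (abs_nonneg _)
    zero_le_one).trans_eq (one_mul _)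

theorem neumannPairing_sourceDist (ht : 0 < t) (hd : IsDensity ν h) (x : ℝ × ℝ) {s : ℝ}
    (hs : 0 ≤ s) :
    neumannPairing t ht (sourceDist ν h) x s =
      (((heatKernel₁ (x.2 - s) t + heatKernel₁ (x.2 + s) t) *
        ∫ y, h y * srcKernel t x.1 s y ∂ν : ℝ) : ℂ) := by
  rw [neumannPairing, map_add, heatSlice_eq, heatSlice_eq, map_smul, map_smul,
    sourceDist_heatSchwartz_eq ht hd hs, sub_neg_eq_add, smul_eq_mul, smul_eq_mul]
  push_cast
  ring

theorem dirichletPairing_sourceDist (ht : 0 < t) (hd : IsDensity ν h) (x : ℝ × ℝ) {s : ℝ}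
    (hs : 0 ≤ s) :
    dirichletPairing t ht (sourceDist ν h) x s =
      (((heatKernel₁ (x.2 - s) t - heatKernel₁ (x.2 + s) t) *
        ∫ y, h y * srcKernel t x.1 s y ∂ν : ℝ) : ℂ) := by
  rw [dirichletPairing, map_sub, heatSlice_eq, heatSlice_eq, map_smul, map_smul,
    sourceDist_heatSchwartz_eq ht hd hs, sub_neg_eq_add, smul_eq_mul, smul_eq_mul]
  push_cast
  ring

theorem integrable_mul_integral_srcKernel (ht : 0 < t) (hd : IsDensity ν h) (x : ℝ) {w : ℝ → ℝ}
    (hw : Integrable w) :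
    Integrable fun s => ((w s * ∫ y, h y * srcKernel t x s y ∂ν : ℝ) : ℂ) :=
  (hw.mul_bdd (measurable_integral_srcKernel ht hd x).aestronglyMeasurable
    (Eventually.of_forall (abs_integral_srcKernel_le ht hd x))).ofReal

theorem integrableOn_neumannPairing (ht : 0 < t) (hd : IsDensity ν h) (x : ℝ × ℝ) :
    IntegrableOn (neumannPairing t ht (sourceDist ν h) x) (Ioi 0) := by
  have hi := integrable_mul_integral_srcKernel ht hd x.1
    (((integrable_heatKernel₁ ht).comp_sub_left x.2).add
      ((integrable_heatKernel₁ ht).comp_add_left x.2))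
  exact hi.integrableOn.congr_fun (fun s hs => (neumannPairing_sourceDist ht hd x
    (le_of_lt hs)).symm) measurableSet_Ioi

theorem integrableOn_dirichletPairing (ht : 0 < t) (hd : IsDensity ν h) (x : ℝ × ℝ) :
    IntegrableOn (dirichletPairing t ht (sourceDist ν h) x) (Ioi 0) := by
  have hi := integrable_mul_integral_srcKernel ht hd x.1
    (((integrable_heatKernel₁ ht).comp_sub_left x.2).sub
      ((integrable_heatKernel₁ ht).comp_add_left x.2))
  exact hi.integrableOn.congr_fun (fun s hs => (dirichletPairing_sourceDist ht hd x
    (le_of_lt hs)).symm) measurableSet_Ioi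

theorem integral_heatKernel₁_mul_srcKernel (t : ℝ) (x : ℝ × ℝ) {y : ℝ × ℝ} (hy : 0 < y.2) :
    ∫ s in Ioi (0 : ℝ), 2 * heatKernel₁ (x.2 + s) t * srcKernel t x.1 s y =
      2 / Real.pi * ∫ s in (0 : ℝ)..y.2, heatKernel₁ (x.2 + s) t *
        heatJRe t 1 (x.1 - y.1) (y.2 - s) := by
  have hpi := Real.pi_pos
  have e : (fun s => 2 * heatKernel₁ (x.2 + s) t * srcKernel t x.1 s y)
      =ᵐ[volume.restrict (Ioi (0 : ℝ))] (Iio y.2).indicator fun s =>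
        2 / Real.pi * (heatKernel₁ (x.2 + s) t * heatJRe t 1 (x.1 - y.1) (y.2 - s)) := by
    filter_upwards [ae_restrict_of_ae (ae_ne_real y.2)] with s hs
    rcases lt_or_gt_of_ne hs with h | h
    · have h' : 0 < y.2 - s := sub_pos.2 h
      rw [indicator_of_mem (show s ∈ Iio y.2 from h), srcKernel, Real.sign_of_pos h',
        abs_of_pos h']
      field_simp
      ring
    · rw [indicator_of_notMem (show s ∉ Iio y.2 from not_lt.2 h.le), srcKernel,
        Real.sign_of_neg (sub_neg.2 h)]
      ring
  rw [integral_congr_ae e, integral_indicator measurableSet_Iio,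
    Measure.restrict_restrict measurableSet_Iio, inter_comm, Ioi_inter_Iio, integral_const_mul,
    intervalIntegral.integral_of_le hy.le, integral_Ioc_eq_integral_Ioo]

theorem heatDist_sub (ht : 0 < t) (hd : IsDensity ν h) (x : ℝ × ℝ) :
    Integrable (fun y => h y * (2 / Real.pi * ∫ s in (0 : ℝ)..y.2, heatKernel₁ (x.2 + s) t *
        heatJRe t 1 (x.1 - y.1) (y.2 - s))) ν ∧
    heatNeumannDist t ht (sourceDist ν h) x - heatDirichletDist t ht (sourceDist ν h) x =
      ((∫ y, h y * (2 / Real.pi * ∫ s in (0 : ℝ)..y.2, heatKernel₁ (x.2 + s) t *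
        heatJRe t 1 (x.1 - y.1) (y.2 - s)) ∂ν : ℝ) : ℂ) := by
  have hw : Integrable fun s => 2 * heatKernel₁ (x.2 + s) t :=
    ((integrable_heatKernel₁ ht).comp_add_left x.2).const_mul 2
  have hi : Integrable (fun p : ℝ × (ℝ × ℝ) =>
      h p.2 * (2 * heatKernel₁ (x.2 + p.1) t * srcKernel t x.1 p.1 p.2))
      ((volume.restrict (Ioi 0)).prod ν) :=
    hd.integrable_mul ((hw.integrableOn.comp_fst ν).mul_bdd
      (measurable_srcKernel ht x.1).aestronglyMeasurable
      (Eventually.of_forall fun p => abs_srcKernel_le ht x.1 p.1 p.2))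
  have e : (fun y => ∫ s in Ioi (0 : ℝ), h y * (2 * heatKernel₁ (x.2 + s) t * srcKernel t x.1 s y))
      =ᵐ[ν] fun y => h y * (2 / Real.pi * ∫ s in (0 : ℝ)..y.2, heatKernel₁ (x.2 + s) t *
        heatJRe t 1 (x.1 - y.1) (y.2 - s)) := by
    filter_upwards [hd.ae_mem] with y hy
    rw [integral_const_mul, integral_heatKernel₁_mul_srcKernel t x hy]
  refine ⟨hi.integral_prod_right.congr e, ?_⟩
  rw [heatNeumannDist, heatDirichletDist, ← integral_sub (integrableOn_neumannPairing ht hd x)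
    (integrableOn_dirichletPairing ht hd x), ← integral_congr_ae e, ← integral_integral_swap hi,
    ← integral_complex_ofReal]
  refine setIntegral_congr_fun measurableSet_Ioi fun s hs => ?_
  have hs' : (0 : ℝ) ≤ s := le_of_lt hs
  rw [neumannPairing_sourceDist ht hd x hs', dirichletPairing_sourceDist ht hd x hs',
    ← Complex.ofReal_sub, ← sub_mul, ← integral_const_mul]
  congr 1
  congr 1; ext y
  ring

variable {μ : SignedMeasure closedHalfPlane}

theorem vorticityFlow_eq_integral_vortKernel (ht : 0 < t) (hd : IsDensity ν h)
    (hrep : ∀ f : ℝ × ℝ → ℝ, Integrable f ν → MIntegrable μ f ∧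
      mIntegral μ f = ∫ y, h y * f y ∂ν) {x : ℝ × ℝ} (hx : 0 < x.2) :
    vorticityFlow t μ x = ∫ y, h y * vortKernel t x y ∂ν :=
  (vorticityFlow_eq ht hd (biotSavart_ae_eq hd hrep) hx).2.trans
    (integral_vortKer_mul_vel ht hd x).2

theorem mIntegral_W (ht : 0 < t) (hd : IsDensity ν h)
    (hrep : ∀ f : ℝ × ℝ → ℝ, Integrable f ν → MIntegrable μ f ∧
      mIntegral μ f = ∫ y, h y * f y ∂ν) (x : ℝ × ℝ) :
    MIntegrable μ (fun y => W x y t) ∧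
      mIntegral μ (fun y => W x y t) = ∫ y, h y * vortKernel t x y ∂ν := by
  have e : (fun y => vortKernel t x y) =ᵐ[ν] fun y => W x y t := by
    filter_upwards [hd.ae_mem] with y hy
    exact (W_eq_vortKernel ht x hy).symm
  obtain ⟨h1, h2⟩ := hrep _ ((integral_vortKer_mul_vel ht hd x).1.congr e)
  refine ⟨h1, h2.trans (integral_congr_ae ?_)⟩
  filter_upwards [e] with y hy
  rw [hy]

theorem heatNeumann_eq (ht : 0 < t) (hd : IsDensity ν h)
    (hrep : ∀ f : ℝ × ℝ → ℝ, Integrable f ν → MIntegrable μ f ∧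
      mIntegral μ f = ∫ y, h y * f y ∂ν) (x : ℝ × ℝ) :
    Integrable (fun y => h y * (heatKernel₁ (x.1 - y.1) t *
      (heatKernel₁ (x.2 - y.2) t + heatKernel₁ (x.2 + y.2) t))) ν ∧
    heatNeumann t μ x = ∫ y, h y * (heatKernel₁ (x.1 - y.1) t *
      (heatKernel₁ (x.2 - y.2) t + heatKernel₁ (x.2 + y.2) t)) ∂ν := by
  have hi : Integrable (fun y : ℝ × ℝ => heatKernel₁ (x.1 - y.1) t *
      (heatKernel₁ (x.2 - y.2) t + heatKernel₁ (x.2 + y.2) t)) ν := by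
    refine Integrable.of_bound (by fun_prop) (heatKernel₁ 0 t *
      (heatKernel₁ 0 t + heatKernel₁ 0 t)) (Eventually.of_forall fun y => ?_)
    have p := fun r => (heatKernel₁_pos ht r).le
    have l := heatKernel₁_le ht
    rw [Real.norm_of_nonneg (mul_nonneg (p _) (add_nonneg (p _) (p _)))]
    exact mul_le_mul (l _) (add_le_add (l _) (l _)) (add_nonneg (p _) (p _)) (p _)
  have e : (fun y => heatKernel₂ (x - y) t + heatKernel₂ (x - reflect y) t) = fun y : ℝ × ℝ =>
      heatKernel₁ (x.1 - y.1) t * (heatKernel₁ (x.2 - y.2) t + heatKernel₁ (x.2 + y.2) t) := by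
    funext y
    rw [heatKernel₂_sub ht, heatKernel₂_sub_reflect ht]
    ring
  refine ⟨hi.bdd_mul hd.measurable.aestronglyMeasurable (Eventually.of_forall hd.le_one), ?_⟩
  rw [heatNeumann, e]
  exact (hrep _ hi).2

theorem vorticityFlow_eq_heat (ht : 0 < t) (hd : IsDensity ν h)
    (hrep : ∀ f : ℝ × ℝ → ℝ, Integrable f ν → MIntegrable μ f ∧
      mIntegral μ f = ∫ y, h y * f y ∂ν) {x : ℝ × ℝ} (hx : 0 < x.2) :
    (vorticityFlow t μ x : ℂ) = (heatNeumann t μ x : ℂ) -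
      (heatNeumannDist t ht (sourceDist ν h) x - heatDirichletDist t ht (sourceDist ν h) x) -
      ((2 * heatKernel₁ x.2 t * heatLine t (tangentialTrace ν h) x.1 : ℝ) : ℂ) := by
  obtain ⟨iA, eA⟩ := heatNeumann_eq ht hd hrep x
  obtain ⟨iB, eB⟩ := heatDist_sub ht hd x
  obtain ⟨iC, eC⟩ := heatLine_tangentialTrace ht hd x.1
  have iC' : Integrable (fun y => h y * (1 / Real.pi * heatJRe t 0 (x.1 - y.1) y.2)) ν := by
    have := (iC.const_mul (1 / Real.pi)).bdd_mul hd.measurable.aestronglyMeasurable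
      (Eventually.of_forall hd.le_one)
    refine this.congr ?_
    filter_upwards [hd.ae_mem] with y hy
    rw [abs_of_pos hy]
  have iAB : Integrable (fun y => h y * (heatKernel₁ (x.1 - y.1) t *
      (heatKernel₁ (x.2 - y.2) t + heatKernel₁ (x.2 + y.2) t)) -
      h y * (2 / Real.pi * ∫ s in (0 : ℝ)..y.2, heatKernel₁ (x.2 + s) t *
        heatJRe t 1 (x.1 - y.1) (y.2 - s))) ν := iA.sub iB
  rw [eB, eA, eC, vorticityFlow_eq_integral_vortKernel ht hd hrep hx, ← integral_const_mul,
    ← Complex.ofReal_sub, ← Complex.ofReal_sub, ← integral_sub iA iB,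
    ← integral_sub iAB (iC'.const_mul _)]
  congr 2; ext y
  rw [vortKernel]
  ring

end

end

end HalfPlaneStokes

theorem lemma3p3 (u₀ : ℝ × ℝ → ℝ × ℝ) (hu₀ : MemWeakL2Solenoidal u₀)
    (ω₀ : SignedMeasure closedHalfPlane) (hω₀ : HasVorticity u₀ ω₀) :
    (∀ t : ℝ, 0 < t → ∀ x ∈ halfPlane,
      StokesConverges t (biotSavart ω₀) x ∧
      DifferentiableAt ℝ (stokes t (biotSavart ω₀)) x ∧
      (∀ y ∈ halfPlane, CorrectionConverges t x y) ∧
      MIntegrable ω₀ (fun y => W x y t) ∧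
      vorticityFlow t ω₀ x = mIntegral ω₀ fun y => W x y t) ∧
    ∃ (g : ℝ → ℝ) (F : TangentialDistribution),
      Integrable g ∧ IsTangentialTrace u₀ g ∧ IsCorrectionSource ω₀ F ∧
      ∀ (t : ℝ) (ht : 0 < t), ∀ x ∈ halfPlane,
        IntegrableOn (neumannPairing t ht F x) (Ioi 0) ∧
        IntegrableOn (dirichletPairing t ht F x) (Ioi 0) ∧
        (vorticityFlow t ω₀ x : ℂ) =
          (heatNeumann t ω₀ x : ℂ) -
            (heatNeumannDist t ht F x - heatDirichletDist t ht F x) -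
            ((2 * heatKernel₁ x.2 t * heatLine t g x.1 : ℝ) : ℂ) := by
  obtain ⟨ν, h, hν, hd, hrep⟩ := exists_isDensity ω₀
  have hu := ae_eq_vel hd hrep hu₀ hω₀
  have hK := biotSavart_ae_eq hd hrep
  refine ⟨fun t ht x hx => ?_, tangentialTrace ν h, sourceDist ν h, integrable_tangentialTrace hd,
    isTangentialTrace hd hu.1, isCorrectionSource_sourceDist hd hrep, fun t ht x hx =>
    ⟨integrableOn_neumannPairing ht hd x, integrableOn_dirichletPairing ht hd x,
      vorticityFlow_eq_heat ht hd hrep hx⟩⟩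
  obtain ⟨hW, hW'⟩ := mIntegral_W ht hd hrep x
  exact ⟨(stokes_eq ht hd hK hx).1, (vorticityFlow_eq ht hd hK hx).1,
    fun y hy => correctionConverges ht x hy, hW,
    (vorticityFlow_eq_integral_vortKernel ht hd hrep hx).trans hW'.symm⟩
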